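/- **Setting.** A discounted MDP has a finite state set $\mathcal S$ ($S$ states), a finite action set $\mathcal A$ ($A$ actions), transition probabilities $P(\cdot\mid s,a)$, deterministic rewards $r(s,a)\in[0,1]$ and a discount factor $\gamma\in(0,1)$. For $\pi:\mathcal S\to\mathcal A$ let $V^\pi(s)=\mathbb E\big[\sum_{t\ge 0}\gamma^t r(s_t,\pi(s_t))\mid s_0=s\big]$ be the value of following $\pi$, and let $V^*(s)=\sup_\pi V^\pi(s)$. At each time $t=1,2,\dots$ a learning algorithm, which does not know $P$, fixes a policy $\pi_t$ from its past observations, observes $s_t$, plays $a_t=\pi_t(s_t)$, receives $r(s_t,a_t)$ and observes $s_{t+1}\sim P(\cdot\mid s_t,a_t)$. Its $\epsilon$-sample complexity is the number of $t\ge1$ with $V^*(s_t)-V^{\pi_t}(s_t)>\epsilon$. **Algorithm UCB-MultiStage-Advantage**, with threshold $\epsilon$, confidence parameter $\delta$ and numerical constants $c_1,c_2>0$. Put $H=\big\lceil\max\{\ln\frac{8}{(1-\gamma)\epsilon}/\ln\frac1\gamma,\ \frac1{1-\gamma}\}\big\rceil$, $B=H^3$, $\iota=\ln(2/\delta)$,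 $N_0=c_1S^3AH^7\ln(4H^2S/\epsilon)\,\iota/\epsilon^2$, $N_1=\lceil c_2SAH^5B\ln(4H/\epsilon)\,\iota\rceil$, $d_1=H$, $d_{j+1}=\lfloor(1+\frac1H)d_j\rfloor$, $\check e_j=d_{\lceil j/B\rceil}$, $\bar e_j=d_j$, $\check{\mathcal L}=\{\sum_{i\le j}\check e_i:\ j\ge1,\ \sum_{i<j}\check e_i\le N_0\}$, $\bar{\mathcal L}=\{\sum_{i\le j}\bar e_i:\ j\ge1,\ \sum_{i<j}\bar e_i\le N_0\}$. For every $(s,a)$ store $Q=\frac1{1-\gamma}$ and $N,\check N,\bar N,\check\mu,\check\sigma,\mu^{\rm ref},\sigma^{\rm ref},\bar\mu=0$; for every $s$ store $V=V^{\rm ref}=\frac1{1-\gamma}$. At time $t$: 1. Play $a_t=\pi_t(s_t)$, where $\pi_t(s)\in\arg\max_a Q(s,a)$ (ties broken by an arbitrary fixed rule); let $(s,a,s')=(s_t,a_t,s_{t+1})$. 2. At $(s,a)$, add $1$ to $N,\check N,\bar N$, add $V(s')-V^{\rm ref}(s')$ to $\check\mu$, its square to $\check\sigma$, $V^{\rm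 ref}(s')$ to $\mu^{\rm ref}$, its square to $\sigma^{\rm ref}$, and $V(s')$ to $\bar\mu$. Write $n,\check n,\bar n$ for the new values of $N,\check N,\bar N$ at $(s,a)$. 3. If $n\in\check{\mathcal L}$: with $$\check b=\min\Big\{2\sqrt2\Big(\sqrt{\tfrac{\check\sigma/\check n-(\check\mu/\check n)^2}{\check n}\iota}+\sqrt{\tfrac{\sigma^{\rm ref}/n-(\mu^{\rm ref}/n)^2}{n}\iota}\Big)+7\Big(\tfrac{H\iota^{3/4}}{n^{3/4}}+\tfrac{H\iota^{3/4}}{\check n^{3/4}}\Big)+4\Big(\tfrac{H\iota}{n}+\tfrac{H\iota}{\check n}\Big),\ \tfrac{2}{1-\gamma}\Big\},$$ set $Q(s,a)\leftarrow\min\{r(s,a)+\gamma(\check\mu/\check n+\mu^{\rm ref}/n+\check b),\,Q(s,a)\}$, reset $\check N,\check\mu,\check\sigma$ at $(s,a)$ to $0$, and set $V(s)\leftarrow\max_{a'}Q(s,a')$. 4. If $n\in\bar{\mathcal L}$: with $\bar b=\min\{2\sqrt{H^2\iota/\bar n},\frac1{1-\gamma}\}$, set $Q(s,a)\leftarrow\min\{r(s,a)+\gamma(\bar\mu/\bar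 n+\bar b),\,Q(s,a)\}$, reset $\bar N,\bar\mu$ at $(s,a)$ to $0$, and set $V(s)\leftarrow\max_{a'}Q(s,a')$. 5. If $\sum_{a'}N(s,a')=N_1$, set $V^{\rm ref}(s)\leftarrow V(s)$. **Theorem.** There are universal constants $c_1,c_2,C>0$, $D\ge1$ and $q,d,k\in\mathbb N$, and a choice of the confidence parameter $\delta=\delta(S,A,\gamma,\epsilon,p)$ with $\big(\frac{p\,\epsilon(1-\gamma)}{SA}\big)^q\le\delta\le p$ for all $S,A\ge1$ and $\gamma,\epsilon,p\in(0,1)$, such that the following holds for every discounted MDP with $S$ states, $A$ actions and discount factor $\gamma$, every initial state (possibly random), every tie-breaking rule, every $\epsilon$ with $0<\epsilon<1/\big(D\,(SA/(1-\gamma))^d\big)$ and every $p\in(0,1)$. The algorithm UCB-MultiStage-Advantage run with threshold $\epsilon$ and confidence parameter $\delta$ is model-free: it stores at most $11\,SA$ numbers. With probability at least $1-p$, its $\epsilon$-sample complexity is at most $$C\cdot\frac{SA\ln(2/p)}{\epsilon^2(1-\gamma)^3}\cdot\Big(\ln\frac{SA}{(1-\gamma)\epsilon}\Big)^{k}.$$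 -/

import Mathlib

open scoped ENNReal

noncomputable section

/-- A discounted tabular Markov decision process with finite state space `S`, action space `A`,
transition probabilities `P s a s'`, deterministic rewards in `[0, 1]` and discount factor
`γ ∈ (0, 1)`. -/
structure DiscountedMDP (S A : Type*) [Fintype S] where
  P : S → A → S → ℝ
  P_nonneg : ∀ s a s', 0 ≤ P s a s'
  P_sum : ∀ s a, ∑ s', P s a s' = 1
  r : S → A → ℝ
  r_nonneg : ∀ s a, 0 ≤ r s a
  r_le_one : ∀ s a, r s a ≤ 1
  γ : ℝ
  γ_pos : 0 < γ
  γ_lt_one : γ < 1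

namespace DiscountedMDP

variable {S A : Type*} [Fintype S] [DecidableEq S]

/-- The transition matrix of the Markov chain followed under the stationary policy `π`. -/
def transition (M : DiscountedMDP S A) (π : S → A) : Matrix S S ℝ :=
  Matrix.of fun s s' => M.P s (π s) s'

/-- The value `V^π(s) = 𝔼[∑ t, γ ^ t * r(s_t, π(s_t)) | s_0 = s]`; the expectation of
`r(s_t, π(s_t))` is the entry at `s` of the `t`-th power of the transition matrix applied to the
reward vector. -/
def value (M : DiscountedMDP S A) (π : S → A) (s : S) : ℝ :=
  ∑' t : ℕ, M.γ ^ t * ((M.transition π ^ t).mulVec fun x => M.r x (π x)) s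

/-- The optimal value `V^*(s) = sup_π V^π(s)`. -/
def optValue (M : DiscountedMDP S A) (s : S) : ℝ :=
  ⨆ π : S → A, M.value π s

end DiscountedMDP

/-- An online learning algorithm whose memory consists of real registers indexed by `R`. It does
not see the MDP: at each time step it plays the action that the policy computed from its memory
prescribes at the current state, and then updates its memory using only the observed
`(state, action, reward, next state)`. -/
structure OnlineAlgorithm (S A R : Type*) where
  init : R → ℝ
  policy : (R → ℝ) → S → A
  update : (R → ℝ) → S → A → ℝ → S → (R → ℝ)

namespace OnlineAlgorithm

variable {S A R : Type*}

/-- The space used by an algorithm: the number of its registers. -/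
def space (_alg : OnlineAlgorithm S A R) : ℕ := Nat.card R

variable [Fintype S]

/-- The memory before time step `t` (time starts at `0`) when the visited states are
`h 0, h 1, …`. It depends only on `h 0, …, h t`. -/
def memory (alg : OnlineAlgorithm S A R) (M : DiscountedMDP S A) (h : ℕ → S) : ℕ → (R → ℝ)
  | 0 => alg.init
  | t + 1 =>
    let m := alg.memory M h t
    let a := alg.policy m (h t)
    alg.update m (h t) a (M.r (h t) a) (h (t + 1))

/-- The policy `π_t` that the algorithm uses at time step `t`. -/
def policyAt (alg : OnlineAlgorithm S A R) (M : DiscountedMDP S A) (h : ℕ → S) (t : ℕ) : S → A :=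
  alg.policy (alg.memory M h t)

/-- The `ε`-sample complexity along the state sequence `h`: the number of time steps `t` with
`V^*(s_t) - V^{π_t}(s_t) > ε`. -/
def sampleComplexity [DecidableEq S] (alg : OnlineAlgorithm S A R) (M : DiscountedMDP S A)
    (ε : ℝ) (h : ℕ → S) : ℝ≥0∞ :=
  open Classical in
  ∑' t : ℕ, if ε < M.optValue (h t) - M.value (alg.policyAt M h t) (h t) then 1 else 0

/-- The random sequence of states `s 0, s 1, …` on the probability space `(Ω, μ)` is generated by
running the algorithm in the MDP, from an arbitrary (possibly random) initial state: given
`s 0, …, s t`, the next state has law `P(· | s_t, π_t(s_t))`. -/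
structure IsTrajectory (alg : OnlineAlgorithm S A R) (M : DiscountedMDP S A)
    {Ω : Type*} [MeasurableSpace Ω] (μ : MeasureTheory.Measure Ω) (s : ℕ → Ω → S) : Prop where
  measurableSet_eq : ∀ t x, MeasurableSet {ω | s t ω = x}
  law : ∀ (t : ℕ) (h : ℕ → S),
    μ {ω | ∀ i ≤ t + 1, s i ω = h i} =
      μ {ω | ∀ i ≤ t, s i ω = h i} *
        ENNReal.ofReal (M.P (h t) (alg.policyAt M h t (h t)) (h (t + 1)))

end OnlineAlgorithm

namespace UCBMultiStageAdvantage

/-- `stageSize H j` is `d_{j+1}`, where `d_1 = H` and `d_{j+1} = ⌊(1 + 1/H) d_j⌋`. -/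
def stageSize (H : ℕ) : ℕ → ℕ
  | 0 => H
  | j + 1 => ⌊(1 + 1 / (H : ℝ)) * (stageSize H j : ℝ)⌋₊

/-- Stages are numbered from `0` here, so that the `j`-th type-I stage has size
`d_⌈(j+1)/B⌉ = stageSize H (j / B)`. -/
def typeISize (H B j : ℕ) : ℕ := stageSize H (j / B)

/-- The size of the `j`-th type-II stage, numbered from `0`. -/
def typeIISize (H j : ℕ) : ℕ := stageSize H j

/-- The visit counts at which a stage of the given sizes ends; the last stage is the first one
after which the total size exceeds `N₀`. -/
def updateCounts (size : ℕ → ℕ) (N₀ : ℝ) : Set ℕ :=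
  {n | ∃ j : ℕ, n = ∑ i ∈ Finset.range (j + 1), size i ∧
    ((∑ i ∈ Finset.range j, size i : ℕ) : ℝ) ≤ N₀}

/-- The parameters of the algorithm. -/
structure Params where
  γ : ℝ
  H : ℕ
  B : ℕ
  ι : ℝ
  N₀ : ℝ
  N₁ : ℕ

/-- `H = ⌈max {ln(8/((1-γ)ε)) / ln(1/γ), 1/(1-γ)}⌉`. -/
def horizon (γ ε : ℝ) : ℕ :=
  ⌈max (Real.log (8 / ((1 - γ) * ε)) / Real.log (1 / γ)) (1 / (1 - γ))⌉₊

/-- The parameters for `S` states, `A` actions, discount factor `γ`, threshold `ε`, confidence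
parameter `δ` and the two numerical constants `c₁`, `c₂`. -/
def params (c₁ c₂ : ℝ) (S A : ℕ) (γ ε δ : ℝ) : Params :=
  let H := horizon γ ε
  let B := H ^ 3
  let ι := Real.log (2 / δ)
  { γ := γ
    H := H
    B := B
    ι := ι
    N₀ := c₁ * (S : ℝ) ^ 3 * A * (H : ℝ) ^ 7 * Real.log (4 * (H : ℝ) ^ 2 * S / ε) * ι / ε ^ 2
    N₁ := ⌈c₂ * S * A * (H : ℝ) ^ 5 * B * Real.log (4 * (H : ℝ) / ε) * ι⌉₊ }

/-- The quantities stored for each state-action pair: the estimate `Q`, the visit counts in total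
and in the current type-I and type-II stage, the sums of the advantages `V - V^ref` and of their
squares in the current type-I stage, the sums of `V^ref` and of its square over all visits, and
the sum of `V` in the current type-II stage (all evaluated at the next state). -/
inductive PairField
  | Q | visits | visitsI | visitsII | advSum | advSqSum | refSum | refSqSum | valueSum

/-- The quantities stored for each state: the value estimate and the reference value. -/
inductive StateField
  | V | Vref

/-- The registers of the algorithm. -/
abbrev Register (S A : Type*) := (PairField × S × A) ⊕ (StateField × S)

/-- The type-I exploration bonus, with stage statistics `nI, advSum, advSqSum` and overall
statistics `n, refSum, refSqSum`. -/
def bonusI (p : Params) (nI advSum advSqSum n refSum refSqSum : ℝ) : ℝ :=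
  min
    (2 * √2 * (√((advSqSum / nI - (advSum / nI) ^ 2) / nI * p.ι) +
          √((refSqSum / n - (refSum / n) ^ 2) / n * p.ι)) +
      7 * (p.H * p.ι ^ (3 / 4 : ℝ) / n ^ (3 / 4 : ℝ) +
          p.H * p.ι ^ (3 / 4 : ℝ) / nI ^ (3 / 4 : ℝ)) +
      4 * (p.H * p.ι / n + p.H * p.ι / nI))
    (2 / (1 - p.γ))

/-- The type-II exploration bonus. -/
def bonusII (p : Params) (nII : ℝ) : ℝ :=
  min (2 * √((p.H : ℝ) ^ 2 * p.ι / nII)) (1 / (1 - p.γ))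

variable {S A : Type*}

/-- Initially `Q = V = V^ref = 1/(1-γ)` and all other registers are `0`. -/
def initMemory (p : Params) : Register S A → ℝ
  | .inl (.Q, _, _) => 1 / (1 - p.γ)
  | .inl (_, _, _) => 0
  | .inr (_, _) => 1 / (1 - p.γ)

open Classical in
/-- One time step of the algorithm, after the action `a` was played at the state `s`, the reward
`rew` received and the next state `s'` observed. -/
def updateMemory [Fintype A] (p : Params) (m : Register S A → ℝ) (s : S) (a : A) (rew : ℝ)
    (s' : S) : Register S A → ℝ :=
  let V : S → ℝ := fun x => m (.inr (.V, x))
  let Vref : S → ℝ := fun x => m (.inr (.Vref, x))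
  let old : PairField → ℝ := fun f => m (.inl (f, s, a))
  -- maintain the statistics
  let n := old .visits + 1
  let nI := old .visitsI + 1
  let nII := old .visitsII + 1
  let advSum := old .advSum + (V s' - Vref s')
  let advSqSum := old .advSqSum + (V s' - Vref s') ^ 2
  let refSum := old .refSum + Vref s'
  let refSqSum := old .refSqSum + Vref s' ^ 2
  let valueSum := old .valueSum + V s'
  -- is a stage of type I or II completed?
  let endI : Prop := ∃ k ∈ updateCounts (typeISize p.H p.B) p.N₀, n = k
  let endII : Prop := ∃ k ∈ updateCounts (typeIISize p.H) p.N₀, n = k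
  -- the type-I update, followed by the type-II update
  let Q₁ : ℝ :=
    if endI then
      min (rew + p.γ * (advSum / nI + refSum / n + bonusI p nI advSum advSqSum n refSum refSqSum))
        (old .Q)
    else old .Q
  let Q₂ : ℝ := if endII then min (rew + p.γ * (valueSum / nII + bonusII p nII)) Q₁ else Q₁
  let Vnew : ℝ :=
    if endI ∨ endII then ⨆ b : A, (if b = a then Q₂ else m (.inl (.Q, s, b))) else V s
  -- the number of visits to `s`, including the present one
  let visitsState : ℝ := (∑ b : A, m (.inl (.visits, s, b))) + 1
  fun
  | .inl (f, x, b) =>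
    if x = s ∧ b = a then
      match f with
      | .Q => Q₂
      | .visits => n
      | .visitsI => if endI then 0 else nI
      | .visitsII => if endII then 0 else nII
      | .advSum => if endI then 0 else advSum
      | .advSqSum => if endI then 0 else advSqSum
      | .refSum => refSum
      | .refSqSum => refSqSum
      | .valueSum => if endII then 0 else valueSum
    else m (.inl (f, x, b))
  | .inr (f, x) =>
    if x = s then
      match f with
      | .V => Vnew
      | .Vref => if visitsState = p.N₁ then Vnew else Vref s
    else m (.inr (f, x))

/-- The algorithm UCB-MultiStage-Advantage. The function `argmax` breaks the ties in the greedy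
choice of the action. -/
def algorithm [Fintype A] (p : Params) (argmax : S → (A → ℝ) → A) :
    OnlineAlgorithm S A (Register S A) where
  init := initMemory p
  policy m s := argmax s fun a => m (.inl (.Q, s, a))
  update := updateMemory p

end UCBMultiStageAdvantage

end

/-!
Write `R = 1 / (1 - γ)`. The proof follows one run of the algorithm along an arbitrary sequence of
states (`Run`), proves deterministic bounds for all sequences along which finitely many sums of
deviations are small (`Run.Good`), and shows that the trajectory is such a sequence with
probability at least `1 - p`.

*Probability.* The law of a trajectory gives Ville's inequality by backward induction
(`IsTrajectory.measure_exists_le`), hence Freedman's inequality for every predictable function of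
the next state (`IsTrajectory.measure_abs_deviation`). A union bound over pairs, stages and integer
parameters gives `Run.measure_not_good_le`; the price is the logarithm of a polynomial, which is
why the confidence parameter is a power of `p ε (1 - γ) / (S A)`.

*Optimism.* On good sequences the bonuses cover all deviations, so that the estimates `Q` and `V`
never fall below the optimal values (`Run.Good.optimistic`).

*Type-II updates.* The overestimation of `Q^*` at a visit is bounded by a bonus plus the average
overestimation of the states reached in the previous stage. As the stages grow by a factor
`1 + 1/H` only, iterating this bounds the overestimation on any set of `m` times by a constant
times `√m` plus a constant (`Run.Good.sum_mul_qgap_le`). Hence only finitely many visits are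
inaccurate at a given scale, and reference values are accurate after `N₁` visits
(`Run.Good.Vref_sub_optValue_le`).

*Type-I updates.* With accurate reference values the type-I bonus after `n` visits is of order
`√((Var V^* + H) ι / n)`, and the Bellman residual of `V` at a visit is bounded by it plus the
decrease of `V` since the previous stage (`Run.Good.residual_le`). Residuals are clipped at a
threshold which is large where `V^*` has a large variance, but which by a law of total variance
amounts to at most `ε / 2` along any policy (`DiscountedMDP.discounted_threshold_le`). What exceeds
the threshold, the excess, sums up to the order `S A H R ι / ε` plus terms of lower order, since
`∑ (a / √n - θ)⁺ ≤ 2 a² / θ` and the decreases of `V` telescope up to a fraction `1 / (H B)`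
(`Run.Good.sum_excess_le`).

*Sample complexity.* The suboptimality of the policy at time `t` is at most `ε / 2` plus the
pseudo-regret, the expected discounted sum of the excesses under the current policy
(`Run.Good.optValue_sub_value_le`). Along the run the pseudo-regrets sum up to at most `3 R` times
the excesses, up to lower order terms (`Run.Good.sum_pseudoRegret_le`), and each time with an
`ε`-suboptimal policy uses up `ε / 2` of this sum. As `ε` is smaller than the inverse of a
polynomial in `S A R`, the lower order terms are dominated by the leading one
(`Run.Good.sampleComplexity_le_of_small`).
-/

open Finset

/-! ### Sums over visits and monotone rearrangements -/

namespace UCBMultiStageAdvantage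

theorem count_nth_of_lt_count (p : ℕ → Prop) [DecidablePred p] {n t : ℕ}
    (hn : n < Nat.count p t) : Nat.count p (Nat.nth p n) = n := by
  apply Nat.count_nth
  intro hf
  exact Nat.lt_of_lt_of_le hn (Nat.count_le_card hf t)

theorem nth_mem_of_lt_count (p : ℕ → Prop) [DecidablePred p] {n t : ℕ}
    (hn : n < Nat.count p t) : p (Nat.nth p n) := by
  apply Nat.nth_mem
  intro hf
  exact Nat.lt_of_lt_of_le hn (Nat.count_le_card hf t)

/-- A sum over the times before `t` at which `p` holds, reindexed by the number of the visit. -/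
theorem sum_ite_eq_sum_nth (p : ℕ → Prop) [DecidablePred p] (F : ℕ → ℝ) (t : ℕ) :
    ∑ i ∈ range t, (if p i then F i else 0) =
      ∑ n ∈ range (Nat.count p t), F (Nat.nth p n) := by
  induction t with
  | zero => simp
  | succ t ih =>
    rw [sum_range_succ, ih]
    by_cases h : p t
    · rw [if_pos h, Nat.count_succ, if_pos h, sum_range_succ, Nat.nth_count h]
    · rw [if_neg h, Nat.count_succ, if_neg h]; simp

theorem sum_ite_count_eq_sum_Ico (p : ℕ → Prop) [DecidablePred p] (F : ℕ → ℝ) {t a b : ℕ}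
    (hb : b ≤ Nat.count p t) :
    ∑ i ∈ range t, (if p i ∧ a ≤ Nat.count p i ∧ Nat.count p i < b then F i else 0) =
      ∑ n ∈ Ico a b, F (Nat.nth p n) := by
  have h := sum_ite_eq_sum_nth p
    (fun i => if a ≤ Nat.count p i ∧ Nat.count p i < b then F i else 0) t
  simp only [ite_and] at h ⊢
  rw [h]
  have h2 : ∑ n ∈ range (Nat.count p t), (if a ≤ Nat.count p (Nat.nth p n) then
      if Nat.count p (Nat.nth p n) < b then F (Nat.nth p n) else 0 else 0) =
      ∑ n ∈ range (Nat.count p t), (if a ≤ n ∧ n < b then F (Nat.nth p n) else 0) := by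
    refine sum_congr rfl fun n hn => ?_
    rw [count_nth_of_lt_count p (mem_range.1 hn), ite_and]
  rw [h2, ← sum_filter]
  refine sum_congr ?_ fun _ _ => rfl
  ext n
  simp only [mem_filter, mem_range, mem_Ico]
  omega

theorem nth_le_nth_of_lt_count (p : ℕ → Prop) [DecidablePred p] {m n t : ℕ} (hmn : m ≤ n)
    (hn : n < Nat.count p t) : Nat.nth p m ≤ Nat.nth p n := by
  by_contra! h
  have h1 := Nat.count_monotone p h.le
  rw [count_nth_of_lt_count p hn, count_nth_of_lt_count p (lt_of_le_of_lt hmn hn)] at h1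
  have : m = n := le_antisymm hmn h1
  subst this
  exact lt_irrefl _ h

/-- The bathtub principle: among weights in `[0, 1]` of total mass `W`, the sum of a nonincreasing
function is largest, up to one term, when the weights fill the first `⌊W⌋` indices. -/
theorem sum_weight_le_sum_range_floor (N : ℕ) (g w : ℕ → ℝ) (R : ℝ)
    (hg : ∀ m n, m ≤ n → n < N → g n ≤ g m) (hg0 : ∀ n < N, 0 ≤ g n) (hgR : ∀ n < N, g n ≤ R)
    (hR : 0 ≤ R)
    (hw0 : ∀ n < N, 0 ≤ w n) (hw1 : ∀ n < N, w n ≤ 1) :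
    ∑ n ∈ range N, w n * g n ≤ ∑ n ∈ range ⌊∑ n ∈ range N, w n⌋₊, g n + R := by
  set W := ∑ n ∈ range N, w n with hW
  have hW0 : 0 ≤ W := sum_nonneg fun n hn => hw0 n (mem_range.1 hn)
  have hWN : W ≤ N := by
    calc W ≤ ∑ n ∈ range N, (1 : ℝ) := sum_le_sum fun n hn => hw1 n (mem_range.1 hn)
      _ = N := by simp
  set c := ⌊W⌋₊ with hc
  have hcW : (c : ℝ) ≤ W := Nat.floor_le hW0
  have hWc : W < c + 1 := Nat.lt_floor_add_one W
  have hcN : c ≤ N := by exact_mod_cast hcW.trans hWN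
  rcases hcN.eq_or_lt with h | h
  · rw [h]
    have : ∑ n ∈ range N, w n * g n ≤ ∑ n ∈ range N, g n := by
      refine sum_le_sum fun n hn => ?_
      have := mem_range.1 hn
      nlinarith [hw1 n this, hg0 n this]
    linarith
  · have key : ∑ n ∈ range N, w n * g n ≤
        ∑ n ∈ range N, ((w n - if n < c then 1 else 0) * g c + if n < c then g n else 0) := by
      refine sum_le_sum fun n hn => ?_
      have hn' := mem_range.1 hn
      split_ifs with hnc
      · nlinarith [hw1 n hn', hg n c hnc.le h]
      · nlinarith [hw0 n hn', hg c n (not_lt.1 hnc) hn']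
    have e1 : (range N).filter (fun n => n < c) = range c := by
      ext n; simp only [mem_filter, mem_range]; omega
    rw [sum_add_distrib, ← sum_mul, sum_sub_distrib, ← sum_filter, ← sum_filter, e1, ← hW] at key
    simp only [sum_const, card_range, nsmul_eq_mul, mul_one] at key
    have h1 : (W - c) * g c ≤ 1 * R := by
      apply mul_le_mul _ (hgR c h) (hg0 c h) (by norm_num)
      linarith
    linarith

theorem sum_inv_sqrt_le (N : ℕ) : ∑ n ∈ range N, 1 / √((n : ℝ) + 1) ≤ 2 * √(N : ℝ) := by
  induction N with
  | zero => simp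
  | succ N ih =>
    rw [sum_range_succ]
    push_cast
    have h1 : 0 < √((N : ℝ) + 1) := Real.sqrt_pos.2 (by positivity)
    have h0 : 0 ≤ √(N : ℝ) := Real.sqrt_nonneg _
    have e1 : √((N : ℝ) + 1) ^ 2 = N + 1 := Real.sq_sqrt (by positivity)
    have e0 : √(N : ℝ) ^ 2 = N := Real.sq_sqrt (by positivity)
    have : 1 / √((N : ℝ) + 1) ≤ 2 * √((N : ℝ) + 1) - 2 * √(N : ℝ) := by
      rw [div_le_iff₀ h1]
      nlinarith [sq_nonneg (√((N : ℝ) + 1) - √(N : ℝ))]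
    linarith

theorem sum_sqrt_le_sqrt_card_mul {ι : Type*} (s : Finset ι) (f : ι → ℝ) (hf : ∀ i ∈ s, 0 ≤ f i) :
    ∑ i ∈ s, √(f i) ≤ √(#s * ∑ i ∈ s, f i) := by
  apply Real.le_sqrt_of_sq_le
  refine (sq_sum_le_card_mul_sum_sq).trans_eq ?_
  congr 1
  exact sum_congr rfl fun i hi => Real.sq_sqrt (hf i hi)

/-- The excess of a bonus `a / √n` over a threshold `θ`, summed over all visits. -/
theorem sum_clip_inv_sqrt_le (N : ℕ) (a θ : ℝ) (ha : 0 ≤ a) (hθ : 0 < θ) :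
    ∑ n ∈ range N, max (a / √((n : ℝ) + 1) - θ) 0 ≤ 2 * a ^ 2 / θ := by
  set K := ⌊a ^ 2 / θ ^ 2⌋₊ with hK
  have hKle : (K : ℝ) ≤ a ^ 2 / θ ^ 2 := Nat.floor_le (by positivity)
  have h1 : ∑ n ∈ range N, max (a / √((n : ℝ) + 1) - θ) 0 ≤
      ∑ n ∈ range N, if n < K then a * (1 / √((n : ℝ) + 1)) else 0 := by
    refine sum_le_sum fun n _ => ?_
    have h1 : 0 < √((n : ℝ) + 1) := Real.sqrt_pos.2 (by positivity)
    split_ifs with h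
    · have : 0 ≤ a * (1 / √((n : ℝ) + 1)) := by positivity
      apply max_le _ this
      rw [mul_one_div]; linarith
    · apply max_le _ le_rfl
      have hlt : a ^ 2 / θ ^ 2 < n + 1 := by
        have := Nat.lt_floor_add_one (a ^ 2 / θ ^ 2)
        have h3 : (K : ℝ) ≤ n := by exact_mod_cast not_lt.1 h
        rw [← hK] at this
        linarith
      rw [sub_nonpos, div_le_iff₀ h1]
      rw [div_lt_iff₀ (by positivity)] at hlt
      have : a ≤ √((θ * √((n : ℝ) + 1)) ^ 2) := by
        apply Real.le_sqrt_of_sq_le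
        rw [mul_pow, Real.sq_sqrt (by positivity)]
        linarith
      rwa [Real.sqrt_sq (by positivity)] at this
  refine h1.trans ?_
  rw [← sum_filter]
  have h2 : ∑ n ∈ (range N).filter (fun n => n < K), a * (1 / √((n : ℝ) + 1)) ≤
      ∑ n ∈ range K, a * (1 / √((n : ℝ) + 1)) := by
    apply sum_le_sum_of_subset_of_nonneg
    · intro n; simp
    · intros; positivity
  refine h2.trans ?_
  rw [← mul_sum]
  have h3 : √(K : ℝ) ≤ a / θ := by
    rw [Real.sqrt_le_left (by positivity), div_pow]; exact hKle
  calc a * ∑ n ∈ range K, 1 / √((n : ℝ) + 1) ≤ a * (2 * (a / θ)) := by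
        apply mul_le_mul_of_nonneg_left _ ha
        linarith [sum_inv_sqrt_le K]
    _ = 2 * a ^ 2 / θ := by ring

end UCBMultiStageAdvantage

/-! ### The stage schedule -/

namespace UCBMultiStageAdvantage

/-- The number of visits before stage `j` of a schedule with stage sizes `e`. -/
def stageStart (e : ℕ → ℕ) (j : ℕ) : ℕ := ∑ i ∈ range j, e i

theorem stageStart_zero (e : ℕ → ℕ) : stageStart e 0 = 0 := by simp [stageStart]

theorem stageStart_succ (e : ℕ → ℕ) (j : ℕ) :
    stageStart e (j + 1) = stageStart e j + e j := sum_range_succ _ _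

theorem mem_updateCounts_iff {e : ℕ → ℕ} {N₀ : ℝ} {n : ℕ} :
    n ∈ updateCounts e N₀ ↔ ∃ j, n = stageStart e (j + 1) ∧ (stageStart e j : ℝ) ≤ N₀ := Iff.rfl

theorem stageStart_mono (e : ℕ → ℕ) : Monotone (stageStart e) :=
  monotone_nat_of_le_succ fun j => by rw [stageStart_succ]; omega

theorem stageStart_strictMono {e : ℕ → ℕ} (he : ∀ j, 0 < e j) : StrictMono (stageStart e) :=
  strictMono_nat_of_lt_succ fun j => by rw [stageStart_succ]; have := he j; omega

theorem le_stageStart {e : ℕ → ℕ} (he : ∀ j, 0 < e j) (j : ℕ) : j ≤ stageStart e j :=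
  (stageStart_strictMono he).le_apply

theorem exists_stage {e : ℕ → ℕ} (he : ∀ j, 0 < e j) (n : ℕ) :
    ∃ j, stageStart e j ≤ n ∧ n < stageStart e (j + 1) := by
  have h : ∃ j, n < stageStart e (j + 1) :=
    ⟨n, lt_of_lt_of_le (Nat.lt_succ_self n) (le_stageStart he _)⟩
  classical
  refine ⟨Nat.find h, ?_, Nat.find_spec h⟩
  by_contra! hlt
  rcases hj : Nat.find h with _ | j
  · rw [hj, stageStart_zero] at hlt; omega
  · rw [hj] at hlt
    have := Nat.find_min' h hlt
    omega

theorem stage_unique {e : ℕ → ℕ} {n j k : ℕ} (h1 : stageStart e j ≤ n)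
    (h2 : n < stageStart e (j + 1)) (h3 : stageStart e k ≤ n) (h4 : n < stageStart e (k + 1)) :
    j = k := by
  by_contra hne
  rcases Nat.lt_or_gt_of_ne hne with h | h
  · have := stageStart_mono e (show j + 1 ≤ k from h); omega
  · have := stageStart_mono e (show k + 1 ≤ j from h); omega

theorem stageStart_mul {H : ℕ} (B k : ℕ) (hB : 1 ≤ B) :
    stageStart (typeISize H B) (B * k) = B * ∑ i ∈ range k, stageSize H i := by
  induction k with
  | zero => simp [stageStart]
  | succ k ih =>
    rw [stageStart, Nat.mul_succ, sum_range_add, ← stageStart, ih, sum_range_succ, mul_add]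
    congr 1
    rw [sum_congr rfl (g := fun _ => stageSize H k), sum_const, card_range, smul_eq_mul]
    intro x hx
    unfold typeISize
    rw [Nat.mul_add_div (by omega), Nat.div_eq_of_lt (mem_range.1 hx), add_zero]

theorem typeIISize_eq {H : ℕ} : typeIISize H = typeISize H 1 := by
  funext j; simp [typeIISize, typeISize]

section

variable {H : ℕ} (hH : 2 ≤ H)
include hH

theorem le_stageSize (j : ℕ) : H ≤ stageSize H j := by
  induction j with
  | zero => exact le_rfl
  | succ j ih =>
    refine ih.trans (Nat.le_floor ?_)
    have : (0 : ℝ) ≤ 1 / (H : ℝ) := by positivity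
    nlinarith [Nat.cast_nonneg (α := ℝ) (stageSize H j)]

theorem stageSize_succ_le (j : ℕ) :
    (stageSize H (j + 1) : ℝ) ≤ (1 + 1 / (H : ℝ)) * stageSize H j :=
  Nat.floor_le (by positivity)

theorem le_stageSize_succ (j : ℕ) :
    (1 + 1 / (2 * (H : ℝ))) * stageSize H j ≤ stageSize H (j + 1) := by
  have hH0 : (0 : ℝ) < H := by exact_mod_cast (by omega : 0 < H)
  set D := stageSize H j with hD
  have hHD : H ≤ D := le_stageSize hH j
  have hdiv : D + D / H ≤ stageSize H (j + 1) := by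
    refine Nat.le_floor ?_
    have : ((D / H : ℕ) : ℝ) ≤ (D : ℝ) / H := Nat.cast_div_le
    push_cast
    rw [← hD]
    calc (D : ℝ) + ((D / H : ℕ) : ℝ) ≤ D + (D : ℝ) / H := by linarith
      _ = (1 + 1 / (H : ℝ)) * D := by ring
  have h2 : D ≤ 2 * H * (D / H) := by
    have h3 := Nat.div_add_mod D H
    have h4 := Nat.mod_lt D (show 0 < H by omega)
    have h5 : 1 ≤ D / H := (Nat.one_le_div_iff (by omega)).2 hHD
    nlinarith
  have h3 : (D : ℝ) ≤ 2 * H * ((D / H : ℕ) : ℝ) := by exact_mod_cast h2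
  have h4 : (D : ℝ) + ((D / H : ℕ) : ℝ) ≤ stageSize H (j + 1) := by exact_mod_cast hdiv
  have h5 : 1 / (2 * (H : ℝ)) * D ≤ ((D / H : ℕ) : ℝ) := by
    rw [one_div_mul_eq_div, div_le_iff₀ (by positivity)]; linarith
  linarith

theorem sum_stageSize_le (k : ℕ) :
    (∑ i ∈ range (k + 1), (stageSize H i : ℝ)) ≤ 3 * H * stageSize H k := by
  have hH0 : (2 : ℝ) ≤ H := by exact_mod_cast hH
  induction k with
  | zero =>
    simp only [zero_add, sum_range_one]
    nlinarith [Nat.cast_nonneg (α := ℝ) (stageSize H 0)]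
  | succ k ih =>
    rw [sum_range_succ]
    have h1 := le_stageSize_succ hH k
    have h2 := stageSize_succ_le hH k
    have h3 : (1 : ℝ) / H ≤ 1 / 2 := by
      apply one_div_le_one_div_of_le <;> linarith
    have h0 := Nat.cast_nonneg (α := ℝ) (stageSize H k)
    have h4 : 3 * (H : ℝ) * ((1 + 1 / (2 * (H : ℝ))) * stageSize H k) =
        3 * H * stageSize H k + 3 / 2 * stageSize H k := by
      field_simp
    have h5 : 3 * (H : ℝ) * ((1 + 1 / (2 * (H : ℝ))) * stageSize H k) ≤
        3 * (H : ℝ) * stageSize H (k + 1) := by gcongr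
    nlinarith

theorem pow_le_stageSize (k : ℕ) : (1 + 1 / (2 * (H : ℝ))) ^ k ≤ stageSize H k := by
  induction k with
  | zero =>
    have : (1 : ℝ) ≤ H := by exact_mod_cast (by omega : 1 ≤ H)
    simpa [stageSize] using this
  | succ k ih =>
    refine le_trans ?_ (le_stageSize_succ hH k)
    rw [pow_succ, mul_comm]
    gcongr

theorem le_typeISize (B j : ℕ) : H ≤ typeISize H B j := le_stageSize hH _

theorem typeISize_pos (B j : ℕ) : 0 < typeISize H B j :=
  lt_of_lt_of_le (by omega) (le_typeISize hH B j)

theorem typeISize_succ_le (B j : ℕ) :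
    (typeISize H B (j + 1) : ℝ) ≤ (1 + 1 / (H : ℝ)) * typeISize H B j := by
  unfold typeISize
  have h1 : j / B ≤ (j + 1) / B := Nat.div_le_div_right (by omega)
  have h2 : (j + 1) / B ≤ j / B + 1 := by
    rcases Nat.eq_zero_or_pos B with h | h
    · simp [h]
    · calc (j + 1) / B ≤ (j + B) / B := Nat.div_le_div_right (by omega)
        _ = j / B + 1 := Nat.add_div_right j h
  rcases (by omega : (j + 1) / B = j / B ∨ (j + 1) / B = j / B + 1) with h | h
  · rw [h]
    have : (0 : ℝ) ≤ 1 / (H : ℝ) := by positivity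
    nlinarith [Nat.cast_nonneg (α := ℝ) (stageSize H (j / B))]
  · rw [h]; exact stageSize_succ_le hH _

theorem typeISize_succ_le_two_mul (B j : ℕ) : typeISize H B (j + 1) ≤ 2 * typeISize H B j := by
  have h := typeISize_succ_le hH B j
  have hH0 : (2 : ℝ) ≤ H := by exact_mod_cast hH
  have h3 : (1 : ℝ) / H ≤ 1 := by
    rw [div_le_one] <;> linarith
  have : (typeISize H B (j + 1) : ℝ) ≤ 2 * typeISize H B j := by
    nlinarith [Nat.cast_nonneg (α := ℝ) (typeISize H B j)]
  exact_mod_cast this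

/-- Up to a factor `3 H B`, a stage is as long as all the visits up to its end. -/
theorem stageStart_succ_le_mul (B j : ℕ) (hB : 1 ≤ B) :
    (stageStart (typeISize H B) (j + 1) : ℝ) ≤ 3 * H * B * typeISize H B j := by
  have h1 : j + 1 ≤ B * (j / B + 1) := by
    have h3 := Nat.div_add_mod j B
    have h4 := Nat.mod_lt j (show 0 < B by omega)
    rw [mul_add]; omega
  have h2 : (stageStart (typeISize H B) (j + 1) : ℝ) ≤
      (B : ℝ) * ∑ i ∈ range (j / B + 1), (stageSize H i : ℝ) := by
    have := stageStart_mono (typeISize H B) h1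
    rw [stageStart_mul _ _ hB] at this
    exact_mod_cast this
  have h3 := sum_stageSize_le hH (j / B)
  calc (stageStart (typeISize H B) (j + 1) : ℝ) ≤ B * (3 * H * stageSize H (j / B)) := by
        refine h2.trans ?_; gcongr
    _ = _ := by unfold typeISize; ring

theorem stageStart_add_two_le (B j : ℕ) (hB : 1 ≤ B) :
    (stageStart (typeISize H B) (j + 2) : ℝ) ≤ 5 * H * B * typeISize H B j := by
  rw [stageStart_succ]
  have h1 := stageStart_succ_le_mul hH B j hB
  have h2 : (typeISize H B (j + 1) : ℝ) ≤ 2 * typeISize H B j := by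
    exact_mod_cast typeISize_succ_le_two_mul hH B j
  have h3 : (1 : ℝ) ≤ H * B := by
    exact_mod_cast Nat.one_le_iff_ne_zero.2 (by positivity)
  have h4 := Nat.cast_nonneg (α := ℝ) (typeISize H B j)
  push_cast
  nlinarith [mul_le_mul_of_nonneg_right h3 h4]

theorem stageStart_add_two_le_three_mul (B j : ℕ) :
    stageStart (typeISize H B) (j + 2) ≤ 3 * stageStart (typeISize H B) (j + 1) := by
  have h := typeISize_succ_le_two_mul hH B j
  rw [stageStart_succ _ (j + 1), stageStart_succ]
  omega

/-- The stages grow geometrically, so few of them start within the first `N` visits. -/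
theorem stage_le_of_stageStart_le (B j : ℕ) (hB : 1 ≤ B) {N : ℝ} (hN : 1 ≤ N)
    (h : (stageStart (typeISize H B) j : ℝ) ≤ N) : (j : ℝ) ≤ B * (3 * H * Real.log N + 1) := by
  have hH0 : (2 : ℝ) ≤ H := by exact_mod_cast hH
  have hlog : 0 ≤ Real.log N := Real.log_nonneg hN
  rcases j with _ | j
  · simp only [Nat.cast_zero]; positivity
  set k := j / B with hk
  have h1 : (stageSize H k : ℝ) ≤ N := by
    refine le_trans ?_ h
    rw [stageStart_succ]
    have : stageSize H k = typeISize H B j := rfl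
    push_cast [this]
    linarith [Nat.cast_nonneg (α := ℝ) (stageStart (typeISize H B) j)]
  have h2 : (k : ℝ) * Real.log (1 + 1 / (2 * (H : ℝ))) ≤ Real.log N := by
    rw [← Real.log_pow]
    exact Real.log_le_log (by positivity) ((pow_le_stageSize hH k).trans h1)
  have h3 : 1 / (3 * (H : ℝ)) ≤ Real.log (1 + 1 / (2 * (H : ℝ))) := by
    have := Real.one_sub_inv_le_log_of_pos (show 0 < 1 + 1 / (2 * (H : ℝ)) by positivity)
    refine le_trans ?_ this
    have e : 1 - (1 + 1 / (2 * (H : ℝ)))⁻¹ = 1 / (2 * H + 1) := by field_simp; ring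
    rw [e]
    apply one_div_le_one_div_of_le <;> linarith
  have h4 : (k : ℝ) ≤ 3 * H * Real.log N := by
    have : (k : ℝ) * (1 / (3 * (H : ℝ))) ≤ Real.log N :=
      (mul_le_mul_of_nonneg_left h3 (Nat.cast_nonneg k)).trans h2
    rw [mul_one_div, div_le_iff₀ (by positivity)] at this
    linarith
  have h5 : j + 1 ≤ B * (k + 1) := by
    have h3 : B * k + j % B = j := Nat.div_add_mod j B
    have h4 := Nat.mod_lt j (show 0 < B by omega)
    rw [mul_add]; omega
  have h6 : ((j + 1 : ℕ) : ℝ) ≤ B * (k + 1) := by exact_mod_cast h5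
  refine h6.trans ?_
  gcongr

/-- The drift of a nonincreasing quantity `G` between consecutive stages. As the stage size changes
only once in `B` stages, and then by a factor of at most `1 + 1/H`, summation by parts leaves only
a fraction `1 / (H B)` of the total of `G`. -/
theorem sum_stage_drift_le (B : ℕ) (hB : 1 ≤ B) (G : ℕ → ℝ) (hG : Antitone G) (hG0 : ∀ n, 0 ≤ G n)
    (J : ℕ) :
    ∑ j ∈ range J, ∑ n ∈ Ico (stageStart (typeISize H B) (j + 1))
        (stageStart (typeISize H B) (j + 2)),
      ((∑ i ∈ Ico (stageStart (typeISize H B) j) (stageStart (typeISize H B) (j + 1)), G i) /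
        typeISize H B j - G n) ≤
      H * G 0 + 1 / (H * B) * ∑ n ∈ range (stageStart (typeISize H B) J), G n := by
  set e := typeISize H B with he
  set st := stageStart e with hst
  have hepos : ∀ j, (0 : ℝ) < e j := fun j => by exact_mod_cast typeISize_pos hH B j
  set a : ℕ → ℝ := fun j => ∑ i ∈ Ico (st j) (st (j + 1)), G i with ha
  have hcard : ∀ j, (#(Ico (st j) (st (j + 1))) : ℝ) = e j := fun j => by
    rw [Nat.card_Ico, hst, stageStart_succ]; simp
  have hinner : ∀ j, ∑ n ∈ Ico (st (j + 1)) (st (j + 2)), (a j / e j - G n) =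
      (e (j + 1) - e j) * (a j / e j) + (a j - a (j + 1)) := fun j => by
    rw [sum_sub_distrib, sum_const, nsmul_eq_mul, hcard (j + 1)]
    have := (hepos j).ne'
    simp only [ha]
    field_simp
    ring
  have ha0 : ∀ j, 0 ≤ a j := fun j => sum_nonneg fun i _ => hG0 i
  have hsum : ∀ k, ∑ j ∈ range k, a j = ∑ n ∈ range (st k), G n := fun k => by
    induction k with
    | zero => simp [hst, stageStart]
    | succ k ih =>
      rw [sum_range_succ, ih, ha]
      exact sum_range_add_sum_Ico _ (stageStart_mono e (by omega))
  have hup : ∀ j, a j / e j ≤ G (st j) := fun j => by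
    rw [div_le_iff₀ (hepos j), ha]
    calc ∑ i ∈ Ico (st j) (st (j + 1)), G i ≤ ∑ i ∈ Ico (st j) (st (j + 1)), G (st j) :=
          sum_le_sum fun i hi => hG (mem_Ico.1 hi).1
      _ = _ := by rw [sum_const, nsmul_eq_mul, hcard, mul_comm]
  have hlow : ∀ j, G (st (j + 1)) ≤ a j / e j := fun j => by
    rw [le_div_iff₀ (hepos j), ha]
    calc G (st (j + 1)) * e j = ∑ i ∈ Ico (st j) (st (j + 1)), G (st (j + 1)) := by
          rw [sum_const, nsmul_eq_mul, hcard, mul_comm]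
      _ ≤ _ := sum_le_sum fun i hi => hG (mem_Ico.1 hi).2.le
  have hanti : Antitone fun j => a j / e j :=
    antitone_nat_of_succ_le fun j => (hup (j + 1)).trans (hlow j)
  set D : ℕ → ℝ := fun j => (e (j + 1) - e j) * (a j / e j) with hD
  have hH0 : (0 : ℝ) < H := by exact_mod_cast (by omega : 0 < H)
  have hB0 : (0 : ℝ) < B := by exact_mod_cast hB
  have hsize : ∀ k r, r < B → e (B * k + r) = stageSize H k := fun k r hr => by
    simp only [he, typeISize]
    rw [Nat.mul_add_div (by omega), Nat.div_eq_of_lt hr, add_zero]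
  have hblock : ∀ k, ∑ r ∈ range B, D (B * k + r) ≤ 1 / (H * B) * ∑ r ∈ range B, a (B * k + r) := by
    intro k
    obtain ⟨b, rfl⟩ : ∃ b, B = b + 1 := ⟨B - 1, by omega⟩
    have h0 : ∀ r ∈ range b, D ((b + 1) * k + r) = 0 := fun r hr => by
      have hr := mem_range.1 hr
      simp only [hD, add_assoc]
      rw [hsize k (r + 1) (by omega), hsize k r (by omega)]; simp
    rw [sum_range_succ, sum_eq_zero h0, zero_add]
    set A := a ((b + 1) * k + b) / e ((b + 1) * k + b) with hA
    have hA0 : 0 ≤ A := div_nonneg (ha0 _) (hepos _).le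
    have h1 : D ((b + 1) * k + b) ≤ (stageSize H k : ℝ) / H * A := by
      simp only [hD]
      rw [← hA]
      apply mul_le_mul_of_nonneg_right _ hA0
      have e1 : (b + 1) * k + b + 1 = (b + 1) * (k + 1) + 0 := by ring
      rw [e1, hsize (k + 1) 0 (by omega), hsize k b (by omega)]
      have := stageSize_succ_le hH k
      rw [add_mul, one_mul, one_div_mul_eq_div] at this
      linarith
    have h2 : ∀ r ∈ range (b + 1), (stageSize H k : ℝ) * A ≤ a ((b + 1) * k + r) := fun r hr => by
      have hr := mem_range.1 hr
      have h3 : A ≤ a ((b + 1) * k + r) / e ((b + 1) * k + r) :=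
        hanti (show (b + 1) * k + r ≤ (b + 1) * k + b by omega)
      rw [le_div_iff₀ (hepos _), hsize k r hr] at h3
      linarith
    have h3 := card_nsmul_le_sum _ _ _ h2
    rw [card_range, nsmul_eq_mul] at h3
    refine h1.trans ?_
    calc (stageSize H k : ℝ) / H * A
        = 1 / (H * ((b + 1 : ℕ) : ℝ)) * (((b + 1 : ℕ) : ℝ) * (stageSize H k * A)) := by
          field_simp
      _ ≤ _ := by gcongr
  have hDall : ∀ k, ∑ j ∈ range (B * k), D j ≤ 1 / (H * B) * ∑ j ∈ range (B * k), a j := by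
    intro k
    induction k with
    | zero => simp
    | succ k ih =>
      rw [Nat.mul_succ, sum_range_add, sum_range_add, mul_add]
      exact add_le_add ih (hblock k)
  have hDJ : ∑ j ∈ range J, D j ≤ 1 / (H * B) * ∑ j ∈ range J, a j := by
    have hJ := Nat.div_add_mod J B
    have hJr := Nat.mod_lt J (show 0 < B by omega)
    set k := J / B
    set r := J % B
    rw [← hJ, sum_range_add, sum_range_add, mul_add]
    refine add_le_add (hDall k) ?_
    have h1 : ∑ x ∈ range r, D (B * k + x) ≤ 0 := by
      refine sum_nonpos fun x hx => ?_
      have hx := mem_range.1 hx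
      simp only [hD, add_assoc]
      rw [hsize k (x + 1) (by omega), hsize k x (by omega)]; simp
    refine h1.trans ?_
    have := sum_nonneg fun x (_ : x ∈ range r) => ha0 (B * k + x)
    positivity
  have htel : ∑ j ∈ range J, (a j - a (j + 1)) = a 0 - a J := sum_range_sub' _ _
  calc _ = ∑ j ∈ range J, (D j + (a j - a (j + 1))) := sum_congr rfl fun j _ => hinner j
    _ = ∑ j ∈ range J, D j + (a 0 - a J) := by rw [sum_add_distrib, htel]
    _ ≤ 1 / (H * B) * ∑ j ∈ range J, a j + H * G 0 := by
        have h1 := hup 0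
        rw [div_le_iff₀ (hepos 0)] at h1
        have h2 : e 0 = H := by simp [he, typeISize, stageSize]
        have h3 : st 0 = 0 := by simp [hst, stageStart]
        rw [h2, h3] at h1
        linarith [ha0 J]
    _ = _ := by rw [hsum]; ring

end

end UCBMultiStageAdvantage

/-! ### Values and the Bellman equations -/

namespace DiscountedMDP

variable {S A : Type*} [Fintype S]

/-- The expectation of `f` at the state reached by playing `a` at `s`. -/
def expect (M : DiscountedMDP S A) (s : S) (a : A) (f : S → ℝ) : ℝ := ∑ s', M.P s a s' * f s'

/-- The variance of `f` at the state reached by playing `a` at `s`. -/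
noncomputable def variance (M : DiscountedMDP S A) (s : S) (a : A) (f : S → ℝ) : ℝ :=
  M.expect s a (fun x => f x ^ 2) - M.expect s a f ^ 2

variable (M : DiscountedMDP S A)

theorem expect_mono (s : S) (a : A) {f g : S → ℝ} (h : ∀ x, f x ≤ g x) :
    M.expect s a f ≤ M.expect s a g :=
  sum_le_sum fun x _ => mul_le_mul_of_nonneg_left (h x) (M.P_nonneg s a x)

theorem expect_const (s : S) (a : A) (c : ℝ) : M.expect s a (fun _ => c) = c := by
  simp [expect, ← sum_mul, M.P_sum]

theorem expect_nonneg (s : S) (a : A) {f : S → ℝ} (h : ∀ x, 0 ≤ f x) : 0 ≤ M.expect s a f :=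
  sum_nonneg fun x _ => mul_nonneg (M.P_nonneg s a x) (h x)

theorem expect_le (s : S) (a : A) {f : S → ℝ} {c : ℝ} (h : ∀ x, f x ≤ c) : M.expect s a f ≤ c :=
  (M.expect_mono s a h).trans_eq (M.expect_const s a c)

theorem le_expect (s : S) (a : A) {f : S → ℝ} {c : ℝ} (h : ∀ x, c ≤ f x) : c ≤ M.expect s a f :=
  (M.expect_const s a c).symm.trans_le (M.expect_mono s a h)

theorem expect_add (s : S) (a : A) (f g : S → ℝ) :
    M.expect s a (fun x => f x + g x) = M.expect s a f + M.expect s a g := by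
  simp [expect, mul_add, sum_add_distrib]

theorem expect_sub (s : S) (a : A) (f g : S → ℝ) :
    M.expect s a (fun x => f x - g x) = M.expect s a f - M.expect s a g := by
  simp [expect, mul_sub, sum_sub_distrib]

theorem expect_mul (s : S) (a : A) (c : ℝ) (f : S → ℝ) :
    M.expect s a (fun x => c * f x) = c * M.expect s a f := by
  simp only [expect, mul_sum]; exact sum_congr rfl fun _ _ => by ring

theorem expect_div (s : S) (a : A) (f : S → ℝ) (c : ℝ) :
    M.expect s a (fun x => f x / c) = M.expect s a f / c := by
  simp only [expect, sum_div]; exact sum_congr rfl fun _ _ => by ring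

theorem variance_eq (s : S) (a : A) (f : S → ℝ) :
    M.variance s a f = M.expect s a (fun x => (f x - M.expect s a f) ^ 2) := by
  have : ∀ x, (f x - M.expect s a f) ^ 2 =
      f x ^ 2 - 2 * M.expect s a f * f x + M.expect s a f ^ 2 := fun x => by ring
  simp only [this]
  rw [expect_add, expect_sub, expect_mul, expect_const, variance]
  ring

theorem variance_nonneg (s : S) (a : A) (f : S → ℝ) : 0 ≤ M.variance s a f := by
  rw [variance_eq]; exact M.expect_nonneg s a fun x => sq_nonneg _

theorem variance_le_expect_sq (s : S) (a : A) (f : S → ℝ) :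
    M.variance s a f ≤ M.expect s a (fun x => f x ^ 2) := by
  unfold variance; linarith [sq_nonneg (M.expect s a f)]

theorem one_sub_γ_pos : 0 < 1 - M.γ := by linarith [M.γ_lt_one]

/-- The discounted sum of `u` along a policy vanishes if `u` is dominated by its own discounted
successor average. -/
theorem nonpos_of_le_expect (π : S → A) {u : S → ℝ}
    (h : ∀ s, u s ≤ M.γ * M.expect s (π s) u) (s : S) : u s ≤ 0 := by
  have : Nonempty S := ⟨s⟩
  obtain ⟨x, hx⟩ := Finite.exists_max u
  have h1 : u x ≤ M.γ * u x :=
    (h x).trans (mul_le_mul_of_nonneg_left (M.expect_le x _ hx) M.γ_pos.le)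
  have h2 : u x ≤ 0 := by nlinarith [M.one_sub_γ_pos]
  exact (hx s).trans h2

theorem transition_mulVec (π : S → A) (y : S → ℝ) (s : S) :
    (M.transition π).mulVec y s = M.expect s (π s) y := rfl

variable [DecidableEq S]

/-- The expected discounted sum of `y` along the policy `π`. -/
noncomputable def discounted (π : S → A) (y : S → ℝ) (s : S) : ℝ :=
  ∑' t : ℕ, M.γ ^ t * ((M.transition π ^ t).mulVec y) s

theorem pow_mulVec_succ (π : S → A) (y : S → ℝ) (t : ℕ) (s : S) :
    ((M.transition π ^ (t + 1)).mulVec y) s =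
      M.expect s (π s) ((M.transition π ^ t).mulVec y) := by
  rw [pow_succ', ← Matrix.mulVec_mulVec, transition_mulVec]

theorem abs_pow_mulVec_le (π : S → A) {y : S → ℝ} {C : ℝ} (hy : ∀ s, |y s| ≤ C) (t : ℕ) (s : S) :
    |((M.transition π ^ t).mulVec y) s| ≤ C := by
  induction t generalizing s with
  | zero => simpa using hy s
  | succ t ih =>
    rw [pow_mulVec_succ, abs_le]
    exact ⟨M.le_expect _ _ fun x => (abs_le.1 (ih x)).1,
      M.expect_le _ _ fun x => (abs_le.1 (ih x)).2⟩

theorem summable_discounted (π : S → A) (y : S → ℝ) (s : S) :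
    Summable fun t : ℕ => M.γ ^ t * ((M.transition π ^ t).mulVec y) s := by
  obtain ⟨C, hC⟩ : ∃ C, ∀ s, |y s| ≤ C := by
    refine ⟨∑ s, |y s|, fun s => ?_⟩
    exact single_le_sum (f := fun s => |y s|) (fun i _ => abs_nonneg _) (mem_univ s)
  refine Summable.of_norm_bounded
    ((summable_geometric_of_lt_one M.γ_pos.le M.γ_lt_one).mul_right C) fun t => ?_
  rw [Real.norm_eq_abs, abs_mul, abs_of_nonneg (pow_nonneg M.γ_pos.le t)]
  exact mul_le_mul_of_nonneg_left (M.abs_pow_mulVec_le π hC t s) (pow_nonneg M.γ_pos.le t)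

theorem discounted_eq (π : S → A) (y : S → ℝ) (s : S) :
    M.discounted π y s = y s + M.γ * M.expect s (π s) (M.discounted π y) := by
  have h := (M.summable_discounted π y s).tsum_eq_zero_add
  unfold discounted expect
  rw [h]
  simp only [pow_zero, Matrix.one_mulVec, one_mul]
  congr 1
  rw [mul_sum]
  simp only [← tsum_mul_left]
  rw [← Summable.tsum_finsetSum]
  · refine tsum_congr fun t => ?_
    rw [pow_mulVec_succ, expect, mul_sum]
    exact sum_congr rfl fun x _ => by ring
  · intro x _
    exact ((M.summable_discounted π y x).mul_left _).mul_left _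

theorem value_eq_discounted (π : S → A) :
    M.value π = M.discounted π fun x => M.r x (π x) := rfl

theorem value_eq (π : S → A) (s : S) :
    M.value π s = M.r s (π s) + M.γ * M.expect s (π s) (M.value π) := by
  rw [value_eq_discounted]; exact M.discounted_eq π _ s

theorem le_discounted (π : S → A) {y u : S → ℝ}
    (h : ∀ s, u s ≤ y s + M.γ * M.expect s (π s) u) (s : S) : u s ≤ M.discounted π y s := by
  have := M.nonpos_of_le_expect π (u := fun s => u s - M.discounted π y s) (fun s => by
    rw [expect_sub]
    linarith [h s, M.discounted_eq π y s]) s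
  linarith

theorem discounted_le (π : S → A) {y u : S → ℝ}
    (h : ∀ s, y s + M.γ * M.expect s (π s) u ≤ u s) (s : S) : M.discounted π y s ≤ u s := by
  have := M.nonpos_of_le_expect π (u := fun s => M.discounted π y s - u s) (fun s => by
    rw [expect_sub]
    linarith [h s, M.discounted_eq π y s]) s
  linarith

theorem discounted_nonneg (π : S → A) {y : S → ℝ} (h : ∀ s, 0 ≤ y s) (s : S) :
    0 ≤ M.discounted π y s :=
  M.le_discounted π (u := fun _ => 0) (fun s => by rw [expect_const]; linarith [h s]) s

theorem discounted_le_div (π : S → A) {y : S → ℝ} {C : ℝ} (h : ∀ s, y s ≤ C) (s : S) :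
    M.discounted π y s ≤ C / (1 - M.γ) :=
  M.discounted_le π (u := fun _ => C / (1 - M.γ)) (fun s => by
    rw [expect_const]
    have := h s
    have h1 := M.one_sub_γ_pos
    have : C + M.γ * (C / (1 - M.γ)) = C / (1 - M.γ) := by field_simp; ring
    linarith) s

/-- The clipping threshold of a state-action pair. It is at least `ε (1 - γ) / 4` and grows with the
variance of `V^*`, hence exceeds the bonuses after many visits; nevertheless its discounted sum
along any policy is at most `ε / 2` (`discounted_threshold_le`). -/
noncomputable def threshold (ε : ℝ) (s : S) (a : A) : ℝ :=
  ε / 4 * ((1 - M.γ) + M.γ * (1 - M.γ) ^ 2 * M.variance s a M.optValue)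

theorem le_threshold {ε : ℝ} (hε : 0 ≤ ε) (s : S) (a : A) :
    ε / 4 * (1 - M.γ) ≤ M.threshold ε s a := by
  unfold threshold
  have h1 := M.variance_nonneg s a M.optValue
  have h2 := M.γ_pos
  have : 0 ≤ ε / 4 * (M.γ * (1 - M.γ) ^ 2 * M.variance s a M.optValue) := by positivity
  linarith

variable [Finite A] [Nonempty A]

/-- A policy of maximal total value satisfies the Bellman optimality inequality: otherwise changing
its action at one state would improve it. -/
theorem exists_optimal_policy :
    ∃ π : S → A, ∀ s a, M.r s a + M.γ * M.expect s a (M.value π) ≤ M.value π s := by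
  classical
  obtain ⟨π, hπ⟩ := Finite.exists_max fun π : S → A => ∑ s, M.value π s
  refine ⟨π, fun s₀ a => ?_⟩
  by_contra! hlt
  set π' := Function.update π s₀ a with hπ'
  have hle : ∀ s, M.value π s ≤ M.r s (π' s) + M.γ * M.expect s (π' s) (M.value π) := fun s => by
    by_cases hs : s = s₀
    · subst hs; rw [hπ', Function.update_self]; exact hlt.le
    · rw [hπ', Function.update_of_ne hs]; exact (M.value_eq π s).le
  have h1 : ∀ s, M.value π s ≤ M.value π' s := M.le_discounted π' hle
  have h2 : M.value π s₀ < M.value π' s₀ := by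
    rw [M.value_eq π' s₀, hπ', Function.update_self, ← hπ']
    refine hlt.trans_le ?_
    have := mul_le_mul_of_nonneg_left (M.expect_mono s₀ a h1) M.γ_pos.le
    linarith
  exact absurd (hπ π') (not_le.2 (sum_lt_sum (fun s _ => h1 s) ⟨s₀, mem_univ _, h2⟩))

theorem exists_value_eq_optValue :
    ∃ π : S → A, (∀ s, M.optValue s = M.value π s) ∧
      ∀ s a, M.r s a + M.γ * M.expect s a (M.value π) ≤ M.value π s := by
  obtain ⟨π, hπ⟩ := M.exists_optimal_policy
  refine ⟨π, fun s => le_antisymm (ciSup_le fun π' => ?_) ?_, hπ⟩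
  · exact M.discounted_le π' (fun s => hπ s (π' s)) s
  · exact le_ciSup (f := fun π => M.value π s) (Set.finite_range _).bddAbove π

theorem bellman_le (s : S) (a : A) :
    M.r s a + M.γ * M.expect s a M.optValue ≤ M.optValue s := by
  obtain ⟨π, h1, h2⟩ := M.exists_value_eq_optValue
  rw [funext h1]; exact h2 s a

theorem exists_bellman_eq (s : S) :
    ∃ a, M.optValue s = M.r s a + M.γ * M.expect s a M.optValue := by
  obtain ⟨π, h1, h2⟩ := M.exists_value_eq_optValue
  exact ⟨π s, by rw [funext h1]; exact M.value_eq π s⟩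

theorem optValue_nonneg (s : S) : 0 ≤ M.optValue s := by
  obtain ⟨π, h1, h2⟩ := M.exists_value_eq_optValue
  rw [h1]; exact M.discounted_nonneg π (fun s => M.r_nonneg _ _) s

theorem optValue_le (s : S) : M.optValue s ≤ 1 / (1 - M.γ) := by
  obtain ⟨π, h1, h2⟩ := M.exists_value_eq_optValue
  rw [h1]; exact M.discounted_le_div π (fun s => M.r_le_one _ _) s

/-- A law of total variance: the discounted sum of the variances of `V^*` along any policy is
bounded by means of the supersolution `2 R V^* - (V^*)²`, where `R = 1 / (1 - γ)`. -/
theorem discounted_threshold_le {ε : ℝ} (hε : 0 ≤ ε) (π : S → A) (s : S) :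
    M.discounted π (fun x => M.threshold ε x (π x)) s ≤ ε / 2 := by
  set R := 1 / (1 - M.γ) with hR
  have hγ := M.one_sub_γ_pos
  have hγ0 := M.γ_pos
  have hR0 : 0 < R := by positivity
  have hRγ : (1 - M.γ) * R = 1 := by rw [hR]; field_simp
  set V := M.optValue with hV
  have hV0 : ∀ x, 0 ≤ V x := M.optValue_nonneg
  have hVR : ∀ x, V x ≤ R := M.optValue_le
  -- `Z` dominates the threshold plus `γ` times its own expectation at the next state
  set Z : S → ℝ := fun x => ε / 4 * (1 + (1 - M.γ) ^ 2 * (2 * R * V x - V x ^ 2)) with hZ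
  have h1 : M.discounted π (fun x => M.threshold ε x (π x)) s ≤ Z s := by
    refine M.discounted_le π (fun x => ?_) s
    set a := π x
    have e1 : M.expect x a Z = ε / 4 * (1 + (1 - M.γ) ^ 2 *
        (2 * R * M.expect x a V - M.expect x a (fun y => V y ^ 2))) := by
      simp only [hZ]
      rw [expect_mul, expect_add, expect_const, expect_mul, expect_sub, expect_mul]
    rw [e1]
    simp only [threshold, variance, hZ, ← hV]
    set E := M.expect x a V
    set E2 := M.expect x a (fun y => V y ^ 2)
    have hb : M.γ * E ≤ V x := by
      have := M.bellman_le x a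
      have h0 := M.r_nonneg x a
      linarith
    have hE0 : 0 ≤ E := M.expect_nonneg x a hV0
    have key : M.γ * (E2 - E ^ 2) + M.γ * (2 * R * E - E2) ≤ 2 * R * V x - V x ^ 2 := by
      have p1 : 0 ≤ (V x - M.γ * E) * (2 * R - (V x + M.γ * E)) := by
        apply mul_nonneg (by linarith)
        linarith [hVR x]
      have p2 : 0 ≤ M.γ * (1 - M.γ) * E ^ 2 := by positivity
      nlinarith
    have key2 := mul_le_mul_of_nonneg_left key (show 0 ≤ ε / 4 * (1 - M.γ) ^ 2 by positivity)
    nlinarith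
  refine h1.trans ?_
  have h2 : 2 * R * V s - V s ^ 2 ≤ R ^ 2 := by nlinarith [sq_nonneg (R - V s)]
  have h3 : (1 - M.γ) ^ 2 * (2 * R * V s - V s ^ 2) ≤ 1 := by
    calc (1 - M.γ) ^ 2 * (2 * R * V s - V s ^ 2) ≤ (1 - M.γ) ^ 2 * R ^ 2 := by gcongr
      _ = 1 := by rw [← mul_pow, hRγ, one_pow]
  simp only [hZ]
  nlinarith

end DiscountedMDP

/-! ### Concentration along a trajectory -/

namespace OnlineAlgorithm

open MeasureTheory

variable {S A R : Type*} [Fintype S] (alg : OnlineAlgorithm S A R) (M : DiscountedMDP S A)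

theorem memory_congr {h h' : ℕ → S} (t : ℕ) (hh : ∀ i ≤ t, h i = h' i) :
    alg.memory M h t = alg.memory M h' t := by
  induction t with
  | zero => rfl
  | succ t ih =>
    simp only [memory]
    rw [ih fun i hi => hh i (by omega), hh t (by omega), hh (t + 1) le_rfl]

/-- The action played at time `t`. -/
def action (h : ℕ → S) (t : ℕ) : A := alg.policyAt M h t (h t)

theorem action_congr {h h' : ℕ → S} (t : ℕ) (hh : ∀ i ≤ t, h i = h' i) :
    alg.action M h t = alg.action M h' t := by
  unfold action policyAt
  rw [alg.memory_congr M t hh, hh t le_rfl]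

variable {alg M} {Ω : Type*} [MeasurableSpace Ω] {μ : Measure Ω} {s : ℕ → Ω → S}

/-- Ville's inequality for a nonnegative supermartingale `F`, conditionally on the first `t + 1`
states and for finitely many steps. Backward induction on the number of steps needs no
measurability. -/
theorem IsTrajectory.measure_exists_le_of_prefix (hs : alg.IsTrajectory M μ s)
    (F : ℕ → (ℕ → S) → ℝ) (hF0 : ∀ t h, 0 ≤ F t h)
    (hFc : ∀ t h h', (∀ i ≤ t, h i = h' i) → F t h = F t h')
    (hF : ∀ t h, M.expect (h t) (alg.action M h t)
      (fun x => F (t + 1) (Function.update h (t + 1) x)) ≤ F t h) (k t : ℕ) (h : ℕ → S) :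
    μ {ω | (∀ i ≤ t, s i ω = h i) ∧ ∃ t', t ≤ t' ∧ t' ≤ t + k ∧ 1 ≤ F t' fun i => s i ω} ≤
      ENNReal.ofReal (F t h) * μ {ω | ∀ i ≤ t, s i ω = h i} := by
  induction k generalizing t h with
  | zero =>
    by_cases h1 : 1 ≤ F t h
    · calc _ ≤ 1 * μ {ω | ∀ i ≤ t, s i ω = h i} := by
            rw [one_mul]; exact measure_mono fun ω hω => hω.1
        _ ≤ _ := by
            gcongr
            rw [← ENNReal.ofReal_one]; exact ENNReal.ofReal_le_ofReal h1
    · have : {ω | (∀ i ≤ t, s i ω = h i) ∧ ∃ t', t ≤ t' ∧ t' ≤ t + 0 ∧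
          1 ≤ F t' fun i => s i ω} = ∅ := by
        ext ω
        simp only [Set.mem_ofPred_eq, Set.mem_empty_iff_false, iff_false]
        rintro ⟨ha, t', h2, h3, h4⟩
        obtain rfl : t' = t := by omega
        exact h1 (h4.trans_eq (hFc _ _ _ ha))
      rw [this]; simp
  | succ k ih =>
    by_cases h1 : 1 ≤ F t h
    · calc _ ≤ 1 * μ {ω | ∀ i ≤ t, s i ω = h i} := by
            rw [one_mul]; exact measure_mono fun ω hω => hω.1
        _ ≤ _ := by
            gcongr
            rw [← ENNReal.ofReal_one]; exact ENNReal.ofReal_le_ofReal h1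
    · set A := μ {ω | ∀ i ≤ t, s i ω = h i} with hA
      have hsub : {ω | (∀ i ≤ t, s i ω = h i) ∧ ∃ t', t ≤ t' ∧ t' ≤ t + (k + 1) ∧
          1 ≤ F t' fun i => s i ω} ⊆ ⋃ x ∈ (univ : Finset S),
          {ω | (∀ i ≤ t + 1, s i ω = Function.update h (t + 1) x i) ∧ ∃ t', t + 1 ≤ t' ∧
            t' ≤ t + 1 + k ∧ 1 ≤ F t' fun i => s i ω} := by
        rintro ω ⟨ha, t', h2, h3, h4⟩
        have hne : t' ≠ t := by
          rintro rfl
          exact h1 (h4.trans_eq (hFc _ _ _ ha))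
        simp only [Set.mem_iUnion, mem_univ, exists_true_left]
        refine ⟨s (t + 1) ω, fun i hi => ?_, t', by omega, by omega, h4⟩
        rcases eq_or_ne i (t + 1) with rfl | hi'
        · simp
        · rw [Function.update_of_ne hi']; exact ha i (by omega)
      refine (measure_mono hsub).trans ((measure_biUnion_finset_le _ _).trans ?_)
      have hterm : ∀ x ∈ (univ : Finset S),
          μ {ω | (∀ i ≤ t + 1, s i ω = Function.update h (t + 1) x i) ∧ ∃ t', t + 1 ≤ t' ∧
            t' ≤ t + 1 + k ∧ 1 ≤ F t' fun i => s i ω} ≤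
          ENNReal.ofReal (M.P (h t) (alg.action M h t) x *
            F (t + 1) (Function.update h (t + 1) x)) * A := fun x _ => by
        refine (ih (t + 1) (Function.update h (t + 1) x)).trans_eq ?_
        have hagree : ∀ i ≤ t, Function.update h (t + 1) x i = h i := fun i hi =>
          Function.update_of_ne (by omega) _ _
        rw [hs.law]
        have e1 : {ω | ∀ i ≤ t, s i ω = Function.update h (t + 1) x i} =
            {ω | ∀ i ≤ t, s i ω = h i} := by
          ext ω
          simp only [Set.mem_ofPred_eq]
          exact forall₂_congr fun i hi => by rw [hagree i hi]
        have e2 : alg.policyAt M (Function.update h (t + 1) x) t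
            (Function.update h (t + 1) x t) = alg.action M h t :=
          alg.action_congr M t hagree
        rw [e1, e2, hagree t le_rfl, Function.update_self, ← hA,
          ENNReal.ofReal_mul (M.P_nonneg _ _ _)]
        ring
      refine (sum_le_sum hterm).trans ?_
      rw [← sum_mul, ← ENNReal.ofReal_sum_of_nonneg
        fun x _ => mul_nonneg (M.P_nonneg _ _ _) (hF0 _ _)]
      gcongr
      exact hF t h

/-- Ville's inequality: the probability that a nonnegative supermartingale which starts below `c`
ever reaches `1` is at most `c`. -/
theorem IsTrajectory.measure_exists_le [IsProbabilityMeasure μ] (hs : alg.IsTrajectory M μ s)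
    (F : ℕ → (ℕ → S) → ℝ) (hF0 : ∀ t h, 0 ≤ F t h)
    (hFc : ∀ t h h', (∀ i ≤ t, h i = h' i) → F t h = F t h')
    (hF : ∀ t h, M.expect (h t) (alg.action M h t)
      (fun x => F (t + 1) (Function.update h (t + 1) x)) ≤ F t h) {c : ℝ}
    (hc : ∀ h, F 0 h ≤ c) :
    μ {ω | ∃ t, 1 ≤ F t fun i => s i ω} ≤ ENNReal.ofReal c := by
  have hfin : ∀ k : ℕ, μ {ω | ∃ t ≤ k, 1 ≤ F t fun i => s i ω} ≤ ENNReal.ofReal c := fun k => by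
    have hsub : {ω | ∃ t ≤ k, 1 ≤ F t fun i => s i ω} ⊆ ⋃ x ∈ (univ : Finset S),
        {ω | (∀ i ≤ 0, s i ω = (fun _ => x) i) ∧ ∃ t', 0 ≤ t' ∧ t' ≤ 0 + k ∧
          1 ≤ F t' fun i => s i ω} := by
      rintro ω ⟨t, ht, h1⟩
      simp only [Set.mem_iUnion, mem_univ, exists_true_left]
      exact ⟨s 0 ω, fun i hi => by rw [Nat.le_zero.1 hi], t, by omega, by omega, h1⟩
    refine (measure_mono hsub).trans ((measure_biUnion_finset_le _ _).trans ?_)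
    have hterm : ∀ x ∈ (univ : Finset S),
        μ {ω | (∀ i ≤ 0, s i ω = (fun _ => x) i) ∧ ∃ t', 0 ≤ t' ∧ t' ≤ 0 + k ∧
          1 ≤ F t' fun i => s i ω} ≤ ENNReal.ofReal c * μ {ω | s 0 ω = x} := fun x _ => by
      refine (hs.measure_exists_le_of_prefix F hF0 hFc hF k 0 fun _ => x).trans ?_
      have e1 : {ω | ∀ i ≤ 0, s i ω = (fun _ => x) i} = {ω | s 0 ω = x} := by
        ext ω; simp
      rw [e1]
      gcongr
      exact hc _
    refine (sum_le_sum hterm).trans ?_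
    rw [← mul_sum, ← measure_biUnion_finset]
    · calc _ ≤ ENNReal.ofReal c * 1 := by gcongr; exact prob_le_one
        _ = _ := mul_one _
    · intro x _ y _ hxy
      refine Set.disjoint_left.2 fun ω h1 h2 => hxy ?_
      exact h1.symm.trans h2
    · exact fun x _ => hs.measurableSet_eq 0 x
  have hU : {ω | ∃ t, 1 ≤ F t fun i => s i ω} =
      ⋃ k : ℕ, {ω | ∃ t ≤ k, 1 ≤ F t fun i => s i ω} := by
    ext ω
    simp only [Set.mem_ofPred_eq, Set.mem_iUnion]
    exact ⟨fun ⟨t, ht⟩ => ⟨t, t, le_rfl, ht⟩, fun ⟨k, t, _, ht⟩ => ⟨t, ht⟩⟩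
  rw [hU, Monotone.measure_iUnion]
  · exact iSup_le hfin
  · intro k l hkl ω ⟨t, ht, h1⟩
    exact ⟨t, ht.trans hkl, h1⟩

variable (alg M)

/-- The sum over the first `t` steps of the deviations of a predictable function `ψ` of the next
state from its conditional expectation. -/
noncomputable def deviation (ψ : (R → ℝ) → S → S → ℝ) (h : ℕ → S) (t : ℕ) : ℝ :=
  ∑ i ∈ range t, (ψ (alg.memory M h i) (h i) (h (i + 1)) -
    M.expect (h i) (alg.action M h i) (ψ (alg.memory M h i) (h i)))

/-- The sum of the conditional variances that belong to `deviation`. -/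
noncomputable def quadVar (ψ : (R → ℝ) → S → S → ℝ) (h : ℕ → S) (t : ℕ) : ℝ :=
  ∑ i ∈ range t, M.variance (h i) (alg.action M h i) (ψ (alg.memory M h i) (h i))

theorem deviation_congr (ψ : (R → ℝ) → S → S → ℝ) {h h' : ℕ → S} (t : ℕ)
    (hh : ∀ i ≤ t, h i = h' i) : alg.deviation M ψ h t = alg.deviation M ψ h' t := by
  refine sum_congr rfl fun i hi => ?_
  have hi := mem_range.1 hi
  rw [alg.memory_congr M i fun k hk => hh k (by omega),
    alg.action_congr M i fun k hk => hh k (by omega), hh i (by omega), hh (i + 1) (by omega)]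

theorem quadVar_congr (ψ : (R → ℝ) → S → S → ℝ) {h h' : ℕ → S} (t : ℕ)
    (hh : ∀ i ≤ t, h i = h' i) : alg.quadVar M ψ h t = alg.quadVar M ψ h' t := by
  refine sum_congr rfl fun i hi => ?_
  have hi := mem_range.1 hi
  rw [alg.memory_congr M i fun k hk => hh k (by omega),
    alg.action_congr M i fun k hk => hh k (by omega), hh i (by omega)]

end OnlineAlgorithm

/-- The conditional step of Freedman's inequality, from `exp y ≤ 1 + y + y²` for `|y| ≤ 1`. -/
theorem DiscountedMDP.expect_exp_le {S A : Type*} [Fintype S] (M : DiscountedMDP S A) (s : S)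
    (a : A) {f : S → ℝ} (hf0 : ∀ x, 0 ≤ f x) (hf1 : ∀ x, f x ≤ 1) {l : ℝ} (hl : |l| ≤ 1) :
    M.expect s a (fun x => Real.exp (l * (f x - M.expect s a f) - l ^ 2 * M.variance s a f)) ≤
      1 := by
  set E := M.expect s a f
  set v := M.variance s a f
  have hE0 : 0 ≤ E := M.expect_nonneg s a hf0
  have hE1 : E ≤ 1 := M.expect_le s a hf1
  have h1 : ∀ x, Real.exp (l * (f x - E)) ≤ 1 + l * (f x - E) + l ^ 2 * (f x - E) ^ 2 := fun x => by
    have h2 : |l * (f x - E)| ≤ 1 := by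
      rw [abs_mul]
      have : |f x - E| ≤ 1 := abs_le.2 ⟨by linarith [hf0 x], by linarith [hf1 x]⟩
      nlinarith [abs_nonneg l, abs_nonneg (f x - E)]
    have h3 := (abs_le.1 (Real.abs_exp_sub_one_sub_id_le h2)).2
    nlinarith
  have h2 : M.expect s a (fun x => Real.exp (l * (f x - E))) ≤ 1 + l ^ 2 * v := by
    refine (M.expect_mono s a h1).trans_eq ?_
    rw [expect_add, expect_add, expect_mul, expect_mul, expect_sub, expect_const, expect_const,
      ← M.variance_eq]
    ring
  have h3 : 1 + l ^ 2 * v ≤ Real.exp (l ^ 2 * v) := by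
    linarith [Real.add_one_le_exp (l ^ 2 * v)]
  have e : (fun x => Real.exp (l * (f x - E) - l ^ 2 * v)) =
      fun x => Real.exp (-(l ^ 2 * v)) * Real.exp (l * (f x - E)) := by
    funext x; rw [← Real.exp_add]; congr 1; ring
  rw [e, expect_mul]
  calc _ ≤ Real.exp (-(l ^ 2 * v)) * Real.exp (l ^ 2 * v) := by gcongr; exact h2.trans h3
    _ = 1 := by rw [← Real.exp_add]; simp

namespace OnlineAlgorithm

open MeasureTheory

variable {S A R : Type*} [Fintype S] {alg : OnlineAlgorithm S A R} {M : DiscountedMDP S A}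
  {Ω : Type*} [MeasurableSpace Ω] {μ : Measure Ω} {s : ℕ → Ω → S}

/-- The exponential supermartingale bound behind Freedman's inequality, for a fixed exponent `l`. -/
theorem IsTrajectory.measure_mul_deviation [IsProbabilityMeasure μ] (hs : alg.IsTrajectory M μ s)
    {ψ : (R → ℝ) → S → S → ℝ} (hψ0 : ∀ m x y, 0 ≤ ψ m x y) (hψ1 : ∀ m x y, ψ m x y ≤ 1)
    {l : ℝ} (hl : |l| ≤ 1) (c : ℝ) :
    μ {ω | ∃ t, l ^ 2 * alg.quadVar M ψ (fun i => s i ω) t + c ≤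
      l * alg.deviation M ψ (fun i => s i ω) t} ≤ ENNReal.ofReal (Real.exp (-c)) := by
  have := hs.measure_exists_le
    (fun t h => Real.exp (l * alg.deviation M ψ h t - l ^ 2 * alg.quadVar M ψ h t - c))
    (fun t h => (Real.exp_pos _).le)
    (fun t h h' hh => by rw [alg.deviation_congr M ψ t hh, alg.quadVar_congr M ψ t hh])
    (fun t h => by
      set a := alg.action M h t
      set m := alg.memory M h t
      have e : ∀ x, Real.exp (l * alg.deviation M ψ (Function.update h (t + 1) x) (t + 1) -
          l ^ 2 * alg.quadVar M ψ (Function.update h (t + 1) x) (t + 1) - c) =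
          Real.exp (l * alg.deviation M ψ h t - l ^ 2 * alg.quadVar M ψ h t - c) *
          Real.exp (l * (ψ m (h t) x - M.expect (h t) a (ψ m (h t))) -
            l ^ 2 * M.variance (h t) a (ψ m (h t))) := fun x => by
        have hagree : ∀ i ≤ t, Function.update h (t + 1) x i = h i := fun i hi =>
          Function.update_of_ne (by omega) _ _
        have e1 : alg.deviation M ψ (Function.update h (t + 1) x) (t + 1) =
            alg.deviation M ψ h t + (ψ m (h t) x - M.expect (h t) a (ψ m (h t))) := by
          rw [deviation, sum_range_succ, ← deviation, alg.deviation_congr M ψ t hagree,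
            alg.memory_congr M t hagree, alg.action_congr M t hagree, hagree t le_rfl,
            Function.update_self]
        have e2 : alg.quadVar M ψ (Function.update h (t + 1) x) (t + 1) =
            alg.quadVar M ψ h t + M.variance (h t) a (ψ m (h t)) := by
          rw [quadVar, sum_range_succ, ← quadVar, alg.quadVar_congr M ψ t hagree,
            alg.memory_congr M t hagree, alg.action_congr M t hagree, hagree t le_rfl]
        rw [e1, e2, ← Real.exp_add]
        congr 1
        ring
      simp only [e]
      rw [M.expect_mul]
      calc _ ≤ Real.exp (l * alg.deviation M ψ h t - l ^ 2 * alg.quadVar M ψ h t - c) * 1 := by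
            gcongr
            exact M.expect_exp_le (h t) a (hψ0 m (h t)) (hψ1 m (h t)) hl
        _ = _ := mul_one _)
    (c := Real.exp (-c)) (fun h => by simp [deviation, quadVar])
  refine (measure_mono ?_).trans this
  rintro ω ⟨t, ht⟩
  exact ⟨t, Real.one_le_exp (by linarith)⟩

/-- Freedman's inequality with a fixed integer parameter `m` in place of the optimal one. -/
theorem IsTrajectory.measure_abs_deviation [IsProbabilityMeasure μ] (hs : alg.IsTrajectory M μ s)
    {ψ : (R → ℝ) → S → S → ℝ} (hψ0 : ∀ m x y, 0 ≤ ψ m x y) (hψ1 : ∀ m x y, ψ m x y ≤ 1)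
    {m : ℕ} (hm : 1 ≤ m) (c : ℝ) :
    μ {ω | ∃ t, alg.quadVar M ψ (fun i => s i ω) t / m + m * c <
      |alg.deviation M ψ (fun i => s i ω) t|} ≤ 2 * ENNReal.ofReal (Real.exp (-c)) := by
  have hm0 : (0 : ℝ) < m := by exact_mod_cast hm
  have hm1 : |1 / (m : ℝ)| ≤ 1 := by
    rw [abs_of_pos (by positivity), div_le_one hm0]; exact_mod_cast hm
  have hm2 : |-(1 / (m : ℝ))| ≤ 1 := by rwa [abs_neg]
  have hsub : {ω | ∃ t, alg.quadVar M ψ (fun i => s i ω) t / m + m * c <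
      |alg.deviation M ψ (fun i => s i ω) t|} ⊆
      {ω | ∃ t, (1 / (m : ℝ)) ^ 2 * alg.quadVar M ψ (fun i => s i ω) t + c ≤
      (1 / (m : ℝ)) * alg.deviation M ψ (fun i => s i ω) t} ∪
      {ω | ∃ t, (-(1 / (m : ℝ))) ^ 2 * alg.quadVar M ψ (fun i => s i ω) t + c ≤
      (-(1 / (m : ℝ))) * alg.deviation M ψ (fun i => s i ω) t} := by
    rintro ω ⟨t, ht⟩
    set q := alg.quadVar M ψ (fun i => s i ω) t
    set d := alg.deviation M ψ (fun i => s i ω) t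
    have e : (1 / (m : ℝ)) ^ 2 * q + c = 1 / m * (q / m + m * c) := by field_simp
    rcases lt_abs.1 ht with h | h
    · left
      refine ⟨t, ?_⟩
      rw [e]
      gcongr
    · right
      refine ⟨t, ?_⟩
      rw [neg_sq, e, neg_mul, ← mul_neg]
      gcongr
  refine (measure_mono hsub).trans ((measure_union_le _ _).trans ?_)
  rw [two_mul]
  exact add_le_add (hs.measure_mul_deviation hψ0 hψ1 hm1 c) (hs.measure_mul_deviation hψ0 hψ1 hm2 c)

end OnlineAlgorithm

/-! ### The memory of the algorithm along a state sequence -/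

namespace UCBMultiStageAdvantage

/-- A register that accumulates `g` at the times satisfying `p` and is reset at the end of each
stage holds the sum over the visits in the current stage. -/
theorem accumulator_eq (p : ℕ → Prop) [DecidablePred p] {e : ℕ → ℕ} (he : ∀ j, 0 < e j) {N₀ : ℝ}
    (c g : ℕ → ℝ) (h0 : c 0 = 0) (hstay : ∀ t, ¬ p t → c (t + 1) = c t)
    (hend : ∀ t, p t → Nat.count p t + 1 ∈ updateCounts e N₀ → c (t + 1) = 0)
    (hacc : ∀ t, p t → Nat.count p t + 1 ∉ updateCounts e N₀ → c (t + 1) = c t + g t) (t j : ℕ)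
    (hj : (stageStart e j : ℝ) ≤ N₀) (h1 : stageStart e j ≤ Nat.count p t)
    (h2 : Nat.count p t < stageStart e (j + 1)) :
    c t = ∑ n ∈ Ico (stageStart e j) (Nat.count p t), g (Nat.nth p n) := by
  induction t generalizing j with
  | zero =>
    simp only [Nat.count_zero, Nat.le_zero] at h1 ⊢
    rw [h0, h1]; simp
  | succ t ih =>
    by_cases hp : p t
    · rw [Nat.count_succ, if_pos hp] at h1 h2 ⊢
      rcases h1.eq_or_lt with h | h
      · rw [hend t hp, h]
        · simp
        · rcases j with _ | j
          · rw [stageStart_zero] at h; omega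
          · refine mem_updateCounts_iff.2 ⟨j, h.symm, le_trans ?_ hj⟩
            exact_mod_cast stageStart_mono e (Nat.le_succ j)
      · rw [hacc t hp, ih j hj (by omega) (by omega), sum_Ico_succ_top (by omega), Nat.nth_count hp]
        rintro hmem
        obtain ⟨k, hk, -⟩ := mem_updateCounts_iff.1 hmem
        rw [hk] at h h2
        have h3 := (stageStart_strictMono he).lt_iff_lt.1 h
        have h4 := (stageStart_strictMono he).lt_iff_lt.1 h2
        omega
    · rw [Nat.count_succ, if_neg hp, add_zero] at h1 h2 ⊢
      rw [hstay t hp]; exact ih j hj h1 h2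

/-- A sequence of states visited by the algorithm, together with the data that determine the
evolution of its memory. -/
structure Run (S A : Type*) [Fintype S] [Fintype A] where
  M : DiscountedMDP S A
  p : Params
  argmax : S → (A → ℝ) → A
  le_argmax : ∀ (s : S) (f : A → ℝ) (a : A), f a ≤ f (argmax s f)
  h : ℕ → S
  γ_eq : p.γ = M.γ
  two_le_H : 2 ≤ p.H
  one_le_B : 1 ≤ p.B

namespace Run

variable {S A : Type*} [Fintype S] [Fintype A] (X : Run S A)

/-- The algorithm that is run. -/
noncomputable def alg : OnlineAlgorithm S A (Register S A) := algorithm X.p X.argmax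

/-- The memory before time `t`. -/
noncomputable def mem (t : ℕ) : Register S A → ℝ := X.alg.memory X.M X.h t

/-- The policy used at time `t`. -/
noncomputable def policy (t : ℕ) : S → A := X.alg.policyAt X.M X.h t

/-- The state-action pair at time `t`. -/
noncomputable def pair (t : ℕ) : S × A := (X.h t, X.policy t (X.h t))

/-- The estimate of `Q^*` before time `t`. -/
noncomputable def Q (t : ℕ) (x : S × A) : ℝ := X.mem t (.inl (.Q, x))

/-- The estimate of `V^*` before time `t`. -/
noncomputable def V (t : ℕ) (s : S) : ℝ := X.mem t (.inr (.V, s))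

/-- The reference value before time `t`. -/
noncomputable def Vref (t : ℕ) (s : S) : ℝ := X.mem t (.inr (.Vref, s))

open Classical in
/-- The number of visits to the pair `x` before time `t`. -/
noncomputable def visits (x : S × A) (t : ℕ) : ℕ := Nat.count (fun i => X.pair i = x) t

/-- The time of the visit number `n` to the pair `x`, counted from `0`; a junk value if there are
at most `n` visits. -/
noncomputable def visitTime (x : S × A) (n : ℕ) : ℕ := Nat.nth (fun i => X.pair i = x) n

open Classical in
/-- The number of visits to the state `s` before time `t`. -/
noncomputable def stateVisits (s : S) (t : ℕ) : ℕ := Nat.count (fun i => X.h i = s) t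

/-- The sizes of the type-I stages. -/
noncomputable def sizeI : ℕ → ℕ := typeISize X.p.H X.p.B

/-- The sizes of the type-II stages. -/
noncomputable def sizeII : ℕ → ℕ := typeIISize X.p.H

/-- The number of visits before the type-I stage `j`. -/
noncomputable def startI (j : ℕ) : ℕ := stageStart X.sizeI j

/-- The number of visits before the type-II stage `j`. -/
noncomputable def startII (j : ℕ) : ℕ := stageStart X.sizeII j

theorem sizeI_pos (j : ℕ) : 0 < X.sizeI j := typeISize_pos X.two_le_H _ j

theorem sizeII_pos (j : ℕ) : 0 < X.sizeII j := by
  unfold sizeII; rw [typeIISize_eq]; exact typeISize_pos X.two_le_H _ j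

/-- A type-I stage ends at time `t`. -/
def EndI (t : ℕ) : Prop := X.visits (X.pair t) t + 1 ∈ updateCounts X.sizeI X.p.N₀

/-- A type-II stage ends at time `t`. -/
def EndII (t : ℕ) : Prop := X.visits (X.pair t) t + 1 ∈ updateCounts X.sizeII X.p.N₀

theorem mem_succ (t : ℕ) : X.mem (t + 1) = updateMemory X.p (X.mem t) (X.h t)
    (X.policy t (X.h t)) (X.M.r (X.h t) (X.policy t (X.h t))) (X.h (t + 1)) := rfl

theorem mem_zero : X.mem 0 = initMemory X.p := rfl

theorem mem_succ_of_ne {t : ℕ} {x : S × A} (hx : X.pair t ≠ x) (f : PairField) :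
    X.mem (t + 1) (.inl (f, x)) = X.mem t (.inl (f, x)) := by
  obtain ⟨s, b⟩ := x
  rw [mem_succ]
  simp only [updateMemory]
  rw [if_neg]
  rintro ⟨rfl, rfl⟩
  exact hx rfl

theorem mem_succ_of_state_ne {t : ℕ} {s : S} (hs : X.h t ≠ s) (f : StateField) :
    X.mem (t + 1) (.inr (f, s)) = X.mem t (.inr (f, s)) := by
  rw [mem_succ]
  simp only [updateMemory]
  rw [if_neg]
  exact fun h => hs h.symm

theorem visits_zero (x : S × A) : X.visits x 0 = 0 := by simp [visits]

theorem visits_succ_pair (t : ℕ) : X.visits (X.pair t) (t + 1) = X.visits (X.pair t) t + 1 := by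
  classical
  unfold visits; rw [Nat.count_succ, if_pos rfl]

theorem visits_succ_of_ne {t : ℕ} {x : S × A} (hx : X.pair t ≠ x) :
    X.visits x (t + 1) = X.visits x t := by
  classical
  unfold visits; rw [Nat.count_succ, if_neg hx, add_zero]

theorem visitTime_visits {t : ℕ} {x : S × A} (hx : X.pair t = x) :
    X.visitTime x (X.visits x t) = t := by
  classical
  exact Nat.nth_count (p := fun i => X.pair i = x) hx

theorem visits_visitTime {t n : ℕ} {x : S × A} (hn : n < X.visits x t) :
    X.visits x (X.visitTime x n) = n := by
  classical
  exact count_nth_of_lt_count _ hn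

theorem pair_visitTime {t n : ℕ} {x : S × A} (hn : n < X.visits x t) :
    X.pair (X.visitTime x n) = x := by
  classical
  exact nth_mem_of_lt_count _ hn

theorem visitTime_lt {t n : ℕ} {x : S × A} (hn : n < X.visits x t) : X.visitTime x n < t := by
  classical
  exact Nat.nth_lt_of_lt_count hn

theorem visitTime_le {t m n : ℕ} {x : S × A} (hmn : m ≤ n) (hn : n < X.visits x t) :
    X.visitTime x m ≤ X.visitTime x n := by
  classical
  exact nth_le_nth_of_lt_count _ hmn hn

theorem mem_visits (x : S × A) (t : ℕ) : X.mem t (.inl (.visits, x)) = X.visits x t := by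
  induction t with
  | zero => simp [mem_zero, initMemory, visits_zero]
  | succ t ih =>
    by_cases hx : X.pair t = x
    · subst hx
      rw [visits_succ_pair, Nat.cast_add, Nat.cast_one, ← ih, mem_succ]
      simp [updateMemory, pair]
    · rw [X.mem_succ_of_ne hx, X.visits_succ_of_ne hx, ih]

theorem exists_visits_eq_iff (t : ℕ) (U : Set ℕ) :
    (∃ k ∈ U, X.mem t (.inl (.visits, X.h t, X.policy t (X.h t))) + 1 = (k : ℝ)) ↔
      X.visits (X.pair t) t + 1 ∈ U := by
  have h := X.mem_visits (X.pair t) t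
  unfold pair at h ⊢
  rw [h]
  constructor
  · rintro ⟨k, hk, h1⟩
    have : X.visits (X.h t, X.policy t (X.h t)) t + 1 = k := by exact_mod_cast h1
    rwa [this]
  · intro hk
    exact ⟨_, hk, by push_cast; rfl⟩

theorem endI_iff (t : ℕ) :
    (∃ k ∈ updateCounts (typeISize X.p.H X.p.B) X.p.N₀,
      X.mem t (.inl (.visits, X.h t, X.policy t (X.h t))) + 1 = (k : ℝ)) ↔ X.EndI t :=
  X.exists_visits_eq_iff t _

theorem endII_iff (t : ℕ) :
    (∃ k ∈ updateCounts (typeIISize X.p.H) X.p.N₀,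
      X.mem t (.inl (.visits, X.h t, X.policy t (X.h t))) + 1 = (k : ℝ)) ↔ X.EndII t :=
  X.exists_visits_eq_iff t _

theorem mem_refSum (x : S × A) (t : ℕ) : X.mem t (.inl (.refSum, x)) =
    ∑ n ∈ range (X.visits x t), X.Vref (X.visitTime x n) (X.h (X.visitTime x n + 1)) := by
  induction t with
  | zero => simp [mem_zero, initMemory, visits_zero]
  | succ t ih =>
    by_cases hx : X.pair t = x
    · subst hx
      rw [visits_succ_pair, sum_range_succ, ← ih, X.visitTime_visits rfl, mem_succ]
      simp [updateMemory, pair, Vref]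
    · rw [X.mem_succ_of_ne hx, X.visits_succ_of_ne hx, ih]

theorem mem_refSqSum (x : S × A) (t : ℕ) : X.mem t (.inl (.refSqSum, x)) =
    ∑ n ∈ range (X.visits x t), X.Vref (X.visitTime x n) (X.h (X.visitTime x n + 1)) ^ 2 := by
  induction t with
  | zero => simp [mem_zero, initMemory, visits_zero]
  | succ t ih =>
    by_cases hx : X.pair t = x
    · subst hx
      rw [visits_succ_pair, sum_range_succ, ← ih, X.visitTime_visits rfl, mem_succ]
      simp [updateMemory, pair, Vref]
    · rw [X.mem_succ_of_ne hx, X.visits_succ_of_ne hx, ih]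

/-- A register that accumulates `g` over the current type-I stage, just before it is reset. -/
theorem registerI_eq (f : PairField) (g : ℕ → ℝ) (h0 : ∀ x, X.mem 0 (.inl (f, x)) = 0)
    (hend : ∀ t, X.EndI t → X.mem (t + 1) (.inl (f, X.pair t)) = 0)
    (hacc : ∀ t, ¬ X.EndI t → X.mem (t + 1) (.inl (f, X.pair t)) =
      X.mem t (.inl (f, X.pair t)) + g t) {x : S × A} {t j : ℕ} (hx : X.pair t = x)
    (hj : (X.startI j : ℝ) ≤ X.p.N₀) (ht : X.visits x t + 1 = X.startI (j + 1)) :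
    X.mem t (.inl (f, x)) + g t =
      ∑ n ∈ Ico (X.startI j) (X.startI (j + 1)), g (X.visitTime x n) := by
  classical
  have hst : X.startI (j + 1) = X.startI j + X.sizeI j := stageStart_succ _ _
  have hpos := X.sizeI_pos j
  have := accumulator_eq (fun i => X.pair i = x) X.sizeI_pos (N₀ := X.p.N₀)
    (fun t => X.mem t (.inl (f, x))) g (h0 x) (fun t ht => X.mem_succ_of_ne ht f)
    (fun t ht h => by
      subst ht; exact hend t h)
    (fun t ht h => by
      subst ht; exact hacc t h) t j hj
    (show X.startI j ≤ X.visits x t by omega) (show X.visits x t < X.startI (j + 1) by omega)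
  rw [this, ← ht, sum_Ico_succ_top (by omega), X.visitTime_visits hx]
  rfl

theorem registerII_eq (f : PairField) (g : ℕ → ℝ) (h0 : ∀ x, X.mem 0 (.inl (f, x)) = 0)
    (hend : ∀ t, X.EndII t → X.mem (t + 1) (.inl (f, X.pair t)) = 0)
    (hacc : ∀ t, ¬ X.EndII t → X.mem (t + 1) (.inl (f, X.pair t)) =
      X.mem t (.inl (f, X.pair t)) + g t) {x : S × A} {t j : ℕ} (hx : X.pair t = x)
    (hj : (X.startII j : ℝ) ≤ X.p.N₀) (ht : X.visits x t + 1 = X.startII (j + 1)) :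
    X.mem t (.inl (f, x)) + g t =
      ∑ n ∈ Ico (X.startII j) (X.startII (j + 1)), g (X.visitTime x n) := by
  classical
  have hst : X.startII (j + 1) = X.startII j + X.sizeII j := stageStart_succ _ _
  have hpos := X.sizeII_pos j
  have := accumulator_eq (fun i => X.pair i = x) X.sizeII_pos (N₀ := X.p.N₀)
    (fun t => X.mem t (.inl (f, x))) g (h0 x) (fun t ht => X.mem_succ_of_ne ht f)
    (fun t ht h => by
      subst ht; exact hend t h)
    (fun t ht h => by
      subst ht; exact hacc t h) t j hj
    (show X.startII j ≤ X.visits x t by omega) (show X.visits x t < X.startII (j + 1) by omega)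
  rw [this, ← ht, sum_Ico_succ_top (by omega), X.visitTime_visits hx]
  rfl

/-- The advantage observed at time `t`. -/
noncomputable def adv (t : ℕ) : ℝ := X.V t (X.h (t + 1)) - X.Vref t (X.h (t + 1))

/-- The sum over the type-I stage `j` of the pair `x` of a function of the time. -/
noncomputable def stageSumI (x : S × A) (j : ℕ) (g : ℕ → ℝ) : ℝ :=
  ∑ n ∈ Ico (X.startI j) (X.startI (j + 1)), g (X.visitTime x n)

/-- The sum over the type-II stage `j` of the pair `x` of a function of the time. -/
noncomputable def stageSumII (x : S × A) (j : ℕ) (g : ℕ → ℝ) : ℝ :=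
  ∑ n ∈ Ico (X.startII j) (X.startII (j + 1)), g (X.visitTime x n)

/-- The sum over the first `n` visits to the pair `x` of a function of the time. -/
noncomputable def prefixSum (x : S × A) (n : ℕ) (g : ℕ → ℝ) : ℝ :=
  ∑ k ∈ range n, g (X.visitTime x k)

/-- The bonus at the end of the type-I stage `j` of the pair `x`. -/
noncomputable def bonusAtI (x : S × A) (j : ℕ) : ℝ :=
  bonusI X.p (X.sizeI j) (X.stageSumI x j X.adv) (X.stageSumI x j fun t => X.adv t ^ 2)
    (X.startI (j + 1)) (X.prefixSum x (X.startI (j + 1)) fun t => X.Vref t (X.h (t + 1)))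
    (X.prefixSum x (X.startI (j + 1)) fun t => X.Vref t (X.h (t + 1)) ^ 2)

/-- The upper bound for `Q^*` computed at the end of the type-I stage `j` of the pair `x`. -/
noncomputable def targetI (x : S × A) (j : ℕ) : ℝ :=
  X.M.r x.1 x.2 + X.M.γ * (X.stageSumI x j X.adv / X.sizeI j +
    (X.prefixSum x (X.startI (j + 1)) fun t => X.Vref t (X.h (t + 1))) / X.startI (j + 1) +
    X.bonusAtI x j)

/-- The upper bound for `Q^*` computed at the end of the type-II stage `j` of the pair `x`. -/
noncomputable def targetII (x : S × A) (j : ℕ) : ℝ :=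
  X.M.r x.1 x.2 + X.M.γ * ((X.stageSumII x j fun t => X.V t (X.h (t + 1))) / X.sizeII j +
    bonusII X.p (X.sizeII j))

/-- The registers used by a type-I update hold the statistics of the stage that ends. -/
theorem register_sums {x : S × A} {t j : ℕ} (hx : X.pair t = x) (hj : (X.startI j : ℝ) ≤ X.p.N₀)
    (ht : X.visits x t + 1 = X.startI (j + 1)) :
    X.mem t (.inl (.visitsI, x)) + 1 = X.sizeI j ∧
    X.mem t (.inl (.advSum, x)) + X.adv t = X.stageSumI x j X.adv ∧
    X.mem t (.inl (.advSqSum, x)) + X.adv t ^ 2 = X.stageSumI x j fun t => X.adv t ^ 2 := by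
  refine ⟨?_, ?_, ?_⟩
  · rw [X.registerI_eq .visitsI (fun _ => 1) (fun x => rfl) (fun t h => ?_) (fun t h => ?_) hx hj ht]
    · have hst : X.startI (j + 1) = X.startI j + X.sizeI j := stageStart_succ _ _
      simp [hst]
    · rw [mem_succ]; simp only [updateMemory, pair, and_self, if_true]
      rw [if_pos ((X.endI_iff t).2 h)]
    · rw [mem_succ]; simp only [updateMemory, pair, and_self, if_true]
      rw [if_neg (mt (X.endI_iff t).1 h)]
  · refine X.registerI_eq .advSum X.adv (fun x => rfl) (fun t h => ?_) (fun t h => ?_) hx hj ht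
    · rw [mem_succ]; simp only [updateMemory, pair, and_self, if_true]
      rw [if_pos ((X.endI_iff t).2 h)]
    · rw [mem_succ]; simp only [updateMemory, pair, and_self, if_true]
      rw [if_neg (mt (X.endI_iff t).1 h)]; rfl
  · refine X.registerI_eq .advSqSum (fun t => X.adv t ^ 2) (fun x => rfl) (fun t h => ?_)
      (fun t h => ?_) hx hj ht
    · rw [mem_succ]; simp only [updateMemory, pair, and_self, if_true]
      rw [if_pos ((X.endI_iff t).2 h)]
    · rw [mem_succ]; simp only [updateMemory, pair, and_self, if_true]
      rw [if_neg (mt (X.endI_iff t).1 h)]; rfl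

/-- The registers used by a type-II update hold the statistics of the stage that ends. -/
theorem register_sumsII {x : S × A} {t j : ℕ} (hx : X.pair t = x) (hj : (X.startII j : ℝ) ≤ X.p.N₀)
    (ht : X.visits x t + 1 = X.startII (j + 1)) :
    X.mem t (.inl (.visitsII, x)) + 1 = X.sizeII j ∧
    X.mem t (.inl (.valueSum, x)) + X.V t (X.h (t + 1)) =
      X.stageSumII x j fun t => X.V t (X.h (t + 1)) := by
  refine ⟨?_, ?_⟩
  · rw [X.registerII_eq .visitsII (fun _ => 1) (fun x => rfl) (fun t h => ?_) (fun t h => ?_)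
      hx hj ht]
    · have hst : X.startII (j + 1) = X.startII j + X.sizeII j := stageStart_succ _ _
      simp [hst]
    · rw [mem_succ]; simp only [updateMemory, pair, and_self, if_true]
      rw [if_pos ((X.endII_iff t).2 h)]
    · rw [mem_succ]; simp only [updateMemory, pair, and_self, if_true]
      rw [if_neg (mt (X.endII_iff t).1 h)]
  · refine X.registerII_eq .valueSum (fun t => X.V t (X.h (t + 1))) (fun x => rfl)
      (fun t h => ?_) (fun t h => ?_) hx hj ht
    · rw [mem_succ]; simp only [updateMemory, pair, and_self, if_true]
      rw [if_pos ((X.endII_iff t).2 h)]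
    · rw [mem_succ]; simp only [updateMemory, pair, and_self, if_true]
      rw [if_neg (mt (X.endII_iff t).1 h)]; rfl

open Classical in
/-- The update of `Q` at the visited pair. -/
theorem Q_succ_pair (t : ℕ) : ∃ q₁ q₂ : ℝ,
    X.Q (t + 1) (X.pair t) = (if X.EndII t then min q₂ (if X.EndI t then min q₁ (X.Q t (X.pair t))
      else X.Q t (X.pair t)) else if X.EndI t then min q₁ (X.Q t (X.pair t))
      else X.Q t (X.pair t)) ∧
    (∀ j, (X.startI j : ℝ) ≤ X.p.N₀ → X.visits (X.pair t) t + 1 = X.startI (j + 1) →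
      q₁ = X.targetI (X.pair t) j) ∧
    (∀ j, (X.startII j : ℝ) ≤ X.p.N₀ → X.visits (X.pair t) t + 1 = X.startII (j + 1) →
      q₂ = X.targetII (X.pair t) j) := by
  set x := X.pair t with hx
  refine ⟨X.M.r x.1 x.2 + X.p.γ *
      ((X.mem t (.inl (.advSum, x)) + X.adv t) / (X.mem t (.inl (.visitsI, x)) + 1) +
      (X.mem t (.inl (.refSum, x)) + X.Vref t (X.h (t + 1))) / (X.mem t (.inl (.visits, x)) + 1) +
      bonusI X.p (X.mem t (.inl (.visitsI, x)) + 1) (X.mem t (.inl (.advSum, x)) + X.adv t)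
        (X.mem t (.inl (.advSqSum, x)) + X.adv t ^ 2) (X.mem t (.inl (.visits, x)) + 1)
        (X.mem t (.inl (.refSum, x)) + X.Vref t (X.h (t + 1)))
        (X.mem t (.inl (.refSqSum, x)) + X.Vref t (X.h (t + 1)) ^ 2)),
    X.M.r x.1 x.2 + X.p.γ *
      ((X.mem t (.inl (.valueSum, x)) + X.V t (X.h (t + 1))) /
        (X.mem t (.inl (.visitsII, x)) + 1) + bonusII X.p (X.mem t (.inl (.visitsII, x)) + 1)),
    ?_, fun j hj ht => ?_, fun j hj ht => ?_⟩
  · rw [hx]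
    unfold Q
    rw [mem_succ]
    simp only [updateMemory, pair, endI_iff, endII_iff]
    simp only [and_self, if_true]
    rfl
  · obtain ⟨h1, h2, h3⟩ := X.register_sums rfl hj ht
    have h4 : X.mem t (.inl (.refSum, x)) + X.Vref t (X.h (t + 1)) =
        X.prefixSum x (X.startI (j + 1)) fun t => X.Vref t (X.h (t + 1)) := by
      rw [mem_refSum, prefixSum, ← ht, sum_range_succ, X.visitTime_visits rfl]
    have h5 : X.mem t (.inl (.refSqSum, x)) + X.Vref t (X.h (t + 1)) ^ 2 =
        X.prefixSum x (X.startI (j + 1)) fun t => X.Vref t (X.h (t + 1)) ^ 2 := by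
      rw [mem_refSqSum, prefixSum, ← ht, sum_range_succ, X.visitTime_visits rfl]
    have h6 : X.mem t (.inl (.visits, x)) + 1 = X.startI (j + 1) := by
      rw [mem_visits, ← ht]; push_cast; rfl
    rw [h1, h2, h3, h4, h5, h6, X.γ_eq]
    rfl
  · obtain ⟨h1, h2⟩ := X.register_sumsII rfl hj ht
    rw [h1, h2, X.γ_eq]
    rfl

theorem endI_of_eq {t j : ℕ} (hj : (X.startI j : ℝ) ≤ X.p.N₀)
    (ht : X.visits (X.pair t) t + 1 = X.startI (j + 1)) : X.EndI t :=
  mem_updateCounts_iff.2 ⟨j, ht, hj⟩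

theorem endII_of_eq {t j : ℕ} (hj : (X.startII j : ℝ) ≤ X.p.N₀)
    (ht : X.visits (X.pair t) t + 1 = X.startII (j + 1)) : X.EndII t :=
  mem_updateCounts_iff.2 ⟨j, ht, hj⟩

theorem Q_succ_of_ne {t : ℕ} {x : S × A} (hx : X.pair t ≠ x) : X.Q (t + 1) x = X.Q t x :=
  X.mem_succ_of_ne hx _

theorem Q_succ_le (t : ℕ) (x : S × A) : X.Q (t + 1) x ≤ X.Q t x := by
  classical
  by_cases hx : X.pair t = x
  · subst hx
    obtain ⟨q₁, q₂, h, -, -⟩ := X.Q_succ_pair t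
    rw [h]
    split_ifs <;> simp
  · rw [X.Q_succ_of_ne hx]

theorem Q_antitone (x : S × A) : Antitone fun t => X.Q t x :=
  antitone_nat_of_succ_le fun t => X.Q_succ_le t x

theorem Q_zero (x : S × A) : X.Q 0 x = 1 / (1 - X.M.γ) := by
  simp [Q, mem_zero, initMemory, X.γ_eq]

theorem Q_le (t : ℕ) (x : S × A) : X.Q t x ≤ 1 / (1 - X.M.γ) :=
  (X.Q_antitone x (Nat.zero_le t)).trans_eq (X.Q_zero x)

theorem Q_succ_eq_of_not_end {t : ℕ} (h1 : ¬ X.EndI t) (h2 : ¬ X.EndII t) (x : S × A) :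
    X.Q (t + 1) x = X.Q t x := by
  classical
  by_cases hx : X.pair t = x
  · subst hx
    obtain ⟨q₁, q₂, h, -, -⟩ := X.Q_succ_pair t
    rw [h, if_neg h2, if_neg h1]
  · rw [X.Q_succ_of_ne hx]

/-- A lower bound for `Q` persists if the targets computed at the end of stages satisfy it. -/
theorem le_Q_succ {t : ℕ} {x : S × A} {c : ℝ} (hc : c ≤ X.Q t x)
    (h1 : ∀ j, (X.startI j : ℝ) ≤ X.p.N₀ → X.visits x (t + 1) = X.startI (j + 1) →
      c ≤ X.targetI x j)
    (h2 : ∀ j, (X.startII j : ℝ) ≤ X.p.N₀ → X.visits x (t + 1) = X.startII (j + 1) →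
      c ≤ X.targetII x j) : c ≤ X.Q (t + 1) x := by
  classical
  by_cases hx : X.pair t = x
  · subst hx
    obtain ⟨q₁, q₂, h, hq1, hq2⟩ := X.Q_succ_pair t
    rw [visits_succ_pair] at h1 h2
    rw [h]
    have hI : c ≤ if X.EndI t then min q₁ (X.Q t (X.pair t)) else X.Q t (X.pair t) := by
      split_ifs with hend
      · obtain ⟨j, hj, hj'⟩ := mem_updateCounts_iff.1 hend
        exact le_min ((h1 j hj' hj).trans_eq (hq1 j hj' hj).symm) hc
      · exact hc
    by_cases hend : X.EndII t
    · rw [if_pos hend]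
      obtain ⟨j, hj, hj'⟩ := mem_updateCounts_iff.1 hend
      exact le_min ((h2 j hj' hj).trans_eq (hq2 j hj' hj).symm) hI
    · rw [if_neg hend]; exact hI
  · rw [X.Q_succ_of_ne hx]; exact hc

theorem Q_le_targetI {t j : ℕ} {x : S × A} (hj : (X.startI j : ℝ) ≤ X.p.N₀)
    (ht : X.startI (j + 1) ≤ X.visits x t) : X.Q t x ≤ X.targetI x j := by
  classical
  induction t with
  | zero =>
    have hst : X.startI (j + 1) = X.startI j + X.sizeI j := stageStart_succ _ _
    have := X.sizeI_pos j
    rw [visits_zero] at ht; omega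
  | succ t ih =>
    by_cases h : X.startI (j + 1) ≤ X.visits x t
    · exact (X.Q_succ_le t x).trans (ih h)
    · by_cases hx : X.pair t = x
      · subst hx
        rw [visits_succ_pair] at ht
        have hv : X.visits (X.pair t) t + 1 = X.startI (j + 1) := by omega
        obtain ⟨q₁, q₂, h, hq1, hq2⟩ := X.Q_succ_pair t
        have hend := X.endI_of_eq hj hv
        rw [h, if_pos hend, ← hq1 j hj hv]
        split_ifs <;> simp
      · rw [X.visits_succ_of_ne hx] at ht; exact absurd ht h

theorem Q_le_targetII {t j : ℕ} {x : S × A} (hj : (X.startII j : ℝ) ≤ X.p.N₀)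
    (ht : X.startII (j + 1) ≤ X.visits x t) : X.Q t x ≤ X.targetII x j := by
  classical
  induction t with
  | zero =>
    have hst : X.startII (j + 1) = X.startII j + X.sizeII j := stageStart_succ _ _
    have := X.sizeII_pos j
    rw [visits_zero] at ht; omega
  | succ t ih =>
    by_cases h : X.startII (j + 1) ≤ X.visits x t
    · exact (X.Q_succ_le t x).trans (ih h)
    · by_cases hx : X.pair t = x
      · subst hx
        rw [visits_succ_pair] at ht
        have hv : X.visits (X.pair t) t + 1 = X.startII (j + 1) := by omega
        obtain ⟨q₁, q₂, h, hq1, hq2⟩ := X.Q_succ_pair t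
        have hend := X.endII_of_eq hj hv
        rw [h, if_pos hend, ← hq2 j hj hv]
        exact min_le_left _ _
      · rw [X.visits_succ_of_ne hx] at ht; exact absurd ht h

/-! ### The value estimates -/

open Classical in
theorem V_succ_state (t : ℕ) : X.V (t + 1) (X.h t) =
    if X.EndI t ∨ X.EndII t then ⨆ b, X.Q (t + 1) (X.h t, b) else X.V t (X.h t) := by
  unfold V Q
  rw [mem_succ]
  simp only [updateMemory, endI_iff, endII_iff, if_true]
  congr 1
  refine iSup_congr fun b => ?_
  by_cases hb : b = X.policy t (X.h t)
  · simp [hb]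
  · simp [hb]

theorem V_eq_iSup [Nonempty A] (t : ℕ) (s : S) : X.V t s = ⨆ b, X.Q t (s, b) := by
  classical
  induction t generalizing s with
  | zero => simp [V, Q, mem_zero, initMemory]
  | succ t ih =>
    by_cases hs : X.h t = s
    · subst hs
      rw [V_succ_state]
      split_ifs with h
      · rfl
      · rw [ih]
        refine iSup_congr fun b => ?_
        rw [X.Q_succ_eq_of_not_end (fun h1 => h (Or.inl h1)) (fun h2 => h (Or.inr h2))]
    · have h1 : X.V (t + 1) s = X.V t s := X.mem_succ_of_state_ne hs _
      rw [h1, ih]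
      refine iSup_congr fun b => ?_
      rw [X.Q_succ_of_ne]
      intro h
      exact hs (congrArg Prod.fst h)

theorem V_eq_Q_policy (t : ℕ) (s : S) : X.V t s = X.Q t (s, X.policy t s) := by
  have : Nonempty A := ⟨X.policy t s⟩
  rw [V_eq_iSup]
  apply le_antisymm
  · exact ciSup_le fun b => X.le_argmax s (fun a => X.Q t (s, a)) b
  · exact le_ciSup (f := fun b => X.Q t (s, b)) (Set.finite_range _).bddAbove (X.policy t s)

theorem V_eq_Q_pair (t : ℕ) : X.V t (X.h t) = X.Q t (X.pair t) := X.V_eq_Q_policy t _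

theorem Q_le_V (t : ℕ) (s : S) (a : A) : X.Q t (s, a) ≤ X.V t s := by
  rw [V_eq_Q_policy]
  exact X.le_argmax s (fun a => X.Q t (s, a)) a

theorem V_succ_le (t : ℕ) (s : S) : X.V (t + 1) s ≤ X.V t s := by
  rw [X.V_eq_Q_policy (t + 1) s]
  exact (X.Q_succ_le t _).trans (X.Q_le_V t s _)

theorem V_antitone (s : S) : Antitone fun t => X.V t s :=
  antitone_nat_of_succ_le fun t => X.V_succ_le t s

theorem V_le (t : ℕ) (s : S) : X.V t s ≤ 1 / (1 - X.M.γ) := by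
  rw [V_eq_Q_policy]; exact X.Q_le _ _

theorem V_succ_eq_of_not_end {t : ℕ} (h1 : ¬ X.EndI t) (h2 : ¬ X.EndII t) (s : S) :
    X.V (t + 1) s = X.V t s := by
  have : Nonempty A := ⟨X.policy t s⟩
  rw [V_eq_iSup, V_eq_iSup]
  exact iSup_congr fun b => X.Q_succ_eq_of_not_end h1 h2 _

/-! ### The reference value -/

theorem stateVisits_mono (s : S) : Monotone (X.stateVisits s) := by
  classical
  exact Nat.count_monotone _

theorem stateVisits_succ_state (t : ℕ) :
    X.stateVisits (X.h t) (t + 1) = X.stateVisits (X.h t) t + 1 := by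
  classical
  unfold stateVisits; rw [Nat.count_succ, if_pos rfl]

theorem stateVisits_succ_of_ne {t : ℕ} {s : S} (hs : X.h t ≠ s) :
    X.stateVisits s (t + 1) = X.stateVisits s t := by
  classical
  unfold stateVisits; rw [Nat.count_succ, if_neg hs, add_zero]

theorem sum_visits (s : S) (t : ℕ) : ∑ b, X.visits (s, b) t = X.stateVisits s t := by
  classical
  induction t with
  | zero => simp [visits, stateVisits]
  | succ t ih =>
    simp only [visits, stateVisits, Nat.count_succ, sum_add_distrib] at ih ⊢
    rw [ih]
    congr 1
    by_cases hs : X.h t = s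
    · subst hs
      simp [pair]
    · simp [pair, hs]

theorem sum_mem_visits (s : S) (t : ℕ) :
    ∑ b, X.mem t (.inl (.visits, s, b)) = X.stateVisits s t := by
  rw [← X.sum_visits s t]
  push_cast
  exact sum_congr rfl fun b _ => X.mem_visits (s, b) t

open Classical in
theorem Vref_succ_state (t : ℕ) : X.Vref (t + 1) (X.h t) =
    if X.stateVisits (X.h t) t + 1 = X.p.N₁ then X.V (t + 1) (X.h t) else X.Vref t (X.h t) := by
  have h1 : ((X.stateVisits (X.h t) t : ℝ) + 1 = (X.p.N₁ : ℝ)) ↔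
      X.stateVisits (X.h t) t + 1 = X.p.N₁ := by norm_cast
  unfold Vref V
  rw [mem_succ]
  simp only [updateMemory, if_true, sum_mem_visits, h1]

theorem Vref_succ_of_ne {t : ℕ} {s : S} (hs : X.h t ≠ s) : X.Vref (t + 1) s = X.Vref t s :=
  X.mem_succ_of_state_ne hs _

theorem V_le_Vref (t : ℕ) (s : S) : X.V t s ≤ X.Vref t s := by
  classical
  induction t generalizing s with
  | zero => simp [V, Vref, mem_zero, initMemory]
  | succ t ih =>
    by_cases hs : X.h t = s
    · subst hs
      rw [Vref_succ_state]
      split_ifs with h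
      · exact le_rfl
      · exact (X.V_succ_le t _).trans (ih _)
    · rw [X.Vref_succ_of_ne hs]
      exact (X.V_succ_le t _).trans (ih _)

theorem Vref_succ_le (t : ℕ) (s : S) : X.Vref (t + 1) s ≤ X.Vref t s := by
  classical
  by_cases hs : X.h t = s
  · subst hs
    rw [Vref_succ_state]
    split_ifs with h
    · exact (X.V_succ_le t _).trans (X.V_le_Vref t _)
    · exact le_rfl
  · rw [X.Vref_succ_of_ne hs]

theorem Vref_antitone (s : S) : Antitone fun t => X.Vref t s :=
  antitone_nat_of_succ_le fun t => X.Vref_succ_le t s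

theorem Vref_le (t : ℕ) (s : S) : X.Vref t s ≤ 1 / (1 - X.M.γ) := by
  refine (X.Vref_antitone s (Nat.zero_le t)).trans_eq ?_
  simp [Vref, mem_zero, initMemory, X.γ_eq]

/-- Once a state has been visited `N₁` times, its reference value does not change any more. -/
theorem Vref_eq_of_settled {s : S} {t u : ℕ} (htu : t ≤ u) (hs : X.p.N₁ ≤ X.stateVisits s t) :
    X.Vref u s = X.Vref t s := by
  classical
  induction u, htu using Nat.le_induction with
  | base => rfl
  | succ u hu ih =>
    rw [← ih]
    have h1 := X.stateVisits_mono s hu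
    by_cases h : X.h u = s
    · subst h
      rw [Vref_succ_state, if_neg (by omega)]
    · exact X.Vref_succ_of_ne h

/-- The settled reference value is the value estimate right after the visit number `N₁`. -/
theorem exists_Vref_eq_of_settled {s : S} {t : ℕ} (hN : 1 ≤ X.p.N₁)
    (hs : X.p.N₁ ≤ X.stateVisits s t) :
    ∃ u < t, X.h u = s ∧ X.stateVisits s u + 1 = X.p.N₁ ∧ X.Vref t s = X.V (u + 1) s := by
  classical
  induction t with
  | zero => simp [stateVisits] at hs; omega
  | succ t ih =>
    by_cases h : X.p.N₁ ≤ X.stateVisits s t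
    · obtain ⟨u, hu, h1, h2, h3⟩ := ih h
      exact ⟨u, by omega, h1, h2, by rw [X.Vref_eq_of_settled (Nat.le_succ t) h, h3]⟩
    · have hst : X.h t = s := by
        by_contra hne
        rw [X.stateVisits_succ_of_ne hne] at hs
        exact h hs
      subst hst
      rw [stateVisits_succ_state] at hs
      refine ⟨t, by omega, rfl, by omega, ?_⟩
      rw [Vref_succ_state, if_pos (by omega)]

end Run

end UCBMultiStageAdvantage

/-! ### Empirical Bernstein bounds -/

namespace UCBMultiStageAdvantage

/-- The bounds with a fixed integer parameter imply the one with the optimal parameter. -/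
theorem le_sqrt_of_forall_le {d A c : ℝ} {U : ℕ} (hA : 0 ≤ A) (hc : 0 < c) (hU1 : 1 ≤ U)
    (hU : A ≤ c * ((U : ℝ) - 1) ^ 2) (h : ∀ m : ℕ, 1 ≤ m → m ≤ U → d ≤ A / m + m * c) :
    d ≤ 2 * √(A * c) + c := by
  have hU0 : (0 : ℝ) ≤ (U : ℝ) - 1 := by
    have : (1 : ℝ) ≤ U := by exact_mod_cast hU1
    linarith
  rcases hA.eq_or_lt with h0 | hApos
  · have := h 1 le_rfl hU1
    rw [← h0] at this ⊢
    simp at this ⊢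
    exact this
  · have hs : 0 < √(A / c) := Real.sqrt_pos.2 (by positivity)
    set m := ⌈√(A / c)⌉₊ with hm
    have hm1 : 1 ≤ m := Nat.one_le_iff_ne_zero.2 (Nat.ceil_pos.2 hs).ne'
    have hle : √(A / c) ≤ m := Nat.le_ceil _
    have hlt : (m : ℝ) < √(A / c) + 1 := Nat.ceil_lt_add_one hs.le
    have hsU : √(A / c) ≤ (U : ℝ) - 1 := by
      rw [Real.sqrt_le_left hU0, div_le_iff₀ hc]; linarith
    have hmU : m ≤ U := Nat.ceil_le.2 (by linarith)
    have key := h m hm1 hmU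
    have e1 : √(A / c) * c = √(A * c) := by
      have : A * c = A / c * (c * c) := by field_simp
      rw [this, Real.sqrt_mul (by positivity), Real.sqrt_mul_self hc.le]
    have e2 : A / √(A / c) = √(A * c) := by
      rw [div_eq_iff hs.ne', ← Real.sqrt_mul (by positivity)]
      have : A * c * (A / c) = A * A := by field_simp
      rw [this, Real.sqrt_mul_self hA]
    have h1 : A / m ≤ √(A * c) := by
      rw [← e2]; exact div_le_div_of_nonneg_left hA hs hle
    have h2 : m * c ≤ √(A * c) + c := by
      rw [← e1]; nlinarith
    linarith

/-- Bernstein's bound with the empirical variance in place of the true one. Here `x` are the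
observations in `[0, 1]`, `μ` their conditional means and `q` the conditional means of their
squares. -/
theorem abs_sub_div_le_empirical (a b : ℕ) (hab : a < b) (x μ q : ℕ → ℝ) {ι : ℝ} (hι : 0 ≤ ι)
    (hx0 : ∀ n ∈ Ico a b, 0 ≤ x n) (hx1 : ∀ n ∈ Ico a b, x n ≤ 1)
    (hμ0 : ∀ n ∈ Ico a b, 0 ≤ μ n) (hμ1 : ∀ n ∈ Ico a b, μ n ≤ 1)
    (hd : |∑ n ∈ Ico a b, (x n - μ n)| ≤ √((∑ n ∈ Ico a b, (q n - μ n ^ 2)) * ι) + ι / 4)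
    (hd1 : |∑ n ∈ Ico a b, (x n - μ n)| ≤ √(((b : ℝ) - a) * ι) + ι / 4)
    (hd2 : |∑ n ∈ Ico a b, (x n ^ 2 - q n)| ≤ √(((b : ℝ) - a) * ι) + ι / 4)
    {z : ℝ} (hz : 0 ≤ z) (hz4 : z ^ 4 = ι / ((b : ℝ) - a)) :
    |(∑ n ∈ Ico a b, x n) / ((b : ℝ) - a) - (∑ n ∈ Ico a b, μ n) / ((b : ℝ) - a)| ≤
      √(((∑ n ∈ Ico a b, x n ^ 2) / ((b : ℝ) - a) - ((∑ n ∈ Ico a b, x n) / ((b : ℝ) - a)) ^ 2) *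
        z ^ 4) + 2 * z ^ 3 + 2 * z ^ 4 := by
  have hcard : ((#(Ico a b) : ℕ) : ℝ) = (b : ℝ) - a := by
    rw [Nat.card_Ico, Nat.cast_sub hab.le]
  have hn : 0 < (b : ℝ) - a := by
    have : (a : ℝ) < b := by exact_mod_cast hab
    linarith
  set n := (b : ℝ) - a with hndef
  set sx := ∑ n ∈ Ico a b, x n with hsx
  set sμ := ∑ n ∈ Ico a b, μ n with hsμ
  set sxx := ∑ n ∈ Ico a b, x n ^ 2 with hsxx
  set sq := ∑ n ∈ Ico a b, q n with hsq
  have hsum_le : ∀ f : ℕ → ℝ, (∀ n ∈ Ico a b, f n ≤ 1) → ∑ n ∈ Ico a b, f n ≤ n := fun f hf => by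
    have := sum_le_card_nsmul _ _ _ hf
    rwa [nsmul_eq_mul, hcard, mul_one] at this
  have hsx1 : sx ≤ n := hsum_le _ hx1
  have hsμ1 : sμ ≤ n := hsum_le _ hμ1
  have hsx0 : 0 ≤ sx := sum_nonneg hx0
  have hsμ0 : 0 ≤ sμ := sum_nonneg hμ0
  rw [sum_sub_distrib] at hd hd1 hd2
  rw [sum_sub_distrib] at hd
  set d1 := |sx - sμ| with hd1def
  have hcs : sμ ^ 2 ≤ n * ∑ n ∈ Ico a b, μ n ^ 2 := by
    have := sq_sum_le_card_mul_sum_sq (s := Ico a b) (f := μ)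
    rwa [hcard] at this
  set smm := ∑ n ∈ Ico a b, μ n ^ 2
  have hι4 : ι = z ^ 4 * n := by rw [hz4]; field_simp
  have hsqrt : √(n * ι) = n * z ^ 2 := by
    rw [hι4, show n * (z ^ 4 * n) = (n * z ^ 2) ^ 2 by ring, Real.sqrt_sq (by positivity)]
  rw [hsqrt] at hd1 hd2
  set v := sxx / n - (sx / n) ^ 2 with hv
  have hA : (sq - smm) / n ≤ v + 3 * z ^ 2 + 3 / 4 * z ^ 4 := by
    have h1 : sq ≤ sxx + (n * z ^ 2 + ι / 4) := by linarith [(abs_le.1 hd2).1]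
    have h2 : sx ^ 2 - sμ ^ 2 ≤ 2 * n * (n * z ^ 2 + ι / 4) := by
      have : sx - sμ ≤ n * z ^ 2 + ι / 4 := (le_abs_self _).trans hd1
      have h0 : 0 ≤ n * z ^ 2 + ι / 4 := by positivity
      nlinarith
    rw [hv, div_le_iff₀ hn]
    have e : (sxx / n - (sx / n) ^ 2 + 3 * z ^ 2 + 3 / 4 * z ^ 4) * n =
        sxx - sx ^ 2 / n + 3 * (n * z ^ 2) + 3 / 4 * ι := by
      rw [hι4]; field_simp
    rw [e]
    have h3 : sx ^ 2 / n ≤ smm + 2 * (n * z ^ 2 + ι / 4) := by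
      rw [div_le_iff₀ hn]; nlinarith
    linarith
  have hroot : √((sq - smm) * ι) ≤ n * (√(v * z ^ 4) + 7 / 4 * z ^ 3 + z ^ 4) := by
    apply Real.sqrt_le_iff.2
    have hs0 := Real.sqrt_nonneg (v * z ^ 4)
    refine ⟨by positivity, ?_⟩
    have h1 : (sq - smm) * ι = (sq - smm) / n * (n ^ 2 * z ^ 4) := by
      rw [hι4]; field_simp
    rw [h1, mul_pow]
    have h2 : v * z ^ 4 ≤ √(v * z ^ 4) ^ 2 := by
      rcases le_total 0 (v * z ^ 4) with h | h
      · rw [Real.sq_sqrt h]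
      · exact h.trans (sq_nonneg _)
    have h3 : (sq - smm) / n * z ^ 4 ≤ (√(v * z ^ 4) + 7 / 4 * z ^ 3 + z ^ 4) ^ 2 := by
      have h4 : (sq - smm) / n * z ^ 4 ≤ (v + 3 * z ^ 2 + 3 / 4 * z ^ 4) * z ^ 4 := by gcongr
      have h5 : 0 ≤ √(v * z ^ 4) * z ^ 3 := by positivity
      have h6 : 0 ≤ √(v * z ^ 4) * z ^ 4 := by positivity
      have h7 : 0 ≤ z ^ 7 := by positivity
      have h8 : 0 ≤ z ^ 6 := by positivity
      have h9 : 0 ≤ z ^ 8 := by positivity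
      have e1 : (√(v * z ^ 4) + 7 / 4 * z ^ 3 + z ^ 4) ^ 2 = √(v * z ^ 4) ^ 2 + 49 / 16 * z ^ 6 +
          z ^ 8 + 7 / 2 * (√(v * z ^ 4) * z ^ 3) + 2 * (√(v * z ^ 4) * z ^ 4) + 7 / 2 * z ^ 7 := by
        ring
      have e2 : (v + 3 * z ^ 2 + 3 / 4 * z ^ 4) * z ^ 4 =
          v * z ^ 4 + 3 * z ^ 6 + 3 / 4 * z ^ 8 := by ring
      linarith
    calc (sq - smm) / n * (n ^ 2 * z ^ 4) = n ^ 2 * ((sq - smm) / n * z ^ 4) := by ring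
      _ ≤ _ := by gcongr
  rw [← sub_div, abs_div, abs_of_pos hn, div_le_iff₀ hn, ← hd1def]
  have h4 : ι / 4 = n * (z ^ 4 / 4) := by rw [hι4]; ring
  rw [h4] at hd
  have h5 : 0 ≤ z ^ 3 := by positivity
  have h6 : 0 ≤ z ^ 4 := by positivity
  have : n * (√(v * z ^ 4) + 7 / 4 * z ^ 3 + z ^ 4) + n * (z ^ 4 / 4) ≤
      (√(v * z ^ 4) + 2 * z ^ 3 + 2 * z ^ 4) * n := by
    nlinarith
  linarith

/-- The average of a nonincreasing sequence over a final segment is at most its overall average. -/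
theorem avg_Ico_le_avg_range (a b : ℕ) (hab : a < b) (g : ℕ → ℝ)
    (hg : ∀ m n, m ≤ n → n < b → g n ≤ g m) :
    (∑ n ∈ Ico a b, g n) / ((b : ℝ) - a) ≤ (∑ n ∈ range b, g n) / b := by
  have hb : (a : ℝ) < b := by exact_mod_cast hab
  have ha0 : (0 : ℝ) ≤ a := Nat.cast_nonneg a
  have hcard : ((#(Ico a b) : ℕ) : ℝ) = (b : ℝ) - a := by
    rw [Nat.card_Ico, Nat.cast_sub hab.le]
  rw [← sum_range_add_sum_Ico g hab.le, div_le_div_iff₀ (by linarith) (by linarith)]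
  have h1 : (a : ℝ) * g a ≤ ∑ n ∈ range a, g n := by
    have := card_nsmul_le_sum (range a) g (g a)
      (fun n hn => hg n a (mem_range.1 hn).le hab)
    rwa [card_range, nsmul_eq_mul] at this
  have h2 : ∑ n ∈ Ico a b, g n ≤ ((b : ℝ) - a) * g a := by
    have := sum_le_card_nsmul (Ico a b) g (g a)
      (fun n hn => hg a n (mem_Ico.1 hn).1 (mem_Ico.1 hn).2)
    rwa [nsmul_eq_mul, hcard] at this
  nlinarith [mul_le_mul_of_nonneg_left h2 ha0, mul_le_mul_of_nonneg_left h1 (sub_pos.2 hb).le]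

/-- Truncation to the unit interval. -/
noncomputable def unit (y : ℝ) : ℝ := max 0 (min y 1)

theorem unit_nonneg (y : ℝ) : 0 ≤ unit y := le_max_left _ _

theorem unit_le_one (y : ℝ) : unit y ≤ 1 := max_le zero_le_one (min_le_right _ _)

theorem unit_of_mem {y : ℝ} (h0 : 0 ≤ y) (h1 : y ≤ 1) : unit y = y := by
  unfold unit; rw [min_eq_left h1, max_eq_right h0]

/-! ### Deviations at a state-action pair -/

namespace Run

variable {S A : Type*} [Fintype S] [Fintype A] (X : Run S A)

open Classical in
/-- The predictable function that equals `f` (truncated to the unit interval) at the visits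
`lo, …, hi - 1` to the pair `x`, and `0` at all other times. -/
noncomputable def test (x : S × A) (lo hi : ℕ) (f : (Register S A → ℝ) → S → ℝ) :
    (Register S A → ℝ) → S → S → ℝ := fun m s s' =>
  if (s, X.argmax s fun a => m (.inl (.Q, s, a))) = x ∧
      (lo : ℝ) ≤ m (.inl (.visits, x)) ∧ m (.inl (.visits, x)) < hi then unit (f m s') else 0

theorem test_nonneg (x : S × A) (lo hi : ℕ) (f : (Register S A → ℝ) → S → ℝ) (m s s') :
    0 ≤ X.test x lo hi f m s s' := by
  unfold test; split_ifs
  · exact unit_nonneg _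
  · exact le_rfl

theorem test_le_one (x : S × A) (lo hi : ℕ) (f : (Register S A → ℝ) → S → ℝ) (m s s') :
    X.test x lo hi f m s s' ≤ 1 := by
  unfold test; split_ifs
  · exact unit_le_one _
  · exact zero_le_one

open Classical in
theorem test_mem (x : S × A) (lo hi : ℕ) (f : (Register S A → ℝ) → S → ℝ) (i : ℕ) (s' : S) :
    X.test x lo hi f (X.mem i) (X.h i) s' =
      if X.pair i = x ∧ lo ≤ X.visits x i ∧ X.visits x i < hi then unit (f (X.mem i) s')
      else 0 := by
  unfold test
  rw [mem_visits]
  simp only [Nat.cast_le, Nat.cast_lt]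
  rfl

theorem deviation_test (x : S × A) {lo hi t : ℕ} (f : (Register S A → ℝ) → S → ℝ)
    (ht : hi ≤ X.visits x t) :
    X.alg.deviation X.M (X.test x lo hi f) X.h t = ∑ n ∈ Ico lo hi,
      (unit (f (X.mem (X.visitTime x n)) (X.h (X.visitTime x n + 1))) -
        X.M.expect x.1 x.2 fun s' => unit (f (X.mem (X.visitTime x n)) s')) := by
  classical
  have := sum_ite_count_eq_sum_Ico (fun i => X.pair i = x)
    (fun i => unit (f (X.mem i) (X.h (i + 1))) -
        X.M.expect x.1 x.2 fun s' => unit (f (X.mem i) s')) (a := lo) ht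
  refine Eq.trans ?_ this
  refine sum_congr rfl fun i _ => ?_
  change X.test x lo hi f (X.mem i) (X.h i) (X.h (i + 1)) - X.M.expect (X.pair i).1 (X.pair i).2
    (fun s' => X.test x lo hi f (X.mem i) (X.h i) s') = _
  simp only [test_mem]
  by_cases h : X.pair i = x ∧ lo ≤ X.visits x i ∧ X.visits x i < hi
  · have h' := h
    unfold visits at h'
    rw [if_pos h']
    simp only [if_pos h]
    rw [h.1]
  · have h' := h
    unfold visits at h'
    rw [if_neg h']
    simp only [if_neg h, X.M.expect_const, sub_zero]

theorem quadVar_test (x : S × A) {lo hi t : ℕ} (f : (Register S A → ℝ) → S → ℝ)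
    (ht : hi ≤ X.visits x t) :
    X.alg.quadVar X.M (X.test x lo hi f) X.h t = ∑ n ∈ Ico lo hi,
      X.M.variance x.1 x.2 fun s' => unit (f (X.mem (X.visitTime x n)) s') := by
  classical
  have := sum_ite_count_eq_sum_Ico (fun i => X.pair i = x)
    (fun i => X.M.variance x.1 x.2 fun s' => unit (f (X.mem i) s')) (a := lo) ht
  refine Eq.trans ?_ this
  refine sum_congr rfl fun i _ => ?_
  change X.M.variance (X.pair i).1 (X.pair i).2
    (fun s' => X.test x lo hi f (X.mem i) (X.h i) s') = _
  simp only [test_mem]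
  by_cases h : X.pair i = x ∧ lo ≤ X.visits x i ∧ X.visits x i < hi
  · have h' := h
    unfold visits at h'
    rw [if_pos h']
    simp only [if_pos h]
    rw [h.1]
  · have h' := h
    unfold visits at h'
    rw [if_neg h']
    simp only [if_neg h, DiscountedMDP.variance]
    simp [X.M.expect_const]

/-- The deviations of `ψ` along the run obey the bound of Freedman's inequality, for all
parameters up to `U`. -/
def Concentrated (U : ℕ) (ψ : (Register S A → ℝ) → S → S → ℝ) : Prop :=
  ∀ m : ℕ, 1 ≤ m → m ≤ U → ∀ t, |X.alg.deviation X.M ψ X.h t| ≤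
    X.alg.quadVar X.M ψ X.h t / m + m * (X.p.ι / 4)

variable {X}

/-- Freedman's inequality for the visits `lo, …, hi - 1` to a pair, with the optimal parameter. The
truncation `unit` disappears once `f` is known to lie in `[0, 1]` at these visits. -/
theorem Concentrated.abs_sum_le {U : ℕ} {x : S × A} {lo hi t : ℕ} (hlh : lo ≤ hi)
    {f : (Register S A → ℝ) → S → ℝ} (hc : X.Concentrated U (X.test x lo hi f))
    (ht : hi ≤ X.visits x t) (hι : 0 < X.p.ι) (hU1 : 1 ≤ U)
    (hU : (hi : ℝ) ≤ X.p.ι / 4 * ((U : ℝ) - 1) ^ 2) (F : ℕ → S → ℝ)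
    (hF : ∀ n ∈ Ico lo hi, ∀ s', unit (f (X.mem (X.visitTime x n)) s') = F n s') :
    |∑ n ∈ Ico lo hi, (F n (X.h (X.visitTime x n + 1)) - X.M.expect x.1 x.2 (F n))| ≤
      √((∑ n ∈ Ico lo hi, X.M.variance x.1 x.2 (F n)) * X.p.ι) + X.p.ι / 4 ∧
    |∑ n ∈ Ico lo hi, (F n (X.h (X.visitTime x n + 1)) - X.M.expect x.1 x.2 (F n))| ≤
      √(((hi : ℝ) - lo) * X.p.ι) + X.p.ι / 4 := by
  have e1 := X.deviation_test x (lo := lo) f ht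
  have e2 := X.quadVar_test x (lo := lo) f ht
  have hF01 : ∀ n ∈ Ico lo hi, ∀ s', 0 ≤ F n s' ∧ F n s' ≤ 1 := fun n hn s' => by
    rw [← hF n hn]; exact ⟨unit_nonneg _, unit_le_one _⟩
  rw [sum_congr rfl fun n hn => by
    rw [hF n hn, funext fun s' => hF n hn s']] at e1
  rw [sum_congr rfl fun n hn => by rw [funext fun s' => hF n hn s']] at e2
  set A := ∑ n ∈ Ico lo hi, X.M.variance x.1 x.2 (F n)
  have hA0 : 0 ≤ A := sum_nonneg fun n _ => X.M.variance_nonneg _ _ _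
  have hA1 : A ≤ (hi : ℝ) - lo := by
    have := sum_le_card_nsmul (Ico lo hi) (fun n => X.M.variance x.1 x.2 (F n)) 1 fun n hn => by
      refine (X.M.variance_le_expect_sq _ _ _).trans (X.M.expect_le _ _ fun s' => ?_)
      have := hF01 n hn s'
      nlinarith
    rwa [nsmul_eq_mul, Nat.card_Ico, mul_one, Nat.cast_sub hlh] at this
  have h1 := le_sqrt_of_forall_le (d := |X.alg.deviation X.M (X.test x lo hi f) X.h t|) hA0
    (by linarith : 0 < X.p.ι / 4) hU1
    (hA1.trans (le_trans (by linarith [Nat.cast_nonneg (α := ℝ) lo]) hU))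
    (fun m hm1 hm2 => by have := hc m hm1 hm2 t; rwa [e2] at this)
  rw [e1] at h1
  have e3 : 2 * √(A * (X.p.ι / 4)) = √(A * X.p.ι) := by
    rw [show A * X.p.ι = 2 ^ 2 * (A * (X.p.ι / 4)) by ring,
      Real.sqrt_mul (by norm_num : (0 : ℝ) ≤ 2 ^ 2), Real.sqrt_sq (by norm_num : (0 : ℝ) ≤ 2)]
  rw [e3] at h1
  refine ⟨h1, h1.trans ?_⟩
  gcongr

end Run

end UCBMultiStageAdvantage

/-! ### Optimism -/

namespace UCBMultiStageAdvantage

/-- The type-I bonus without its truncation. -/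
noncomputable def radius (p : Params) (nI advSum advSqSum n refSum refSqSum : ℝ) : ℝ :=
  2 * √2 * (√((advSqSum / nI - (advSum / nI) ^ 2) / nI * p.ι) +
      √((refSqSum / n - (refSum / n) ^ 2) / n * p.ι)) +
    7 * (p.H * p.ι ^ (3 / 4 : ℝ) / n ^ (3 / 4 : ℝ) +
        p.H * p.ι ^ (3 / 4 : ℝ) / nI ^ (3 / 4 : ℝ)) +
    4 * (p.H * p.ι / n + p.H * p.ι / nI)

namespace Run

variable {S A : Type*} [Fintype S] [Fintype A] (X : Run S A)

/-- The range `1 / (1 - γ)` of the values. -/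
noncomputable def R : ℝ := 1 / (1 - X.M.γ)

theorem R_pos : 0 < X.R := one_div_pos.2 X.M.one_sub_γ_pos

theorem one_le_R : 1 ≤ X.R := by
  unfold R; rw [le_div_iff₀ X.M.one_sub_γ_pos]; linarith [X.M.γ_pos]

theorem γ_eq_one_sub : X.M.γ = 1 - 1 / X.R := by simp [R]

/-- The greedy policy computed from a memory. -/
noncomputable def greedy (m : Register S A → ℝ) (s : S) : A :=
  X.argmax s fun a => m (.inl (.Q, s, a))

variable {X}

theorem startI_zero : X.startI 0 = 0 := stageStart_zero _

theorem startII_zero : X.startII 0 = 0 := stageStart_zero _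

theorem startI_succ (j : ℕ) : X.startI (j + 1) = X.startI j + X.sizeI j := stageStart_succ _ _

theorem startII_succ (j : ℕ) : X.startII (j + 1) = X.startII j + X.sizeII j := stageStart_succ _ _

theorem sizeII_eq : X.sizeII = typeISize X.p.H 1 := typeIISize_eq

theorem sizeI_zero : X.sizeI 0 = X.p.H := by simp [sizeI, typeISize, stageSize]

theorem sizeII_zero : X.sizeII 0 = X.p.H := by simp [sizeII, typeIISize, stageSize]

theorem startI_succ_le {j : ℕ} (hH : (X.p.H : ℝ) ≤ X.p.N₀) (hj : (X.startI j : ℝ) ≤ X.p.N₀) :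
    (X.startI (j + 1) : ℝ) ≤ 3 * X.p.N₀ := by
  have h0 : (0 : ℝ) ≤ X.p.N₀ := (Nat.cast_nonneg _).trans hH
  rcases j with _ | j
  · rw [startI_succ, startI_zero, sizeI_zero, zero_add]; linarith
  · have h : X.startI (j + 2) ≤ 3 * X.startI (j + 1) :=
      stageStart_add_two_le_three_mul X.two_le_H _ j
    have h' : (X.startI (j + 2) : ℝ) ≤ 3 * X.startI (j + 1) := by exact_mod_cast h
    linarith

theorem startII_succ_le {j : ℕ} (hH : (X.p.H : ℝ) ≤ X.p.N₀) (hj : (X.startII j : ℝ) ≤ X.p.N₀) :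
    (X.startII (j + 1) : ℝ) ≤ 3 * X.p.N₀ := by
  have h0 : (0 : ℝ) ≤ X.p.N₀ := (Nat.cast_nonneg _).trans hH
  rcases j with _ | j
  · rw [startII_succ, startII_zero, sizeII_zero, zero_add]; linarith
  · have h : X.startII (j + 2) ≤ 3 * X.startII (j + 1) := by
      unfold startII
      rw [sizeII_eq]
      exact stageStart_add_two_le_three_mul X.two_le_H _ j
    have h' : (X.startII (j + 2) : ℝ) ≤ 3 * X.startII (j + 1) := by exact_mod_cast h
    linarith

variable (X)

/-- The untruncated bonus at the end of the type-I stage `j` of the pair `x`. -/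
noncomputable def radiusAt (x : S × A) (j : ℕ) : ℝ :=
  radius X.p (X.sizeI j) (X.stageSumI x j X.adv) (X.stageSumI x j fun t => X.adv t ^ 2)
    (X.startI (j + 1)) (X.prefixSum x (X.startI (j + 1)) fun t => X.Vref t (X.h (t + 1)))
    (X.prefixSum x (X.startI (j + 1)) fun t => X.Vref t (X.h (t + 1)) ^ 2)

theorem bonusAtI_eq (x : S × A) (j : ℕ) : X.bonusAtI x j = min (X.radiusAt x j) (2 * X.R) := by
  unfold bonusAtI radiusAt bonusI radius R
  rw [X.γ_eq, mul_one_div]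

theorem bonusII_nonneg (n : ℝ) : 0 ≤ bonusII X.p n := by
  unfold bonusII
  rw [X.γ_eq]
  exact le_min (by positivity) X.R_pos.le

variable [DecidableEq S]

/-- The excess over the clipping threshold of the Bellman residual of the value estimate. -/
noncomputable def excess (ε : ℝ) (m : Register S A → ℝ) (s : S) : ℝ :=
  max 0 (m (.inr (.V, s)) - X.M.r s (X.greedy m s) -
    X.M.γ * X.M.expect s (X.greedy m s) (fun y => m (.inr (.V, y))) -
    X.M.threshold ε s (X.greedy m s))

/-- The clipped pseudo-regret: the expected discounted sum of the excesses along the greedy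
policy. -/
noncomputable def pseudoRegret (ε : ℝ) (m : Register S A → ℝ) (s : S) : ℝ :=
  X.M.discounted (X.greedy m) (X.excess ε m) s

/-- The part of the overestimation `V - V^*` that exceeds `β`, normalized to `[0, 1]`. -/
noncomputable def gapTest (β : ℝ) : (Register S A → ℝ) → S → S → ℝ := fun m _ s' =>
  unit ((m (.inr (.V, s')) - X.M.optValue s' - β) / X.R)

/-- The clipped pseudo-regret, normalized to `[0, 1]`. -/
noncomputable def regretTest (ε : ℝ) : (Register S A → ℝ) → S → S → ℝ := fun m _ s' =>
  unit (X.pseudoRegret ε m s' / X.R ^ 2)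

/-- The optimal value of the next state, normalized to `[0, 1]`. -/
noncomputable def optFun (_m : Register S A → ℝ) (s' : S) : ℝ := X.M.optValue s' / X.R

/-- The negative of the advantage of the next state, normalized to `[0, 1]`: the value estimates
never exceed the reference values. -/
noncomputable def advFun (m : Register S A → ℝ) (s' : S) : ℝ :=
  (m (.inr (.Vref, s')) - m (.inr (.V, s'))) / X.R

/-- The reference value of the next state, normalized to `[0, 1]`. -/
noncomputable def refFun (m : Register S A → ℝ) (s' : S) : ℝ := m (.inr (.Vref, s')) / X.R

open Classical in
/-- The indicator of the states whose reference value is not settled. -/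
noncomputable def unsettledFun (m : Register S A → ℝ) (s' : S) : ℝ :=
  if ∑ b, m (.inl (.visits, s', b)) < X.p.N₁ then 1 else 0

/-- The squared deviation of `V^*` from its expectation after playing `x`, normalized to `[0, 1]`;
its expectation is the variance of `V^*` up to the normalization. -/
noncomputable def varFun (x : S × A) (_m : Register S A → ℝ) (s' : S) : ℝ :=
  ((X.M.optValue s' - X.M.expect x.1 x.2 X.M.optValue) / X.R) ^ 2

/-- The runs along which all the relevant deviations obey Freedman's inequality, for parameters up
to `U`. The first fields are conditions on the constants; `U_large` makes the integer parameters up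
to `U` as good as the optimal real one. The next seven fields concern the statistics of single
stages, or of all visits before the end of a stage, at the pair `x`; `gap` and `regret` concern the
whole run. -/
structure Good (U : ℕ) (β ε : ℝ) : Prop where
  ι_pos : 0 < X.p.ι
  one_le_U : 1 ≤ U
  U_large : 3 * X.p.N₀ ≤ X.p.ι / 4 * ((U : ℝ) - 1) ^ 2
  H_le_N₀ : (X.p.H : ℝ) ≤ X.p.N₀
  R_le_H : X.R ≤ X.p.H
  opt : ∀ x j, (X.startII j : ℝ) ≤ X.p.N₀ →
    X.Concentrated U (X.test x (X.startII j) (X.startII (j + 1)) X.optFun)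
  adv : ∀ x j, (X.startI j : ℝ) ≤ X.p.N₀ →
    X.Concentrated U (X.test x (X.startI j) (X.startI (j + 1)) X.advFun)
  advSq : ∀ x j, (X.startI j : ℝ) ≤ X.p.N₀ →
    X.Concentrated U (X.test x (X.startI j) (X.startI (j + 1)) fun m s' => X.advFun m s' ^ 2)
  ref : ∀ x j, (X.startI j : ℝ) ≤ X.p.N₀ →
    X.Concentrated U (X.test x 0 (X.startI (j + 1)) X.refFun)
  refSq : ∀ x j, (X.startI j : ℝ) ≤ X.p.N₀ →
    X.Concentrated U (X.test x 0 (X.startI (j + 1)) fun m s' => X.refFun m s' ^ 2)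
  unsettled : ∀ x j, (X.startI j : ℝ) ≤ X.p.N₀ →
    X.Concentrated U (X.test x 0 (X.startI (j + 1)) X.unsettledFun)
  var : ∀ x j, (X.startI j : ℝ) ≤ X.p.N₀ →
    X.Concentrated U (X.test x 0 (X.startI (j + 1)) (X.varFun x))
  gap : X.Concentrated U (X.gapTest β)
  regret : X.Concentrated U (X.regretTest ε)

variable {X}

variable {U : ℕ} {β ε : ℝ}

/-- The bonus of a type-II stage covers the deviation of the average of `V^*`. -/
theorem Good.abs_avg_optValue_sub_le [Nonempty A] (hX : X.Good U β ε) {x : S × A} {j t : ℕ}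
    (hj : (X.startII j : ℝ) ≤ X.p.N₀) (ht : X.startII (j + 1) ≤ X.visits x t) :
    |(X.stageSumII x j fun t => X.M.optValue (X.h (t + 1))) / X.sizeII j -
      X.M.expect x.1 x.2 X.M.optValue| ≤ bonusII X.p (X.sizeII j) := by
  have hR := X.R_pos
  have hι := hX.ι_pos
  have hsucc := startII_succ (X := X) j
  have hV0 := X.M.optValue_nonneg
  have hV1 : ∀ s, X.M.optValue s ≤ X.R := X.M.optValue_le
  have he : (0 : ℝ) < X.sizeII j := by exact_mod_cast X.sizeII_pos j
  set e : ℝ := ((X.sizeII j : ℕ) : ℝ) with hedef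
  set E := X.M.expect x.1 x.2 X.M.optValue
  set sv := X.stageSumII x j fun t => X.M.optValue (X.h (t + 1)) with hsv
  have hE0 : 0 ≤ E := X.M.expect_nonneg _ _ hV0
  have hE1 : E ≤ X.R := X.M.expect_le _ _ hV1
  have hcard : ((#(Ico (X.startII j) (X.startII (j + 1))) : ℕ) : ℝ) = e := by
    rw [Nat.card_Ico, hsucc]; simp [hedef]
  have hS0 : 0 ≤ sv := sum_nonneg fun n _ => hV0 _
  have hS1 : sv ≤ e * X.R := by
    have := sum_le_card_nsmul (Ico (X.startII j) (X.startII (j + 1)))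
      (fun n => X.M.optValue (X.h (X.visitTime x n + 1))) X.R fun n _ => hV1 _
    rwa [nsmul_eq_mul, hcard] at this
  have hR1 : |sv / e - E| ≤ X.R := by
    have h1 : 0 ≤ sv / e := by positivity
    have h2 : sv / e ≤ X.R := by rw [div_le_iff₀ he]; linarith
    exact abs_le.2 ⟨by linarith, by linarith⟩
  have key := ((hX.opt x j hj).abs_sum_le (t := t) (by omega) ht hι hX.one_le_U
    ((startII_succ_le hX.H_le_N₀ hj).trans hX.U_large) (fun _ s' => X.M.optValue s' / X.R)
    (fun n _ s' => by
      exact unit_of_mem (div_nonneg (hV0 _) hR.le) ((div_le_one hR).2 (hV1 _)))).2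
  rw [X.M.expect_div, sum_sub_distrib, ← sum_div, sum_const, nsmul_eq_mul, hcard] at key
  have hcast : (X.startII (j + 1) : ℝ) - X.startII j = e := by rw [hsucc]; push_cast; ring
  rw [hcast] at key
  have hz : |sv / e - E| = X.R / e * |sv / X.R - e * (E / X.R)| := by
    rw [← abs_of_pos (div_pos hR he), ← abs_mul]
    congr 1
    field_simp
  have hmain : |sv / e - E| ≤ X.R * (√(X.p.ι / e) + X.p.ι / e / 4) := by
    rw [hz]
    have h1 : X.R / e * |sv / X.R - e * (E / X.R)| ≤ X.R / e * (√(e * X.p.ι) + X.p.ι / 4) := by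
      gcongr
      exact key
    refine h1.trans_eq ?_
    have h2 : √(e * X.p.ι) = e * √(X.p.ι / e) := by
      rw [show e * X.p.ι = e ^ 2 * (X.p.ι / e) by field_simp, Real.sqrt_mul (by positivity),
        Real.sqrt_sq he.le]
    rw [h2]
    field_simp
  unfold bonusII
  rw [X.γ_eq]
  refine le_min ?_ hR1
  have hHR := hX.R_le_H
  have h3 : √((X.p.H : ℝ) ^ 2 * X.p.ι / e) = X.p.H * √(X.p.ι / e) := by
    rw [mul_div_assoc, Real.sqrt_mul (by positivity), Real.sqrt_sq (by positivity)]
  rw [h3]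
  set w := √(X.p.ι / e) with hw
  have hw0 : 0 ≤ w := Real.sqrt_nonneg _
  have hw2 : w ^ 2 = X.p.ι / e := Real.sq_sqrt (by positivity)
  rw [← hw2] at hmain
  rcases le_total w 1 with h | h
  · have : X.R * (w + w ^ 2 / 4) ≤ X.p.H * (2 * w) := by
      apply mul_le_mul hHR _ (by positivity) (by positivity)
      nlinarith
    linarith
  · have : X.R ≤ X.p.H * w := by nlinarith
    nlinarith

/-- Averages over visits of a predictable function with values in `[0, R]` are close to the
averages of its conditional expectations. -/
theorem Good.abs_avg_sub_le (hX : X.Good U β ε) {x : S × A} {lo hi t : ℕ} (hlh : lo < hi)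
    (ht : hi ≤ X.visits x t) (hhi : (hi : ℝ) ≤ 3 * X.p.N₀)
    {f : (Register S A → ℝ) → S → ℝ} (hc : X.Concentrated U (X.test x lo hi f))
    (hc2 : X.Concentrated U (X.test x lo hi fun m s' => f m s' ^ 2)) (G : ℕ → S → ℝ)
    (hG0 : ∀ n ∈ Ico lo hi, ∀ s', 0 ≤ G (X.visitTime x n) s')
    (hG1 : ∀ n ∈ Ico lo hi, ∀ s', G (X.visitTime x n) s' ≤ X.R)
    (hf : ∀ n ∈ Ico lo hi, ∀ s', f (X.mem (X.visitTime x n)) s' = G (X.visitTime x n) s' / X.R) :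
    |(∑ n ∈ Ico lo hi, G (X.visitTime x n) (X.h (X.visitTime x n + 1))) / ((hi : ℝ) - lo) -
      (∑ n ∈ Ico lo hi, X.M.expect x.1 x.2 (G (X.visitTime x n))) / ((hi : ℝ) - lo)| ≤
      √(((∑ n ∈ Ico lo hi, G (X.visitTime x n) (X.h (X.visitTime x n + 1)) ^ 2) / ((hi : ℝ) - lo) -
        ((∑ n ∈ Ico lo hi, G (X.visitTime x n) (X.h (X.visitTime x n + 1))) /
          ((hi : ℝ) - lo)) ^ 2) / ((hi : ℝ) - lo) * X.p.ι) +
      2 * (X.R * X.p.ι ^ (3 / 4 : ℝ) / ((hi : ℝ) - lo) ^ (3 / 4 : ℝ)) +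
      2 * (X.R * X.p.ι / ((hi : ℝ) - lo)) := by
  have hR := X.R_pos
  have hι := hX.ι_pos
  have hn : 0 < (hi : ℝ) - lo := by
    have : (lo : ℝ) < hi := by exact_mod_cast hlh
    linarith
  set F : ℕ → S → ℝ := fun n s' => G (X.visitTime x n) s' / X.R with hF
  have hF01 : ∀ n ∈ Ico lo hi, ∀ s', 0 ≤ F n s' ∧ F n s' ≤ 1 := fun n hn s' =>
    ⟨div_nonneg (hG0 n hn s') hR.le, (div_le_one hR).2 (hG1 n hn s')⟩
  have hU := hhi.trans hX.U_large
  have k1 := hc.abs_sum_le hlh.le ht hι hX.one_le_U hU F (fun n hn s' => by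
    rw [hf n hn]; exact unit_of_mem (hF01 n hn s').1 (hF01 n hn s').2)
  have k2 := hc2.abs_sum_le hlh.le ht hι hX.one_le_U hU (fun n s' => F n s' ^ 2)
    (fun n hn s' => by
      simp only [hf n hn]
      have := hF01 n hn s'
      exact unit_of_mem (sq_nonneg _) (by nlinarith))
  set z : ℝ := (X.p.ι / ((hi : ℝ) - lo)) ^ (1 / 4 : ℝ) with hz
  have hz0 : 0 ≤ z := by positivity
  have hz4 : z ^ 4 = X.p.ι / ((hi : ℝ) - lo) := by
    rw [hz, ← Real.rpow_natCast, ← Real.rpow_mul (by positivity)]; norm_num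
  have hz3 : z ^ 3 = X.p.ι ^ (3 / 4 : ℝ) / ((hi : ℝ) - lo) ^ (3 / 4 : ℝ) := by
    rw [hz, ← Real.rpow_natCast, ← Real.rpow_mul (by positivity),
      ← Real.div_rpow hι.le hn.le]; norm_num
  have key := abs_sub_div_le_empirical lo hi hlh (fun n => F n (X.h (X.visitTime x n + 1)))
    (fun n => X.M.expect x.1 x.2 (F n)) (fun n => X.M.expect x.1 x.2 fun s' => F n s' ^ 2) hι.le
    (fun n hn => (hF01 n hn _).1) (fun n hn => (hF01 n hn _).2)
    (fun n hn => X.M.expect_nonneg _ _ fun s' => (hF01 n hn s').1)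
    (fun n hn => X.M.expect_le _ _ fun s' => (hF01 n hn s').2) k1.1 k1.2 k2.2 hz0 hz4
  have eF : ∀ n, X.M.expect x.1 x.2 (F n) = X.M.expect x.1 x.2 (G (X.visitTime x n)) / X.R :=
    fun n => X.M.expect_div _ _ _ _
  simp only [eF] at key
  simp only [hF, div_pow, ← sum_div] at key
  set n := (hi : ℝ) - lo
  set a := ∑ n ∈ Ico lo hi, G (X.visitTime x n) (X.h (X.visitTime x n + 1))
  set b := ∑ n ∈ Ico lo hi, X.M.expect x.1 x.2 (G (X.visitTime x n))
  set c := ∑ n ∈ Ico lo hi, G (X.visitTime x n) (X.h (X.visitTime x n + 1)) ^ 2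
  have e1 : |a / X.R / n - b / X.R / n| = |a / n - b / n| / X.R := by
    rw [← abs_of_pos hR, ← abs_div, abs_of_pos hR]; congr 1; field_simp
  have e2 : (c / X.R ^ 2 / n - (a / X.R) ^ 2 / n ^ 2) * z ^ 4 =
      ((c / n - a ^ 2 / n ^ 2) / n * X.p.ι) / X.R ^ 2 := by
    rw [hz4]; field_simp
  simp only [div_pow] at e2 key ⊢
  rw [e1, e2, Real.sqrt_div' _ (by positivity), Real.sqrt_sq hR.le, div_le_iff₀ hR, hz3, hz4] at key
  refine key.trans_eq ?_
  field_simp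

/-- The value estimates up to time `t` are optimistic. -/
def OptimisticUpTo (X : Run S A) (t : ℕ) : Prop := ∀ i < t, ∀ s, X.M.optValue s ≤ X.V i s

/-- The untruncated type-I bonus covers the deviations of the average advantage and of the average
reference value. Optimism so far keeps the value estimates nonnegative. -/
theorem Good.abs_avg_adv_add_abs_avg_ref_le [Nonempty A] (hX : X.Good U β ε) {x : S × A} {j t : ℕ}
    (hj : (X.startI j : ℝ) ≤ X.p.N₀) (ht : X.startI (j + 1) ≤ X.visits x t)
    (hopt : X.OptimisticUpTo t) :
    |X.stageSumI x j X.adv / X.sizeI j -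
      (X.stageSumI x j fun t => X.M.expect x.1 x.2 fun s' => X.V t s' - X.Vref t s') /
        X.sizeI j| +
    |(X.prefixSum x (X.startI (j + 1)) fun t => X.Vref t (X.h (t + 1))) / X.startI (j + 1) -
      (X.prefixSum x (X.startI (j + 1)) fun t => X.M.expect x.1 x.2 (X.Vref t)) /
        X.startI (j + 1)| ≤ X.radiusAt x j := by
  have hR := X.R_pos
  have hι := hX.ι_pos
  have hsucc := startI_succ (X := X) j
  have hpos := X.sizeI_pos j
  have hhi := startI_succ_le hX.H_le_N₀ hj
  have hcast : (X.startI (j + 1) : ℝ) - X.startI j = X.sizeI j := by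
    rw [hsucc]; push_cast; ring
  have hlt : ∀ n, n < X.startI (j + 1) → X.visitTime x n < t := fun n hn =>
    X.visitTime_lt (lt_of_lt_of_le hn ht)
  have hV0 : ∀ n, n < X.startI (j + 1) → ∀ s, 0 ≤ X.V (X.visitTime x n) s := fun n hn s =>
    (X.M.optValue_nonneg s).trans (hopt _ (hlt n hn) s)
  have h1 := hX.abs_avg_sub_le (show X.startI j < X.startI (j + 1) by omega) ht hhi (hX.adv x j hj)
    (hX.advSq x j hj) (fun t s' => X.Vref t s' - X.V t s')
    (fun n _ s' => sub_nonneg.2 (X.V_le_Vref _ _))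
    (fun n hn s' => by
      have := X.Vref_le (X.visitTime x n) s'
      have := hV0 n (mem_Ico.1 hn).2 s'
      unfold R; linarith)
    (fun n _ s' => rfl)
  have h2 := hX.abs_avg_sub_le (show 0 < X.startI (j + 1) by omega) ht hhi (hX.ref x j hj)
    (hX.refSq x j hj) (fun t s' => X.Vref t s')
    (fun n hn s' => (hV0 n (mem_Ico.1 hn).2 s').trans (X.V_le_Vref _ _))
    (fun n _ s' => X.Vref_le _ _)
    (fun n _ s' => rfl)
  rw [hcast] at h1
  rw [Nat.cast_zero, sub_zero, ← range_eq_Ico] at h2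
  have e1 : ∑ n ∈ Ico (X.startI j) (X.startI (j + 1)),
      (X.Vref (X.visitTime x n) (X.h (X.visitTime x n + 1)) -
        X.V (X.visitTime x n) (X.h (X.visitTime x n + 1))) = -X.stageSumI x j X.adv := by
    rw [stageSumI, ← sum_neg_distrib]
    exact sum_congr rfl fun n _ => by simp only [Run.adv]; ring
  have e2 : ∑ n ∈ Ico (X.startI j) (X.startI (j + 1)), X.M.expect x.1 x.2
      (fun s' => X.Vref (X.visitTime x n) s' - X.V (X.visitTime x n) s') =
      -X.stageSumI x j fun t => X.M.expect x.1 x.2 fun s' => X.V t s' - X.Vref t s' := by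
    rw [stageSumI, ← sum_neg_distrib]
    refine sum_congr rfl fun n _ => ?_
    rw [X.M.expect_sub, X.M.expect_sub]; ring
  have e3 : ∑ n ∈ Ico (X.startI j) (X.startI (j + 1)),
      (X.Vref (X.visitTime x n) (X.h (X.visitTime x n + 1)) -
        X.V (X.visitTime x n) (X.h (X.visitTime x n + 1))) ^ 2 =
      X.stageSumI x j fun t => X.adv t ^ 2 := by
    rw [stageSumI]
    exact sum_congr rfl fun n _ => by simp only [Run.adv]; ring
  rw [e1, e2, e3] at h1
  have e4 : ∀ a b c : ℝ, |-a / c - -b / c| = |a / c - b / c| := fun a b c => by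
    rw [← abs_neg]; congr 1; ring
  rw [e4, neg_div, neg_sq] at h1
  have hHR := hX.R_le_H
  have hr2 : (1 : ℝ) ≤ 2 * √2 := by
    have : (1 : ℝ) ≤ √2 := Real.one_le_sqrt.2 (by norm_num)
    linarith
  have hscale : ∀ v n : ℝ, 0 < n → √v + 2 * (X.R * X.p.ι ^ (3 / 4 : ℝ) / n ^ (3 / 4 : ℝ)) +
      2 * (X.R * X.p.ι / n) ≤ 2 * √2 * √v + 7 * (X.p.H * X.p.ι ^ (3 / 4 : ℝ) / n ^ (3 / 4 : ℝ)) +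
      4 * (X.p.H * X.p.ι / n) := fun v n hn => by
    have a1 : √v ≤ 2 * √2 * √v := by nlinarith [Real.sqrt_nonneg v]
    have a2 : X.R * X.p.ι ^ (3 / 4 : ℝ) / n ^ (3 / 4 : ℝ) ≤
        X.p.H * X.p.ι ^ (3 / 4 : ℝ) / n ^ (3 / 4 : ℝ) := by gcongr
    have a3 : X.R * X.p.ι / n ≤ X.p.H * X.p.ι / n := by gcongr
    have a4 : 0 ≤ X.R * X.p.ι ^ (3 / 4 : ℝ) / n ^ (3 / 4 : ℝ) := by positivity
    have a5 : 0 ≤ X.R * X.p.ι / n := by positivity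
    linarith
  have g1 := h1.trans (hscale _ _ (by exact_mod_cast hpos))
  have g2 := h2.trans (hscale _ _ (by exact_mod_cast (by omega : 0 < X.startI (j + 1))))
  unfold radiusAt radius
  unfold prefixSum
  linarith

/-- Type-I targets are optimistic: the reference values are averaged over all visits, and since they
decrease, this average is at least the one over the stage alone. -/
theorem Good.bellman_le_targetI [Nonempty A] (hX : X.Good U β ε) {x : S × A} {j t : ℕ}
    (hj : (X.startI j : ℝ) ≤ X.p.N₀) (ht : X.startI (j + 1) ≤ X.visits x t)
    (hopt : X.OptimisticUpTo t) :
    X.M.r x.1 x.2 + X.M.γ * X.M.expect x.1 x.2 X.M.optValue ≤ X.targetI x j := by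
  have hsucc := startI_succ (X := X) j
  have hpos := X.sizeI_pos j
  have he : (0 : ℝ) < X.sizeI j := by exact_mod_cast hpos
  have hn : (0 : ℝ) < X.startI (j + 1) := by exact_mod_cast (by omega : 0 < X.startI (j + 1))
  have hcast : (X.startI (j + 1) : ℝ) - X.startI j = X.sizeI j := by
    rw [hsucc]; push_cast; ring
  have hcard : ((#(Ico (X.startI j) (X.startI (j + 1))) : ℕ) : ℝ) = X.sizeI j := by
    rw [Nat.card_Ico, hsucc]; simp
  have hlt : ∀ n, n < X.startI (j + 1) → X.visitTime x n < t := fun n hn =>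
    X.visitTime_lt (lt_of_lt_of_le hn ht)
  unfold targetI
  have hγ := X.M.γ_pos
  suffices h : X.M.expect x.1 x.2 X.M.optValue ≤ X.stageSumI x j X.adv / X.sizeI j +
      (X.prefixSum x (X.startI (j + 1)) fun t => X.Vref t (X.h (t + 1))) / X.startI (j + 1) +
      X.bonusAtI x j by
    have := mul_le_mul_of_nonneg_left h hγ.le
    linarith
  rw [bonusAtI_eq]
  rcases min_cases (X.radiusAt x j) (2 * X.R) with ⟨h, -⟩ | ⟨h, -⟩
  · rw [h]
    have hdev := hX.abs_avg_adv_add_abs_avg_ref_le hj ht hopt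
    set a := X.stageSumI x j X.adv / X.sizeI j
    set b := (X.prefixSum x (X.startI (j + 1)) fun t => X.Vref t (X.h (t + 1))) / X.startI (j + 1)
    have havg : (X.stageSumI x j fun t => X.M.expect x.1 x.2 (X.Vref t)) / X.sizeI j ≤
        (X.prefixSum x (X.startI (j + 1)) fun t => X.M.expect x.1 x.2 (X.Vref t)) /
          X.startI (j + 1) := by
      have := avg_Ico_le_avg_range (X.startI j) (X.startI (j + 1)) (by omega)
        (fun n => X.M.expect x.1 x.2 (X.Vref (X.visitTime x n))) (fun m n hmn hn =>
          X.M.expect_mono _ _ fun s => X.Vref_antitone s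
            (X.visitTime_le hmn (lt_of_lt_of_le hn ht)))
      rwa [hcast] at this
    have hsum : X.M.expect x.1 x.2 X.M.optValue ≤
        (X.stageSumI x j fun t => X.M.expect x.1 x.2 fun s' => X.V t s' - X.Vref t s') /
          X.sizeI j + (X.stageSumI x j fun t => X.M.expect x.1 x.2 (X.Vref t)) / X.sizeI j := by
      rw [← add_div, stageSumI, stageSumI, ← sum_add_distrib, le_div_iff₀ he]
      have := card_nsmul_le_sum (Ico (X.startI j) (X.startI (j + 1)))
        (fun n => X.M.expect x.1 x.2 (fun s' => X.V (X.visitTime x n) s' -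
          X.Vref (X.visitTime x n) s') + X.M.expect x.1 x.2 (X.Vref (X.visitTime x n)))
        (X.M.expect x.1 x.2 X.M.optValue) (fun n hn => by
          rw [X.M.expect_sub, sub_add_cancel]
          exact X.M.expect_mono _ _ fun s => hopt _ (hlt n (mem_Ico.1 hn).2) s)
      rw [nsmul_eq_mul, hcard] at this
      linarith
    have d1 := neg_abs_le (a - (X.stageSumI x j fun t => X.M.expect x.1 x.2
      fun s' => X.V t s' - X.Vref t s') / X.sizeI j)
    have d2 := neg_abs_le (b - (X.prefixSum x (X.startI (j + 1))
      fun t => X.M.expect x.1 x.2 (X.Vref t)) / X.startI (j + 1))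
    linarith
  · rw [h]
    have hE : X.M.expect x.1 x.2 X.M.optValue ≤ X.R := X.M.expect_le _ _ X.M.optValue_le
    have h1 : -X.R ≤ X.stageSumI x j X.adv / X.sizeI j := by
      rw [le_div_iff₀ he]
      have := card_nsmul_le_sum (Ico (X.startI j) (X.startI (j + 1)))
        (fun n => X.adv (X.visitTime x n)) (-X.R) (fun n hn => by
          have h1 := X.Vref_le (X.visitTime x n) (X.h (X.visitTime x n + 1))
          have h2 := (X.M.optValue_nonneg (X.h (X.visitTime x n + 1))).trans
            (hopt _ (hlt n (mem_Ico.1 hn).2) _)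
          simp only [Run.adv, R]
          linarith)
      rw [nsmul_eq_mul, hcard] at this
      unfold stageSumI
      linarith
    have h2 : 0 ≤ (X.prefixSum x (X.startI (j + 1)) fun t => X.Vref t (X.h (t + 1))) /
        X.startI (j + 1) := by
      refine div_nonneg (sum_nonneg fun n hn => ?_) hn.le
      exact ((X.M.optValue_nonneg _).trans (hopt _ (hlt n (mem_range.1 hn)) _)).trans
        (X.V_le_Vref _ _)
    linarith

theorem Good.bellman_le_targetII [Nonempty A] (hX : X.Good U β ε) {x : S × A} {j t : ℕ}
    (hj : (X.startII j : ℝ) ≤ X.p.N₀) (ht : X.startII (j + 1) ≤ X.visits x t)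
    (hopt : X.OptimisticUpTo t) :
    X.M.r x.1 x.2 + X.M.γ * X.M.expect x.1 x.2 X.M.optValue ≤ X.targetII x j := by
  have he : (0 : ℝ) < X.sizeII j := by exact_mod_cast X.sizeII_pos j
  have hdev := (abs_le.1 (hX.abs_avg_optValue_sub_le hj ht)).1
  have h1 : (X.stageSumII x j fun t => X.M.optValue (X.h (t + 1))) / X.sizeII j ≤
      (X.stageSumII x j fun t => X.V t (X.h (t + 1))) / X.sizeII j := by
    apply div_le_div_of_nonneg_right _ he.le
    exact sum_le_sum fun n hn => hopt _ (X.visitTime_lt (lt_of_lt_of_le (mem_Ico.1 hn).2 ht)) _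
  unfold targetII
  have hγ := X.M.γ_pos
  have : X.M.expect x.1 x.2 X.M.optValue ≤
      (X.stageSumII x j fun t => X.V t (X.h (t + 1))) / X.sizeII j + bonusII X.p (X.sizeII j) := by
    linarith
  have := mul_le_mul_of_nonneg_left this hγ.le
  linarith

theorem optValue_le_V_of_bellman_le [Nonempty A] {t : ℕ}
    (h : ∀ x : S × A, X.M.r x.1 x.2 + X.M.γ * X.M.expect x.1 x.2 X.M.optValue ≤ X.Q t x) (s : S) :
    X.M.optValue s ≤ X.V t s := by
  obtain ⟨a, ha⟩ := X.M.exists_bellman_eq s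
  rw [ha]
  exact (h (s, a)).trans (X.Q_le_V t s a)

theorem Good.optimistic [Nonempty A] (hX : X.Good U β ε) (t : ℕ) :
    X.OptimisticUpTo t ∧ ∀ x : S × A,
      X.M.r x.1 x.2 + X.M.γ * X.M.expect x.1 x.2 X.M.optValue ≤ X.Q t x := by
  induction t with
  | zero =>
    refine ⟨fun i hi => absurd hi (by omega), fun x => ?_⟩
    rw [Q_zero]
    exact (X.M.bellman_le _ _).trans (X.M.optValue_le _)
  | succ t ih =>
    have hopt : X.OptimisticUpTo (t + 1) := fun i hi s => by
      rcases (by omega : i < t ∨ i = t) with h | rfl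
      · exact ih.1 i h s
      · exact optValue_le_V_of_bellman_le ih.2 s
    refine ⟨hopt, fun x => X.le_Q_succ (ih.2 x) (fun j hj h => ?_) fun j hj h => ?_⟩
    · exact hX.bellman_le_targetI hj h.ge hopt
    · exact hX.bellman_le_targetII hj h.ge hopt

theorem Good.bellman_le_Q [Nonempty A] (hX : X.Good U β ε) (t : ℕ) (x : S × A) :
    X.M.r x.1 x.2 + X.M.γ * X.M.expect x.1 x.2 X.M.optValue ≤ X.Q t x := (hX.optimistic t).2 x

theorem Good.optValue_le_V [Nonempty A] (hX : X.Good U β ε) (t : ℕ) (s : S) :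
    X.M.optValue s ≤ X.V t s := optValue_le_V_of_bellman_le (hX.bellman_le_Q t) s

theorem Good.V_nonneg [Nonempty A] (hX : X.Good U β ε) (t : ℕ) (s : S) : 0 ≤ X.V t s :=
  (X.M.optValue_nonneg s).trans (hX.optValue_le_V t s)

end Run

end UCBMultiStageAdvantage

/-! ### The type-II updates: how often the estimates are inaccurate -/

namespace UCBMultiStageAdvantage

theorem sum_range_stageStart (e : ℕ → ℕ) (f : ℕ → ℝ) (J : ℕ) :
    ∑ n ∈ range (stageStart e J), f n =
      ∑ j ∈ range J, ∑ n ∈ Ico (stageStart e j) (stageStart e (j + 1)), f n := by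
  induction J with
  | zero => simp [stageStart]
  | succ J ih =>
    rw [sum_range_succ, ← ih, sum_range_add_sum_Ico _ (stageStart_mono e (Nat.le_succ J))]

/-- If a quantity at each visit is bounded by a bonus plus an average over the previous stage,
then its sum over the first `c` visits is bounded by the sum of the bonuses plus a weighted sum
over earlier visits, whose weights have total mass at most `c` and are at most `ρ`. -/
theorem exists_weights_of_le_stage_avg {e : ℕ → ℕ} (he : ∀ j, 0 < e j) {ρ : ℝ}
    (hρ : ∀ j, (e (j + 1) : ℝ) ≤ ρ * e j) (c : ℕ) (g b G : ℕ → ℝ) {R : ℝ} (hR : 0 ≤ R)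
    (hb : ∀ n < c, 0 ≤ b n) (hg0 : ∀ n < c, g n ≤ R)
    (hg : ∀ j n, stageStart e (j + 1) ≤ n → n < stageStart e (j + 2) → n < c →
      g n ≤ b n + (∑ i ∈ Ico (stageStart e j) (stageStart e (j + 1)), G i) / e j) :
    ∃ ω : ℕ → ℝ, (∀ i, 0 ≤ ω i) ∧ (∀ i, ω i ≤ ρ) ∧ (∀ i, c ≤ i → ω i = 0) ∧
      ∑ i ∈ range c, ω i ≤ c ∧
      ∑ n ∈ range c, g n ≤ e 0 * R + ∑ n ∈ range c, b n + ∑ i ∈ range c, ω i * G i := by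
  classical
  choose J hJ1 hJ2 using exists_stage he
  set st := stageStart e with hst
  set cnt : ℕ → ℝ := fun j => #((Ico (st (j + 1)) (st (j + 2))).filter (· < c)) with hcnt
  have hepos : ∀ j, (0 : ℝ) < e j := fun j => by exact_mod_cast he j
  have hJeq : ∀ j, ∀ i ∈ Ico (st j) (st (j + 1)), J i = j := fun j i hi =>
    stage_unique (hJ1 i) (hJ2 i) (mem_Ico.1 hi).1 (mem_Ico.1 hi).2
  have hcard : ∀ j, (#(Ico (st j) (st (j + 1))) : ℝ) = e j := fun j => by
    rw [Nat.card_Ico, hst, stageStart_succ]; simp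
  set ω : ℕ → ℝ := fun i => cnt (J i) / e (J i) with hω
  have hω0 : ∀ i, 0 ≤ ω i := fun i => div_nonneg (Nat.cast_nonneg _) (hepos _).le
  have hωρ : ∀ i, ω i ≤ ρ := fun i => by
    simp only [hω]
    rw [div_le_iff₀ (hepos _)]
    refine le_trans ?_ (hρ (J i))
    rw [← hcard (J i + 1)]
    exact Nat.cast_le.2 (card_filter_le _ _)
  have hωc : ∀ i, c ≤ i → ω i = 0 := fun i hi => by
    have : cnt (J i) = 0 := by
      simp only [hcnt, Nat.cast_eq_zero, card_eq_zero, filter_eq_empty_iff, mem_Ico]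
      rintro n ⟨h1, -⟩ h2
      have : i < st (J i + 1) := hJ2 i
      omega
    simp only [hω, this, zero_div]
  have hsumω : ∀ F : ℕ → ℝ, ∑ i ∈ range (st c), ω i * F i =
      ∑ j ∈ range c, cnt j / e j * ∑ i ∈ Ico (st j) (st (j + 1)), F i := fun F => by
    rw [hst, sum_range_stageStart]
    refine sum_congr rfl fun j _ => ?_
    rw [mul_sum]
    refine sum_congr rfl fun i hi => ?_
    simp only [hω, hJeq j i hi]
  have hcst : c ≤ st c := le_stageStart he c
  have hrange : ∀ F : ℕ → ℝ, ∑ i ∈ range c, ω i * F i = ∑ i ∈ range (st c), ω i * F i := fun F => by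
    refine sum_subset (range_subset_range.2 hcst) fun i _ hi => ?_
    rw [hωc i (by simpa using hi), zero_mul]
  have hstc1 : c ≤ st (c + 1) := hcst.trans (stageStart_mono e (Nat.le_succ c))
  have hsplit : ∀ F : ℕ → ℝ, ∑ n ∈ range c, F n = ∑ n ∈ range (e 0), (if n < c then F n else 0) +
      ∑ j ∈ range c, ∑ n ∈ (Ico (st (j + 1)) (st (j + 2))).filter (· < c), F n := fun F => by
    have h1 : ∑ n ∈ range c, F n = ∑ n ∈ range (st (c + 1)), if n < c then F n else 0 := by
      rw [← sum_filter]
      refine sum_congr ?_ fun _ _ => rfl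
      ext n; simp only [mem_filter, mem_range]; omega
    rw [h1, hst, sum_range_stageStart, sum_range_succ']
    have h2 : Ico (stageStart e 0) (stageStart e (0 + 1)) = range (e 0) := by
      rw [stageStart_succ, stageStart_zero, zero_add, range_eq_Ico]
    rw [h2, add_comm]
    congr 1
    exact sum_congr rfl fun j _ => (sum_filter _ _).symm
  refine ⟨ω, hω0, hωρ, hωc, ?_, ?_⟩
  · have h1 := hrange fun _ => 1
    rw [hsumω] at h1
    simp only [mul_one, sum_const, nsmul_eq_mul, hcard] at h1
    rw [h1]
    have h2 := hsplit fun _ => 1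
    simp only [sum_const, nsmul_eq_mul, card_range, mul_one] at h2
    rw [h2]
    have h3 : ∑ j ∈ range c, cnt j / e j * e j = ∑ j ∈ range c, cnt j :=
      sum_congr rfl fun j _ => div_mul_cancel₀ _ (hepos j).ne'
    rw [h3]
    have h4 : (0 : ℝ) ≤ ∑ n ∈ range (e 0), if n < c then (1 : ℝ) else 0 :=
      sum_nonneg fun n _ => by split_ifs <;> norm_num
    linarith
  · rw [hrange, hsumω, hsplit g, hsplit b]
    have h1 : ∑ n ∈ range (e 0), (if n < c then g n else 0) ≤ e 0 * R := by
      have := sum_le_card_nsmul (range (e 0)) (fun n => if n < c then g n else 0) R fun n _ => by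
        show (if n < c then g n else 0) ≤ R
        split_ifs with h
        · exact hg0 n h
        · exact hR
      rwa [nsmul_eq_mul, card_range] at this
    have h2 : 0 ≤ ∑ n ∈ range (e 0), (if n < c then b n else 0) :=
      sum_nonneg fun n _ => by
        split_ifs with h
        · exact hb n h
        · exact le_rfl
    have h3 : ∑ j ∈ range c, ∑ n ∈ (Ico (st (j + 1)) (st (j + 2))).filter (· < c), g n ≤
        ∑ j ∈ range c, ∑ n ∈ (Ico (st (j + 1)) (st (j + 2))).filter (· < c), b n +
        ∑ j ∈ range c, cnt j / e j * ∑ i ∈ Ico (st j) (st (j + 1)), G i := by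
      rw [← sum_add_distrib]
      refine sum_le_sum fun j _ => ?_
      have e1 : cnt j / e j * ∑ i ∈ Ico (st j) (st (j + 1)), G i =
          ∑ n ∈ (Ico (st (j + 1)) (st (j + 2))).filter (· < c),
            (∑ i ∈ Ico (st j) (st (j + 1)), G i) / e j := by
        rw [sum_const, nsmul_eq_mul]; simp only [hcnt]; ring
      rw [e1, ← sum_add_distrib]
      refine sum_le_sum fun n hn => ?_
      rw [mem_filter, mem_Ico] at hn
      exact hg j n hn.1.1 hn.1.2 hn.2
    linarith

namespace Run

variable {S A : Type*} [Fintype S] [Fintype A] {X : Run S A}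

theorem sum_range_eq_sum_pairs (X : Run S A) (f : ℕ → ℝ) (T : ℕ) : ∑ t ∈ range T, f t =
    ∑ x : S × A, ∑ n ∈ range (X.visits x T), f (X.visitTime x n) := by
  classical
  have h1 : ∀ x : S × A, ∑ n ∈ range (X.visits x T), f (X.visitTime x n) =
      ∑ t ∈ range T, if X.pair t = x then f t else 0 := fun x =>
    (sum_ite_eq_sum_nth (fun i => X.pair i = x) f T).symm
  simp only [h1]
  rw [sum_comm]
  exact sum_congr rfl fun t _ => by simp

/-- The number of state-action pairs. -/
noncomputable def size (_X : Run S A) : ℝ := Fintype.card S * Fintype.card A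

theorem size_eq : X.size = Fintype.card (S × A) := by
  unfold size; rw [Fintype.card_prod]; push_cast; ring

/-- The leading coefficient in the bound for sums of overestimations, see `Good.sum_mul_qgap_le`. -/
noncomputable def coeffK (X : Run S A) : ℝ := 36 * X.R * √((X.p.H : ℝ) ^ 3 * X.p.ι * X.size)

/-- The constant term in the bound for sums of overestimations. -/
noncomputable def coeffK' (X : Run S A) : ℝ := 4 * X.size * X.p.H * X.R ^ 3

theorem coeffK_nonneg : 0 ≤ X.coeffK := by
  have := X.R_pos
  unfold coeffK; positivity

theorem coeffK'_nonneg : 0 ≤ X.coeffK' := by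
  have := X.R_pos
  unfold coeffK' size; positivity

/-- A bound for the number of times at which the overestimation exceeds `b`. -/
noncomputable def countBound (X : Run S A) (b : ℝ) : ℝ :=
  4 * X.coeffK ^ 2 / b ^ 2 + 2 * X.coeffK' / b + 1

/-- The weights of the recursion grow slowly enough for the discount factor to win. -/
theorem γ_mul_bounds (hRH : X.R ≤ X.p.H) :
    X.M.γ * √(1 + 1 / (X.p.H : ℝ)) ≤ 1 - 1 / (2 * X.R) ∧
      X.M.γ * (1 + 1 / (X.p.H : ℝ)) ≤ 1 - 1 / X.R ^ 2 := by
  have hR := X.R_pos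
  have hR1 := X.one_le_R
  have hinv : 1 / (X.p.H : ℝ) ≤ 1 / X.R := one_div_le_one_div_of_le hR hRH
  have hu1 : 1 / X.R ≤ 1 := by rw [div_le_one hR]; exact hR1
  have hu0 : 0 < 1 / X.R := by positivity
  have e2 : 1 / (2 * X.R) = 1 / X.R / 2 := by field_simp
  have e3 : 1 / X.R ^ 2 = (1 / X.R) ^ 2 := by field_simp
  rw [γ_eq_one_sub, e2, e3]
  set u := 1 / X.R
  constructor
  · have h1 : √(1 + 1 / (X.p.H : ℝ)) ≤ 1 + u / 2 := by
      rw [Real.sqrt_le_left (by positivity)]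
      nlinarith
    have := mul_le_mul_of_nonneg_left h1 (show 0 ≤ 1 - u by linarith)
    nlinarith
  · have := mul_le_mul_of_nonneg_left hinv (show 0 ≤ 1 - u by linarith)
    nlinarith

/-- The constants `coeffK` and `coeffK'` are chosen such that one step of the recursion in
`Good.sum_mul_qgap_le` reproduces the bound. -/
theorem recursion_le (hRH : X.R ≤ X.p.H) {m : ℝ} (hm0 : 0 ≤ m) :
    X.size * (X.p.H * X.R + X.R) + 18 * √((X.p.H : ℝ) ^ 3 * X.p.ι * X.size) * √m +
      (X.M.γ * ((1 + 1 / (X.p.H : ℝ)) * (X.coeffK * √(m / (1 + 1 / (X.p.H : ℝ))) + X.coeffK')) +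
        2 * (X.size * X.R)) ≤ X.coeffK * √m + X.coeffK' := by
  have hR := X.R_pos
  have hH2 : (2 : ℝ) ≤ X.p.H := by exact_mod_cast X.two_le_H
  have hsize0 : 0 ≤ X.size := by unfold size; positivity
  have hK0 := coeffK_nonneg (X := X)
  have hK'0 := coeffK'_nonneg (X := X)
  obtain ⟨hγ1, hγ2⟩ := γ_mul_bounds hRH
  have hρ1 : 0 < 1 + 1 / (X.p.H : ℝ) := by positivity
  set ρ : ℝ := 1 + 1 / (X.p.H : ℝ) with hρ
  have e1 : ρ * √(m / ρ) = √ρ * √m := by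
    rw [Real.sqrt_div hm0, mul_div_assoc', mul_div_right_comm, Real.div_sqrt]
  have e2 : X.M.γ * (ρ * (X.coeffK * √(m / ρ) + X.coeffK')) =
      (X.M.γ * √ρ) * (X.coeffK * √m) + (X.M.γ * ρ) * X.coeffK' := by
    rw [mul_add, show ρ * (X.coeffK * √(m / ρ)) = X.coeffK * (ρ * √(m / ρ)) by ring, e1]; ring
  rw [e2]
  have hKm : 0 ≤ X.coeffK * √m := mul_nonneg hK0 (Real.sqrt_nonneg _)
  have h1 := mul_le_mul_of_nonneg_right hγ1 hKm
  have h2 := mul_le_mul_of_nonneg_right hγ2 hK'0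
  have h3 : 1 / (2 * X.R) * (X.coeffK * √m) =
      18 * √((X.p.H : ℝ) ^ 3 * X.p.ι * X.size) * √m := by
    unfold coeffK
    generalize √((X.p.H : ℝ) ^ 3 * X.p.ι * X.size) = y
    field_simp
    ring
  have h4 : 1 / X.R ^ 2 * X.coeffK' = 4 * X.size * X.p.H * X.R := by
    unfold coeffK'; field_simp
  have h5 : X.size * (X.p.H * X.R + X.R) + 2 * (X.size * X.R) ≤ 4 * X.size * X.p.H * X.R := by
    have h6 : 0 ≤ X.size * X.R := by positivity
    have := mul_le_mul_of_nonneg_left hH2 h6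
    linarith
  linarith

variable [DecidableEq S]

/-- The optimal value of a state-action pair. -/
noncomputable def optQ (X : Run S A) (x : S × A) : ℝ :=
  X.M.r x.1 x.2 + X.M.γ * X.M.expect x.1 x.2 X.M.optValue

/-- The overestimation of `Q^*` at the pair played at time `t`. -/
noncomputable def qgap (X : Run S A) (t : ℕ) : ℝ := X.Q t (X.pair t) - X.optQ (X.pair t)

variable {U : ℕ} {β ε : ℝ}

variable [Nonempty A]

theorem optQ_nonneg (x : S × A) : 0 ≤ X.optQ x :=
  add_nonneg (X.M.r_nonneg _ _)
    (mul_nonneg X.M.γ_pos.le (X.M.expect_nonneg _ _ X.M.optValue_nonneg))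

theorem optQ_le (x : S × A) : X.optQ x ≤ X.M.optValue x.1 := X.M.bellman_le _ _

theorem Q_sub_optQ_le (t : ℕ) (x : S × A) : X.Q t x - X.optQ x ≤ X.R := by
  have := X.Q_le t x
  have := optQ_nonneg (X := X) x
  unfold R; linarith

theorem V_sub_optValue_le_qgap (t : ℕ) : X.V t (X.h t) - X.M.optValue (X.h t) ≤ X.qgap t := by
  have h1 := X.V_eq_Q_pair t
  have h2 : X.optQ (X.pair t) ≤ X.M.optValue (X.h t) := optQ_le (X := X) (X.pair t)
  unfold qgap; linarith

theorem Good.Q_sub_optQ_nonneg (hX : X.Good U β ε) (t : ℕ) (x : S × A) : 0 ≤ X.Q t x - X.optQ x :=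
  sub_nonneg.2 (hX.bellman_le_Q t x)

theorem Good.qgap_nonneg (hX : X.Good U β ε) (t : ℕ) : 0 ≤ X.qgap t := hX.Q_sub_optQ_nonneg _ _

/-- After the first stage, the overestimation at a visit is bounded by the bonus and the average
overestimation at the states reached in the previous stage. -/
theorem Good.Q_sub_optQ_le_avg (hX : X.Good U β ε) {x : S × A} {t j n : ℕ}
    (hn1 : X.startII (j + 1) ≤ n) (hn2 : n < X.startII (j + 2)) (hnt : n < X.visits x t)
    (hN : (n : ℝ) ≤ X.p.N₀) :
    X.Q (X.visitTime x n) x - X.optQ x ≤ 9 * √((X.p.H : ℝ) ^ 3 * X.p.ι) * (1 / √((n : ℝ) + 1)) +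
      (∑ i ∈ Ico (X.startII j) (X.startII (j + 1)), X.M.γ * (X.V (X.visitTime x i)
        (X.h (X.visitTime x i + 1)) - X.M.optValue (X.h (X.visitTime x i + 1)))) /
        X.sizeII j := by
  have hι := hX.ι_pos
  have hγ0 := X.M.γ_pos
  have hγ1 := X.M.γ_lt_one
  have he : (0 : ℝ) < X.sizeII j := by exact_mod_cast X.sizeII_pos j
  have hH0 : (0 : ℝ) < X.p.H := by exact_mod_cast (by linarith [X.two_le_H] : 0 < X.p.H)
  have hj : (X.startII j : ℝ) ≤ X.p.N₀ := by
    have : X.startII j ≤ n := by rw [startII_succ] at hn1; omega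
    have : (X.startII j : ℝ) ≤ n := by exact_mod_cast this
    linarith
  have hv : X.startII (j + 1) ≤ X.visits x (X.visitTime x n) := by
    rw [X.visits_visitTime hnt]; exact hn1
  have h1 := X.Q_le_targetII hj hv
  have h2 := (abs_le.1 (hX.abs_avg_optValue_sub_le hj hv)).2
  unfold targetII at h1
  set b := bonusII X.p (X.sizeII j) with hb
  have hb0 : 0 ≤ b := bonusII_nonneg X _
  have hb1 : 2 * b ≤ 9 * √((X.p.H : ℝ) ^ 3 * X.p.ι) * (1 / √((n : ℝ) + 1)) := by
    have h3 : b ≤ 2 * √((X.p.H : ℝ) ^ 2 * X.p.ι / X.sizeII j) := min_le_left _ _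
    have h4 : (n : ℝ) + 1 ≤ 5 * X.p.H * X.sizeII j := by
      have h5 := stageStart_add_two_le X.two_le_H 1 j le_rfl
      rw [Nat.cast_one, mul_one, ← sizeII_eq (X := X)] at h5
      have h6 : ((n + 1 : ℕ) : ℝ) ≤ X.startII (j + 2) := by exact_mod_cast hn2
      push_cast at h6
      exact h6.trans h5
    have h5 : (X.p.H : ℝ) ^ 2 * X.p.ι / X.sizeII j ≤
        5 * ((X.p.H : ℝ) ^ 3 * X.p.ι) / ((n : ℝ) + 1) := by
      rw [div_le_div_iff₀ he (by positivity)]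
      have := mul_le_mul_of_nonneg_left h4 (show 0 ≤ (X.p.H : ℝ) ^ 2 * X.p.ι by positivity)
      linarith
    have h6 : √((X.p.H : ℝ) ^ 2 * X.p.ι / X.sizeII j) ≤
        9 / 4 * (√((X.p.H : ℝ) ^ 3 * X.p.ι) * (1 / √((n : ℝ) + 1))) := by
      refine (Real.sqrt_le_sqrt h5).trans ?_
      rw [Real.sqrt_div (by positivity), Real.sqrt_mul (by norm_num)]
      have h7 : √(5 : ℝ) ≤ 9 / 4 := by
        rw [Real.sqrt_le_left (by norm_num)]; norm_num
      rw [mul_div_assoc, div_eq_mul_one_div √((X.p.H : ℝ) ^ 3 * X.p.ι)]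
      gcongr
    linarith
  set a := (X.stageSumII x j fun t => X.V t (X.h (t + 1))) / X.sizeII j
  set a' := (X.stageSumII x j fun t => X.M.optValue (X.h (t + 1))) / X.sizeII j
  have e1 : (∑ i ∈ Ico (X.startII j) (X.startII (j + 1)), X.M.γ * (X.V (X.visitTime x i)
        (X.h (X.visitTime x i + 1)) - X.M.optValue (X.h (X.visitTime x i + 1)))) /
        X.sizeII j = X.M.γ * (a - a') := by
    rw [← mul_sum, sum_sub_distrib, mul_div_assoc, sub_div]; rfl
  rw [e1]
  unfold optQ
  set E := X.M.expect x.1 x.2 X.M.optValue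
  have h5 : X.M.γ * (a' - E) ≤ X.M.γ * b := mul_le_mul_of_nonneg_left h2 hγ0.le
  have h6 : X.M.γ * b ≤ b := by nlinarith
  nlinarith

/-- The total decrease of the value estimates along the visited states. -/
theorem Good.sum_V_drop_le (hX : X.Good U β ε) (T : ℕ) :
    ∑ t ∈ range T, (X.V t (X.h (t + 1)) - X.V (t + 1) (X.h (t + 1))) ≤ Fintype.card S * X.R := by
  calc ∑ t ∈ range T, (X.V t (X.h (t + 1)) - X.V (t + 1) (X.h (t + 1)))
      ≤ ∑ t ∈ range T, ∑ s, (X.V t s - X.V (t + 1) s) :=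
        sum_le_sum fun t _ => single_le_sum (f := fun s => X.V t s - X.V (t + 1) s)
          (fun s _ => sub_nonneg.2 (X.V_succ_le t s)) (mem_univ _)
    _ = ∑ s, (X.V 0 s - X.V T s) := by
        rw [sum_comm]
        exact sum_congr rfl fun s _ => sum_range_sub' (fun t => X.V t s) T
    _ ≤ ∑ _s : S, X.R := sum_le_sum fun s _ => by
        have h1 := X.V_le 0 s
        have h2 := hX.V_nonneg T s
        unfold R; linarith
    _ = Fintype.card S * X.R := by simp

/-- The type-II updates bound the overestimation summed over any set of at most `N₀` times, with
weights. Every time is charged to the times following the previous stage of its pair; one step of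
this recursion contracts the leading term by `γ √(1 + 1/H)`, since the weights grow by a factor
`1 + 1/H` while their mass does not. Moving the weights of a pair to its earliest visits keeps
them within the first `N₀` visits, where stages are completed. -/
theorem Good.sum_mul_qgap_le (hX : X.Good U β ε) (k : ℕ) : ∀ (T : ℕ) (w : ℕ → ℝ) (m : ℝ),
    (∀ t < T, 0 ≤ w t) → (∀ t < T, w t ≤ 1) → ∑ t ∈ range T, w t ≤ m → m ≤ X.p.N₀ →
    m ≤ (1 + 1 / (X.p.H : ℝ)) ^ k →
    ∑ t ∈ range T, w t * X.qgap t ≤ X.coeffK * √m + X.coeffK' := by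
  classical
  have hR := X.R_pos
  have hR1 := X.one_le_R
  have hι := hX.ι_pos
  have hH2 : (2 : ℝ) ≤ X.p.H := by exact_mod_cast X.two_le_H
  have hA1 : (1 : ℝ) ≤ Fintype.card A := by exact_mod_cast Fintype.card_pos
  have hsize0 : 0 ≤ X.size := by unfold size; positivity
  have hS : (Fintype.card S : ℝ) ≤ X.size := by
    unfold size; exact le_mul_of_one_le_right (Nat.cast_nonneg _) hA1
  have hK0 := coeffK_nonneg (X := X)
  have hK'0 := coeffK'_nonneg (X := X)
  set ρ : ℝ := 1 + 1 / (X.p.H : ℝ) with hρ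
  have hρ1 : 1 ≤ ρ := by rw [hρ]; linarith [show 0 ≤ 1 / (X.p.H : ℝ) by positivity]
  have hρ2 : ρ ≤ 2 := by
    rw [hρ]
    have : 1 / (X.p.H : ℝ) ≤ 1 := by rw [div_le_one] <;> linarith
    linarith
  induction k with
  | zero =>
    intro T w m hw0 hw1 hsum hmN hm
    rcases Nat.eq_zero_or_pos T with rfl | hTpos
    · simp only [range_zero, sum_empty]; positivity
    have : Nonempty S := ⟨X.h 0⟩
    have hsize1 : 1 ≤ X.size := by
      have : (1 : ℝ) ≤ Fintype.card S := by exact_mod_cast Fintype.card_pos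
      linarith
    have h1 : ∑ t ∈ range T, w t * X.qgap t ≤ (∑ t ∈ range T, w t) * X.R := by
      rw [sum_mul]
      refine sum_le_sum fun t ht => ?_
      exact mul_le_mul_of_nonneg_left (Q_sub_optQ_le _ _) (hw0 t (mem_range.1 ht))
    rw [pow_zero] at hm
    have h2 : (∑ t ∈ range T, w t) * X.R ≤ 1 * X.R := by gcongr; linarith
    have h3 : X.R ≤ X.coeffK' := by
      unfold coeffK'
      have : 1 ≤ 4 * X.size * X.p.H * X.R ^ 2 := by
        have := one_le_pow₀ hR1 (n := 2)
        nlinarith [mul_le_mul hsize1 (show (1 : ℝ) ≤ X.p.H by linarith) zero_le_one hsize0]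
      nlinarith
    have h4 : 0 ≤ X.coeffK * √m := by positivity
    linarith
  | succ k ih =>
    intro T w m hw0 hw1 hsum hmN hm
    have hm0 : 0 ≤ m := (sum_nonneg fun t ht => hw0 t (mem_range.1 ht)).trans hsum
    -- the mass `W x` of the pair `x` is moved to its first `c x = ⌊W x⌋₊` visits
    set W : S × A → ℝ := fun x => ∑ n ∈ range (X.visits x T), w (X.visitTime x n) with hW
    set c : S × A → ℕ := fun x => ⌊W x⌋₊ with hc
    have hlt : ∀ x n, n < X.visits x T → X.visitTime x n < T := fun x n hn => X.visitTime_lt hn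
    have hW0 : ∀ x, 0 ≤ W x := fun x => sum_nonneg fun n hn => hw0 _ (hlt x n (mem_range.1 hn))
    have hWsum : ∑ x, W x ≤ m := by
      rw [← X.sum_range_eq_sum_pairs w T]; exact hsum
    have hcW : ∀ x, (c x : ℝ) ≤ W x := fun x => Nat.floor_le (hW0 x)
    have hcsum : ∑ x, (c x : ℝ) ≤ m := (sum_le_sum fun x _ => hcW x).trans hWsum
    have hcm : ∀ x, (c x : ℝ) ≤ m := fun x =>
      (single_le_sum (f := fun x => (c x : ℝ)) (fun _ _ => Nat.cast_nonneg _) (mem_univ x)).trans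
        hcsum
    have hcv : ∀ x, c x ≤ X.visits x T := fun x => by
      have : W x ≤ X.visits x T := by
        have := sum_le_card_nsmul (range (X.visits x T)) (fun n => w (X.visitTime x n)) 1
          fun n hn => hw1 _ (hlt x n (mem_range.1 hn))
        rwa [nsmul_eq_mul, card_range, mul_one] at this
      exact_mod_cast (hcW x).trans this
    -- the discounted overestimation of the state reached after the visit `i`, and the bonus
    set G : S × A → ℕ → ℝ := fun x i => X.M.γ * (X.V (X.visitTime x i)
        (X.h (X.visitTime x i + 1)) - X.M.optValue (X.h (X.visitTime x i + 1))) with hG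
    set b : ℕ → ℝ := fun n => 9 * √((X.p.H : ℝ) ^ 3 * X.p.ι) * (1 / √((n : ℝ) + 1)) with hb
    have hstage : ∀ x, ∃ ω : ℕ → ℝ, (∀ i, 0 ≤ ω i) ∧ (∀ i, ω i ≤ ρ) ∧ (∀ i, c x ≤ i → ω i = 0) ∧
        ∑ i ∈ range (c x), ω i ≤ c x ∧
        ∑ n ∈ range (c x), (X.Q (X.visitTime x n) x - X.optQ x) ≤ X.sizeII 0 * X.R +
          ∑ n ∈ range (c x), b n + ∑ i ∈ range (c x), ω i * G x i := fun x => by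
      refine exists_weights_of_le_stage_avg X.sizeII_pos (fun j => ?_) (c x) _ b (G x)
        hR.le (fun n _ => by positivity) (fun n _ => Q_sub_optQ_le _ _) fun j n h1 h2 h3 => ?_
      · rw [sizeII_eq]; exact typeISize_succ_le X.two_le_H 1 j
      · refine hX.Q_sub_optQ_le_avg (t := T) h1 h2 (lt_of_lt_of_le h3 (hcv x)) ?_
        have : (n : ℝ) ≤ c x := by exact_mod_cast h3.le
        linarith [hcm x]
    choose ω hω0 hωρ hωc hωsum hωle using hstage
    have hbath : ∀ x, ∑ n ∈ range (X.visits x T), w (X.visitTime x n) * X.qgap (X.visitTime x n) ≤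
        ∑ n ∈ range (c x), (X.Q (X.visitTime x n) x - X.optQ x) + X.R := fun x => by
      have := sum_weight_le_sum_range_floor (X.visits x T)
        (fun n => X.Q (X.visitTime x n) x - X.optQ x) (fun n => w (X.visitTime x n)) X.R
        (fun i n hin hn => by
          have := X.Q_antitone x (X.visitTime_le hin hn)
          simp only at this ⊢
          linarith)
        (fun n _ => hX.Q_sub_optQ_nonneg _ _) (fun n _ => Q_sub_optQ_le _ _) hR.le
        (fun n hn => hw0 _ (hlt x n hn)) (fun n hn => hw1 _ (hlt x n hn))
      refine le_trans (le_of_eq (sum_congr rfl fun n hn => ?_)) this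
      simp only [qgap, X.pair_visitTime (mem_range.1 hn)]
    -- the weights of the next level of the recursion: time `t` is charged through the visit at time
    -- `t - 1`, which led to the state at time `t`
    set w' : ℕ → ℝ := fun t => if t = 0 then 0 else
      ω (X.pair (t - 1)) (X.visits (X.pair (t - 1)) (t - 1)) with hw'
    have hw'0 : ∀ t, 0 ≤ w' t := fun t => by
      simp only [hw']; split_ifs
      · exact le_rfl
      · exact hω0 _ _
    have hw'ρ : ∀ t, w' t ≤ ρ := fun t => by
      simp only [hw']; split_ifs
      · linarith
      · exact hωρ _ _
    have hw'sum : ∀ F : ℕ → ℝ, ∑ t ∈ range T, w' (t + 1) * F t =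
        ∑ x, ∑ i ∈ range (c x), ω x i * F (X.visitTime x i) := fun F => by
      rw [X.sum_range_eq_sum_pairs]
      refine sum_congr rfl fun x _ => ?_
      rw [eq_comm]
      refine (sum_subset (range_subset_range.2 (hcv x)) fun i _ hi => ?_).trans
        (sum_congr rfl fun i hi => ?_)
      · rw [hωc x i (by simpa using hi), zero_mul]
      · have hi := mem_range.1 hi
        simp only [hw', Nat.add_sub_cancel, Nat.succ_ne_zero, if_false, X.pair_visitTime hi,
          X.visits_visitTime hi]
    have hmass : ∑ t ∈ range (T + 1), w' t ≤ m := by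
      rw [sum_range_succ']
      have h1 := hw'sum fun _ => 1
      simp only [mul_one] at h1
      rw [h1]
      have h2 : w' 0 = 0 := by simp [hw']
      rw [h2, add_zero]
      exact (sum_le_sum fun x _ => hωsum x).trans hcsum
    have hIH := ih (T + 1) (fun t => w' t / ρ) (m / ρ)
      (fun t _ => div_nonneg (hw'0 t) (by linarith))
      (fun t _ => (div_le_one (by linarith)).2 (hw'ρ t))
      (by rw [← sum_div]; gcongr)
      ((div_le_self hm0 hρ1).trans hmN)
      (by rw [div_le_iff₀ (by linarith), ← pow_succ]; exact hm)
    have hIH' : ∑ t ∈ range (T + 1), w' t * X.qgap t ≤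
        ρ * (X.coeffK * √(m / ρ) + X.coeffK') := by
      have e1 : ∑ t ∈ range (T + 1), w' t / ρ * X.qgap t =
          (∑ t ∈ range (T + 1), w' t * X.qgap t) / ρ := by
        rw [sum_div]; exact sum_congr rfl fun t _ => by ring
      rw [e1, div_le_iff₀ (by linarith)] at hIH
      linarith
    -- at time `t` the value of the next state was used, at time `t + 1` it may have decreased;
    -- these decreases sum up to at most one range `R` per state
    have hGsum : ∑ x, ∑ i ∈ range (c x), ω x i * G x i ≤
        X.M.γ * (∑ t ∈ range (T + 1), w' t * X.qgap t) + 2 * (X.size * X.R) := by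
      have h1 := hw'sum fun t => X.M.γ * (X.V t (X.h (t + 1)) - X.M.optValue (X.h (t + 1)))
      rw [← h1]
      have h2 : ∀ t ∈ range T, w' (t + 1) *
          (X.M.γ * (X.V t (X.h (t + 1)) - X.M.optValue (X.h (t + 1)))) ≤
          X.M.γ * (w' (t + 1) * X.qgap (t + 1)) +
            2 * (X.V t (X.h (t + 1)) - X.V (t + 1) (X.h (t + 1))) := fun t _ => by
        have h3 := V_sub_optValue_le_qgap (X := X) (t + 1)
        have h4 := X.V_succ_le t (X.h (t + 1))
        have h5 : X.M.γ * w' (t + 1) ≤ 2 := by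
          have := hw'ρ (t + 1)
          nlinarith [X.M.γ_lt_one, X.M.γ_pos, hw'0 (t + 1)]
        have h6 : 0 ≤ X.M.γ * w' (t + 1) := mul_nonneg X.M.γ_pos.le (hw'0 _)
        nlinarith
      refine (sum_le_sum h2).trans ?_
      rw [sum_add_distrib, ← mul_sum, ← mul_sum]
      have h3 := hX.sum_V_drop_le T
      have h4 : ∑ t ∈ range T, w' (t + 1) * X.qgap (t + 1) =
          ∑ t ∈ range (T + 1), w' t * X.qgap t := by
        rw [sum_range_succ']; simp [hw']
      rw [h4]
      have h5 : (Fintype.card S : ℝ) * X.R ≤ X.size * X.R := by gcongr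
      linarith
    have hbsum : ∑ x, ∑ n ∈ range (c x), b n ≤
        18 * √((X.p.H : ℝ) ^ 3 * X.p.ι * X.size) * √m := by
      have h1 : ∀ x ∈ univ, ∑ n ∈ range (c x), b n ≤
          18 * √((X.p.H : ℝ) ^ 3 * X.p.ι) * √(c x : ℝ) := fun x _ => by
        simp only [hb]
        rw [← mul_sum]
        have := sum_inv_sqrt_le (c x)
        nlinarith [Real.sqrt_nonneg ((X.p.H : ℝ) ^ 3 * X.p.ι)]
      refine (sum_le_sum h1).trans ?_
      rw [← mul_sum]
      have h2 := sum_sqrt_le_sqrt_card_mul univ (fun x : S × A => (c x : ℝ))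
        fun _ _ => Nat.cast_nonneg _
      have h3 : √((#(univ : Finset (S × A)) : ℝ) * ∑ x, (c x : ℝ)) ≤ √(X.size * m) := by
        apply Real.sqrt_le_sqrt
        rw [size_eq, card_univ]
        gcongr
      rw [Real.sqrt_mul (by positivity) X.size]
      rw [Real.sqrt_mul hsize0] at h3
      calc _ ≤ 18 * √((X.p.H : ℝ) ^ 3 * X.p.ι) * (√X.size * √m) := by gcongr; exact h2.trans h3
        _ = _ := by ring
    have hcardX : ((Fintype.card (S × A) : ℕ) : ℝ) = X.size := size_eq.symm
    have htotal : ∑ t ∈ range T, w t * X.qgap t ≤ X.size * (X.p.H * X.R + X.R) +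
        18 * √((X.p.H : ℝ) ^ 3 * X.p.ι * X.size) * √m +
        (X.M.γ * (ρ * (X.coeffK * √(m / ρ) + X.coeffK')) + 2 * (X.size * X.R)) := by
      rw [X.sum_range_eq_sum_pairs]
      have h1 : ∑ x, ∑ n ∈ range (X.visits x T), w (X.visitTime x n) * X.qgap (X.visitTime x n) ≤
          ∑ x : S × A, ((X.p.H * X.R + X.R) + ∑ n ∈ range (c x), b n +
            ∑ i ∈ range (c x), ω x i * G x i) := sum_le_sum fun x _ => by
        have h2 := hbath x
        have h3 := hωle x
        rw [sizeII_zero] at h3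
        linarith
      refine h1.trans ?_
      rw [sum_add_distrib, sum_add_distrib, sum_const, nsmul_eq_mul, card_univ, hcardX]
      have := mul_le_mul_of_nonneg_left hIH' X.M.γ_pos.le
      linarith
    exact htotal.trans (recursion_le hX.R_le_H hm0)

theorem Good.sum_qgap_le (hX : X.Good U β ε) (T : ℕ) (s : Finset ℕ) (hs : ∀ t ∈ s, t < T) {m : ℝ}
    (hm : (#s : ℝ) ≤ m) (hmN : m ≤ X.p.N₀) :
    ∑ t ∈ s, X.qgap t ≤ X.coeffK * √m + X.coeffK' := by
  classical
  have hρ : 1 < 1 + 1 / (X.p.H : ℝ) := by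
    have : (0 : ℝ) < X.p.H := by exact_mod_cast (by linarith [X.two_le_H] : 0 < X.p.H)
    linarith [show 0 < 1 / (X.p.H : ℝ) by positivity]
  obtain ⟨k, hk⟩ := pow_unbounded_of_one_lt m hρ
  have hsub : (range T).filter (· ∈ s) = s := by
    ext t; simp only [mem_filter, mem_range]; exact ⟨fun h => h.2, fun h => ⟨hs t h, h⟩⟩
  have := hX.sum_mul_qgap_le k T (fun t => if t ∈ s then 1 else 0) m
    (fun t _ => by split_ifs <;> norm_num)
    (fun t _ => by split_ifs <;> norm_num)
    (by rw [← sum_filter, hsub]; simpa using hm) hmN hk.le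
  refine le_trans (le_of_eq ?_) this
  simp only [ite_mul, one_mul, zero_mul]
  rw [← sum_filter, hsub]

/-- A set of times with overestimation above `b` cannot have `countBound b` elements, by
`Good.sum_qgap_le` applied to a subset of about that size. -/
theorem Good.card_qgap_lt (hX : X.Good U β ε) {b : ℝ} (hb : 0 < b)
    (hbN : X.countBound b ≤ X.p.N₀) (T : ℕ) (s : Finset ℕ) (hs : ∀ t ∈ s, t < T)
    (hsb : ∀ t ∈ s, b < X.qgap t) : (#s : ℝ) < X.countBound b := by
  have hK0 := coeffK_nonneg (X := X)
  have hK'0 := coeffK'_nonneg (X := X)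
  by_contra! hcard
  have h0 : 0 ≤ 4 * X.coeffK ^ 2 / b ^ 2 + 2 * X.coeffK' / b := by positivity
  set m := ⌊4 * X.coeffK ^ 2 / b ^ 2 + 2 * X.coeffK' / b⌋₊ + 1 with hm
  have hm1 : 4 * X.coeffK ^ 2 / b ^ 2 + 2 * X.coeffK' / b < m := by
    rw [hm]; push_cast; exact Nat.lt_floor_add_one _
  have hm2 : (m : ℝ) ≤ X.countBound b := by
    rw [hm]; push_cast; unfold countBound
    linarith [Nat.floor_le h0]
  have hms : m ≤ #s := by exact_mod_cast hm2.trans hcard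
  obtain ⟨u, hus, hum⟩ := exists_subset_card_eq hms
  have h1 := hX.sum_qgap_le T u (fun t ht => hs t (hus ht)) (m := m) (by rw [hum])
    (hm2.trans hbN)
  have h2 : (m : ℝ) * b ≤ ∑ t ∈ u, X.qgap t := by
    have := card_nsmul_le_sum u X.qgap b fun t ht => (hsb t (hus ht)).le
    rwa [nsmul_eq_mul, hum] at this
  have hm0 : (0 : ℝ) < m := lt_of_le_of_lt h0 hm1
  have h3 : X.coeffK ≤ √(m : ℝ) * (b / 2) := by
    have : 2 * X.coeffK / b ≤ √(m : ℝ) := by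
      apply Real.le_sqrt_of_sq_le
      have e1 : (2 * X.coeffK / b) ^ 2 = 4 * X.coeffK ^ 2 / b ^ 2 := by ring
      rw [e1]
      have : 0 ≤ 2 * X.coeffK' / b := by positivity
      linarith
    rw [div_le_iff₀ hb] at this
    linarith
  have h4 : X.coeffK' < m * (b / 2) := by
    have : 2 * X.coeffK' / b < m := by
      have : 0 ≤ 4 * X.coeffK ^ 2 / b ^ 2 := by positivity
      linarith
    rw [div_lt_iff₀ hb] at this
    linarith
  have h5 : X.coeffK * √(m : ℝ) ≤ m * (b / 2) := by
    calc X.coeffK * √(m : ℝ) ≤ √(m : ℝ) * (b / 2) * √(m : ℝ) := by gcongr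
      _ = √(m : ℝ) * √(m : ℝ) * (b / 2) := by ring
      _ = m * (b / 2) := by rw [Real.mul_self_sqrt hm0.le]
  linarith

/-- As the overestimation at a pair decreases, a pair with an inaccurate estimate was overestimated
at all its visits. -/
theorem Good.Q_sub_optQ_le_of_visits (hX : X.Good U β ε) {b : ℝ} (hb : 0 < b)
    (hbN : X.countBound b ≤ X.p.N₀) {x : S × A} {t : ℕ} (ht : X.countBound b ≤ X.visits x t) :
    X.Q t x - X.optQ x ≤ b := by
  classical
  by_contra! hlt
  have h1 := hX.card_qgap_lt hb hbN t ((range t).filter fun i => X.pair i = x)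
    (fun i hi => mem_range.1 (mem_filter.1 hi).1) (fun i hi => by
      have hi := mem_filter.1 hi
      have := X.Q_antitone x (mem_range.1 hi.1).le
      unfold qgap
      rw [hi.2]
      simp only at this
      linarith)
  have h2 : #((range t).filter fun i => X.pair i = x) = X.visits x t :=
    by
    rw [visits, Nat.count_eq_card_filter_range]; congr!
  rw [h2] at h1
  linarith

theorem Good.V_sub_optValue_le_of_visits (hX : X.Good U β ε) {b : ℝ} (hb : 0 < b)
    (hbN : X.countBound b ≤ X.p.N₀) {s : S} {t : ℕ} (ht : X.countBound b ≤ X.stateVisits s t) :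
    X.V t s - X.M.optValue s ≤ b := by
  classical
  by_contra! hlt
  have h1 := hX.card_qgap_lt hb hbN t ((range t).filter fun i => X.h i = s)
    (fun i hi => mem_range.1 (mem_filter.1 hi).1) (fun i hi => by
      have hi := mem_filter.1 hi
      have h1 := X.V_antitone s (mem_range.1 hi.1).le
      have h2 := V_sub_optValue_le_qgap (X := X) i
      rw [hi.2] at h2
      simp only at h1
      linarith)
  have h2 : #((range t).filter fun i => X.h i = s) = X.stateVisits s t :=
    by
    rw [stateVisits, Nat.count_eq_card_filter_range]; congr!
  rw [h2] at h1
  linarith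

theorem Good.sum_clip_V_le (hX : X.Good U β ε) {b : ℝ} (hb : 0 < b)
    (hbN : X.countBound b ≤ X.p.N₀) (T : ℕ) :
    ∑ t ∈ range T, max (X.V t (X.h t) - X.M.optValue (X.h t) - b) 0 ≤
      X.coeffK * √(X.countBound b) + X.coeffK' := by
  classical
  set s := (range T).filter fun t => b < X.qgap t with hs
  have h1 := hX.card_qgap_lt hb hbN T s (fun i hi => mem_range.1 (mem_filter.1 hi).1)
    fun i hi => (mem_filter.1 hi).2
  have h2 := hX.sum_qgap_le T s (fun i hi => mem_range.1 (mem_filter.1 hi).1) h1.le hbN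
  refine le_trans ?_ h2
  rw [hs, sum_filter]
  refine sum_le_sum fun t _ => ?_
  have h3 := V_sub_optValue_le_qgap (X := X) t
  split_ifs with h
  · exact max_le (by linarith) (hX.qgap_nonneg t)
  · exact max_le (by linarith) le_rfl

end Run

end UCBMultiStageAdvantage

/-! ### The reference values -/

namespace UCBMultiStageAdvantage

theorem sum_ite_count_lt_le (p : ℕ → Prop) [DecidablePred p] (m T : ℕ) :
    ∑ i ∈ range T, (if p i ∧ Nat.count p i < m then (1 : ℝ) else 0) ≤ m := by
  have h : ∀ T, ∑ i ∈ range T, (if p i ∧ Nat.count p i < m then (1 : ℝ) else 0) =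
      (min (Nat.count p T) m : ℕ) := fun T => by
    induction T with
    | zero => simp
    | succ T ih =>
      rw [sum_range_succ, ih, Nat.count_succ]
      by_cases h1 : p T
      · by_cases h2 : Nat.count p T < m
        · rw [if_pos ⟨h1, h2⟩, if_pos h1, min_eq_left h2.le, min_eq_left (by omega)]; push_cast; ring
        · rw [if_neg (by tauto), if_pos h1, min_eq_right (by omega), min_eq_right (by omega)]; simp
      · rw [if_neg (by tauto), if_neg h1]; simp
  rw [h]
  exact_mod_cast min_le_right _ _

/-- The untruncated type-I bonus after many visits, in terms of the variance `v` of the optimal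
value; `N` stands for the number of visits. -/
theorem two_mul_radius_le {p : Params} (hι : 0 < p.ι) (hH : 1 ≤ p.H) (hB : 1 ≤ p.B)
    {nI advSum advSqSum n refSum refSqSum N v : ℝ} (hnI : 0 < nI) (hn : nI ≤ n) (hv : 0 ≤ v)
    (hN : N ≤ 5 * p.H * p.B * nI) (hNlarge : 4802000 * (p.H : ℝ) ^ 7 * (p.B : ℝ) ^ 3 * p.ι ≤ N)
    (hadv : advSqSum / nI / nI * p.ι ≤ 6 * p.H * (p.ι / N))
    (href : (refSqSum / n - (refSum / n) ^ 2) / n * p.ι ≤ 9 * (v + p.H) * (p.ι / N)) :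
    2 * radius p nI advSum advSqSum n refSum refSqSum ≤ 36 * √((v + p.H) * (p.ι / N)) := by
  unfold radius
  have hH' : (1 : ℝ) ≤ p.H := by exact_mod_cast hH
  have hB' : (1 : ℝ) ≤ p.B := by exact_mod_cast hB
  have hN0 : 0 < N := lt_of_lt_of_le (by positivity) hNlarge
  set H : ℝ := (p.H : ℝ)
  set B : ℝ := (p.B : ℝ)
  set y := p.ι / N with hy
  have hy0 : 0 < y := by positivity
  have hylarge : 4802000 * H ^ 7 * B ^ 3 * y ≤ 1 := by
    rw [hy, ← mul_div_assoc, div_le_one hN0]; exact hNlarge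
  have hyI : p.ι / nI ≤ 5 * H * B * y := by
    rw [hy, ← mul_div_assoc, div_le_div_iff₀ hnI hN0]
    have := mul_le_mul_of_nonneg_left hN hι.le
    linarith
  have hyn : p.ι / n ≤ p.ι / nI := div_le_div_of_nonneg_left hι.le hnI hn
  set Y := √((v + H) * y) with hY
  have hsy : √y ≤ Y := Real.sqrt_le_sqrt (by nlinarith)
  -- the empirical variances
  have t1 : √((advSqSum / nI - (advSum / nI) ^ 2) / nI * p.ι) ≤ 5 / 2 * Y := by
    rw [hY, ← Real.sqrt_sq (show (0 : ℝ) ≤ 5 / 2 by norm_num), ← Real.sqrt_mul (by positivity)]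
    apply Real.sqrt_le_sqrt
    have h1 : (advSqSum / nI - (advSum / nI) ^ 2) / nI * p.ι ≤ advSqSum / nI / nI * p.ι := by
      gcongr
      linarith [sq_nonneg (advSum / nI)]
    have h2 : 0 ≤ v * y := by positivity
    have h3 : 0 ≤ H * y := by positivity
    nlinarith
  have t2 : √((refSqSum / n - (refSum / n) ^ 2) / n * p.ι) ≤ 3 * Y := by
    rw [hY, ← Real.sqrt_sq (show (0 : ℝ) ≤ 3 by norm_num), ← Real.sqrt_mul (by positivity)]
    apply Real.sqrt_le_sqrt
    linarith
  -- the lower order terms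
  have t3 : 7 * (H * p.ι ^ (3 / 4 : ℝ) / n ^ (3 / 4 : ℝ) +
      H * p.ι ^ (3 / 4 : ℝ) / nI ^ (3 / 4 : ℝ)) ≤ √y := by
    set z : ℝ := (5 * H * B * y) ^ (1 / 4 : ℝ) with hz
    have hz0 : 0 ≤ z := by positivity
    have hz4 : z ^ 4 = 5 * H * B * y := by
      rw [hz, ← Real.rpow_natCast, ← Real.rpow_mul (by positivity)]; norm_num
    have hz3 : z ^ 3 = (5 * H * B * y) ^ (3 / 4 : ℝ) := by
      rw [hz, ← Real.rpow_natCast, ← Real.rpow_mul (by positivity)]; norm_num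
    have h1 : p.ι ^ (3 / 4 : ℝ) / nI ^ (3 / 4 : ℝ) ≤ z ^ 3 := by
      rw [hz3, ← Real.div_rpow hι.le hnI.le]
      exact Real.rpow_le_rpow (by positivity) hyI (by norm_num)
    have h2 : p.ι ^ (3 / 4 : ℝ) / n ^ (3 / 4 : ℝ) ≤ z ^ 3 := by
      rw [hz3, ← Real.div_rpow hι.le (by linarith)]
      exact Real.rpow_le_rpow (div_nonneg hι.le (by linarith)) (hyn.trans hyI) (by norm_num)
    have h3 : 14 * H * z ^ 3 ≤ √y := by
      apply Real.le_sqrt_of_sq_le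
      have h4 : (14 * H * z * z) ^ 2 ≤ 1 * (1 / (5 * H * B)) := by
        have e : (14 * H * z * z) ^ 2 = (196 * H ^ 2) * z ^ 4 := by ring
        rw [e, hz4, one_mul, le_div_iff₀ (by positivity)]
        have : 196 * H ^ 2 * (5 * H * B * y) * (5 * H * B) = 4900 * (H ^ 4 * B ^ 2) * y := by ring
        rw [this]
        have h5 : H ^ 4 * B ^ 2 ≤ H ^ 7 * B ^ 3 := by gcongr <;> first | exact hH' | exact hB' | norm_num
        have h6 := mul_le_mul_of_nonneg_right h5 hy0.le
        nlinarith
      have h5 : (14 * H * z ^ 3) ^ 2 = (14 * H * z * z) ^ 2 * z ^ 2 := by ring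
      rw [h5]
      have e : (14 * H * z * z) ^ 2 * z ^ 2 = 196 * H ^ 2 * z ^ 2 * (5 * H * B) * y := by
        calc (14 * H * z * z) ^ 2 * z ^ 2 = 196 * H ^ 2 * z ^ 2 * z ^ 4 := by ring
          _ = _ := by rw [hz4]; ring
      rw [e]
      have h6 : 196 * H ^ 2 * z ^ 2 * (5 * H * B) ≤ 1 := by
        refine (sq_le_one_iff₀ (by positivity)).1 ?_
        have : (196 * H ^ 2 * z ^ 2 * (5 * H * B)) ^ 2 = 4802000 * H ^ 7 * B ^ 3 * y := by
          calc _ = 38416 * 25 * H ^ 6 * B ^ 2 * z ^ 4 := by ring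
            _ = _ := by rw [hz4]; ring
        rw [this]; exact hylarge
      exact mul_le_of_le_one_left hy0.le h6
    rw [mul_div_assoc, mul_div_assoc]
    have h4 := mul_le_mul_of_nonneg_left h1 (show 0 ≤ 7 * H by positivity)
    have h5 := mul_le_mul_of_nonneg_left h2 (show 0 ≤ 7 * H by positivity)
    linarith
  have t4 : 4 * (H * p.ι / n + H * p.ι / nI) ≤ √y := by
    rw [mul_div_assoc, mul_div_assoc]
    have h1 : H * (p.ι / nI) ≤ H * (5 * H * B * y) := by gcongr
    have h2 : H * (p.ι / n) ≤ H * (5 * H * B * y) := by gcongr; exact hyn.trans hyI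
    have h3 : 40 * H ^ 2 * B * y ≤ √y := by
      apply Real.le_sqrt_of_sq_le
      have e : (40 * H ^ 2 * B * y) ^ 2 = 1600 * (H ^ 4 * B ^ 2) * y * y := by ring
      rw [e]
      apply mul_le_of_le_one_left hy0.le
      have h5 : H ^ 4 * B ^ 2 ≤ H ^ 7 * B ^ 3 := by gcongr <;> first | exact hH' | exact hB' | norm_num
      have h6 := mul_le_mul_of_nonneg_right h5 hy0.le
      nlinarith
    linarith
  have hs2 : √2 ≤ 17 / 12 := by
    rw [Real.sqrt_le_left (by norm_num)]; norm_num
  have hY0 : 0 ≤ Y := Real.sqrt_nonneg _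
  have h5 : 2 * √2 * (√((advSqSum / nI - (advSum / nI) ^ 2) / nI * p.ι) +
      √((refSqSum / n - (refSum / n) ^ 2) / n * p.ι)) ≤ 2 * (17 / 12) * (5 / 2 * Y + 3 * Y) := by
    gcongr
  linarith

namespace Run

variable {S A : Type*} [Fintype S] [Fintype A] {X : Run S A}

open Classical in
theorem unsettledFun_mem (t : ℕ) (s : S) :
    X.unsettledFun (X.mem t) s = if X.stateVisits s t < X.p.N₁ then 1 else 0 := by
  unfold unsettledFun
  rw [sum_mem_visits]
  simp only [Nat.cast_lt]

/-- A bound for the number of times at which a state is reached whose reference value is not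
settled. -/
noncomputable def unsettledBound (X : Run S A) : ℝ := Fintype.card S * ((X.p.N₁ : ℝ) + 1)

theorem unsettledFun_nonneg (m : Register S A → ℝ) (s : S) : 0 ≤ X.unsettledFun m s := by
  unfold unsettledFun; split_ifs <;> norm_num

theorem unsettledFun_le_one (m : Register S A → ℝ) (s : S) : X.unsettledFun m s ≤ 1 := by
  unfold unsettledFun; split_ifs <;> norm_num

/-- Every state is unsettled during its first `N₁` visits only. -/
theorem sum_unsettledFun_le (T : ℕ) :
    ∑ t ∈ range T, X.unsettledFun (X.mem t) (X.h (t + 1)) ≤ X.unsettledBound := by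
  classical
  have h1 : ∀ t, X.unsettledFun (X.mem t) (X.h (t + 1)) ≤
      ∑ s, if X.h (t + 1) = s ∧ X.stateVisits s (t + 1) < X.p.N₁ + 1 then (1 : ℝ) else 0 := fun t => by
    have h2 : ∑ s, (if X.h (t + 1) = s ∧ X.stateVisits s (t + 1) < X.p.N₁ + 1 then (1 : ℝ) else 0) =
        if X.stateVisits (X.h (t + 1)) (t + 1) < X.p.N₁ + 1 then 1 else 0 := by
      simp only [ite_and]
      rw [sum_ite_eq univ (X.h (t + 1))]
      simp
    rw [h2, unsettledFun_mem]
    have h3 : X.stateVisits (X.h (t + 1)) (t + 1) ≤ X.stateVisits (X.h (t + 1)) t + 1 := by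
      by_cases h : X.h t = X.h (t + 1)
      · rw [← h, stateVisits_succ_state]
      · rw [X.stateVisits_succ_of_ne h]; omega
    split_ifs
    · exact le_rfl
    · omega
    · exact zero_le_one
    · exact le_rfl
  refine (sum_le_sum fun t _ => h1 t).trans ?_
  rw [sum_comm]
  have h2 : ∀ s ∈ (univ : Finset S), ∑ t ∈ range T, (if X.h (t + 1) = s ∧
      X.stateVisits s (t + 1) < X.p.N₁ + 1 then (1 : ℝ) else 0) ≤ (X.p.N₁ : ℝ) + 1 := fun s _ => by
    have h3 := sum_ite_count_lt_le (fun i => X.h i = s) (X.p.N₁ + 1) (T + 1)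
    rw [sum_range_succ'] at h3
    have h4 : (0 : ℝ) ≤ if X.h 0 = s ∧ Nat.count (fun i => X.h i = s) 0 < X.p.N₁ + 1 then 1 else 0 := by
      split_ifs <;> norm_num
    push_cast at h3
    refine le_trans (le_of_eq (sum_congr rfl fun t _ => ?_)) ((le_add_of_nonneg_right h4).trans h3)
    unfold stateVisits
    congr!
  refine (sum_le_sum h2).trans ?_
  rw [sum_const, nsmul_eq_mul, card_univ]
  rfl

theorem sum_visitTime_le {g : ℕ → ℝ} (hg : ∀ t, 0 ≤ g t) {x : S × A} {T : ℕ} {s : Finset ℕ}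
    (hs : ∀ n ∈ s, n < X.visits x T) : ∑ n ∈ s, g (X.visitTime x n) ≤ ∑ t ∈ range T, g t := by
  rw [X.sum_range_eq_sum_pairs]
  refine (sum_le_sum_of_subset_of_nonneg (t := range (X.visits x T))
    (fun n hn => mem_range.2 (hs n hn)) fun n _ _ => hg _).trans ?_
  exact single_le_sum (f := fun x => ∑ n ∈ range (X.visits x T), g (X.visitTime x n))
    (fun x _ => sum_nonneg fun n _ => hg _) (mem_univ x)

variable {U : ℕ}

theorem two_mul_le_of_abs_sub_le {a e q c : ℝ} (h : |a - e| ≤ q / 2 + 2 * (c / 4)) (hq : q ≤ e) :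
    e ≤ 2 * a + c ∧ a ≤ 3 / 2 * e + c / 2 := by
  obtain ⟨h1, h2⟩ := abs_le.1 h
  exact ⟨by linarith, by linarith⟩

/-- A sum of conditional expectations of a function with values in `[0, 1]` is at most twice the sum
of the observed values, up to a constant: Freedman's inequality with parameter `2`. -/
theorem Concentrated.sum_expect_le {lo hi t : ℕ} {x : S × A}
    {f : (Register S A → ℝ) → S → ℝ} (hc : X.Concentrated U (X.test x lo hi f))
    (ht : hi ≤ X.visits x t) (hU : 2 ≤ U) (F : ℕ → S → ℝ)
    (hF : ∀ n ∈ Ico lo hi, ∀ s', unit (f (X.mem (X.visitTime x n)) s') = F n s') :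
    ∑ n ∈ Ico lo hi, X.M.expect x.1 x.2 (F n) ≤
        2 * ∑ n ∈ Ico lo hi, F n (X.h (X.visitTime x n + 1)) + X.p.ι ∧
      ∑ n ∈ Ico lo hi, F n (X.h (X.visitTime x n + 1)) ≤
        3 / 2 * ∑ n ∈ Ico lo hi, X.M.expect x.1 x.2 (F n) + X.p.ι / 2 := by
  have e1 := X.deviation_test x (lo := lo) f ht
  have e2 := X.quadVar_test x (lo := lo) f ht
  have hF01 : ∀ n ∈ Ico lo hi, ∀ s', 0 ≤ F n s' ∧ F n s' ≤ 1 := fun n hn s' => by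
    rw [← hF n hn]; exact ⟨unit_nonneg _, unit_le_one _⟩
  rw [sum_congr rfl fun n hn => by
    rw [hF n hn, funext fun s' => hF n hn s']] at e1
  rw [sum_congr rfl fun n hn => by rw [funext fun s' => hF n hn s']] at e2
  have h := hc 2 (by norm_num) hU t
  rw [e1, e2, sum_sub_distrib] at h
  push_cast at h
  refine two_mul_le_of_abs_sub_le h (sum_le_sum fun n hn => ?_)
  refine (X.M.variance_le_expect_sq _ _ _).trans (X.M.expect_mono _ _ fun s' => ?_)
  have := hF01 n hn s'
  nlinarith

variable [DecidableEq S] {β ε : ℝ}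

/-- The number of unsettled states among the first visits to a pair, in expectation. -/
theorem Good.sum_expect_unsettledFun_le (hX : X.Good U β ε) (hU : 2 ≤ U) {x : S × A} {j t : ℕ}
    (hj : (X.startI j : ℝ) ≤ X.p.N₀) (ht : X.startI (j + 1) ≤ X.visits x t) :
    ∑ n ∈ range (X.startI (j + 1)), X.M.expect x.1 x.2 (X.unsettledFun (X.mem (X.visitTime x n))) ≤
      2 * X.unsettledBound + X.p.ι := by
  have h1 := ((hX.unsettled x j hj).sum_expect_le ht hU
    (fun n s' => X.unsettledFun (X.mem (X.visitTime x n)) s') (fun n _ s' =>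
      unit_of_mem (unsettledFun_nonneg _ _) (unsettledFun_le_one _ _))).1
  have h2 := sum_visitTime_le (X := X) (g := fun t => X.unsettledFun (X.mem t) (X.h (t + 1)))
    (fun t => unsettledFun_nonneg _ _) (x := x) (T := t) (s := range (X.startI (j + 1)))
    fun n hn => lt_of_lt_of_le (mem_range.1 hn) ht
  rw [← range_eq_Ico] at h1
  have h3 := sum_unsettledFun_le (X := X) t
  linarith

variable [Nonempty A]

/-- The empirical second moment of `V^*` around its mean is of the order of its variance. -/
theorem Good.sum_sq_optValue_sub_le (hX : X.Good U β ε) (hU : 2 ≤ U) {x : S × A} {j t : ℕ}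
    (hj : (X.startI j : ℝ) ≤ X.p.N₀) (ht : X.startI (j + 1) ≤ X.visits x t) :
    ∑ n ∈ range (X.startI (j + 1)), (X.M.optValue (X.h (X.visitTime x n + 1)) -
      X.M.expect x.1 x.2 X.M.optValue) ^ 2 ≤
      3 / 2 * (X.startI (j + 1) * X.M.variance x.1 x.2 X.M.optValue) + X.R ^ 2 * X.p.ι / 2 := by
  have hR := X.R_pos
  set E := X.M.expect x.1 x.2 X.M.optValue
  have hE0 : 0 ≤ E := X.M.expect_nonneg _ _ X.M.optValue_nonneg
  have hE1 : E ≤ X.R := X.M.expect_le _ _ X.M.optValue_le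
  have h1 := ((hX.var x j hj).sum_expect_le ht hU
    (fun _ s' => ((X.M.optValue s' - E) / X.R) ^ 2) (fun n _ s' =>
      unit_of_mem (y := ((X.M.optValue s' - E) / X.R) ^ 2) (sq_nonneg _) (by
        have h0 := X.M.optValue_nonneg s'
        have h1 : X.M.optValue s' ≤ X.R := X.M.optValue_le s'
        rw [sq_le_one_iff_abs_le_one, abs_div, abs_of_pos hR, div_le_one hR, abs_le]
        constructor <;> linarith))).2
  simp only [div_pow] at h1
  rw [← sum_div] at h1
  rw [X.M.expect_div, ← X.M.variance_eq, sum_const, nsmul_eq_mul, Nat.card_Ico, Nat.sub_zero,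
    ← range_eq_Ico, div_le_iff₀ (by positivity)] at h1
  refine h1.trans_eq ?_
  field_simp

/-- A settled reference value is accurate. -/
theorem Good.Vref_sub_optValue_le (hX : X.Good U β ε) {b : ℝ} (hb : 0 < b)
    (hb0 : X.countBound b ≤ X.p.N₀) (hb1 : X.countBound b ≤ X.p.N₁) (t : ℕ) (s : S) :
    X.Vref t s - X.M.optValue s ≤ b + X.R * X.unsettledFun (X.mem t) s := by
  classical
  rw [unsettledFun_mem]
  have hR := X.R_pos
  split_ifs with h
  · have h1 : X.Vref t s ≤ X.R := X.Vref_le t s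
    have h2 := X.M.optValue_nonneg s
    linarith
  · have hN : 1 ≤ X.p.N₁ := by
      have : (1 : ℝ) ≤ X.p.N₁ := by
        refine le_trans ?_ hb1
        have := coeffK'_nonneg (X := X)
        unfold countBound
        have : 0 ≤ 4 * X.coeffK ^ 2 / b ^ 2 + 2 * X.coeffK' / b := by positivity
        linarith
      exact_mod_cast this
    obtain ⟨u, -, hu1, hu2, hu3⟩ := X.exists_Vref_eq_of_settled hN (not_lt.1 h)
    rw [hu3, mul_zero, add_zero]
    refine hX.V_sub_optValue_le_of_visits hb hb0 ?_
    rw [← hu1, stateVisits_succ_state, hu1, hu2]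
    exact hb1

theorem Good.Vref_sub_le (hX : X.Good U β ε) {t u : ℕ} (htu : t ≤ u) (s : S) :
    X.Vref t s - X.Vref u s ≤ X.R * X.unsettledFun (X.mem t) s := by
  classical
  rw [unsettledFun_mem]
  split_ifs with h
  · have h1 : X.Vref t s ≤ X.R := X.Vref_le t s
    have h2 := (hX.V_nonneg u s).trans (X.V_le_Vref u s)
    linarith
  · rw [X.Vref_eq_of_settled htu (not_lt.1 h)]; simp

theorem Good.Vref_sub_optValue_sq_le (hX : X.Good U β ε) {b : ℝ} (hb : 0 < b)
    (hb0 : X.countBound b ≤ X.p.N₀) (hb1 : X.countBound b ≤ X.p.N₁) (t : ℕ) (s : S) :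
    (X.Vref t s - X.M.optValue s) ^ 2 ≤ b ^ 2 + X.R ^ 2 * X.unsettledFun (X.mem t) s := by
  classical
  have h1 := hX.Vref_sub_optValue_le hb hb0 hb1 t s
  have h2 : 0 ≤ X.Vref t s - X.M.optValue s :=
    sub_nonneg.2 ((hX.optValue_le_V t s).trans (X.V_le_Vref t s))
  have h3 : X.Vref t s - X.M.optValue s ≤ X.R := by
    have : X.Vref t s ≤ X.R := X.Vref_le t s
    have := X.M.optValue_nonneg s
    linarith
  rw [unsettledFun_mem] at h1 ⊢
  split_ifs at h1 ⊢ <;> nlinarith [sq_nonneg b]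

theorem Good.adv_sq_le (hX : X.Good U β ε) {b : ℝ} (hb : 0 < b)
    (hb0 : X.countBound b ≤ X.p.N₀) (hb1 : X.countBound b ≤ X.p.N₁) (t : ℕ) :
    X.adv t ^ 2 ≤ b ^ 2 + X.R ^ 2 * X.unsettledFun (X.mem t) (X.h (t + 1)) := by
  refine le_trans ?_ (hX.Vref_sub_optValue_sq_le hb hb0 hb1 t (X.h (t + 1)))
  have h1 := hX.optValue_le_V t (X.h (t + 1))
  have h2 := X.V_le_Vref t (X.h (t + 1))
  unfold Run.adv
  nlinarith

theorem Good.sum_adv_sq_le (hX : X.Good U β ε) {b : ℝ} (hb : 0 < b)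
    (hb0 : X.countBound b ≤ X.p.N₀) (hb1 : X.countBound b ≤ X.p.N₁) {x : S × A} {j t : ℕ}
    (ht : X.startI (j + 1) ≤ X.visits x t) :
    (X.stageSumI x j fun t => X.adv t ^ 2) ≤ X.sizeI j * b ^ 2 + X.R ^ 2 * X.unsettledBound := by
  have h2 := sum_visitTime_le (X := X) (g := fun t => X.unsettledFun (X.mem t) (X.h (t + 1)))
    (fun t => unsettledFun_nonneg _ _) (x := x) (T := t) (s := Ico (X.startI j) (X.startI (j + 1)))
    fun n hn => lt_of_lt_of_le (mem_Ico.1 hn).2 ht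
  have h3 := sum_unsettledFun_le (X := X) t
  have h4 := h2.trans h3
  refine (sum_le_sum fun n _ => hX.adv_sq_le hb hb0 hb1 (X.visitTime x n)).trans ?_
  rw [sum_add_distrib, ← mul_sum, sum_const, nsmul_eq_mul, Nat.card_Ico, startI_succ,
    Nat.add_sub_cancel_left]
  rw [startI_succ] at h4
  gcongr

/-- The empirical variance of the reference values is bounded by their empirical second moment
around the expectation of `V^*`. -/
theorem Good.empirical_variance_ref_le (hX : X.Good U β ε) (hU : 2 ≤ U) {b : ℝ} (hb : 0 < b)
    (hb0 : X.countBound b ≤ X.p.N₀) (hb1 : X.countBound b ≤ X.p.N₁) {x : S × A} {j t : ℕ}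
    (hj : (X.startI j : ℝ) ≤ X.p.N₀) (ht : X.startI (j + 1) ≤ X.visits x t) :
    (X.prefixSum x (X.startI (j + 1)) fun t => X.Vref t (X.h (t + 1)) ^ 2) / X.startI (j + 1) -
      ((X.prefixSum x (X.startI (j + 1)) fun t => X.Vref t (X.h (t + 1))) /
        X.startI (j + 1)) ^ 2 ≤
    3 * X.M.variance x.1 x.2 X.M.optValue + 2 * b ^ 2 +
      X.R ^ 2 * (X.p.ι + 2 * X.unsettledBound) / X.startI (j + 1) := by
  have hn : (0 : ℝ) < X.startI (j + 1) := by
    have := X.sizeI_pos j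
    have := startI_succ (X := X) j
    exact_mod_cast (by omega : 0 < X.startI (j + 1))
  have h1 := hX.sum_sq_optValue_sub_le hU hj ht
  set E := X.M.expect x.1 x.2 X.M.optValue
  set v := X.M.variance x.1 x.2 X.M.optValue
  unfold prefixSum
  set a := ∑ n ∈ range (X.startI (j + 1)), X.Vref (X.visitTime x n) (X.h (X.visitTime x n + 1)) with ha
  set c := ∑ n ∈ range (X.startI (j + 1)),
    X.Vref (X.visitTime x n) (X.h (X.visitTime x n + 1)) ^ 2 with hc
  have hsum : ∑ n ∈ range (X.startI (j + 1)),
      (X.Vref (X.visitTime x n) (X.h (X.visitTime x n + 1)) - E) ^ 2 =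
      c - 2 * E * a + X.startI (j + 1) * E ^ 2 := by
    rw [hc, ha, mul_sum, ← sum_sub_distrib]
    have : (X.startI (j + 1) : ℝ) * E ^ 2 = ∑ _n ∈ range (X.startI (j + 1)), E ^ 2 := by
      rw [sum_const, nsmul_eq_mul, card_range]
    rw [this, ← sum_add_distrib]
    exact sum_congr rfl fun n _ => by ring
  have h2 : ∀ n ∈ range (X.startI (j + 1)),
      (X.Vref (X.visitTime x n) (X.h (X.visitTime x n + 1)) - E) ^ 2 ≤
      2 * (X.M.optValue (X.h (X.visitTime x n + 1)) - E) ^ 2 + (2 * b ^ 2 +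
        2 * X.R ^ 2 * X.unsettledFun (X.mem (X.visitTime x n)) (X.h (X.visitTime x n + 1))) :=
    fun n _ => by
      have := hX.Vref_sub_optValue_sq_le hb hb0 hb1 (X.visitTime x n) (X.h (X.visitTime x n + 1))
      set u := X.Vref (X.visitTime x n) (X.h (X.visitTime x n + 1))
      set w := X.M.optValue (X.h (X.visitTime x n + 1))
      nlinarith [sq_nonneg ((u - w) - (w - E))]
  have h3 := sum_le_sum h2
  rw [hsum, sum_add_distrib, sum_add_distrib, sum_const, nsmul_eq_mul, card_range,
    ← mul_sum, ← mul_sum] at h3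
  have h4 := sum_visitTime_le (X := X) (g := fun t => X.unsettledFun (X.mem t) (X.h (t + 1)))
    (fun t => unsettledFun_nonneg _ _) (x := x) (T := t) (s := range (X.startI (j + 1)))
    fun n hn => lt_of_lt_of_le (mem_range.1 hn) ht
  have h5 := mul_le_mul_of_nonneg_left (h4.trans (sum_unsettledFun_le (X := X) t))
    (show 0 ≤ 2 * X.R ^ 2 by positivity)
  set n : ℝ := (X.startI (j + 1) : ℝ)
  have h6 : c / n - (a / n) ^ 2 ≤ (c - 2 * E * a + n * E ^ 2) / n := by
    have e : (c - 2 * E * a + n * E ^ 2) / n = c / n - (a / n) ^ 2 + (a / n - E) ^ 2 := by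
      field_simp; ring
    rw [e]; linarith [sq_nonneg (a / n - E)]
  refine h6.trans ?_
  rw [div_le_iff₀ hn]
  have e : (3 * v + 2 * b ^ 2 + X.R ^ 2 * (X.p.ι + 2 * X.unsettledBound) / n) * n =
      3 * (n * v) + 2 * b ^ 2 * n + X.R ^ 2 * (X.p.ι + 2 * X.unsettledBound) := by
    field_simp
  rw [e]
  linarith

end Run

end UCBMultiStageAdvantage

/-! ### The Bellman residuals -/

namespace UCBMultiStageAdvantage

namespace Run

variable {S A : Type*} [Fintype S] [Fintype A] {X : Run S A}

/-- A number of visits after which the lower order terms of the bonuses are dominated by the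
leading terms. -/
noncomputable def burnIn (X : Run S A) : ℝ :=
  5000000 * (X.p.H : ℝ) ^ 7 * (X.p.B : ℝ) ^ 3 * X.R ^ 2 * (1 + X.unsettledBound / X.p.ι) ^ 2 * X.p.ι +
    X.p.H + 1

theorem unsettledBound_nonneg : 0 ≤ X.unsettledBound := by
  unfold unsettledBound; positivity

/-- The consequences of `burnIn ≤ N` that are used. -/
theorem le_of_burnIn_le (hι : 0 < X.p.ι) {N : ℝ} (hN : X.burnIn ≤ N) :
    (X.p.H : ℝ) + 1 ≤ N ∧ 4802000 * (X.p.H : ℝ) ^ 7 * (X.p.B : ℝ) ^ 3 * X.p.ι ≤ N ∧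
      25 * X.R ^ 2 * X.unsettledBound * X.p.H * (X.p.B : ℝ) ^ 2 ≤ N ∧
      3 * (X.R ^ 2 * (X.p.ι + 2 * X.unsettledBound)) ≤ N ∧
      (3 * X.R * (2 * X.unsettledBound + X.p.ι)) ^ 2 ≤ X.p.ι * N := by
  have hR1 := X.one_le_R
  have hH : (1 : ℝ) ≤ X.p.H := by exact_mod_cast (by linarith [X.two_le_H] : 1 ≤ X.p.H)
  have hB : (1 : ℝ) ≤ X.p.B := by exact_mod_cast X.one_le_B
  have hW := unsettledBound_nonneg (X := X)
  set W := X.unsettledBound with hWdef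
  set q := 1 + W / X.p.ι with hq
  have hq1 : 1 ≤ q := by rw [hq]; linarith [show 0 ≤ W / X.p.ι by positivity]
  have hWq : W = (q - 1) * X.p.ι := by rw [hq]; field_simp; ring
  have hN' : 5000000 * (X.p.H : ℝ) ^ 7 * (X.p.B : ℝ) ^ 3 * X.R ^ 2 * q ^ 2 * X.p.ι + X.p.H + 1 ≤
    N := hN
  have h1 : 1 ≤ (X.p.H : ℝ) ^ 6 := one_le_pow₀ hH
  have h1' : 1 ≤ (X.p.H : ℝ) ^ 7 := one_le_pow₀ hH
  have h2 : 1 ≤ (X.p.B : ℝ) ^ 3 := one_le_pow₀ hB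
  have h3 : 1 ≤ X.R ^ 2 := one_le_pow₀ hR1
  have h4 : 1 ≤ q ^ 2 := one_le_pow₀ hq1
  have h5 : q ≤ q ^ 2 := by nlinarith
  have h6 : (1 : ℝ) ≤ (X.p.H : ℝ) ^ 7 * (X.p.B : ℝ) ^ 3 := one_le_mul_of_one_le_of_one_le h1' h2
  have h7 : X.R ^ 2 * q ^ 2 * X.p.ι ≤
      (X.p.H : ℝ) ^ 7 * (X.p.B : ℝ) ^ 3 * (X.R ^ 2 * q ^ 2 * X.p.ι) :=
    le_mul_of_one_le_left (by positivity) h6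
  have hmain : 0 ≤ (X.p.H : ℝ) ^ 7 * (X.p.B : ℝ) ^ 3 * (X.R ^ 2 * q ^ 2 * X.p.ι) := by positivity
  have hN2 : 5000000 * ((X.p.H : ℝ) ^ 7 * (X.p.B : ℝ) ^ 3 * (X.R ^ 2 * q ^ 2 * X.p.ι)) ≤ N := by
    have : (0 : ℝ) ≤ X.p.H := by positivity
    linarith
  refine ⟨?_, ?_, ?_, ?_, ?_⟩
  · linarith
  · have : (X.p.H : ℝ) ^ 7 * (X.p.B : ℝ) ^ 3 * X.p.ι ≤
        (X.p.H : ℝ) ^ 7 * (X.p.B : ℝ) ^ 3 * (X.R ^ 2 * q ^ 2 * X.p.ι) := by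
      gcongr
      exact le_mul_of_one_le_left hι.le (one_le_mul_of_one_le_of_one_le h3 h4)
    linarith
  · have : X.R ^ 2 * W * X.p.H * (X.p.B : ℝ) ^ 2 ≤
        (X.p.H : ℝ) ^ 7 * (X.p.B : ℝ) ^ 3 * (X.R ^ 2 * q ^ 2 * X.p.ι) := by
      have e1 : W ≤ q ^ 2 * X.p.ι := by rw [hWq]; gcongr; linarith
      have e2 : (X.p.B : ℝ) ^ 2 ≤ (X.p.B : ℝ) ^ 3 := pow_le_pow_right₀ hB (by norm_num)
      have e3 : (X.p.H : ℝ) ≤ (X.p.H : ℝ) ^ 7 := le_self_pow₀ hH (by norm_num)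
      calc X.R ^ 2 * W * X.p.H * (X.p.B : ℝ) ^ 2 ≤
          X.R ^ 2 * (q ^ 2 * X.p.ι) * (X.p.H : ℝ) ^ 7 * (X.p.B : ℝ) ^ 3 := by gcongr
        _ = _ := by ring
    linarith
  · have : X.R ^ 2 * (X.p.ι + 2 * W) ≤ 2 * (X.R ^ 2 * q ^ 2 * X.p.ι) := by
      have e1 : X.p.ι + 2 * W ≤ 2 * (q ^ 2 * X.p.ι) := by rw [hWq]; nlinarith
      nlinarith
    linarith
  · have e1 : 2 * W + X.p.ι ≤ 2 * (q * X.p.ι) := by rw [hWq]; nlinarith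
    have e2 : (3 * X.R * (2 * W + X.p.ι)) ^ 2 ≤ (3 * X.R * (2 * (q * X.p.ι))) ^ 2 := by gcongr
    have e3 : X.p.ι * (36 * (X.R ^ 2 * q ^ 2 * X.p.ι)) ≤ X.p.ι * N := by
      apply mul_le_mul_of_nonneg_left _ hι.le
      linarith
    refine e2.trans (le_trans (le_of_eq ?_) e3)
    ring

variable [DecidableEq S] [Nonempty A] {U : ℕ} {β ε : ℝ}

/-- The reference values used in a type-I update are close to the final ones, on average. -/
theorem Good.avg_Vref_sub_avg_le (hX : X.Good U β ε) (hU : 2 ≤ U) {x : S × A} {j t : ℕ}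
    (hj : (X.startI j : ℝ) ≤ X.p.N₀) (ht : X.startI (j + 1) ≤ X.visits x t) :
    (X.prefixSum x (X.startI (j + 1)) fun t => X.M.expect x.1 x.2 (X.Vref t)) / X.startI (j + 1) -
      (X.stageSumI x j fun t => X.M.expect x.1 x.2 (X.Vref t)) / X.sizeI j ≤
    X.R * (2 * X.unsettledBound + X.p.ι) / X.startI (j + 1) := by
  have he : (0 : ℝ) < X.sizeI j := by exact_mod_cast X.sizeI_pos j
  have hn : (0 : ℝ) < X.startI (j + 1) := by
    have := X.sizeI_pos j
    have := startI_succ (X := X) j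
    exact_mod_cast (by omega : 0 < X.startI (j + 1))
  set E := X.M.expect x.1 x.2 (X.Vref t) with hE
  have hlt : ∀ n, n < X.startI (j + 1) → X.visitTime x n ≤ t := fun n hn =>
    (X.visitTime_lt (lt_of_lt_of_le hn ht)).le
  have h1 : E ≤ (X.stageSumI x j fun t => X.M.expect x.1 x.2 (X.Vref t)) / X.sizeI j := by
    rw [le_div_iff₀ he]
    have := card_nsmul_le_sum (Ico (X.startI j) (X.startI (j + 1)))
      (fun n => X.M.expect x.1 x.2 (X.Vref (X.visitTime x n))) E fun n hn =>
        X.M.expect_mono _ _ fun s => X.Vref_antitone s (hlt n (mem_Ico.1 hn).2)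
    rw [nsmul_eq_mul, Nat.card_Ico, startI_succ, Nat.add_sub_cancel_left] at this
    rw [stageSumI, startI_succ]
    linarith
  have h2 : (X.prefixSum x (X.startI (j + 1)) fun t => X.M.expect x.1 x.2 (X.Vref t)) ≤
      X.startI (j + 1) * E + X.R * (2 * X.unsettledBound + X.p.ι) := by
    have h3 : ∀ n ∈ range (X.startI (j + 1)), X.M.expect x.1 x.2 (X.Vref (X.visitTime x n)) ≤
        E + X.R * X.M.expect x.1 x.2 (X.unsettledFun (X.mem (X.visitTime x n))) := fun n hn => by
      rw [hE, ← X.M.expect_mul, ← X.M.expect_add]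
      refine X.M.expect_mono _ _ fun s => ?_
      have := hX.Vref_sub_le (hlt n (mem_range.1 hn)) s
      linarith
    refine (sum_le_sum h3).trans ?_
    rw [sum_add_distrib, ← mul_sum, sum_const, nsmul_eq_mul, card_range]
    have := mul_le_mul_of_nonneg_left (hX.sum_expect_unsettledFun_le hU hj ht) X.R_pos.le
    linarith
  have h4 : (X.prefixSum x (X.startI (j + 1)) fun t => X.M.expect x.1 x.2 (X.Vref t)) /
      X.startI (j + 1) ≤ E + X.R * (2 * X.unsettledBound + X.p.ι) / X.startI (j + 1) := by
    rw [div_le_iff₀ hn, add_mul, div_mul_cancel₀ _ hn.ne']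
    linarith
  linarith

/-- The Bellman residual of the estimate of `Q^*` after sufficiently many visits. Apart from the
decrease of the value estimates since the previous stage, it is of the order of the standard
deviation of `V^*`. -/
theorem Good.residual_le (hX : X.Good U β ε) (hU : 2 ≤ U) {b : ℝ} (hb : 0 < b)
    (hb0 : X.countBound b ≤ X.p.N₀) (hb1 : X.countBound b ≤ X.p.N₁) (hbB : b ^ 2 * X.p.B ≤ 1)
    {x : S × A} {t j n : ℕ} (hnt : n = X.visits x t) (hnN : (n : ℝ) ≤ X.p.N₀)
    (hburn : X.burnIn ≤ (n : ℝ) + 1) (hj1 : X.startI (j + 1) ≤ n) (hj2 : n < X.startI (j + 2)) :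
    X.Q t x - X.M.r x.1 x.2 - X.M.γ * X.M.expect x.1 x.2 (X.V t) ≤
      X.M.γ * ((X.stageSumI x j fun t => X.M.expect x.1 x.2 (X.V t)) / X.sizeI j -
        X.M.expect x.1 x.2 (X.V t)) +
      37 * √((X.M.variance x.1 x.2 X.M.optValue + X.p.H) * (X.p.ι / ((n : ℝ) + 1))) := by
  have hR := X.R_pos
  have hι := hX.ι_pos
  have hsucc := startI_succ (X := X) j
  have hpos := X.sizeI_pos j
  have he : (0 : ℝ) < X.sizeI j := by exact_mod_cast hpos
  have hH1 : (1 : ℝ) ≤ X.p.H := by exact_mod_cast (by linarith [X.two_le_H] : 1 ≤ X.p.H)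
  have hB1 : (1 : ℝ) ≤ X.p.B := by exact_mod_cast X.one_le_B
  have hW := unsettledBound_nonneg (X := X)
  have hj : (X.startI j : ℝ) ≤ X.p.N₀ := by
    have : (X.startI j : ℝ) ≤ n := by exact_mod_cast (by omega : X.startI j ≤ n)
    linarith
  have ht : X.startI (j + 1) ≤ X.visits x t := hnt ▸ hj1
  obtain ⟨-, hL2, hL3, hL4, hL5⟩ := le_of_burnIn_le hι hburn
  set N : ℝ := (n : ℝ) + 1 with hNdef
  have hN0 : 0 < N := by positivity
  have hcast : (X.startI (j + 1) : ℝ) = X.startI j + X.sizeI j := by rw [hsucc]; push_cast; ring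
  have hn' : (0 : ℝ) < X.startI (j + 1) := by rw [hcast]; positivity
  have hsize_le : (X.sizeI j : ℝ) ≤ X.startI (j + 1) := by
    rw [hcast]; linarith [Nat.cast_nonneg (α := ℝ) (X.startI j)]
  have hN1 : N ≤ 5 * X.p.H * X.p.B * X.sizeI j := by
    have h5 := stageStart_add_two_le X.two_le_H X.p.B j X.one_le_B
    have h6 : ((n + 1 : ℕ) : ℝ) ≤ X.startI (j + 2) := by exact_mod_cast hj2
    push_cast at h6
    exact h6.trans h5
  have hN3 : N ≤ 3 * X.startI (j + 1) := by
    have h5 : X.startI (j + 2) ≤ 3 * X.startI (j + 1) :=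
      stageStart_add_two_le_three_mul X.two_le_H X.p.B j
    have h6 : n + 1 ≤ 3 * X.startI (j + 1) := by omega
    rw [hNdef]; exact_mod_cast h6
  have h1 := X.Q_le_targetI hj ht
  have h2 := hX.abs_avg_adv_add_abs_avg_ref_le hj ht (hX.optimistic t).1
  have h3 : X.bonusAtI x j ≤ X.radiusAt x j := by rw [bonusAtI_eq]; exact min_le_left _ _
  have h4 := hX.avg_Vref_sub_avg_le hU hj ht
  set v := X.M.variance x.1 x.2 X.M.optValue with hv
  have hv0 : 0 ≤ v := X.M.variance_nonneg _ _ _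
  -- the bonus: the squared advantages are small since the reference values are accurate, which
  -- makes up for the shortness of the stage; the reference values have about the variance of `V^*`
  have h5 : 2 * X.radiusAt x j ≤ 36 * √((v + X.p.H) * (X.p.ι / N)) := by
    refine two_mul_radius_le hι (by linarith [X.two_le_H]) X.one_le_B he hsize_le hv0 hN1 hL2 ?_ ?_
    · have h6 := hX.sum_adv_sq_le hb hb0 hb1 ht
      rw [div_div, ← mul_div_assoc, div_mul_eq_mul_div, div_le_div_iff₀ (by positivity) hN0]
      set a := X.stageSumI x j fun t => X.adv t ^ 2
      set e : ℝ := (X.sizeI j : ℝ)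
      have h7 : a * N ≤ 6 * X.p.H * (e * e) := by
        have h8 : a * N ≤ (e * b ^ 2) * N + X.R ^ 2 * X.unsettledBound * N := by
          rw [← add_mul]; gcongr
        have h9 : (e * b ^ 2) * N ≤ 5 * X.p.H * (e * e) := by
          calc (e * b ^ 2) * N ≤ (e * b ^ 2) * (5 * X.p.H * X.p.B * e) := by gcongr
            _ = (5 * X.p.H * (e * e)) * (b ^ 2 * X.p.B) := by ring
            _ ≤ (5 * X.p.H * (e * e)) * 1 := by gcongr
            _ = _ := mul_one _
        have h10 : X.R ^ 2 * X.unsettledBound * N ≤ X.p.H * (e * e) := by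
          have e1 : N * N ≤ (5 * X.p.H * X.p.B * e) * (5 * X.p.H * X.p.B * e) := by gcongr
          have e2 := mul_le_mul_of_nonneg_right hL3 hN0.le
          have e3 : 0 < 25 * X.p.H * (X.p.B : ℝ) ^ 2 := by positivity
          refine le_of_mul_le_mul_left ?_ e3
          calc 25 * X.p.H * (X.p.B : ℝ) ^ 2 * (X.R ^ 2 * X.unsettledBound * N) =
              25 * X.R ^ 2 * X.unsettledBound * X.p.H * (X.p.B : ℝ) ^ 2 * N := by ring
            _ ≤ N * N := e2
            _ ≤ _ := e1
            _ = _ := by ring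
        linarith
      calc a * X.p.ι * N = (a * N) * X.p.ι := by ring
        _ ≤ (6 * X.p.H * (e * e)) * X.p.ι := by gcongr
        _ = _ := by ring
    · have h6 := hX.empirical_variance_ref_le hU hb hb0 hb1 hj ht
      have h7 : X.R ^ 2 * (X.p.ι + 2 * X.unsettledBound) / X.startI (j + 1) ≤ 1 := by
        rw [div_le_one hn']; linarith
      have h8 : b ^ 2 ≤ 1 := by nlinarith [sq_nonneg b]
      rw [div_mul_eq_mul_div, ← mul_div_assoc, div_le_div_iff₀ hn' hN0]
      set c := (X.prefixSum x (X.startI (j + 1)) fun t => X.Vref t (X.h (t + 1)) ^ 2) /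
        X.startI (j + 1) - ((X.prefixSum x (X.startI (j + 1)) fun t => X.Vref t (X.h (t + 1))) /
        X.startI (j + 1)) ^ 2
      have h9 : c ≤ 3 * (v + X.p.H) := by linarith
      calc c * X.p.ι * N ≤ 3 * (v + X.p.H) * X.p.ι * (3 * X.startI (j + 1)) := by gcongr
        _ = _ := by ring
  -- the bias from the visits at which the reference values were not settled
  have h6 : X.R * (2 * X.unsettledBound + X.p.ι) / X.startI (j + 1) ≤
      √((v + X.p.H) * (X.p.ι / N)) := by
    apply Real.le_sqrt_of_sq_le
    have e1 : X.R * (2 * X.unsettledBound + X.p.ι) / X.startI (j + 1) ≤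
        3 * X.R * (2 * X.unsettledBound + X.p.ι) / N := by
      rw [div_le_div_iff₀ hn' hN0]
      have := mul_le_mul_of_nonneg_left hN3
        (show 0 ≤ X.R * (2 * X.unsettledBound + X.p.ι) by positivity)
      linarith
    calc (X.R * (2 * X.unsettledBound + X.p.ι) / X.startI (j + 1)) ^ 2 ≤
        (3 * X.R * (2 * X.unsettledBound + X.p.ι) / N) ^ 2 := by gcongr
      _ = (3 * X.R * (2 * X.unsettledBound + X.p.ι)) ^ 2 / N / N := by rw [div_pow, sq N, div_div]
      _ ≤ X.p.ι * N / N / N := by gcongr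
      _ = 1 * (X.p.ι / N) := by field_simp
      _ ≤ (v + X.p.H) * (X.p.ι / N) := by gcongr; linarith
  set Y := √((v + X.p.H) * (X.p.ι / N))
  have h7 : (X.stageSumI x j fun t => X.M.expect x.1 x.2 fun s' => X.V t s' - X.Vref t s') /
      X.sizeI j = (X.stageSumI x j fun t => X.M.expect x.1 x.2 (X.V t)) / X.sizeI j -
        (X.stageSumI x j fun t => X.M.expect x.1 x.2 (X.Vref t)) / X.sizeI j := by
    rw [← sub_div]
    simp only [stageSumI, X.M.expect_sub, sum_sub_distrib]
  rw [h7] at h2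
  unfold targetI at h1
  set a₁ := X.stageSumI x j X.adv / X.sizeI j
  set a₂ := (X.prefixSum x (X.startI (j + 1)) fun t => X.Vref t (X.h (t + 1))) / X.startI (j + 1)
  set a₃ := (X.stageSumI x j fun t => X.M.expect x.1 x.2 (X.V t)) / X.sizeI j
  set a₄ := (X.stageSumI x j fun t => X.M.expect x.1 x.2 (X.Vref t)) / X.sizeI j
  set a₅ := (X.prefixSum x (X.startI (j + 1)) fun t => X.M.expect x.1 x.2 (X.Vref t)) /
    X.startI (j + 1)
  have h8 := le_abs_self (a₁ - (a₃ - a₄))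
  have h9 := le_abs_self (a₂ - a₅)
  have h10 : a₁ + a₂ + X.bonusAtI x j ≤ a₃ + 37 * Y := by linarith
  have h11 := mul_le_mul_of_nonneg_left h10 X.M.γ_pos.le
  have h12 : X.M.γ * (37 * Y) ≤ 37 * Y :=
    mul_le_of_le_one_left (by positivity) X.M.γ_lt_one.le
  linarith

/-- The part of the overestimation of the optimal value that exceeds `β`. -/
noncomputable def overshoot (X : Run S A) (β : ℝ) (t : ℕ) (s : S) : ℝ :=
  max (X.V t s - X.M.optValue s - β) 0

omit [Nonempty A] in
theorem overshoot_nonneg (t : ℕ) (s : S) : 0 ≤ X.overshoot β t s := le_max_right _ _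

omit [Nonempty A] in
theorem overshoot_antitone (s : S) : Antitone fun t => X.overshoot β t s := fun t u htu => by
  have := X.V_antitone s htu
  simp only at this
  exact max_le_max (by linarith) le_rfl

theorem overshoot_le (hβ : 0 ≤ β) (t : ℕ) (s : S) : X.overshoot β t s ≤ X.R := by
  have h1 : X.V t s ≤ X.R := X.V_le t s
  have := X.M.optValue_nonneg s
  exact max_le (by linarith) X.R_pos.le

theorem Good.V_sub_V_le (hX : X.Good U β ε) (t u : ℕ) (hβ : 0 ≤ β) (s : S) :
    X.V t s - X.V u s ≤ β + (X.overshoot β t s - X.overshoot β u s) := by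
  have h1 := hX.optValue_le_V u s
  have h2 : X.V t s - X.M.optValue s - β ≤ X.overshoot β t s := le_max_left _ _
  rcases max_cases (X.V u s - X.M.optValue s - β) 0 with ⟨h, -⟩ | ⟨h, -⟩
  · have : X.overshoot β u s = X.V u s - X.M.optValue s - β := h
    linarith
  · have : X.overshoot β u s = 0 := h
    linarith

omit [Nonempty A] in
theorem excess_eq (t : ℕ) : X.excess ε (X.mem t) (X.h t) =
    max 0 (X.Q t (X.pair t) - X.M.r (X.pair t).1 (X.pair t).2 -
      X.M.γ * X.M.expect (X.pair t).1 (X.pair t).2 (X.V t) -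
      X.M.threshold ε (X.pair t).1 (X.pair t).2) := by
  rw [← V_eq_Q_pair]
  rfl

omit [Nonempty A] in
theorem excess_nonneg (m : Register S A → ℝ) (s : S) : 0 ≤ X.excess ε m s := le_max_left _ _

theorem Good.excess_le (hX : X.Good U β ε) (hε : 0 ≤ ε) (t : ℕ) (s : S) :
    X.excess ε (X.mem t) s ≤ X.R := by
  have h1 : X.V t s ≤ X.R := X.V_le t s
  have h2 := X.M.r_nonneg s (X.greedy (X.mem t) s)
  have h3 : 0 ≤ X.M.γ * X.M.expect s (X.greedy (X.mem t) s) (X.V t) :=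
    mul_nonneg X.M.γ_pos.le (X.M.expect_nonneg _ _ (hX.V_nonneg t))
  have h4 : 0 ≤ X.M.threshold ε s (X.greedy (X.mem t) s) :=
    le_trans (mul_nonneg (by linarith) X.M.one_sub_γ_pos.le) (X.M.le_threshold hε _ _)
  refine max_le X.R_pos.le ?_
  change X.V t s - X.M.r s (X.greedy (X.mem t) s) -
    X.M.γ * X.M.expect s (X.greedy (X.mem t) s) (X.V t) - _ ≤ _
  linarith

/-- After sufficiently many visits the estimate of `Q^*` is accurate, and there is no excess. -/
theorem Good.excess_eq_zero (hX : X.Good U β ε) (hβ : 0 < β) (hε : 0 ≤ ε)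
    (hβε : β ≤ ε / 4 * (1 - X.M.γ)) (hβN : X.countBound β ≤ X.p.N₀) {t : ℕ}
    (ht : X.countBound β ≤ X.visits (X.pair t) t) : X.excess ε (X.mem t) (X.h t) = 0 := by
  rw [excess_eq]
  apply max_eq_left
  have h1 := hX.Q_sub_optQ_le_of_visits hβ hβN ht
  have h2 := X.M.le_threshold hε (X.pair t).1 (X.pair t).2
  have h3 := X.M.expect_mono (X.pair t).1 (X.pair t).2 (hX.optValue_le_V t)
  have h4 := mul_le_mul_of_nonneg_left h3 X.M.γ_pos.le
  unfold optQ at h1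
  linarith

/-- The decrease of the expected overshoot since the type-I stage `j`. -/
noncomputable def drift (X : Run S A) (β : ℝ) (x : S × A) (j t : ℕ) : ℝ :=
  (X.stageSumI x j fun t => X.M.expect x.1 x.2 (X.overshoot β t)) / X.sizeI j -
    X.M.expect x.1 x.2 (X.overshoot β t)

omit [Nonempty A] in
theorem drift_nonneg {x : S × A} {j t : ℕ} (ht : X.startI (j + 1) ≤ X.visits x t) :
    0 ≤ X.drift β x j t := by
  have he : (0 : ℝ) < X.sizeI j := by exact_mod_cast X.sizeI_pos j
  unfold drift
  rw [sub_nonneg, le_div_iff₀ he]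
  have := card_nsmul_le_sum (Ico (X.startI j) (X.startI (j + 1)))
    (fun n => X.M.expect x.1 x.2 (X.overshoot β (X.visitTime x n)))
    (X.M.expect x.1 x.2 (X.overshoot β t)) fun n hn =>
      X.M.expect_mono _ _ fun s => overshoot_antitone s
        (X.visitTime_lt (lt_of_lt_of_le (mem_Ico.1 hn).2 ht)).le
  rw [nsmul_eq_mul, Nat.card_Ico, startI_succ, Nat.add_sub_cancel_left] at this
  rw [stageSumI, startI_succ]
  linarith

/-- After the burn-in, the excess is at most the drift of the overshoot plus a clipped bonus; beyond
`N₀` visits there is none. -/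
theorem Good.excess_le_drift (hX : X.Good U β ε) (hU : 2 ≤ U) {b : ℝ} (hb : 0 < b)
    (hb0 : X.countBound b ≤ X.p.N₀) (hb1 : X.countBound b ≤ X.p.N₁) (hbB : b ^ 2 * X.p.B ≤ 1)
    (hβ : 0 < β) (hε : 0 ≤ ε) (hβε : β ≤ ε / 8 * (1 - X.M.γ)) (hβN : X.countBound β ≤ X.p.N₀)
    {x : S × A} {t j n : ℕ} (hx : X.pair t = x) (hnt : n = X.visits x t)
    (hburn : X.burnIn ≤ (n : ℝ) + 1) (hj1 : X.startI (j + 1) ≤ n) (hj2 : n < X.startI (j + 2)) :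
    X.excess ε (X.mem t) (X.h t) ≤ X.drift β x j t +
      max (37 * √((X.M.variance x.1 x.2 X.M.optValue + X.p.H) * X.p.ι) / √((n : ℝ) + 1) -
        X.M.threshold ε x.1 x.2 / 2) 0 := by
  have hd : 0 ≤ X.drift β x j t := drift_nonneg (hnt ▸ hj1)
  have hm := le_max_right (37 * √((X.M.variance x.1 x.2 X.M.optValue + X.p.H) * X.p.ι) /
    √((n : ℝ) + 1) - X.M.threshold ε x.1 x.2 / 2) 0
  have hm' := le_max_left (37 * √((X.M.variance x.1 x.2 X.M.optValue + X.p.H) * X.p.ι) /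
    √((n : ℝ) + 1) - X.M.threshold ε x.1 x.2 / 2) 0
  set mx := max (37 * √((X.M.variance x.1 x.2 X.M.optValue + X.p.H) * X.p.ι) /
    √((n : ℝ) + 1) - X.M.threshold ε x.1 x.2 / 2) 0
  rcases le_or_gt (n : ℝ) X.p.N₀ with hnN | hnN
  · have h1 := hX.residual_le hU hb hb0 hb1 hbB hnt hnN hburn hj1 hj2
    have he : (0 : ℝ) < X.sizeI j := by exact_mod_cast X.sizeI_pos j
    have h2 : (X.stageSumI x j fun t => X.M.expect x.1 x.2 (X.V t)) / X.sizeI j -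
        X.M.expect x.1 x.2 (X.V t) ≤ β + X.drift β x j t := by
      have h3 : ∀ n ∈ Ico (X.startI j) (X.startI (j + 1)),
          X.M.expect x.1 x.2 (X.V (X.visitTime x n)) ≤ (X.M.expect x.1 x.2 (X.V t) + β -
            X.M.expect x.1 x.2 (X.overshoot β t)) +
            X.M.expect x.1 x.2 (X.overshoot β (X.visitTime x n)) := fun n _ => by
        have h4 := X.M.expect_mono x.1 x.2 (hX.V_sub_V_le (X.visitTime x n) t hβ.le)
        rw [X.M.expect_add, X.M.expect_const, X.M.expect_sub, X.M.expect_sub] at h4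
        linarith
      have h4 := sum_le_sum h3
      rw [sum_add_distrib, sum_const, nsmul_eq_mul, Nat.card_Ico, startI_succ,
        Nat.add_sub_cancel_left] at h4
      unfold drift
      rw [stageSumI, stageSumI, startI_succ]
      have h5 := div_le_div_of_nonneg_right h4 he.le
      rw [add_div, mul_div_cancel_left₀ _ he.ne'] at h5
      linarith
    have h3 : X.M.γ * ((X.stageSumI x j fun t => X.M.expect x.1 x.2 (X.V t)) / X.sizeI j -
        X.M.expect x.1 x.2 (X.V t)) ≤ β + X.drift β x j t :=
      (mul_le_mul_of_nonneg_left h2 X.M.γ_pos.le).trans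
        (mul_le_of_le_one_left (by positivity) X.M.γ_lt_one.le)
    have h4 := X.M.le_threshold hε x.1 x.2
    rw [← mul_div_assoc, Real.sqrt_div' _ (by positivity), ← mul_div_assoc] at h1
    rw [excess_eq, hx]
    refine max_le (by positivity) ?_
    linarith
  · rw [hX.excess_eq_zero hβ hε (hβε.trans (by
      have := mul_nonneg hε X.M.one_sub_γ_pos.le
      linarith)) hβN (by
      rw [hx, ← hnt]; linarith)]
    positivity

end Run

end UCBMultiStageAdvantage

/-! ### The sum of the excesses -/

namespace UCBMultiStageAdvantage

/-- A sum over visits is bounded stage by stage. -/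
theorem sum_range_le_sum_stages {e : ℕ → ℕ} (he : ∀ j, 0 < e j) (c : ℕ) (F D : ℕ → ℝ)
    (hD : ∀ j < c, ∀ n ∈ Ico (stageStart e (j + 1)) (stageStart e (j + 2)),
      0 ≤ (∑ i ∈ Ico (stageStart e j) (stageStart e (j + 1)), D i) / e j - D n)
    (hF0 : ∀ n < c, n < e 0 → F n ≤ 0)
    (hF : ∀ j, ∀ n < c, stageStart e (j + 1) ≤ n → n < stageStart e (j + 2) →
      F n ≤ (∑ i ∈ Ico (stageStart e j) (stageStart e (j + 1)), D i) / e j - D n) :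
    ∑ n ∈ range c, F n ≤ ∑ j ∈ range c, ∑ n ∈ Ico (stageStart e (j + 1)) (stageStart e (j + 2)),
      ((∑ i ∈ Ico (stageStart e j) (stageStart e (j + 1)), D i) / e j - D n) := by
  have hstc : c ≤ stageStart e (c + 1) :=
    (le_stageStart he c).trans (stageStart_mono e (Nat.le_succ c))
  have h1 : ∑ n ∈ range c, F n = ∑ n ∈ range (stageStart e (c + 1)), if n < c then F n else 0 := by
    rw [← sum_filter]
    refine sum_congr ?_ fun _ _ => rfl
    ext n; simp only [mem_filter, mem_range]; omega
  rw [h1, sum_range_stageStart, sum_range_succ']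
  have h2 : ∑ n ∈ Ico (stageStart e 0) (stageStart e (0 + 1)), (if n < c then F n else 0) ≤ 0 := by
    refine sum_nonpos fun n hn => ?_
    rw [stageStart_succ, stageStart_zero, zero_add] at hn
    split_ifs with h
    · exact hF0 n h (mem_Ico.1 hn).2
    · exact le_rfl
  have h3 : ∑ j ∈ range c, ∑ n ∈ Ico (stageStart e (j + 1)) (stageStart e (j + 1 + 1)),
      (if n < c then F n else 0) ≤
      ∑ j ∈ range c, ∑ n ∈ Ico (stageStart e (j + 1)) (stageStart e (j + 2)),
      ((∑ i ∈ Ico (stageStart e j) (stageStart e (j + 1)), D i) / e j - D n) := by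
    refine sum_le_sum fun j hj => sum_le_sum fun n hn => ?_
    split_ifs with h
    · exact hF j n h (mem_Ico.1 hn).1 (mem_Ico.1 hn).2
    · exact hD j (mem_range.1 hj) n hn
  linarith

namespace Run

variable {S A : Type*} [Fintype S] [Fintype A] {X : Run S A}
theorem coeffK_mul_sqrt_countBound_le {β : ℝ} (hβ : 0 < β) (X : Run S A) :
    X.coeffK * √(X.countBound β) ≤ 5 / 2 * X.coeffK ^ 2 / β + X.coeffK' + β / 2 := by
  have hK := coeffK_nonneg (X := X)
  have hK' := coeffK'_nonneg (X := X)
  have h0 : 0 ≤ X.countBound β := by unfold countBound; positivity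
  have e1 : X.coeffK * √(X.countBound β) = √(X.coeffK ^ 2 / β * (β * X.countBound β)) := by
    rw [show X.coeffK ^ 2 / β * (β * X.countBound β) = X.coeffK ^ 2 * X.countBound β by field_simp,
      Real.sqrt_mul (by positivity), Real.sqrt_sq hK]
  rw [e1]
  have h1 : √(X.coeffK ^ 2 / β * (β * X.countBound β)) ≤
      (X.coeffK ^ 2 / β + β * X.countBound β) / 2 := by
    rw [Real.sqrt_le_left (by positivity)]
    nlinarith [sq_nonneg (X.coeffK ^ 2 / β - β * X.countBound β)]
  refine h1.trans (le_of_eq ?_)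
  unfold countBound
  field_simp
  ring

variable [DecidableEq S] [Nonempty A] {U : ℕ} {β ε : ℝ}

/-- The clipping threshold exceeds a multiple of `ε` times the factor in the bonus of
`Good.residual_le`. -/
theorem variance_add_H_le (hRH : X.R ≤ X.p.H) (hε : 0 < ε) (x : S × A) :
    X.M.variance x.1 x.2 X.M.optValue + X.p.H ≤
      12 * X.p.H * X.R / ε * X.M.threshold ε x.1 x.2 := by
  have hR := X.R_pos
  have hR1 := X.one_le_R
  have hγ := γ_eq_one_sub (X := X)
  have hv0 := X.M.variance_nonneg x.1 x.2 X.M.optValue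
  have hvR : X.M.variance x.1 x.2 X.M.optValue ≤ X.R ^ 2 :=
    (X.M.variance_le_expect_sq _ _ _).trans (X.M.expect_le _ _ fun s => by
      have h0 := X.M.optValue_nonneg s
      have h1 : X.M.optValue s ≤ X.R := X.M.optValue_le s
      gcongr)
  unfold DiscountedMDP.threshold
  set v := X.M.variance x.1 x.2 X.M.optValue
  have e1 : 12 * X.p.H * X.R / ε * (ε / 4 * ((1 - X.M.γ) + X.M.γ * (1 - X.M.γ) ^ 2 * v)) =
      3 * X.p.H * (1 + X.M.γ * v / X.R) := by
    have e2 : 1 - X.M.γ = 1 / X.R := by rw [hγ]; ring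
    rw [e2]; field_simp; ring
  rw [e1]
  have hH0 : (0 : ℝ) < X.p.H := by linarith
  rcases le_total 2 X.R with h2 | h2
  · have h3 : 1 / 2 ≤ X.M.γ := by
      rw [hγ]
      have : 1 / X.R ≤ 1 / 2 := one_div_le_one_div_of_le (by norm_num) h2
      linarith
    have h4 : v ≤ 2 * X.p.H * (X.M.γ * v / X.R) := by
      have h5 : v ≤ 2 * (X.M.γ * v) := by nlinarith
      have h6 : 2 * (X.M.γ * v) ≤ 2 * X.p.H * (X.M.γ * v / X.R) := by
        rw [← mul_div_assoc, le_div_iff₀ hR]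
        have := mul_le_mul_of_nonneg_left hRH (show 0 ≤ 2 * (X.M.γ * v) by
          have := X.M.γ_pos; positivity)
        linarith
      linarith
    have : 0 ≤ X.p.H * (X.M.γ * v / X.R) := by have := X.M.γ_pos; positivity
    nlinarith
  · have h3 : v ≤ 2 * X.p.H := by nlinarith
    have : 0 ≤ X.p.H * (X.M.γ * v / X.R) := by have := X.M.γ_pos; positivity
    nlinarith

/-- The excesses at the visits to one pair: the visits before the burn-in, the clipped bonuses, and
the drift of the expected overshoot. -/
theorem Good.sum_excess_pair_le (hX : X.Good U β ε) (hU : 2 ≤ U) {b : ℝ} (hb : 0 < b)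
    (hb0 : X.countBound b ≤ X.p.N₀) (hb1 : X.countBound b ≤ X.p.N₁) (hbB : b ^ 2 * X.p.B ≤ 1)
    (hβ : 0 < β) (hε : 0 < ε) (hβε : β ≤ ε / 8 * (1 - X.M.γ)) (hβN : X.countBound β ≤ X.p.N₀)
    (x : S × A) (T : ℕ) :
    ∑ n ∈ range (X.visits x T), X.excess ε (X.mem (X.visitTime x n)) (X.h (X.visitTime x n)) ≤
      X.R * X.burnIn + X.p.H * X.R + 65712 * X.p.H * X.R * X.p.ι / ε +
      1 / (X.p.H * X.p.B) * ∑ n ∈ range (X.visits x T),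
        X.M.expect x.1 x.2 (X.overshoot β (X.visitTime x n)) := by
  classical
  have hR := X.R_pos
  have hι := hX.ι_pos
  set c := X.visits x T with hc
  set v := X.M.variance x.1 x.2 X.M.optValue
  set θ := X.M.threshold ε x.1 x.2 with hθ
  set a := 37 * √((v + X.p.H) * X.p.ι) with ha
  have hv0 : 0 ≤ v := X.M.variance_nonneg _ _ _
  have hθ0 : 0 < θ := lt_of_lt_of_le (mul_pos (by linarith) X.M.one_sub_γ_pos)
    (X.M.le_threshold hε.le x.1 x.2)
  have hburn0 : (X.p.H : ℝ) + 1 ≤ X.burnIn := (le_of_burnIn_le hι le_rfl).1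
  set E : ℕ → ℝ := fun n => X.excess ε (X.mem (X.visitTime x n)) (X.h (X.visitTime x n)) with hE
  -- `I` stands for the burn-in, `m` for the clipped bonuses; `G` is cut off at the number of visits
  -- since visit times are junk values beyond it
  set I : ℕ → ℝ := fun n => if (n : ℝ) + 1 < X.burnIn then X.R else 0 with hI
  set m : ℕ → ℝ := fun n => max (a / √((n : ℝ) + 1) - θ / 2) 0 with hm
  set G : ℕ → ℝ := fun n => if n < c then X.M.expect x.1 x.2 (X.overshoot β (X.visitTime x n)) else 0
    with hG
  have hI0 : ∀ n, 0 ≤ I n := fun n => by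
    simp only [hI]; split_ifs
    · exact hR.le
    · exact le_rfl
  have hm0 : ∀ n, 0 ≤ m n := fun n => le_max_right _ _
  have hG0 : ∀ n, 0 ≤ G n := fun n => by
    simp only [hG]; split_ifs
    · exact X.M.expect_nonneg _ _ fun s => overshoot_nonneg _ _
    · exact le_rfl
  have hGanti : Antitone G := fun n n' hnn => by
    simp only [hG]
    by_cases h : n' < c
    · rw [if_pos h, if_pos (lt_of_le_of_lt hnn h)]
      exact X.M.expect_mono _ _ fun s => overshoot_antitone s (X.visitTime_le hnn h)
    · rw [if_neg h]; exact hG0 n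
  have hGc : ∀ j n, X.startI (j + 1) ≤ n → n < c →
      (∑ i ∈ Ico (X.startI j) (X.startI (j + 1)), G i) / X.sizeI j - G n =
        X.drift β x j (X.visitTime x n) := fun j n hjn hnc => by
    unfold drift stageSumI
    simp only [hG, if_pos hnc]
    congr 2
    refine sum_congr rfl fun i hi => ?_
    rw [if_pos (lt_of_lt_of_le (mem_Ico.1 hi).2 (hjn.trans hnc.le))]
  have hEle : ∀ n, E n ≤ X.R := fun n => hX.excess_le hε.le _ _
  have hD : ∀ j n, X.startI (j + 1) ≤ n →
      0 ≤ (∑ i ∈ Ico (X.startI j) (X.startI (j + 1)), G i) / X.sizeI j - G n := fun j n hjn => by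
    have he : (0 : ℝ) < X.sizeI j := by exact_mod_cast X.sizeI_pos j
    rw [sub_nonneg, le_div_iff₀ he]
    have := card_nsmul_le_sum (Ico (X.startI j) (X.startI (j + 1))) G (G n) fun i hi =>
      hGanti ((mem_Ico.1 hi).2.le.trans hjn)
    rw [nsmul_eq_mul, Nat.card_Ico, startI_succ, Nat.add_sub_cancel_left] at this
    rw [startI_succ]
    linarith
  have h1 := sum_range_le_sum_stages X.sizeI_pos c (fun n => E n - I n - m n) G
    (fun j _ n hn => hD j n (mem_Ico.1 hn).1)
    (fun n hnc hn => by
      rw [sizeI_zero] at hn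
      have h2 : I n = X.R := if_pos (by
        have : (n : ℝ) + 1 ≤ X.p.H := by exact_mod_cast hn
        linarith)
      have := hEle n
      have := hm0 n
      linarith)
    (fun j n hnc hn1 hn2 => by
      by_cases hb' : (n : ℝ) + 1 < X.burnIn
      · have h2 : I n = X.R := if_pos hb'
        have := hEle n
        have := hm0 n
        have := hD j n hn1
        unfold startI at this
        linarith
      · have h2 := hX.excess_le_drift hU hb hb0 hb1 hbB hβ hε.le hβε hβN (X.pair_visitTime hnc)
          (X.visits_visitTime hnc).symm (not_lt.1 hb') hn1 hn2
        have h3 := hGc j n hn1 hnc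
        unfold startI at h3
        rw [h3]
        have := hI0 n
        have : E n ≤ X.drift β x j (X.visitTime x n) + m n := h2
        linarith)
  have h2 := sum_stage_drift_le X.two_le_H X.p.B X.one_le_B G hGanti hG0 c
  have h3 : ∑ n ∈ range c, (E n - I n - m n) ≤ X.p.H * G 0 +
      1 / (X.p.H * X.p.B) * ∑ n ∈ range (X.startI c), G n := h1.trans h2
  have h4 : ∑ n ∈ range (X.startI c), G n =
      ∑ n ∈ range c, X.M.expect x.1 x.2 (X.overshoot β (X.visitTime x n)) := by
    simp only [hG]
    rw [← sum_filter]
    refine sum_congr ?_ fun _ _ => rfl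
    have : c ≤ X.startI c := le_stageStart X.sizeI_pos c
    ext n; simp only [mem_filter, mem_range]; omega
  have h5 : G 0 ≤ X.R := by
    simp only [hG]; split_ifs
    · exact X.M.expect_le _ _ fun s => overshoot_le hβ.le _ _
    · exact hR.le
  have h6 : ∑ n ∈ range c, I n ≤ X.R * X.burnIn := by
    simp only [hI]
    rw [← sum_filter, sum_const, nsmul_eq_mul, mul_comm]
    gcongr
    have h7 : (range c).filter (fun n : ℕ => (n : ℝ) + 1 < X.burnIn) ⊆ range ⌊X.burnIn⌋₊ := by
      intro n hn
      rw [mem_filter] at hn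
      rw [mem_range]
      have h8 : n + 1 ≤ ⌊X.burnIn⌋₊ := Nat.le_floor (by push_cast; exact hn.2.le)
      omega
    have h8 := card_le_card h7
    rw [card_range] at h8
    exact (Nat.cast_le.2 h8).trans (Nat.floor_le (by linarith [Nat.cast_nonneg (α := ℝ) X.p.H]))
  have h7 : ∑ n ∈ range c, m n ≤ 65712 * X.p.H * X.R * X.p.ι / ε := by
    refine (sum_clip_inv_sqrt_le c a (θ / 2) (by positivity) (by positivity)).trans ?_
    have e1 : a ^ 2 = 1369 * ((v + X.p.H) * X.p.ι) := by
      rw [ha, mul_pow, Real.sq_sqrt (by positivity)]; norm_num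
    rw [e1, div_le_iff₀ (by positivity)]
    have h8 := mul_le_mul_of_nonneg_right (variance_add_H_le hX.R_le_H hε x) hι.le
    calc 2 * (1369 * ((v + X.p.H) * X.p.ι)) = 2738 * ((v + X.p.H) * X.p.ι) := by ring
      _ ≤ 2738 * (12 * X.p.H * X.R / ε * θ * X.p.ι) := by linarith
      _ = _ := by ring
  rw [sum_sub_distrib, sum_sub_distrib, h4] at h3
  have h8 : X.p.H * G 0 ≤ X.p.H * X.R := by gcongr
  linarith

/-- The expected overshoots are controlled by the overshoots at the visited states. -/
theorem Good.sum_expect_overshoot_le (hX : X.Good U β ε) (hU : 2 ≤ U) (hβ : 0 < β)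
    (hβN : X.countBound β ≤ X.p.N₀) (T : ℕ) :
    ∑ t ∈ range T, X.M.expect (X.pair t).1 (X.pair t).2 (X.overshoot β t) ≤
      2 * (X.coeffK * √(X.countBound β) + X.coeffK' + Fintype.card S * X.R) + X.R * X.p.ι := by
  have hR := X.R_pos
  have hg : ∀ t s, X.gapTest β (X.mem t) (X.h t) s = X.overshoot β t s / X.R := fun t s => by
    have h1 : X.overshoot β t s / X.R ≤ 1 := (div_le_one hR).2 (overshoot_le hβ.le t s)
    have h2 : (X.V t s - X.M.optValue s - β) / X.R ≤ 1 :=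
      (div_le_div_of_nonneg_right (le_max_left _ _) hR.le).trans h1
    change max 0 (min ((X.V t s - X.M.optValue s - β) / X.R) 1) = _
    rw [min_eq_left h2, max_comm]
    unfold overshoot
    rw [← max_div_div_right hR.le, zero_div]
  have h1 := hX.gap 2 (by norm_num) hU T
  have e1 : X.alg.deviation X.M (X.gapTest β) X.h T =
      ∑ t ∈ range T, X.overshoot β t (X.h (t + 1)) / X.R -
        ∑ t ∈ range T, X.M.expect (X.pair t).1 (X.pair t).2 (fun s => X.overshoot β t s / X.R) := by
    rw [← sum_sub_distrib]
    refine sum_congr rfl fun t _ => ?_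
    rw [← hg, ← funext fun s => hg t s]
    rfl
  have e2 : X.alg.quadVar X.M (X.gapTest β) X.h T =
      ∑ t ∈ range T, X.M.variance (X.pair t).1 (X.pair t).2 fun s => X.overshoot β t s / X.R := by
    refine sum_congr rfl fun t _ => ?_
    rw [← funext fun s => hg t s]
    rfl
  rw [e1, e2] at h1
  push_cast at h1
  have h2 := (two_mul_le_of_abs_sub_le h1 (sum_le_sum fun t _ =>
    (X.M.variance_le_expect_sq _ _ _).trans (X.M.expect_mono _ _ fun s => by
      have h3 : X.overshoot β t s / X.R ≤ 1 := (div_le_one hR).2 (overshoot_le hβ.le t s)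
      have h4 : 0 ≤ X.overshoot β t s / X.R := div_nonneg (overshoot_nonneg _ _) hR.le
      nlinarith))).1
  simp only [X.M.expect_div] at h2
  rw [← sum_div, ← sum_div, div_le_iff₀ hR] at h2
  have h3 : ∑ t ∈ range T, X.overshoot β t (X.h (t + 1)) ≤
      X.coeffK * √(X.countBound β) + X.coeffK' + Fintype.card S * X.R := by
    have h4 := hX.sum_clip_V_le hβ hβN (T + 1)
    rw [sum_range_succ'] at h4
    have h5 := hX.sum_V_drop_le T
    have h6 : ∀ t ∈ range T, X.overshoot β t (X.h (t + 1)) ≤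
        max (X.V (t + 1) (X.h (t + 1)) - X.M.optValue (X.h (t + 1)) - β) 0 +
          (X.V t (X.h (t + 1)) - X.V (t + 1) (X.h (t + 1))) := fun t _ => by
      have h7 := X.V_succ_le t (X.h (t + 1))
      have h8 := le_max_left (X.V (t + 1) (X.h (t + 1)) - X.M.optValue (X.h (t + 1)) - β) 0
      have h9 := le_max_right (X.V (t + 1) (X.h (t + 1)) - X.M.optValue (X.h (t + 1)) - β) 0
      exact max_le (by linarith) (by linarith)
    have h7 := sum_le_sum h6
    rw [sum_add_distrib] at h7
    have h8 := le_max_right (X.V 0 (X.h 0) - X.M.optValue (X.h 0) - β) 0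
    linarith
  have e3 : (2 * ((∑ t ∈ range T, X.overshoot β t (X.h (t + 1))) / X.R) + X.p.ι) * X.R =
      2 * (∑ t ∈ range T, X.overshoot β t (X.h (t + 1))) + X.R * X.p.ι := by
    field_simp
  linarith

/-- The total excess, up to terms that do not depend on `ε` polynomially. -/
theorem Good.sum_excess_le (hX : X.Good U β ε) (hU : 2 ≤ U) {b : ℝ} (hb : 0 < b)
    (hb0 : X.countBound b ≤ X.p.N₀) (hb1 : X.countBound b ≤ X.p.N₁) (hbB : b ^ 2 * X.p.B ≤ 1)
    (hβ : 0 < β) (hε : 0 < ε) (hβε : β ≤ ε / 8 * (1 - X.M.γ)) (hβN : X.countBound β ≤ X.p.N₀)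
    (T : ℕ) :
    ∑ t ∈ range T, X.excess ε (X.mem t) (X.h t) ≤
      X.size * (X.R * X.burnIn + X.p.H * X.R + 65712 * X.p.H * X.R * X.p.ι / ε) +
      1 / (X.p.H * X.p.B) * (5 * X.coeffK ^ 2 / β + 4 * X.coeffK' + β +
        2 * Fintype.card S * X.R + X.R * X.p.ι) := by
  have h1 := sum_le_sum fun (x : S × A) (_ : x ∈ univ) =>
    hX.sum_excess_pair_le hU hb hb0 hb1 hbB hβ hε hβε hβN x T
  rw [← X.sum_range_eq_sum_pairs (fun t => X.excess ε (X.mem t) (X.h t))] at h1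
  refine h1.trans ?_
  rw [sum_add_distrib, ← mul_sum, sum_const, nsmul_eq_mul, card_univ, ← size_eq]
  have h2 : ∑ x : S × A, ∑ n ∈ range (X.visits x T),
      X.M.expect x.1 x.2 (X.overshoot β (X.visitTime x n)) =
      ∑ t ∈ range T, X.M.expect (X.pair t).1 (X.pair t).2 (X.overshoot β t) := by
    rw [X.sum_range_eq_sum_pairs]
    refine sum_congr rfl fun x _ => sum_congr rfl fun n hn => ?_
    rw [X.pair_visitTime (mem_range.1 hn)]
  rw [h2]
  have h3 := hX.sum_expect_overshoot_le hU hβ hβN T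
  have h4 := coeffK_mul_sqrt_countBound_le hβ X
  have hHB : 0 ≤ 1 / ((X.p.H : ℝ) * X.p.B) := by positivity
  gcongr
  refine h3.trans ?_
  have e : 5 * X.coeffK ^ 2 / β = 2 * (5 / 2 * X.coeffK ^ 2 / β) := by ring
  rw [e]
  linarith

end Run

end UCBMultiStageAdvantage

/-! ### From the excesses to the sample complexity -/

namespace UCBMultiStageAdvantage

/-- A bound for the number of completed stages. -/
theorem card_updateCounts_le {H : ℕ} (hH : 2 ≤ H) {B : ℕ} (hB : 1 ≤ B) {N₀ : ℝ} (hN : 1 ≤ N₀)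
    {s : Finset ℕ} (hs : ∀ n ∈ s, n ∈ updateCounts (typeISize H B) N₀) :
    (#s : ℝ) ≤ B * (3 * H * Real.log N₀ + 1) + 1 := by
  set J : ℝ := B * (3 * H * Real.log N₀ + 1) with hJ
  have hJ0 : 0 ≤ J := by have := Real.log_nonneg hN; positivity
  have h1 : s ⊆ (range (⌊J⌋₊ + 1)).image fun j => stageStart (typeISize H B) (j + 1) := fun n hn => by
    obtain ⟨j, hj1, hj2⟩ := mem_updateCounts_iff.1 (hs n hn)
    rw [mem_image]
    refine ⟨j, mem_range.2 (Nat.lt_succ_of_le (Nat.le_floor ?_)), hj1.symm⟩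
    exact stage_le_of_stageStart_le hH B j hB hN hj2
  have h2 := (card_le_card h1).trans card_image_le
  rw [card_range] at h2
  have h3 : (#s : ℝ) ≤ ⌊J⌋₊ + 1 := by exact_mod_cast h2
  linarith [Nat.floor_le hJ0]

namespace Run

variable {S A : Type*} [Fintype S] [Fintype A] {X : Run S A}

/-- A bound for the number of times at which the estimates change. -/
noncomputable def updateBound (X : Run S A) : ℝ :=
  2 * X.size * (X.p.B * (3 * X.p.H * Real.log X.p.N₀ + 1) + 1)

/-- At every pair, each stage ends only once. -/
theorem card_end_le (hN : 1 ≤ X.p.N₀) {e : ℕ → ℕ} {B : ℕ} (hB : 1 ≤ B) (he : e = typeISize X.p.H B)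
    (hBB : B ≤ X.p.B) (s : Finset ℕ) (T : ℕ)
    (hs : ∀ t ∈ s, t < T ∧ X.visits (X.pair t) t + 1 ∈ updateCounts e X.p.N₀) :
    (#s : ℝ) ≤ X.size * (X.p.B * (3 * X.p.H * Real.log X.p.N₀ + 1) + 1) := by
  classical
  have h1 : #s = ∑ x : S × A, #(s.filter fun t => X.pair t = x) :=
    card_eq_sum_card_fiberwise fun t _ => mem_univ _
  rw [h1, size_eq, ← card_univ, ← nsmul_eq_mul]
  push_cast
  refine sum_le_card_nsmul _ _ _ fun x _ => ?_
  have h2 : #(s.filter fun t => X.pair t = x) =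
      #((s.filter fun t => X.pair t = x).image fun t => X.visits x t + 1) := by
    refine (card_image_of_injOn fun t ht u hu htu => ?_).symm
    have ht' := (mem_filter.1 ht).2
    have hu' := (mem_filter.1 hu).2
    rw [← X.visitTime_visits ht', ← X.visitTime_visits hu']
    simp only [Nat.add_right_cancel_iff] at htu
    rw [htu]
  rw [h2]
  have h3 := card_updateCounts_le X.two_le_H hB hN
    (s := (s.filter fun t => X.pair t = x).image fun t => X.visits x t + 1) fun n hn => by
      obtain ⟨t, ht, rfl⟩ := mem_image.1 hn
      obtain ⟨ht1, ht2⟩ := mem_filter.1 ht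
      have := (hs t ht1).2
      rw [ht2, he] at this
      exact this
  refine h3.trans ?_
  have := Real.log_nonneg hN
  gcongr

theorem card_update_le (hN : 1 ≤ X.p.N₀) (s : Finset ℕ) (hs : ∀ t ∈ s, X.EndI t ∨ X.EndII t) :
    (#s : ℝ) ≤ X.updateBound := by
  classical
  have hT : ∀ t ∈ s, t < s.sup id + 1 := fun t ht => Nat.lt_succ_of_le (le_sup (f := id) ht)
  have h1 := card_end_le (X := X) hN X.one_le_B rfl le_rfl (s.filter X.EndI) (s.sup id + 1)
    fun t ht => ⟨hT t (mem_filter.1 ht).1, (mem_filter.1 ht).2⟩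
  have h2 := card_end_le (X := X) hN le_rfl sizeII_eq X.one_le_B (s.filter X.EndII) (s.sup id + 1)
    fun t ht => ⟨hT t (mem_filter.1 ht).1, (mem_filter.1 ht).2⟩
  have h3 : s ⊆ s.filter X.EndI ∪ s.filter X.EndII := fun t ht => by
    rw [mem_union, mem_filter, mem_filter]
    rcases hs t ht with h | h
    · exact Or.inl ⟨ht, h⟩
    · exact Or.inr ⟨ht, h⟩
  have h4 : (#s : ℝ) ≤ #(s.filter X.EndI) + #(s.filter X.EndII) := by
    exact_mod_cast (card_le_card h3).trans (card_union_le _ _)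
  unfold updateBound
  linarith

variable [DecidableEq S] {U : ℕ} {β ε : ℝ}

theorem pseudoRegret_nonneg (m : Register S A → ℝ) (s : S) : 0 ≤ X.pseudoRegret ε m s :=
  X.M.discounted_nonneg _ (fun s => excess_nonneg m s) s

theorem pseudoRegret_eq (t : ℕ) : X.pseudoRegret ε (X.mem t) (X.h t) =
    X.excess ε (X.mem t) (X.h t) +
      X.M.γ * X.M.expect (X.pair t).1 (X.pair t).2 (X.pseudoRegret ε (X.mem t)) :=
  X.M.discounted_eq _ _ _

/-- The pseudo-regret does not change between updates. -/
theorem pseudoRegret_succ_eq {t : ℕ} (h1 : ¬ X.EndI t) (h2 : ¬ X.EndII t) (s : S) :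
    X.pseudoRegret ε (X.mem (t + 1)) s = X.pseudoRegret ε (X.mem t) s := by
  have hV : ∀ s, X.mem (t + 1) (.inr (.V, s)) = X.mem t (.inr (.V, s)) :=
    X.V_succ_eq_of_not_end h1 h2
  have hQ : ∀ x, X.mem (t + 1) (.inl (.Q, x)) = X.mem t (.inl (.Q, x)) :=
    X.Q_succ_eq_of_not_end h1 h2
  have hg : X.greedy (X.mem (t + 1)) = X.greedy (X.mem t) := by
    funext s; unfold greedy; simp only [hQ]
  unfold pseudoRegret excess
  simp only [hg, hV]

variable [Nonempty A]

theorem Good.pseudoRegret_le (hX : X.Good U β ε) (hε : 0 ≤ ε) (t : ℕ) (s : S) :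
    X.pseudoRegret ε (X.mem t) s ≤ X.R ^ 2 := by
  refine (X.M.discounted_le_div _ (fun s => hX.excess_le hε t s) s).trans_eq ?_
  rw [sq, div_eq_mul_one_div]; rfl

/-- The suboptimality of the policy used at time `t`: the residuals below the clipping threshold
contribute at most `ε / 2`. -/
theorem Good.optValue_sub_value_le (hX : X.Good U β ε) (hε : 0 ≤ ε) (t : ℕ) (s : S) :
    X.M.optValue s - X.M.value (X.policy t) s ≤ ε / 2 + X.pseudoRegret ε (X.mem t) s := by
  set π := X.policy t with hπ
  set D := X.M.discounted π fun x => X.M.threshold ε x (π x) with hD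
  have h1 : ∀ s, X.V t s - X.M.value π s - D s ≤ X.excess ε (X.mem t) s +
      X.M.γ * X.M.expect s (π s) fun s => X.V t s - X.M.value π s - D s := fun s => by
    rw [X.M.expect_sub, X.M.expect_sub, X.M.value_eq π s, hD,
      X.M.discounted_eq π (fun x => X.M.threshold ε x (π x)) s]
    have h2 : X.V t s - X.M.r s (π s) - X.M.γ * X.M.expect s (π s) (X.V t) -
        X.M.threshold ε s (π s) ≤ X.excess ε (X.mem t) s := le_max_right _ _
    linarith
  have h2 : X.V t s - X.M.value π s - D s ≤ X.pseudoRegret ε (X.mem t) s :=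
    X.M.le_discounted π h1 s
  have h3 : D s ≤ ε / 2 := X.M.discounted_threshold_le hε π s
  have h4 := hX.optValue_le_V t s
  linarith

/-- The excesses control the pseudo-regret along the run: between updates, the pseudo-regret is
the expected discounted sum of the excesses to come. -/
theorem Good.sum_pseudoRegret_le (hX : X.Good U β ε) (hε : 0 ≤ ε) (hU : 3 * X.R ≤ U)
    (hN : 1 ≤ X.p.N₀) (T : ℕ) :
    ∑ t ∈ range T, X.pseudoRegret ε (X.mem t) (X.h t) ≤
      3 * X.R * (∑ t ∈ range T, X.excess ε (X.mem t) (X.h t) +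
        X.R ^ 2 * (1 + X.updateBound) + X.R ^ 3 * X.p.ι) := by
  classical
  have hR := X.R_pos
  have hR1 := X.one_le_R
  have hι := hX.ι_pos
  set Φ : ℕ → S → ℝ := fun t => X.pseudoRegret ε (X.mem t) with hΦ
  have hΦ0 : ∀ t s, 0 ≤ Φ t s := fun t s => pseudoRegret_nonneg _ _
  have hΦ1 : ∀ t s, Φ t s ≤ X.R ^ 2 := fun t s => hX.pseudoRegret_le hε t s
  have hg : ∀ t s, X.regretTest ε (X.mem t) (X.h t) s = Φ t s / X.R ^ 2 := fun t s =>
    unit_of_mem (div_nonneg (hΦ0 t s) (by positivity)) ((div_le_one (by positivity)).2 (hΦ1 t s))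
  set Y := ∑ t ∈ range T, X.M.expect (X.pair t).1 (X.pair t).2 (Φ t) with hY
  set E := ∑ t ∈ range T, X.excess ε (X.mem t) (X.h t) with hE
  set Z := ∑ t ∈ range T, Φ t (X.h t) with hZ
  have hY0 : 0 ≤ Y := sum_nonneg fun t _ => X.M.expect_nonneg _ _ (hΦ0 t)
  have hE0 : 0 ≤ E := sum_nonneg fun t _ => excess_nonneg _ _
  have hZE : Z = E + X.M.γ * Y := by
    rw [hZ, hE, hY, mul_sum, ← sum_add_distrib]
    exact sum_congr rfl fun t _ => pseudoRegret_eq t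
  -- at the next state the pseudo-regret has changed only if there was an update
  have hnext : ∑ t ∈ range T, Φ t (X.h (t + 1)) ≤ Z + X.R ^ 2 * (1 + X.updateBound) := by
    have h1 : ∀ t ∈ range T, Φ t (X.h (t + 1)) ≤ Φ (t + 1) (X.h (t + 1)) +
        (if X.EndI t ∨ X.EndII t then X.R ^ 2 else 0) := fun t _ => by
      split_ifs with h
      · linarith [hΦ1 t (X.h (t + 1)), hΦ0 (t + 1) (X.h (t + 1))]
      · rw [not_or] at h
        rw [add_zero]
        exact (pseudoRegret_succ_eq h.1 h.2 _).ge
    have h2 := sum_le_sum h1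
    rw [sum_add_distrib, ← sum_filter, sum_const, nsmul_eq_mul] at h2
    have h3 := card_update_le (X := X) hN ((range T).filter fun t => X.EndI t ∨ X.EndII t)
      fun t ht => (mem_filter.1 ht).2
    have h4 := mul_le_mul_of_nonneg_right h3 (show 0 ≤ X.R ^ 2 by positivity)
    have h5 : ∑ t ∈ range T, Φ (t + 1) (X.h (t + 1)) ≤ Z + X.R ^ 2 := by
      have h6 := sum_range_succ' (fun t => Φ t (X.h t)) T
      rw [sum_range_succ] at h6
      linarith [hΦ1 T (X.h T), hΦ0 0 (X.h 0)]
    linarith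
  -- with a parameter of order `R`, Freedman's inequality costs only a fraction of the contraction
  -- `1 - γ = 1 / R`
  set m := ⌈2 * X.R⌉₊ with hm
  have hm1 : 2 * X.R ≤ m := Nat.le_ceil _
  have hm2 : (m : ℝ) ≤ 3 * X.R := by
    have := (Nat.ceil_lt_add_one (show 0 ≤ 2 * X.R by positivity)).le
    rw [← hm] at this
    linarith
  have hm0 : (0 : ℝ) < m := by linarith
  have h1 := hX.regret m (by exact_mod_cast (by linarith : (1 : ℝ) ≤ m))
    (by exact_mod_cast hm2.trans hU) T
  have e1 : X.alg.deviation X.M (X.regretTest ε) X.h T =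
      ∑ t ∈ range T, Φ t (X.h (t + 1)) / X.R ^ 2 -
        ∑ t ∈ range T, X.M.expect (X.pair t).1 (X.pair t).2 (fun s => Φ t s / X.R ^ 2) := by
    rw [← sum_sub_distrib]
    refine sum_congr rfl fun t _ => ?_
    rw [← hg, ← funext fun s => hg t s]
    rfl
  have e2 : X.alg.quadVar X.M (X.regretTest ε) X.h T =
      ∑ t ∈ range T, X.M.variance (X.pair t).1 (X.pair t).2 fun s => Φ t s / X.R ^ 2 := by
    refine sum_congr rfl fun t _ => ?_
    rw [← funext fun s => hg t s]
    rfl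
  have h2 : X.alg.quadVar X.M (X.regretTest ε) X.h T ≤ Y / X.R ^ 2 := by
    rw [e2, hY, sum_div]
    refine sum_le_sum fun t _ => ?_
    rw [← X.M.expect_div]
    refine (X.M.variance_le_expect_sq _ _ _).trans (X.M.expect_mono _ _ fun s => ?_)
    have h3 : Φ t s / X.R ^ 2 ≤ 1 := (div_le_one (by positivity)).2 (hΦ1 t s)
    have h4 : 0 ≤ Φ t s / X.R ^ 2 := div_nonneg (hΦ0 t s) (by positivity)
    nlinarith
  have h3 := (abs_le.1 h1).1
  rw [e1] at h3
  simp only [X.M.expect_div] at h3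
  rw [← sum_div, ← sum_div, ← hY] at h3
  have h4 : X.alg.quadVar X.M (X.regretTest ε) X.h T / m ≤ Y / X.R ^ 2 / (2 * X.R) :=
    (div_le_div_of_nonneg_right h2 hm0.le).trans
      (div_le_div_of_nonneg_left (by positivity) (by positivity) hm1)
  have h5 : (m : ℝ) * (X.p.ι / 4) ≤ X.R * X.p.ι := by
    have := mul_le_mul_of_nonneg_right hm2 hι.le
    have : 0 ≤ X.R * X.p.ι := by positivity
    linarith
  set L := X.R ^ 2 * (1 + X.updateBound) with hL
  have h6 : Y / X.R ^ 2 ≤ (Z + L) / X.R ^ 2 + Y / X.R ^ 2 / (2 * X.R) + X.R * X.p.ι := by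
    have := div_le_div_of_nonneg_right hnext (show 0 ≤ X.R ^ 2 by positivity)
    linarith
  have h7 : Y ≤ Z + L + Y / (2 * X.R) + X.R ^ 3 * X.p.ι := by
    have := mul_le_mul_of_nonneg_left h6 (show 0 ≤ X.R ^ 2 by positivity)
    have e3 : X.R ^ 2 * (Y / X.R ^ 2) = Y := by field_simp
    have e4 : X.R ^ 2 * ((Z + L) / X.R ^ 2 + Y / X.R ^ 2 / (2 * X.R) + X.R * X.p.ι) =
        Z + L + Y / (2 * X.R) + X.R ^ 3 * X.p.ι := by field_simp
    linarith
  have h8 : Y / (2 * X.R) ≤ E + L + X.R ^ 3 * X.p.ι := by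
    have e3 : X.M.γ * Y = Y - 2 * (Y / (2 * X.R)) := by
      rw [γ_eq_one_sub]; field_simp
    linarith
  rw [div_le_iff₀ (by positivity)] at h8
  have h9 : X.M.γ * Y ≤ Y := mul_le_of_le_one_left hY0 X.M.γ_lt_one.le
  have h10 : 0 ≤ L + X.R ^ 3 * X.p.ι := by
    have : 0 ≤ X.updateBound := (Nat.cast_nonneg _).trans
      (card_update_le (X := X) hN ∅ (by simp))
    positivity
  have h11 : E ≤ X.R * (E + L + X.R ^ 3 * X.p.ι) := by nlinarith
  linarith

/-- At a time with an `ε`-suboptimal policy the pseudo-regret exceeds `ε / 2`. -/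
theorem Good.sampleComplexity_le (hX : X.Good U β ε) (hε : 0 < ε) {C : ℝ}
    (hC : ∀ T, ∑ t ∈ range T, X.pseudoRegret ε (X.mem t) (X.h t) ≤ C) :
    X.alg.sampleComplexity X.M ε X.h ≤ ENNReal.ofReal (2 * C / ε) := by
  classical
  unfold OnlineAlgorithm.sampleComplexity
  rw [ENNReal.tsum_eq_iSup_nat]
  refine iSup_le fun T => ?_
  have h1 : ∀ t ∈ range T, (if ε < X.M.optValue (X.h t) -
      X.M.value (X.alg.policyAt X.M X.h t) (X.h t) then (1 : ℝ≥0∞) else 0) ≤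
      ENNReal.ofReal (2 / ε * X.pseudoRegret ε (X.mem t) (X.h t)) := fun t _ => by
    split_ifs with h
    · rw [← ENNReal.ofReal_one]
      apply ENNReal.ofReal_le_ofReal
      have h2 := hX.optValue_sub_value_le hε.le t (X.h t)
      have h3 : ε < X.M.optValue (X.h t) - X.M.value (X.policy t) (X.h t) := h
      rw [div_mul_eq_mul_div, le_div_iff₀ hε]
      linarith
    · exact zero_le
  have h4 : ∀ t ∈ range T, 0 ≤ 2 / ε * X.pseudoRegret ε (X.mem t) (X.h t) := fun t _ =>
    mul_nonneg (by positivity) (pseudoRegret_nonneg _ _)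
  refine le_trans (le_of_eq ?_) ((sum_le_sum h1).trans ?_)
  · exact sum_congr rfl fun t _ => by congr
  · rw [← ENNReal.ofReal_sum_of_nonneg h4, ← mul_sum]
    apply ENNReal.ofReal_le_ofReal
    rw [mul_comm 2 C, mul_div_assoc, mul_comm C]
    exact mul_le_mul_of_nonneg_left (hC T) (by positivity)

end Run

end UCBMultiStageAdvantage

/-! ### The probability of the good event -/

namespace UCBMultiStageAdvantage

namespace Run

variable {S A : Type*} [Fintype S] [Fintype A] (X : Run S A)

/-- The run with the same algorithm along another state sequence. -/
noncomputable def withPath (h : ℕ → S) : Run S A := { X with h := h }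

variable [DecidableEq S]

/-- The test functions that belong to the stages numbered `j` of the pair `x`. -/
noncomputable def stageTests (x : S × A) (j : ℕ) : Fin 7 → (Register S A → ℝ) → S → S → ℝ :=
  ![X.test x (X.startII j) (X.startII (j + 1)) X.optFun,
    X.test x (X.startI j) (X.startI (j + 1)) X.advFun,
    X.test x (X.startI j) (X.startI (j + 1)) fun m s' => X.advFun m s' ^ 2,
    X.test x 0 (X.startI (j + 1)) X.refFun,
    X.test x 0 (X.startI (j + 1)) fun m s' => X.refFun m s' ^ 2,
    X.test x 0 (X.startI (j + 1)) X.unsettledFun,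
    X.test x 0 (X.startI (j + 1)) (X.varFun x)]

theorem stageTests_mem (x : S × A) (j : ℕ) (k : Fin 7) (m s s') :
    0 ≤ X.stageTests x j k m s s' ∧ X.stageTests x j k m s s' ≤ 1 := by
  obtain ⟨lo, hi, f, h⟩ : ∃ lo hi f, X.stageTests x j k = X.test x lo hi f := by
    fin_cases k <;> exact ⟨_, _, _, rfl⟩
  rw [h]
  exact ⟨X.test_nonneg _ _ _ _ _ _ _, X.test_le_one _ _ _ _ _ _ _⟩

variable {X} {Ω : Type*} [MeasurableSpace Ω] {μ : MeasureTheory.Measure Ω}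
  [MeasureTheory.IsProbabilityMeasure μ] {s : ℕ → Ω → S} {U : ℕ} {β ε : ℝ}

omit [DecidableEq S] in
theorem measure_not_concentrated_le (hs : X.alg.IsTrajectory X.M μ s)
    {ψ : (Register S A → ℝ) → S → S → ℝ} (hψ : ∀ m s s', 0 ≤ ψ m s s' ∧ ψ m s s' ≤ 1) :
    μ {ω | ¬ (X.withPath fun t => s t ω).Concentrated U ψ} ≤
      U * (2 * ENNReal.ofReal (Real.exp (-(X.p.ι / 4)))) := by
  have h1 : {ω | ¬ (X.withPath fun t => s t ω).Concentrated U ψ} ⊆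
      ⋃ m ∈ Icc 1 U, {ω | ∃ t, X.alg.quadVar X.M ψ (fun t => s t ω) t / m + m * (X.p.ι / 4) <
        |X.alg.deviation X.M ψ (fun t => s t ω) t|} := by
    intro ω hω
    simp only [Concentrated, Set.mem_ofPred_eq, not_forall, not_le] at hω
    obtain ⟨m, hm1, hm2, t, ht⟩ := hω
    simp only [Set.mem_iUnion, mem_Icc]
    exact ⟨m, ⟨hm1, hm2⟩, t, ht⟩
  refine (MeasureTheory.measure_mono h1).trans
    ((MeasureTheory.measure_biUnion_finset_le _ _).trans ?_)
  refine (sum_le_sum fun m hm => hs.measure_abs_deviation (ψ := ψ) (fun m s s' => (hψ m s s').1)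
    (fun m s s' => (hψ m s s').2) (mem_Icc.1 hm).1 (X.p.ι / 4)).trans ?_
  rw [sum_const, nsmul_eq_mul, Nat.card_Icc, Nat.add_sub_cancel]

/-- With high probability, all the deviations obey Freedman's inequality. -/
theorem measure_not_good_le (hs : X.alg.IsTrajectory X.M μ s) (hι : 0 < X.p.ι)
    (hU : 3 * X.p.N₀ ≤ X.p.ι / 4 * ((U : ℝ) - 1) ^ 2) (hHN : (X.p.H : ℝ) ≤ X.p.N₀)
    (hRH : X.R ≤ X.p.H) (hNU : X.p.N₀ < U) (hsize : 1 ≤ X.size) :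
    μ {ω | ¬ (X.withPath fun t => s t ω).Good U β ε} ≤
      ENNReal.ofReal (18 * X.size * (U : ℝ) ^ 2 * Real.exp (-(X.p.ι / 4))) := by
  have hU1 : 1 ≤ U := by
    have : (0 : ℝ) < U := (Nat.cast_nonneg X.p.H).trans_lt (hHN.trans_lt hNU)
    exact_mod_cast this
  have hjU : ∀ e : ℕ → ℕ, (∀ j, 0 < e j) → ∀ j, (stageStart e j : ℝ) ≤ X.p.N₀ → j < U :=
    fun e he j hj => by
      have h1 : (j : ℝ) ≤ stageStart e j := by exact_mod_cast le_stageStart he j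
      exact_mod_cast (h1.trans hj).trans_lt hNU
  have h1 : {ω | ¬ (X.withPath fun t => s t ω).Good U β ε} ⊆
      (⋃ x ∈ (univ : Finset (S × A)), ⋃ j ∈ range U, ⋃ k ∈ (univ : Finset (Fin 7)),
        {ω | ¬ (X.withPath fun t => s t ω).Concentrated U (X.stageTests x j k)}) ∪
      ({ω | ¬ (X.withPath fun t => s t ω).Concentrated U (X.gapTest β)} ∪
        {ω | ¬ (X.withPath fun t => s t ω).Concentrated U (X.regretTest ε)}) := by
    intro ω hω
    by_contra hcon
    simp only [Set.mem_union, Set.mem_iUnion, Set.mem_ofPred_eq, mem_univ, mem_range, not_or,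
      not_exists, not_not, exists_prop, true_and, not_and] at hcon
    obtain ⟨h1, h2, h3⟩ := hcon
    exact hω
      { ι_pos := hι
        one_le_U := hU1
        U_large := hU
        H_le_N₀ := hHN
        R_le_H := hRH
        opt := fun x j hj => h1 x j (hjU _ X.sizeII_pos j hj) 0
        adv := fun x j hj => h1 x j (hjU _ X.sizeI_pos j hj) 1
        advSq := fun x j hj => h1 x j (hjU _ X.sizeI_pos j hj) 2
        ref := fun x j hj => h1 x j (hjU _ X.sizeI_pos j hj) 3
        refSq := fun x j hj => h1 x j (hjU _ X.sizeI_pos j hj) 4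
        unsettled := fun x j hj => h1 x j (hjU _ X.sizeI_pos j hj) 5
        var := fun x j hj => h1 x j (hjU _ X.sizeI_pos j hj) 6
        gap := h2
        regret := h3 }
  set c := (U : ℝ≥0∞) * (2 * ENNReal.ofReal (Real.exp (-(X.p.ι / 4)))) with hc
  have h2 : μ (⋃ x ∈ (univ : Finset (S × A)), ⋃ j ∈ range U, ⋃ k ∈ (univ : Finset (Fin 7)),
      {ω | ¬ (X.withPath fun t => s t ω).Concentrated U (X.stageTests x j k)}) ≤
      Fintype.card (S × A) * (U * (7 * c)) := by
    refine (MeasureTheory.measure_biUnion_finset_le _ _).trans ?_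
    refine (sum_le_card_nsmul _ _ (U * (7 * c)) fun x _ => ?_).trans_eq
      (by rw [nsmul_eq_mul, card_univ])
    refine (MeasureTheory.measure_biUnion_finset_le _ _).trans ?_
    refine (sum_le_card_nsmul _ _ (7 * c) fun j _ => ?_).trans_eq
      (by rw [nsmul_eq_mul, card_range])
    refine (MeasureTheory.measure_biUnion_finset_le _ _).trans ?_
    refine (sum_le_card_nsmul _ _ c fun k _ => ?_).trans_eq
      (by rw [nsmul_eq_mul, card_univ, Fintype.card_fin]; norm_num)
    exact measure_not_concentrated_le hs (X.stageTests_mem x j k)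
  have h3 : μ {ω | ¬ (X.withPath fun t => s t ω).Concentrated U (X.gapTest β)} ≤ c :=
    measure_not_concentrated_le hs fun m s s' => ⟨unit_nonneg _, unit_le_one _⟩
  have h4 : μ {ω | ¬ (X.withPath fun t => s t ω).Concentrated U (X.regretTest ε)} ≤ c :=
    measure_not_concentrated_le hs fun m s s' => ⟨unit_nonneg _, unit_le_one _⟩
  refine (MeasureTheory.measure_mono h1).trans ((MeasureTheory.measure_union_le _ _).trans
    ((add_le_add h2 ((MeasureTheory.measure_union_le _ _).trans (add_le_add h3 h4))).trans ?_))
  obtain ⟨r, hr⟩ : ∃ r : ℝ, r = U * (2 * Real.exp (-(X.p.ι / 4))) := ⟨_, rfl⟩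
  have hc' : c = ENNReal.ofReal r := by
    rw [hc, hr, ENNReal.ofReal_mul (by positivity), ENNReal.ofReal_natCast,
      ENNReal.ofReal_mul (by norm_num), ENNReal.ofReal_ofNat]
  clear_value c
  have hr0 : 0 ≤ r := by rw [hr]; positivity
  have h5 : (Fintype.card (S × A) : ℝ≥0∞) * (U * (7 * c)) + (c + c) =
      ENNReal.ofReal (Fintype.card (S × A) * (U * (7 * r)) + (r + r)) := by
    rw [hc', ENNReal.ofReal_add (by positivity) (by positivity), ENNReal.ofReal_add hr0 hr0,
      ENNReal.ofReal_mul (Nat.cast_nonneg _), ENNReal.ofReal_mul (Nat.cast_nonneg U),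
      ENNReal.ofReal_mul (by norm_num : (0 : ℝ) ≤ 7), ENNReal.ofReal_natCast,
      ENNReal.ofReal_natCast, ENNReal.ofReal_ofNat]
  rw [h5, ← size_eq]
  apply ENNReal.ofReal_le_ofReal
  have hU1' : (1 : ℝ) ≤ U := by exact_mod_cast hU1
  have h6 : r ≤ X.size * (U * r) := by
    have := mul_le_mul_of_nonneg_right (one_le_mul_of_one_le_of_one_le hsize hU1') hr0
    linarith
  have e : 18 * X.size * (U : ℝ) ^ 2 * Real.exp (-(X.p.ι / 4)) = 9 * (X.size * (U * r)) := by
    rw [hr]; ring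
  rw [e]
  linarith

end Run

end UCBMultiStageAdvantage

/-! ### The choice of the constants -/

namespace UCBMultiStageAdvantage

namespace Run

variable {S A : Type*} [Fintype S] [Fintype A] {X : Run S A}

theorem H_one_le : (1 : ℝ) ≤ X.p.H := by exact_mod_cast (by linarith [X.two_le_H] : 1 ≤ X.p.H)

theorem R_pow_mul_H_pow_le (hRH : X.R ≤ X.p.H) {a b : ℕ} (n : ℕ) (hab : a + b ≤ n) :
    X.R ^ a * (X.p.H : ℝ) ^ b ≤ (X.p.H : ℝ) ^ n := by
  have hH := H_one_le (X := X)
  have hR := X.R_pos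
  calc X.R ^ a * (X.p.H : ℝ) ^ b ≤ (X.p.H : ℝ) ^ a * (X.p.H : ℝ) ^ b := by gcongr
    _ = (X.p.H : ℝ) ^ (a + b) := (pow_add _ _ _).symm
    _ ≤ _ := pow_le_pow_right₀ hH hab

theorem coeffK_sq (hι : 0 ≤ X.p.ι) :
    X.coeffK ^ 2 = 1296 * X.R ^ 2 * ((X.p.H : ℝ) ^ 3 * X.p.ι * X.size) := by
  have : 0 ≤ X.size := by unfold size; positivity
  unfold coeffK
  rw [mul_pow, Real.sq_sqrt (by positivity)]
  ring

/-- The number of inaccurate estimates, at the scale of the reference values. -/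
theorem countBound_ref_le (hι : 1 ≤ X.p.ι) (hRH : X.R ≤ X.p.H) (hsize : 1 ≤ X.size) :
    X.countBound (1 / √((X.p.H : ℝ) ^ 3)) ≤ 6000 * X.size * (X.p.H : ℝ) ^ 8 * X.p.ι := by
  have hH := H_one_le (X := X)
  have hR := X.R_pos
  unfold countBound
  rw [coeffK_sq (by linarith), div_pow, Real.sq_sqrt (by positivity), one_pow]
  unfold coeffK'
  have hs : √((X.p.H : ℝ) ^ 3) ≤ (X.p.H : ℝ) ^ 2 := by
    rw [Real.sqrt_le_left (by positivity), ← pow_mul]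
    exact pow_le_pow_right₀ hH (by norm_num)
  have h1 : X.R ^ 2 * (X.p.H : ℝ) ^ 6 ≤ (X.p.H : ℝ) ^ 8 := R_pow_mul_H_pow_le hRH 8 (by norm_num)
  have h2 : X.R ^ 3 * (X.p.H : ℝ) ^ 3 ≤ (X.p.H : ℝ) ^ 8 := R_pow_mul_H_pow_le hRH 8 (by norm_num)
  have h3 : 1 ≤ (X.p.H : ℝ) ^ 8 := one_le_pow₀ hH
  set T := X.size * (X.p.H : ℝ) ^ 8 * X.p.ι with hT
  have hT1 : 1 ≤ T := one_le_mul_of_one_le_of_one_le (one_le_mul_of_one_le_of_one_le hsize h3) hι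
  have e1 : 4 * (1296 * X.R ^ 2 * ((X.p.H : ℝ) ^ 3 * X.p.ι * X.size)) / (1 / (X.p.H : ℝ) ^ 3) ≤
      5184 * T := by
    calc _ = 5184 * (X.size * (X.R ^ 2 * (X.p.H : ℝ) ^ 6) * X.p.ι) := by field_simp; ring
      _ ≤ 5184 * T := by rw [hT]; gcongr
  have e2 : 2 * (4 * X.size * X.p.H * X.R ^ 3) / (1 / √((X.p.H : ℝ) ^ 3)) ≤ 8 * T := by
    calc _ = 8 * X.size * X.p.H * X.R ^ 3 * √((X.p.H : ℝ) ^ 3) := by field_simp; ring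
      _ ≤ 8 * X.size * X.p.H * X.R ^ 3 * (X.p.H : ℝ) ^ 2 := by gcongr
      _ = 8 * (X.size * (X.R ^ 3 * (X.p.H : ℝ) ^ 3) * 1) := by ring
      _ ≤ 8 * T := by rw [hT]; gcongr
  have e3 : 6000 * X.size * (X.p.H : ℝ) ^ 8 * X.p.ι = 6000 * T := by rw [hT]; ring
  rw [e3]
  linarith

/-- The number of inaccurate estimates, at the scale of the clipping threshold. -/
theorem countBound_threshold_le (hι : 1 ≤ X.p.ι) (hRH : X.R ≤ X.p.H) (hsize : 1 ≤ X.size) {ε : ℝ}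
    (hε : 0 < ε) (hε1 : ε ≤ 1) :
    X.countBound (ε / (8 * X.R)) ≤ 400000 * X.size * (X.p.H : ℝ) ^ 7 * X.p.ι / ε ^ 2 := by
  have hH := H_one_le (X := X)
  have hR := X.R_pos
  unfold countBound
  rw [coeffK_sq (by linarith)]
  unfold coeffK'
  have h1 : X.R ^ 4 * (X.p.H : ℝ) ^ 3 ≤ (X.p.H : ℝ) ^ 7 := R_pow_mul_H_pow_le hRH 7 (by norm_num)
  have h2 : X.R ^ 4 * (X.p.H : ℝ) ^ 1 ≤ (X.p.H : ℝ) ^ 7 := R_pow_mul_H_pow_le hRH 7 (by norm_num)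
  have h3 : 1 ≤ (X.p.H : ℝ) ^ 7 := one_le_pow₀ hH
  set T := X.size * (X.p.H : ℝ) ^ 7 * X.p.ι with hT
  have hT1 : 1 ≤ T := one_le_mul_of_one_le_of_one_le (one_le_mul_of_one_le_of_one_le hsize h3) hι
  have hε2 : ε ^ 2 ≤ 1 := pow_le_one₀ hε.le hε1
  rw [le_div_iff₀ (by positivity)]
  have e : (4 * (1296 * X.R ^ 2 * ((X.p.H : ℝ) ^ 3 * X.p.ι * X.size)) / (ε / (8 * X.R)) ^ 2 +
      2 * (4 * X.size * X.p.H * X.R ^ 3) / (ε / (8 * X.R)) + 1) * ε ^ 2 =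
      331776 * (X.size * (X.R ^ 4 * (X.p.H : ℝ) ^ 3) * X.p.ι) +
        64 * (X.size * (X.R ^ 4 * (X.p.H : ℝ) ^ 1) * ε) + ε ^ 2 := by
    field_simp; ring
  rw [e]
  have e1 : X.size * (X.R ^ 4 * (X.p.H : ℝ) ^ 3) * X.p.ι ≤ T := by rw [hT]; gcongr
  have e2 : X.size * (X.R ^ 4 * (X.p.H : ℝ) ^ 1) * ε ≤ T := by
    rw [hT]; gcongr; linarith
  have e3 : 400000 * X.size * (X.p.H : ℝ) ^ 7 * X.p.ι = 400000 * T := by rw [hT]; ring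
  rw [e3]
  linarith

/-- The terms of lower order in the bound for the sample complexity. -/
theorem lower_order_le (hι : 1 ≤ X.p.ι) (hRH : X.R ≤ X.p.H) (hS : 1 ≤ Fintype.card S)
    (hA : 1 ≤ Fintype.card A) (hB : X.p.B = X.p.H ^ 3) {l β : ℝ} (hl : 1 ≤ l) (hβ : β ≤ 1)
    (hN₁ : (X.p.N₁ : ℝ) ≤ 6000 * X.size * (X.p.H : ℝ) ^ 8 * l * X.p.ι + 1)
    (hN₀ : Real.log X.p.N₀ ≤ X.p.ι) :
    X.size * (X.R * X.burnIn + X.p.H * X.R) +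
      1 / (X.p.H * X.p.B) * (4 * X.coeffK' + β + 2 * Fintype.card S * X.R + X.R * X.p.ι) +
      X.R ^ 2 * (1 + X.updateBound) + X.R ^ 3 * X.p.ι ≤
    300000000000000 * (X.size ^ 5 * (X.p.H : ℝ) ^ 36 * l ^ 2 * X.p.ι) := by
  have hH := H_one_le (X := X)
  have hR := X.R_pos
  have hR1 := X.one_le_R
  have hS' : (1 : ℝ) ≤ Fintype.card S := by exact_mod_cast hS
  have hA' : (1 : ℝ) ≤ Fintype.card A := by exact_mod_cast hA
  have hsize : 1 ≤ X.size := one_le_mul_of_one_le_of_one_le hS' hA'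
  have hSs : (Fintype.card S : ℝ) ≤ X.size := le_mul_of_one_le_right (by positivity) hA'
  have hB' : (X.p.B : ℝ) = (X.p.H : ℝ) ^ 3 := by exact_mod_cast hB
  have hι0 : 0 < X.p.ι := by linarith
  set σ := X.size with hσ
  set H : ℝ := (X.p.H : ℝ) with hHdef
  set ι := X.p.ι with hιdef
  set T := σ ^ 5 * H ^ 36 * l ^ 2 * ι with hT
  have hmono : ∀ a b c e : ℕ, a ≤ 5 → b ≤ 36 → c ≤ 2 → e ≤ 1 → σ ^ a * H ^ b * l ^ c * ι ^ e ≤ T :=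
    fun a b c e h1 h2 h3 h4 => by
      have g1 := pow_le_pow_right₀ hsize h1
      have g2 := pow_le_pow_right₀ hH h2
      have g3 := pow_le_pow_right₀ hl h3
      have g4 := pow_le_pow_right₀ hι h4
      rw [pow_one] at g4
      rw [hT]
      gcongr
  have hone : ∀ n : ℕ, 1 ≤ H ^ n := fun n => one_le_pow₀ hH
  -- the unsettled states
  have hW : 1 + X.unsettledBound / ι ≤ 6003 * (σ ^ 2 * H ^ 8 * l) := by
    have h1 : X.unsettledBound ≤ 6002 * (σ ^ 2 * H ^ 8 * l) * ι := by
      unfold unsettledBound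
      have h2 : 1 ≤ σ * H ^ 8 * l * ι := one_le_mul_of_one_le_of_one_le
        (one_le_mul_of_one_le_of_one_le (one_le_mul_of_one_le_of_one_le hsize (hone 8)) hl) hι
      calc (Fintype.card S : ℝ) * ((X.p.N₁ : ℝ) + 1) ≤ σ * (6002 * (σ * H ^ 8 * l * ι)) := by
            gcongr; linarith
        _ = _ := by ring
    have h2 : X.unsettledBound / ι ≤ 6002 * (σ ^ 2 * H ^ 8 * l) := (div_le_iff₀ hι0).2 h1
    have h3 : 1 ≤ σ ^ 2 * H ^ 8 * l := one_le_mul_of_one_le_of_one_le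
      (one_le_mul_of_one_le_of_one_le (one_le_pow₀ hsize) (hone 8)) hl
    linarith
  have hWnn : 0 ≤ X.unsettledBound := unsettledBound_nonneg
  have t1 : σ * (X.R * X.burnIn) ≤ 200000000000000 * T := by
    have h1 : X.burnIn ≤ 5000000 * H ^ 7 * (H ^ 3) ^ 3 * H ^ 2 *
        (6003 * (σ ^ 2 * H ^ 8 * l)) ^ 2 * ι + H + 1 := by
      unfold burnIn
      rw [hB', ← hHdef, ← hιdef]
      gcongr
    have h2 : σ * (X.R * X.burnIn) ≤ σ * (H * (5000000 * H ^ 7 * (H ^ 3) ^ 3 * H ^ 2 *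
        (6003 * (σ ^ 2 * H ^ 8 * l)) ^ 2 * ι + H + 1)) := by
      have : 0 ≤ X.burnIn := by unfold burnIn; positivity
      gcongr
    have e : σ * (H * (5000000 * H ^ 7 * (H ^ 3) ^ 3 * H ^ 2 *
        (6003 * (σ ^ 2 * H ^ 8 * l)) ^ 2 * ι + H + 1)) =
        180180045000000 * (σ ^ 5 * H ^ 35 * l ^ 2 * ι ^ 1) + σ ^ 1 * H ^ 2 * l ^ 0 * ι ^ 0 +
          σ ^ 1 * H ^ 1 * l ^ 0 * ι ^ 0 := by ring
    rw [e] at h2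
    have h3 := hmono 5 35 2 1 (by norm_num) (by norm_num) (by norm_num) (by norm_num)
    have h4 := hmono 1 2 0 0 (by norm_num) (by norm_num) (by norm_num) (by norm_num)
    have h5 := hmono 1 1 0 0 (by norm_num) (by norm_num) (by norm_num) (by norm_num)
    have h6 := hmono 0 0 0 0 (by norm_num) (by norm_num) (by norm_num) (by norm_num)
    simp only [pow_zero, mul_one] at h6
    linarith
  have hT1 : 1 ≤ T := by
    have h6 := hmono 0 0 0 0 (by norm_num) (by norm_num) (by norm_num) (by norm_num)
    simpa using h6
  have t2 : σ * (H * X.R) ≤ T := by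
    refine le_trans ?_ (hmono 1 2 0 0 (by norm_num) (by norm_num) (by norm_num) (by norm_num))
    rw [pow_one, pow_zero, pow_zero, mul_one, mul_one, sq]
    gcongr
  have t3 : 1 / (H * X.p.B) * (4 * X.coeffK' + β + 2 * Fintype.card S * X.R + X.R * ι) ≤ 20 * T := by
    have h1 : 1 / (H * (X.p.B : ℝ)) ≤ 1 := by
      rw [hB', div_le_one (by positivity)]
      exact one_le_mul_of_one_le_of_one_le hH (hone 3)
    have h2 : 4 * X.coeffK' ≤ 16 * T := by
      unfold coeffK'
      have h3 : σ * H * X.R ^ 3 ≤ T := by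
        refine le_trans ?_ (hmono 1 4 0 0 (by norm_num) (by norm_num) (by norm_num) (by norm_num))
        calc σ * H * X.R ^ 3 ≤ σ * H * H ^ 3 := by gcongr
          _ = _ := by ring
      calc 4 * (4 * σ * H * X.R ^ 3) = 16 * (σ * H * X.R ^ 3) := by ring
        _ ≤ _ := by linarith
    have h3 : (Fintype.card S : ℝ) * X.R ≤ T := by
      refine le_trans ?_ (hmono 1 1 0 0 (by norm_num) (by norm_num) (by norm_num) (by norm_num))
      rw [pow_one, pow_one, pow_zero, pow_zero, mul_one, mul_one]
      gcongr
    have h4 : X.R * ι ≤ T := by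
      refine le_trans ?_ (hmono 0 1 0 1 (by norm_num) (by norm_num) (by norm_num) (by norm_num))
      rw [pow_zero, pow_one, pow_zero, pow_one, one_mul, mul_one]
      gcongr
    calc _ ≤ 1 / (H * (X.p.B : ℝ)) * (20 * T) := by gcongr; linarith
      _ ≤ 1 * (20 * T) := by gcongr
      _ = _ := one_mul _
  have t4 : X.R ^ 2 * (1 + X.updateBound) ≤ 12 * T := by
    have h1 : X.updateBound ≤ 2 * σ * (H ^ 3 * (3 * H * ι + 1) + 1) := by
      unfold updateBound
      rw [hB', ← hHdef, ← hσ]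
      gcongr
    have h2 : X.R ^ 2 * (1 + X.updateBound) ≤
        H ^ 2 * (1 + 2 * σ * (H ^ 3 * (3 * H * ι + 1) + 1)) := by
      calc _ ≤ X.R ^ 2 * (1 + 2 * σ * (H ^ 3 * (3 * H * ι + 1) + 1)) := by gcongr
        _ ≤ _ := by gcongr
    have e : H ^ 2 * (1 + 2 * σ * (H ^ 3 * (3 * H * ι + 1) + 1)) =
        σ ^ 0 * H ^ 2 * l ^ 0 * ι ^ 0 + 6 * (σ ^ 1 * H ^ 6 * l ^ 0 * ι ^ 1) +
          2 * (σ ^ 1 * H ^ 5 * l ^ 0 * ι ^ 0) + 2 * (σ ^ 1 * H ^ 2 * l ^ 0 * ι ^ 0) := by ring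
    rw [e] at h2
    have h3 := hmono 0 2 0 0 (by norm_num) (by norm_num) (by norm_num) (by norm_num)
    have h4 := hmono 1 6 0 1 (by norm_num) (by norm_num) (by norm_num) (by norm_num)
    have h5 := hmono 1 5 0 0 (by norm_num) (by norm_num) (by norm_num) (by norm_num)
    have h6 := hmono 1 2 0 0 (by norm_num) (by norm_num) (by norm_num) (by norm_num)
    linarith
  have t5 : X.R ^ 3 * ι ≤ T := by
    refine le_trans ?_ (hmono 0 3 0 1 (by norm_num) (by norm_num) (by norm_num) (by norm_num))
    rw [pow_zero, one_mul, pow_zero, mul_one, pow_one]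
    gcongr
  rw [mul_add]
  linarith

variable [DecidableEq S] [Nonempty A] {U : ℕ} {ε : ℝ}

/-- The sample complexity on the good event. The variance of the optimal value contributes the
leading term, all other contributions are dominated by it when `ε` is small. -/
theorem Good.sampleComplexity_le_of_small (hX : X.Good U (ε / (8 * X.R)) ε) (hU : 3 * X.R ≤ U)
    (hι : 1 ≤ X.p.ι) (hB : X.p.B = X.p.H ^ 3) (hε : 0 < ε) (hε1 : ε ≤ 1) {l : ℝ} (hl : 1 ≤ l)
    (hN₁ : (X.p.N₁ : ℝ) ≤ 6000 * X.size * (X.p.H : ℝ) ^ 8 * l * X.p.ι + 1)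
    (hN₀ : Real.log X.p.N₀ ≤ X.p.ι) (hS : 1 ≤ Fintype.card S)
    (hb0 : X.countBound (1 / √((X.p.H : ℝ) ^ 3)) ≤ X.p.N₀)
    (hb1 : X.countBound (1 / √((X.p.H : ℝ) ^ 3)) ≤ X.p.N₁)
    (hβN : X.countBound (ε / (8 * X.R)) ≤ X.p.N₀)
    (hsmall : ε * (300000000000000 * (X.size ^ 5 * (X.p.H : ℝ) ^ 36 * l ^ 2)) ≤ 1) :
    X.alg.sampleComplexity X.M ε X.h ≤
      ENNReal.ofReal (705318 * (X.size * X.p.H * X.R ^ 2 * X.p.ι) / ε ^ 2) := by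
  have hH := H_one_le (X := X)
  have hR := X.R_pos
  have hR1 := X.one_le_R
  have hRH := hX.R_le_H
  have hA : 1 ≤ Fintype.card A := Fintype.card_pos
  have hsize : 1 ≤ X.size := one_le_mul_of_one_le_of_one_le (by exact_mod_cast hS)
    (by exact_mod_cast hA)
  have hB' : (X.p.B : ℝ) = (X.p.H : ℝ) ^ 3 := by exact_mod_cast hB
  have hβ0 : 0 < ε / (8 * X.R) := by positivity
  have hβ1 : ε / (8 * X.R) ≤ 1 := by rw [div_le_one (by positivity)]; linarith
  have hN1 : 1 ≤ X.p.N₀ := hH.trans hX.H_le_N₀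
  have hE := fun T => hX.sum_excess_le (b := 1 / √((X.p.H : ℝ) ^ 3))
    (by have : (2 : ℝ) ≤ U ∨ U < 2 := by
          rcases lt_or_ge U 2 with h | h
          · exact Or.inr h
          · exact Or.inl (by exact_mod_cast h)
        rcases this with h | h
        · exact_mod_cast h
        · have : (U : ℝ) ≤ 1 := by exact_mod_cast (by omega : U ≤ 1)
          linarith)
    (by positivity) hb0 hb1
    (by rw [div_pow, Real.sq_sqrt (by positivity), hB', one_pow, one_div,
          inv_mul_cancel₀ (by positivity)]) hβ0 hε
    (by
      have : 1 - X.M.γ = 1 / X.R := by rw [γ_eq_one_sub]; ring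
      rw [this, ← div_mul_eq_div_mul_one_div]) hβN T
  have hlow := lower_order_le hι hRH hS hA hB hl hβ1 hN₁ hN₀
  have hK : 1 / (X.p.H * X.p.B) * (5 * X.coeffK ^ 2 / (ε / (8 * X.R))) ≤
      51840 * (X.size * X.p.H * X.R * X.p.ι) / ε := by
    rw [coeffK_sq (by linarith), hB']
    have h1 : X.R ^ 2 ≤ (X.p.H : ℝ) * X.p.H := by rw [sq]; gcongr
    have e1 : 1 / ((X.p.H : ℝ) * (X.p.H : ℝ) ^ 3) *
        (5 * (1296 * X.R ^ 2 * ((X.p.H : ℝ) ^ 3 * X.p.ι * X.size)) / (ε / (8 * X.R))) =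
        51840 * (X.size * (X.R ^ 2 / X.p.H) * X.R * X.p.ι) / ε := by field_simp; ring
    rw [e1]
    have h2 : X.R ^ 2 / X.p.H ≤ X.p.H := by rw [div_le_iff₀ (by positivity)]; exact h1
    gcongr
  set M₀ := X.size * X.p.H * X.R * X.p.ι with hM₀
  have hM1 : X.p.ι ≤ M₀ := by
    rw [hM₀]
    exact le_mul_of_one_le_left (by linarith) (one_le_mul_of_one_le_of_one_le
      (one_le_mul_of_one_le_of_one_le hsize hH) hR1)
  have hlow' : 300000000000000 * (X.size ^ 5 * (X.p.H : ℝ) ^ 36 * l ^ 2 * X.p.ι) ≤ M₀ / ε := by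
    rw [le_div_iff₀ hε]
    have := mul_le_mul_of_nonneg_right hsmall (show 0 ≤ X.p.ι by linarith)
    linarith
  have hC : ∀ T, ∑ t ∈ range T, X.pseudoRegret ε (X.mem t) (X.h t) ≤
      3 * X.R * (117553 * M₀ / ε) := fun T => by
    refine (hX.sum_pseudoRegret_le hε.le hU hN1 T).trans ?_
    apply mul_le_mul_of_nonneg_left _ (by positivity)
    have h1 := hE T
    have e1 : X.size * (65712 * X.p.H * X.R * X.p.ι / ε) = 65712 * M₀ / ε := by
      rw [hM₀]; field_simp
    have e2 : 117553 * M₀ / ε = 65712 * M₀ / ε + 51840 * M₀ / ε + M₀ / ε := by ring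
    rw [e2]
    set w := 1 / ((X.p.H : ℝ) * X.p.B)
    set g := X.size
    have e3 : g * (X.R * X.burnIn + X.p.H * X.R + 65712 * X.p.H * X.R * X.p.ι / ε) =
        g * (X.R * X.burnIn + X.p.H * X.R) + g * (65712 * X.p.H * X.R * X.p.ι / ε) := by ring
    have e4 : w * (5 * X.coeffK ^ 2 / (ε / (8 * X.R)) + 4 * X.coeffK' + ε / (8 * X.R) +
        2 * Fintype.card S * X.R + X.R * X.p.ι) = w * (5 * X.coeffK ^ 2 / (ε / (8 * X.R))) +
        w * (4 * X.coeffK' + ε / (8 * X.R) + 2 * Fintype.card S * X.R + X.R * X.p.ι) := by ring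
    rw [e3, e4, e1] at h1
    linarith
  refine (hX.sampleComplexity_le hε hC).trans (le_of_eq ?_)
  congr 1
  rw [hM₀]
  field_simp
  ring

end Run

end UCBMultiStageAdvantage

namespace UCBMultiStageAdvantage

/-- The constant factor in the condition that `ε` is small. -/
noncomputable def smallConst : ℝ := (300000000000000 * 304 ^ 36 * 228 ^ 2) ^ 2

theorem le_smallConst : (1000000000000000000000 : ℝ) ≤ smallConst := by
  unfold smallConst; norm_num

theorem horizon_bounds {γ ε : ℝ} (hγ0 : 0 < γ) (hγ1 : γ < 1) (hε : 0 < ε) (hε8 : 8 * ε ≤ 1) :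
    1 / (1 - γ) ≤ horizon γ ε ∧ 2 ≤ horizon γ ε ∧
      (horizon γ ε : ℝ) ≤ 2 * (1 / (1 - γ)) * Real.log (8 * (1 / (1 - γ)) / ε) := by
  have h1 : 0 < 1 - γ := by linarith
  have hR1 : 1 < 1 / (1 - γ) := by rw [lt_div_iff₀ h1]; linarith
  set R := 1 / (1 - γ) with hR
  have hRH : R ≤ horizon γ ε := (le_max_right _ _).trans (Nat.le_ceil _)
  refine ⟨hRH, ?_, ?_⟩
  · have : (1 : ℝ) < horizon γ ε := hR1.trans_le hRH
    have : 1 < horizon γ ε := by exact_mod_cast this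
    omega
  · have hlog : 1 ≤ Real.log (8 * R / ε) := by
      rw [Real.le_log_iff_exp_le (by positivity), le_div_iff₀ hε]
      have := Real.exp_one_lt_d9
      nlinarith
    have hγlog : 1 - γ ≤ Real.log (1 / γ) := by
      rw [one_div, Real.log_inv]
      linarith [Real.log_le_sub_one_of_pos hγ0]
    have h2 : Real.log (8 / ((1 - γ) * ε)) / Real.log (1 / γ) ≤ R * Real.log (8 * R / ε) := by
      have e : 8 / ((1 - γ) * ε) = 8 * R / ε := by rw [hR]; field_simp
      rw [e, div_le_iff₀ (by linarith)]
      have h3 : 1 ≤ R * Real.log (1 / γ) := by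
        rw [hR, one_div_mul_eq_div, le_div_iff₀ h1]; linarith
      nlinarith
    have h3 : R ≤ R * Real.log (8 * R / ε) := le_mul_of_one_le_right (by linarith) hlog
    have h4 : (horizon γ ε : ℝ) < max (Real.log (8 / ((1 - γ) * ε)) / Real.log (1 / γ)) R + 1 :=
      Nat.ceil_lt_add_one (le_max_of_le_right (by linarith))
    have h5 := max_le h2 h3
    linarith

/-- Powers of `ε` beat the powers of the logarithm of `1 / ε` that enter through the horizon. -/
theorem bounds_of_small {σ R ε H : ℝ} (hσ : 1 ≤ σ) (hR : 1 ≤ R) (hε : 0 < ε)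
    (hsmall : ε * (smallConst * (σ * R) ^ 82) ≤ 1) (hRH : R ≤ H)
    (hH : H ≤ 2 * R * Real.log (8 * R / ε)) :
    ε * smallConst ≤ 1 ∧ 1 ≤ Real.log (σ * R / ε) ∧ H ≤ 4 * R * Real.log (σ * R / ε) ∧
      H ≤ 1 / ε ^ 2 ∧ 1 ≤ Real.log (4 * H / ε) ∧
      ε * (300000000000000 * (σ ^ 5 * H ^ 36 * Real.log (4 * H / ε) ^ 2)) ≤ 1 := by
  have hD := le_smallConst
  set y := σ * R with hy
  have hy1 : 1 ≤ y := one_le_mul_of_one_le_of_one_le hσ hR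
  have hyy : y ≤ y ^ 82 := le_self_pow₀ hy1 (by norm_num)
  have hDy : smallConst * y ≤ 1 / ε := by
    rw [le_div_iff₀ hε]
    have : smallConst * y ≤ smallConst * y ^ 82 := by gcongr
    nlinarith
  have hD1 : smallConst ≤ 1 / ε := by nlinarith
  set w := 1 / ε with hw
  have hw1 : 1 ≤ w := by linarith
  have hεw : ε * w = 1 := mul_one_div_cancel hε.ne'
  have hRy : R ≤ y := le_mul_of_one_le_left (by linarith) hσ
  have hσy : σ ≤ y := le_mul_of_one_le_right (by linarith) hR
  -- with the 76th root `z` of `1 / ε`, the 38 logarithmic factors amount to a multiple of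
  -- `z ^ 38 = √(1 / ε)`
  obtain ⟨z, hz0, hz⟩ : ∃ z : ℝ, 0 < z ∧ z ^ 76 = w :=
    ⟨w ^ (1 / 76 : ℝ), by positivity, by
      rw [← Real.rpow_natCast, ← Real.rpow_mul (by linarith)]; norm_num⟩
  have hz1 : 1 ≤ z := by
    by_contra! h
    have := pow_lt_one₀ hz0.le h (show 76 ≠ 0 by norm_num)
    linarith
  have hlogw : Real.log w ≤ 76 * z := by
    rw [← hz, Real.log_pow]
    push_cast
    have := Real.log_le_self hz0.le
    linarith
  have hzw : z ≤ w := by rw [← hz]; exact le_self_pow₀ hz1 (by norm_num)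
  have hdiv : ∀ a, a / ε = a * w := fun a => by rw [hw]; ring
  have h8R : Real.log (8 * R / ε) ≤ 2 * Real.log w := by
    rw [hdiv]
    have : 2 * Real.log w = Real.log (w ^ 2) := by rw [Real.log_pow]; norm_num
    rw [this]
    apply Real.log_le_log (by positivity)
    nlinarith
  have hHz : H ≤ 304 * y * z := by
    calc H ≤ 2 * R * (2 * (76 * z)) := hH.trans (by gcongr; linarith)
      _ = 304 * R * z := by ring
      _ ≤ _ := by gcongr
  have hy304 : 1216 * y ≤ w := by nlinarith
  have hHw : H ≤ w ^ 2 := by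
    calc H ≤ 304 * y * z := hHz
      _ ≤ w * w := by
        have : 304 * y ≤ w := by linarith
        gcongr
      _ = _ := (sq w).symm
  have h1H : 1 ≤ H := hR.trans hRH
  have h4H : Real.log (4 * H / ε) ≤ 228 * z := by
    rw [hdiv]
    have h1 : 4 * H * w ≤ w ^ 3 := by
      have : 4 * H ≤ w ^ 2 := by
        calc 4 * H ≤ 1216 * y * z := by linarith
          _ ≤ w * w := by gcongr
          _ = _ := (sq w).symm
      calc 4 * H * w ≤ w ^ 2 * w := by gcongr
        _ = _ := by ring
    have h2 := Real.log_le_log (by positivity) h1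
    rw [Real.log_pow] at h2
    push_cast at h2
    linarith
  have he1 := Real.exp_one_lt_d9
  have hlog4 : 1 ≤ Real.log (4 * H / ε) := by
    rw [Real.le_log_iff_exp_le (by positivity), hdiv]
    nlinarith
  refine ⟨?_, ?_, ?_, ?_, hlog4, ?_⟩
  · rw [← hεw]; gcongr
  · rw [Real.le_log_iff_exp_le (by positivity), hdiv]
    nlinarith
  · have h1 : Real.log (8 * R / ε) ≤ 2 * Real.log (y / ε) := by
      have : 2 * Real.log (y / ε) = Real.log ((y / ε) ^ 2) := by rw [Real.log_pow]; norm_num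
      rw [this]
      apply Real.log_le_log (by positivity)
      rw [hdiv, hdiv]
      have h2 : 8 * (y * w) ≤ (y * w) * (y * w) := by
        apply mul_le_mul_of_nonneg_right _ (by positivity)
        nlinarith
      have h3 : R * w ≤ y * w := by gcongr
      nlinarith
    calc H ≤ 2 * R * (2 * Real.log (y / ε)) := hH.trans (by gcongr)
      _ = _ := by ring
  · rw [hw, one_div_pow] at hHw; exact hHw
  · set K : ℝ := 300000000000000 * 304 ^ 36 * 228 ^ 2 with hK
    have h1 : 300000000000000 * (σ ^ 5 * H ^ 36 * Real.log (4 * H / ε) ^ 2) ≤ K * y ^ 41 * z ^ 38 := by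
      calc 300000000000000 * (σ ^ 5 * H ^ 36 * Real.log (4 * H / ε) ^ 2)
          ≤ 300000000000000 * (y ^ 5 * (304 * y * z) ^ 36 * (228 * z) ^ 2) := by gcongr
        _ = K * y ^ 41 * z ^ 38 := by rw [hK]; ring
    have h2 : K * y ^ 41 ≤ z ^ 38 := by
      have h3 : (K * y ^ 41) ^ 2 ≤ (z ^ 38) ^ 2 := by
        have e1 : (K * y ^ 41) ^ 2 = smallConst * y ^ 82 := by
          rw [hK]; unfold smallConst; ring
        have e2 : (z ^ 38) ^ 2 = w := by rw [← hz]; ring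
        rw [e1, e2, hw, le_div_iff₀ hε]
        linarith
      exact le_of_sq_le_sq h3 (by positivity)
    calc ε * (300000000000000 * (σ ^ 5 * H ^ 36 * Real.log (4 * H / ε) ^ 2)) ≤
        ε * (z ^ 38 * z ^ 38) := mul_le_mul_of_nonneg_left
          (h1.trans (mul_le_mul_of_nonneg_right h2 (by positivity))) hε.le
      _ = ε * z ^ 76 := by ring
      _ = 1 := by rw [hz, hεw]

/-- The logarithmic factor `ι` for the confidence parameter `(p ε (1 - γ) / (S A)) ^ 216`, in terms
of `G = S A / (p ε (1 - γ))`. -/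
theorem log_two_div_pow_eq {G : ℝ} (hG : 0 < G) :
    Real.log (2 / (1 / G) ^ 216) = Real.log 2 + 216 * Real.log G := by
  rw [one_div_pow, div_div_eq_mul_div, div_one, Real.log_mul (by norm_num) (by positivity),
    Real.log_pow]
  norm_num

theorem log_confidence_le {y ε p : ℝ} (hy : 0 < y) (hε : 0 < ε) (hp0 : 0 < p) (hp1 : p ≤ 1)
    (hL : 1 ≤ Real.log (y / ε)) :
    Real.log 2 + 216 * Real.log (y / (p * ε)) ≤ 649 * (Real.log (y / ε) * Real.log (2 / p)) := by
  have e1 : Real.log (y / (p * ε)) = Real.log (y / ε) - Real.log p := by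
    rw [← Real.log_div (by positivity) hp0.ne']; congr 1; field_simp
  have e2 : Real.log (2 / p) = Real.log 2 - Real.log p := Real.log_div (by norm_num) hp0.ne'
  have h1 := Real.log_nonpos hp0.le hp1
  have h2 := Real.log_two_gt_d9
  rw [e1, e2]
  set L := Real.log (y / ε)
  set a := Real.log 2
  set b := Real.log p
  nlinarith

theorem N₀_le {S A H ε ι G : ℝ} (hS : 1 ≤ S) (hA : 1 ≤ A) (hH : 1 ≤ H) (hε : 0 < ε) (hι0 : 0 ≤ ι)
    (hσ : S * A ≤ G) (hSε : S / ε ≤ G) (hεG : 1 / ε ≤ G) (hHG : H ≤ 1 / ε ^ 2)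
    (hι : ι ≤ 217 * G) :
    400000 * S ^ 3 * A * H ^ 7 * Real.log (4 * H ^ 2 * S / ε) * ι / ε ^ 2 ≤
      347200000 * G ^ 25 := by
  have hG0 : 0 ≤ G := le_trans (by positivity) hεG
  have h2 : 1 / ε ^ 2 ≤ G ^ 2 := by rw [← one_div_pow]; gcongr
  have hHG' : H ≤ G ^ 2 := hHG.trans h2
  have h3 : Real.log (4 * H ^ 2 * S / ε) ≤ 4 * G ^ 5 := by
    refine (Real.log_le_self (by positivity)).trans ?_
    calc 4 * H ^ 2 * S / ε = 4 * H ^ 2 * (S / ε) := by ring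
      _ ≤ 4 * (G ^ 2) ^ 2 * G := by gcongr
      _ = _ := by ring
  have h4 : S ^ 3 * A ≤ G ^ 3 := by
    calc S ^ 3 * A ≤ S ^ 3 * A ^ 3 := by gcongr; exact le_self_pow₀ hA (by norm_num)
      _ = (S * A) ^ 3 := by ring
      _ ≤ _ := by gcongr
  calc 400000 * S ^ 3 * A * H ^ 7 * Real.log (4 * H ^ 2 * S / ε) * ι / ε ^ 2
      = 400000 * (S ^ 3 * A) * H ^ 7 * Real.log (4 * H ^ 2 * S / ε) * ι * (1 / ε ^ 2) := by ring
    _ ≤ 400000 * (S ^ 3 * A) * H ^ 7 * (4 * G ^ 5) * ι * (1 / ε ^ 2) := by gcongr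
    _ ≤ 400000 * G ^ 3 * (G ^ 2) ^ 7 * (4 * G ^ 5) * (217 * G) * G ^ 2 := by gcongr
    _ = _ := by ring

/-- The failure probability in the union bound is at most `p`. -/
theorem failure_probability_le {σ G p N₀ U ι : ℝ} (hσ0 : 0 ≤ σ) (hσ : σ ≤ G)
    (hG : 1000000000000000000000 ≤ G) (hp : 1 / G ≤ p) (hU0 : 0 ≤ U)
    (hU : U ≤ 14 * N₀) (hN₀ : N₀ ≤ 347200000 * G ^ 25) (hι : ι = Real.log 2 + 216 * Real.log G) :
    18 * σ * U ^ 2 * Real.exp (-(ι / 4)) ≤ p := by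
  have hG0 : 0 < G := by linarith
  have h1 : Real.exp (-(ι / 4)) ≤ 1 / G ^ 54 := by
    have e : (1 : ℝ) / G ^ 54 = Real.exp (-(54 * Real.log G)) := by
      rw [Real.exp_neg, one_div, mul_comm, Real.exp_mul, Real.exp_log hG0]
      norm_cast
    rw [e]
    apply Real.exp_le_exp.2
    rw [hι]
    linarith [Real.log_two_gt_d9]
  have h2 : U ≤ 14 * (347200000 * G ^ 25) := by linarith
  refine le_trans ?_ hp
  calc 18 * σ * U ^ 2 * Real.exp (-(ι / 4))
      ≤ 18 * G * (14 * (347200000 * G ^ 25)) ^ 2 * (1 / G ^ 54) := by gcongr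
    _ = 18 * (14 * 347200000) ^ 2 * (1 / G ^ 2) * (1 / G) := by field_simp
    _ ≤ 1 * (1 / G) := by
        apply mul_le_mul_of_nonneg_right _ (by positivity)
        rw [mul_one_div, div_le_one (by positivity)]
        nlinarith
    _ = _ := one_mul _

theorem log_N₀_le {G N₀ ι : ℝ} (hG : 1000000000000000000000 ≤ G) (hN1 : 0 < N₀)
    (hN₀ : N₀ ≤ 347200000 * G ^ 25) (hι : ι = Real.log 2 + 216 * Real.log G) : Real.log N₀ ≤ ι := by
  have h1 : N₀ ≤ G ^ 26 := by
    refine hN₀.trans ?_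
    rw [pow_succ' G 25]
    gcongr
    linarith
  have h2 := Real.log_le_log hN1 h1
  rw [Real.log_pow] at h2
  push_cast at h2
  have h3 : 0 ≤ Real.log G := Real.log_nonneg (by linarith)
  rw [hι]
  linarith [Real.log_two_gt_d9]

theorem card_register_le {S A : Type*} [Fintype S] [Fintype A] (hA : 1 ≤ Fintype.card A) :
    Nat.card (Register S A) ≤ 11 * (Fintype.card S * Fintype.card A) := by
  let f : PairField → Fin 9 := fun
    | .Q => 0 | .visits => 1 | .visitsI => 2 | .visitsII => 3 | .advSum => 4
    | .advSqSum => 5 | .refSum => 6 | .refSqSum => 7 | .valueSum => 8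
  let g : StateField → Fin 2 := fun
    | .V => 0 | .Vref => 1
  have hf : Function.Injective f := fun a b h => by
    cases a <;> cases b <;> first | rfl | exact absurd h (by decide)
  have hg : Function.Injective g := fun a b h => by
    cases a <;> cases b <;> first | rfl | exact absurd h (by decide)
  have h1 := Nat.card_le_card_of_injective
    (Sum.map (Prod.map f (id : S × A → S × A)) (Prod.map g (id : S → S)))
    (Function.Injective.sumMap (hf.prodMap Function.injective_id) (hg.prodMap Function.injective_id))
  rw [Nat.card_eq_fintype_card (α := (Fin 9 × S × A) ⊕ (Fin 2 × S))] at h1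
  simp only [Fintype.card_sum, Fintype.card_prod, Fintype.card_fin] at h1
  refine h1.trans ?_
  nlinarith [Nat.zero_le (Fintype.card S)]

end UCBMultiStageAdvantage

/-! ### The sample complexity bound -/

namespace UCBMultiStageAdvantage

/-- The confidence parameter with which the algorithm is run to fail with probability at most `p`.
The exponent makes `exp (-ι / 4)` beat the polynomial number of events in the union bound. -/
noncomputable def confidence (nS nA : ℕ) (γ ε p : ℝ) : ℝ := (p * ε * (1 - γ) / (nS * nA)) ^ 216

theorem confidence_le {nS nA : ℕ} {γ ε p : ℝ} (hS : 1 ≤ nS) (hA : 1 ≤ nA) (hγ0 : 0 < γ)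
    (hγ1 : γ < 1) (hε0 : 0 < ε) (hε1 : ε < 1) (hp0 : 0 < p) (hp1 : p < 1) :
    confidence nS nA γ ε p ≤ p := by
  have hS' : (1 : ℝ) ≤ nS := by exact_mod_cast hS
  have hA' : (1 : ℝ) ≤ nA := by exact_mod_cast hA
  have h1 : 0 < 1 - γ := by linarith
  have hnn : 0 ≤ p * ε * (1 - γ) / (nS * nA) := by positivity
  have hle : p * ε * (1 - γ) / (nS * nA) ≤ p := by
    rw [div_le_iff₀ (by positivity)]
    have h2 : ε * (1 - γ) ≤ 1 := by nlinarith
    have h3 : (1 : ℝ) ≤ nS * nA := one_le_mul_of_one_le_of_one_le hS' hA'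
    calc p * ε * (1 - γ) = p * (ε * (1 - γ)) := by ring
      _ ≤ p * (nS * nA) := mul_le_mul_of_nonneg_left (h2.trans h3) hp0.le
  exact (pow_le_of_le_one hnn (hle.trans hp1.le) (by norm_num)).trans hle

namespace Run

variable {S A : Type*} [Fintype S] [DecidableEq S] [Fintype A] {X : Run S A}

/-- The sample complexity bound with high probability, under the conditions that the parameters
of the algorithm have to satisfy. -/
theorem one_sub_le_measure_sampleComplexity_le {Ω : Type*} [MeasurableSpace Ω]
    {μ : MeasureTheory.Measure Ω} [MeasureTheory.IsProbabilityMeasure μ] {s : ℕ → Ω → S}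
    (hs : X.alg.IsTrajectory X.M μ s) {ε p l : ℝ} (hε : 0 < ε) (hε1 : ε ≤ 1) (hp0 : 0 ≤ p)
    (hS : 1 ≤ Fintype.card S) (hA : 1 ≤ Fintype.card A) (hRH : X.R ≤ X.p.H) (hι : 1 ≤ X.p.ι)
    (hB : X.p.B = X.p.H ^ 3) (hHε : (X.p.H : ℝ) ≤ 1 / ε ^ 2) (hl : 1 ≤ l)
    (hN₀ : 400000 * X.size * (X.p.H : ℝ) ^ 7 * X.p.ι / ε ^ 2 ≤ X.p.N₀)
    (hN₀log : Real.log X.p.N₀ ≤ X.p.ι)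
    (hN₁ : 6000 * X.size * (X.p.H : ℝ) ^ 8 * l * X.p.ι ≤ X.p.N₁)
    (hN₁le : (X.p.N₁ : ℝ) ≤ 6000 * X.size * (X.p.H : ℝ) ^ 8 * l * X.p.ι + 1)
    (hsmall : ε * (300000000000000 * (X.size ^ 5 * (X.p.H : ℝ) ^ 36 * l ^ 2)) ≤ 1)
    (hfail : ∀ U : ℝ, 0 ≤ U → U ≤ 14 * X.p.N₀ →
      18 * X.size * U ^ 2 * Real.exp (-(X.p.ι / 4)) ≤ p) :
    ENNReal.ofReal (1 - p) ≤
      μ {ω | X.alg.sampleComplexity X.M ε (fun t => s t ω) ≤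
        ENNReal.ofReal (705318 * (X.size * X.p.H * X.R ^ 2 * X.p.ι) / ε ^ 2)} := by
  have hS' : (1 : ℝ) ≤ Fintype.card S := by exact_mod_cast hS
  have hA' : (1 : ℝ) ≤ Fintype.card A := by exact_mod_cast hA
  have : Nonempty A := Fintype.card_pos_iff.1 hA
  have hσ1 : 1 ≤ X.size := one_le_mul_of_one_le_of_one_le hS' hA'
  have hR1 := X.one_le_R
  have hH1 : (1 : ℝ) ≤ X.p.H := hR1.trans hRH
  have hι0 : 0 ≤ X.p.ι := by linarith
  have hβN : X.countBound (ε / (8 * X.R)) ≤ X.p.N₀ :=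
    (countBound_threshold_le hι hRH hσ1 hε hε1).trans hN₀
  have hbref := countBound_ref_le hι hRH hσ1
  have hb0 : X.countBound (1 / √((X.p.H : ℝ) ^ 3)) ≤ X.p.N₀ := by
    refine hbref.trans (le_trans ?_ hN₀)
    have h1 : 0 ≤ X.size * (X.p.H : ℝ) ^ 7 * X.p.ι := by positivity
    calc 6000 * X.size * (X.p.H : ℝ) ^ 8 * X.p.ι =
        6000 * (X.size * (X.p.H : ℝ) ^ 7 * X.p.ι) * X.p.H := by ring
      _ ≤ 400000 * (X.size * (X.p.H : ℝ) ^ 7 * X.p.ι) * (1 / ε ^ 2) :=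
          mul_le_mul (by linarith) hHε (by positivity) (by linarith)
      _ = _ := by ring
  have hb1 : X.countBound (1 / √((X.p.H : ℝ) ^ 3)) ≤ X.p.N₁ := by
    refine hbref.trans (le_trans ?_ hN₁)
    have h1 : 0 ≤ 6000 * X.size * (X.p.H : ℝ) ^ 8 * X.p.ι := by positivity
    have := le_mul_of_one_le_right h1 hl
    linarith
  have hHN₀ : (X.p.H : ℝ) ≤ X.p.N₀ := by
    refine le_trans ?_ hN₀
    rw [le_div_iff₀ (by positivity)]
    have h1 : ε ^ 2 ≤ 1 := pow_le_one₀ hε.le hε1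
    have h2 : 1 ≤ X.size * (X.p.H : ℝ) ^ 6 * X.p.ι := one_le_mul_of_one_le_of_one_le
      (one_le_mul_of_one_le_of_one_le hσ1 (one_le_pow₀ hH1)) hι
    calc (X.p.H : ℝ) * ε ^ 2 ≤ X.p.H * 1 := by gcongr
      _ ≤ X.p.H * (400000 * (X.size * (X.p.H : ℝ) ^ 6 * X.p.ι)) := by gcongr; linarith
      _ = _ := by ring
  have hN₀1 : 1 ≤ X.p.N₀ := hH1.trans hHN₀
  -- the range of the parameters in Freedman's inequality: it has to cover the optimal parameter for
  -- up to `3 * N₀` visits, and only enters the union bound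
  obtain ⟨U, hU⟩ : ∃ U : ℕ, U = ⌈12 * X.p.N₀⌉₊ + 1 := ⟨_, rfl⟩
  have hUcast : (U : ℝ) = ⌈12 * X.p.N₀⌉₊ + 1 := by rw [hU]; push_cast; ring
  have hU12 : 12 * X.p.N₀ ≤ (U : ℝ) - 1 := by
    rw [hUcast]; linarith [Nat.le_ceil (12 * X.p.N₀)]
  have hU14 : (U : ℝ) ≤ 14 * X.p.N₀ := by
    have := Nat.ceil_lt_add_one (show 0 ≤ 12 * X.p.N₀ by linarith)
    rw [hUcast]; linarith
  have hRU : 3 * X.R ≤ U := by linarith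
  have hUlarge : 3 * X.p.N₀ ≤ X.p.ι / 4 * ((U : ℝ) - 1) ^ 2 := by
    have h1 : (12 * X.p.N₀) ^ 2 ≤ ((U : ℝ) - 1) ^ 2 := pow_le_pow_left₀ (by linarith) hU12 2
    have h2 : 1 / 4 * (12 * X.p.N₀) ^ 2 ≤ X.p.ι / 4 * ((U : ℝ) - 1) ^ 2 :=
      mul_le_mul (by linarith) h1 (by positivity) (by linarith)
    have h3 := le_mul_of_one_le_right (by linarith : 0 ≤ X.p.N₀) hN₀1
    nlinarith only [h2, h3, hN₀1]
  have hbad := measure_not_good_le (X := X) (β := ε / (8 * X.R)) (ε := ε) (U := U) hs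
    (by linarith) hUlarge hHN₀ hRH (by linarith) hσ1
  have hbad' := hbad.trans (ENNReal.ofReal_le_ofReal (hfail U (Nat.cast_nonneg U) hU14))
  have hgood : ∀ ω, (X.withPath fun t => s t ω).Good U (ε / (8 * X.R)) ε →
      X.alg.sampleComplexity X.M ε (fun t => s t ω) ≤
        ENNReal.ofReal (705318 * (X.size * X.p.H * X.R ^ 2 * X.p.ι) / ε ^ 2) := fun ω hω =>
    Good.sampleComplexity_le_of_small (X := X.withPath fun t => s t ω) hω hRU hι hB hε hε1 hl
      hN₁le hN₀log hS hb0 hb1 hβN hsmall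
  have hsub : (Set.univ : Set Ω) ⊆
      {ω | X.alg.sampleComplexity X.M ε (fun t => s t ω) ≤
        ENNReal.ofReal (705318 * (X.size * X.p.H * X.R ^ 2 * X.p.ι) / ε ^ 2)} ∪
        {ω | ¬ (X.withPath fun t => s t ω).Good U (ε / (8 * X.R)) ε} := fun ω _ => by
    by_cases h : (X.withPath fun t => s t ω).Good U (ε / (8 * X.R)) ε
    · exact Or.inl (hgood ω h)
    · exact Or.inr h
  have h1 := (MeasureTheory.measure_mono hsub).trans (MeasureTheory.measure_union_le (μ := μ) _ _)
  rw [MeasureTheory.measure_univ] at h1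
  rw [ENNReal.ofReal_sub _ hp0, ENNReal.ofReal_one, tsub_le_iff_right]
  exact h1.trans (add_le_add le_rfl hbad')

end Run

/-- The base `G = nS * nA * R / (p * ε)` of the confidence parameter dominates all the problem
parameters. -/
theorem le_div_confidence_base {nS nA R ε p : ℝ} (hS : 1 ≤ nS) (hA : 1 ≤ nA) (hR : 1 ≤ R)
    (hε : 0 < ε) (hεc : ε * smallConst ≤ 1) (hp0 : 0 < p) (hp1 : p ≤ 1) :
    1 / ε ≤ nS * nA * R / (p * ε) ∧ 1000000000000000000000 ≤ nS * nA * R / (p * ε) ∧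
      nS * nA ≤ nS * nA * R / (p * ε) ∧ nS / ε ≤ nS * nA * R / (p * ε) ∧
      1 / (nS * nA * R / (p * ε)) ≤ p := by
  have hD := le_smallConst
  have hε1 : ε ≤ 1 := by nlinarith
  have hσ1 : 1 ≤ nS * nA := one_le_mul_of_one_le_of_one_le hS hA
  have hy1 : 1 ≤ nS * nA * R := one_le_mul_of_one_le_of_one_le hσ1 hR
  have hpε : p * ε ≤ ε := mul_le_of_le_one_left hε.le hp1
  have hεG : 1 / ε ≤ nS * nA * R / (p * ε) :=
    div_le_div₀ (by positivity) hy1 (by positivity) hpε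
  refine ⟨hεG, ?_, ?_, ?_, ?_⟩
  · refine (hD.trans ?_).trans hεG
    rw [le_div_iff₀ hε]; linarith
  · rw [le_div_iff₀ (by positivity)]
    have h2 : nS * nA ≤ nS * nA * R := le_mul_of_one_le_right (by positivity) hR
    exact (mul_le_of_le_one_right (by positivity) (hpε.trans hε1)).trans h2
  · exact div_le_div₀ (by positivity) ((le_mul_of_one_le_right (by positivity) hA).trans
      (le_mul_of_one_le_right (by positivity) hR)) (by positivity) hpε
  · rw [one_div_div, div_le_iff₀ (by positivity)]
    exact mul_le_mul_of_nonneg_left (hε1.trans hy1) hp0.le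

/-- The leading term of the sample complexity, with the horizon and the logarithm of the
confidence parameter replaced by their bounds. -/
theorem leading_term_le {σ γ ε p H ι : ℝ} (hγ1 : γ < 1) (hσ : 0 ≤ σ) (hε : 0 < ε)
    (hp0 : 0 < p) (hp1 : p ≤ 1) (hH0 : 0 ≤ H) (hι0 : 0 ≤ ι)
    (hH : H ≤ 4 * (1 / (1 - γ)) * Real.log (σ * (1 / (1 - γ)) / ε))
    (hι : ι ≤ 649 * (Real.log (σ * (1 / (1 - γ)) / ε) * Real.log (2 / p))) :
    705318 * (σ * H * (1 / (1 - γ)) ^ 2 * ι) / ε ^ 2 ≤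
      2000000000 * (σ * Real.log (2 / p) / (ε ^ 2 * (1 - γ) ^ 3)) *
        Real.log (σ / ((1 - γ) * ε)) ^ 2 := by
  have h1 : 0 < 1 - γ := by linarith
  have e1 : σ / ((1 - γ) * ε) = σ * (1 / (1 - γ)) / ε := by field_simp
  have e2 : σ * Real.log (2 / p) / (ε ^ 2 * (1 - γ) ^ 3) =
      σ * Real.log (2 / p) * (1 / (1 - γ)) ^ 3 / ε ^ 2 := by field_simp
  rw [e1, e2, mul_div_assoc', div_mul_eq_mul_div]
  refine div_le_div_of_nonneg_right ?_ (by positivity)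
  have hR : 0 < 1 / (1 - γ) := by positivity
  set R := 1 / (1 - γ)
  set L := Real.log (σ * R / ε)
  have hlogp : 0 ≤ Real.log (2 / p) := Real.log_nonneg (by
    rw [le_div_iff₀ hp0]; linarith)
  set l := Real.log (2 / p)
  have h3 : 0 ≤ 4 * R * L := hH0.trans hH
  calc 705318 * (σ * H * R ^ 2 * ι)
      ≤ 705318 * (σ * (4 * R * L) * R ^ 2 * (649 * (L * l))) := by gcongr
    _ = 1831005528 * (σ * l * R ^ 3 * L ^ 2) := by ring
    _ ≤ 2000000000 * (σ * l * R ^ 3 * L ^ 2) :=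
        mul_le_mul_of_nonneg_right (by norm_num) (by positivity)
    _ = _ := by ring

/-- The sample complexity bound for parameters that satisfy the equations of `params`, with
`c₁ = 400000` and `c₂ = 6000`. -/
theorem measure_sampleComplexity_le {S A : Type*} [Fintype S] [DecidableEq S] [Fintype A]
    (M : DiscountedMDP S A) (argmax : S → (A → ℝ) → A)
    (hargmax : ∀ (s : S) (f : A → ℝ) (a : A), f a ≤ f (argmax s f)) {ε p : ℝ} (hε : 0 < ε)
    (hεD : ε < 1 / (smallConst * ((Fintype.card S : ℝ) * Fintype.card A / (1 - M.γ)) ^ 82))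
    (hp0 : 0 < p) (hp1 : p < 1) {P : Params} (hPγ : P.γ = M.γ) (hPH : P.H = horizon M.γ ε)
    (hPB : P.B = P.H ^ 3)
    (hPι : P.ι = Real.log (2 / confidence (Fintype.card S) (Fintype.card A) M.γ ε p))
    (hPN₀ : P.N₀ = 400000 * (Fintype.card S : ℝ) ^ 3 * Fintype.card A * (P.H : ℝ) ^ 7 *
      Real.log (4 * (P.H : ℝ) ^ 2 * Fintype.card S / ε) * P.ι / ε ^ 2)
    (hPN₁ : P.N₁ = ⌈6000 * (Fintype.card S : ℝ) * Fintype.card A * (P.H : ℝ) ^ 5 * P.B *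
      Real.log (4 * (P.H : ℝ) / ε) * P.ι⌉₊)
    {Ω : Type*} [MeasurableSpace Ω] (μ : MeasureTheory.Measure Ω)
    [MeasureTheory.IsProbabilityMeasure μ] (s : ℕ → Ω → S)
    (hs : (algorithm P argmax).IsTrajectory M μ s)
    (hS : 1 ≤ Fintype.card S) (hA : 1 ≤ Fintype.card A) :
    ENNReal.ofReal (1 - p) ≤
      μ {ω | (algorithm P argmax).sampleComplexity M ε (fun t => s t ω) ≤
        ENNReal.ofReal (2000000000 * (Fintype.card S * Fintype.card A * Real.log (2 / p) /
          (ε ^ 2 * (1 - M.γ) ^ 3)) *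
          Real.log (Fintype.card S * Fintype.card A / ((1 - M.γ) * ε)) ^ 2)} := by
  obtain ⟨s₀⟩ : Nonempty S := Fintype.card_pos_iff.1 hS
  have hS' : (1 : ℝ) ≤ Fintype.card S := by exact_mod_cast hS
  have hA' : (1 : ℝ) ≤ Fintype.card A := by exact_mod_cast hA
  have hγ := M.one_sub_γ_pos
  have hD := le_smallConst
  set R := 1 / (1 - M.γ) with hR
  have hR1 : 1 ≤ R := by rw [hR, le_div_iff₀ hγ]; linarith [M.γ_pos]
  set σ : ℝ := (Fintype.card S : ℝ) * Fintype.card A with hσ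
  have hσ1 : 1 ≤ σ := one_le_mul_of_one_le_of_one_le hS' hA'
  have hσR : σ / (1 - M.γ) = σ * R := by rw [hR]; ring
  rw [hσR] at hεD
  have hy1 : 1 ≤ σ * R := one_le_mul_of_one_le_of_one_le hσ1 hR1
  have hsmall : ε * (smallConst * (σ * R) ^ 82) ≤ 1 :=
    ((lt_div_iff₀ (mul_pos (by linarith) (by positivity))).1 hεD).le
  have hεc : ε * smallConst ≤ 1 := by
    have h1 : 1 ≤ (σ * R) ^ 82 := one_le_pow₀ hy1
    have h2 : smallConst ≤ smallConst * (σ * R) ^ 82 :=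
      le_mul_of_one_le_right (by linarith) h1
    have := mul_le_mul_of_nonneg_left h2 hε.le
    linarith
  obtain ⟨hRH, hH2, hHle⟩ := horizon_bounds M.γ_pos M.γ_lt_one hε (by nlinarith)
  obtain ⟨-, hL1, hHL, hHε, hl1, hlow⟩ := bounds_of_small hσ1 hR1 hε hsmall hRH hHle
  rw [← hPH] at hRH hH2 hHL hHε hl1 hlow
  have hH1 : (1 : ℝ) ≤ P.H := hR1.trans hRH
  have hε1 : ε ≤ 1 := by nlinarith
  clear hεD hsmall
  -- the logarithmic factor
  set G := σ * R / (p * ε) with hG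
  have hGpos : 0 < G := by positivity
  have hιG : P.ι = Real.log 2 + 216 * Real.log G := by
    have e : p * ε * (1 - M.γ) / ((Fintype.card S : ℝ) * Fintype.card A) = 1 / G := by
      rw [hG, hR, ← hσ]; field_simp
    rw [← log_two_div_pow_eq hGpos, ← e, hPι, confidence]
  obtain ⟨hεG, hGbig, hσG, hSG, hpG⟩ := le_div_confidence_base hS' hA' hR1 hε hεc hp0 hp1.le
  rw [← hσ, ← hG] at hεG hGbig hσG hSG hpG
  have hlogG : 1 / 2 ≤ Real.log G := by
    have h1 := Real.one_sub_inv_le_log_of_pos hGpos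
    have h2 : G⁻¹ ≤ 1 / 2 := by
      rw [inv_eq_one_div]; exact one_div_le_one_div_of_le (by norm_num) (by linarith)
    linarith
  have hι1 : 1 ≤ P.ι := by rw [hιG]; linarith [Real.log_two_gt_d9]
  have hι217 : P.ι ≤ 217 * G := by
    rw [hιG]
    have := Real.log_le_self hGpos.le
    linarith [Real.log_two_lt_d9]
  have hιL : P.ι ≤ 649 * (Real.log (σ * R / ε) * Real.log (2 / p)) := by
    rw [hιG]; exact log_confidence_le (by positivity) hε hp0 hp1.le hL1
  have hι0 : 0 ≤ P.ι := zero_le_one.trans hι1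
  -- the conditions on `N₀` and `N₁`
  have hlog4 : 1 ≤ Real.log (4 * (P.H : ℝ) ^ 2 * Fintype.card S / ε) := by
    refine hl1.trans (Real.log_le_log (by positivity) (div_le_div_of_nonneg_right ?_ hε.le))
    have h1 : (P.H : ℝ) ≤ (P.H : ℝ) ^ 2 := le_self_pow₀ hH1 (by norm_num)
    have h2 : 4 * (P.H : ℝ) ^ 2 ≤ 4 * (P.H : ℝ) ^ 2 * Fintype.card S :=
      le_mul_of_one_le_right (by positivity) hS'
    linarith
  have hN₀G : P.N₀ ≤ 347200000 * G ^ 25 := by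
    rw [hPN₀]
    exact N₀_le hS' hA' hH1 hε hι0 hσG hSG hεG hHε hι217
  have hN₀low : 400000 * σ * (P.H : ℝ) ^ 7 * P.ι / ε ^ 2 ≤ P.N₀ := by
    rw [hPN₀]
    have h1 : σ ≤ (Fintype.card S : ℝ) ^ 3 * Fintype.card A := by
      rw [hσ]; gcongr; exact le_self_pow₀ hS' (by norm_num)
    calc 400000 * σ * (P.H : ℝ) ^ 7 * P.ι / ε ^ 2 ≤
        400000 * ((Fintype.card S : ℝ) ^ 3 * Fintype.card A) * (P.H : ℝ) ^ 7 * P.ι / ε ^ 2 := by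
          gcongr
      _ ≤ 400000 * ((Fintype.card S : ℝ) ^ 3 * Fintype.card A) * (P.H : ℝ) ^ 7 * P.ι / ε ^ 2 *
          Real.log (4 * (P.H : ℝ) ^ 2 * Fintype.card S / ε) :=
          le_mul_of_one_le_right (by positivity) hlog4
      _ = _ := by ring
  have hN₀pos : 0 < P.N₀ := by
    refine lt_of_lt_of_le ?_ hN₀low
    have : 0 < P.ι := zero_lt_one.trans_le hι1
    positivity
  have hN₁eq : P.N₁ = ⌈6000 * σ * (P.H : ℝ) ^ 8 * Real.log (4 * (P.H : ℝ) / ε) * P.ι⌉₊ := by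
    rw [hPN₁, hPB, hσ]; push_cast; congr 1; ring
  have hN₁ : 6000 * σ * (P.H : ℝ) ^ 8 * Real.log (4 * (P.H : ℝ) / ε) * P.ι ≤ P.N₁ := by
    rw [hN₁eq]; exact Nat.le_ceil _
  have hN₁le : (P.N₁ : ℝ) ≤
      6000 * σ * (P.H : ℝ) ^ 8 * Real.log (4 * (P.H : ℝ) / ε) * P.ι + 1 := by
    rw [hN₁eq]
    exact (Nat.ceil_lt_add_one (by positivity)).le
  let X : Run S A :=
    { M := M, p := P, argmax := argmax, le_argmax := hargmax, h := fun _ => s₀, γ_eq := hPγ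
      two_le_H := hH2, one_le_B := hPB ▸ Nat.one_le_pow _ _ (by omega) }
  have hmain := Run.one_sub_le_measure_sampleComplexity_le (X := X) hs hε hε1 hp0.le hS hA hRH hι1
    hPB hHε hl1 hN₀low (log_N₀_le hGbig hN₀pos hN₀G hιG) hN₁ hN₁le hlow fun U hU0 hU14 =>
      failure_probability_le (zero_le_one.trans hσ1) hσG hGbig hpG hU0 hU14 hN₀G hιG
  have hbound := leading_term_le M.γ_lt_one (zero_le_one.trans hσ1) hε hp0 hp1.le
    (zero_le_one.trans hH1) hι0 hHL hιL
  exact hmain.trans (MeasureTheory.measure_mono fun ω hω =>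
    hω.trans (ENNReal.ofReal_le_ofReal hbound))

end UCBMultiStageAdvantage

theorem theorem1 :
    -- the numerical constants and the internal confidence parameter of the algorithm
    ∃ (c₁ c₂ : ℝ) (δ : ℕ → ℕ → ℝ → ℝ → ℝ → ℝ) (q : ℕ),
      0 < c₁ ∧ 0 < c₂ ∧
      (∀ (nS nA : ℕ) (γ ε p : ℝ), 1 ≤ nS → 1 ≤ nA → 0 < γ → γ < 1 → 0 < ε → ε < 1 →
        0 < p → p < 1 →
        (p * ε * (1 - γ) / (nS * nA)) ^ q ≤ δ nS nA γ ε p ∧ δ nS nA γ ε p ≤ p) ∧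
      -- the polynomial `D * (S * A / (1 - γ)) ^ d` and the constants of the bound
      ∃ (D : ℝ) (d : ℕ) (C : ℝ) (k : ℕ), 1 ≤ D ∧ 0 < C ∧
        ∀ (S A : Type*) [Fintype S] [DecidableEq S] [Fintype A] (M : DiscountedMDP S A)
          (argmax : S → (A → ℝ) → A) (_ : ∀ (s : S) (f : A → ℝ) (a : A), f a ≤ f (argmax s f))
          (ε p : ℝ), 0 < ε →
          ε < 1 / (D * ((Fintype.card S : ℝ) * Fintype.card A / (1 - M.γ)) ^ d) →
          0 < p → p < 1 →
          ∀ alg, alg = UCBMultiStageAdvantage.algorithm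
            (UCBMultiStageAdvantage.params c₁ c₂ (Fintype.card S) (Fintype.card A) M.γ ε
              (δ (Fintype.card S) (Fintype.card A) M.γ ε p)) argmax →
          ∀ (Ω : Type*) [MeasurableSpace Ω] (μ : MeasureTheory.Measure Ω)
            [MeasureTheory.IsProbabilityMeasure μ] (s : ℕ → Ω → S),
            alg.IsTrajectory M μ s →
            alg.space ≤ 11 * (Fintype.card S * Fintype.card A) ∧
            ENNReal.ofReal (1 - p) ≤
              μ {ω | alg.sampleComplexity M ε (fun t => s t ω) ≤
                ENNReal.ofReal
                  (C * (Fintype.card S * Fintype.card A * Real.log (2 / p) /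
                      (ε ^ 2 * (1 - M.γ) ^ 3)) *
                    Real.log (Fintype.card S * Fintype.card A / ((1 - M.γ) * ε)) ^ k)} := by
  refine ⟨400000, 6000, UCBMultiStageAdvantage.confidence, 216, by norm_num, by norm_num,
    fun nS nA γ ε p hS hA hγ0 hγ1 hε0 hε1 hp0 hp1 =>
      ⟨le_rfl, UCBMultiStageAdvantage.confidence_le hS hA hγ0 hγ1 hε0 hε1 hp0 hp1⟩,
    UCBMultiStageAdvantage.smallConst, 82, 2000000000, 2,
    by linarith [UCBMultiStageAdvantage.le_smallConst], by norm_num, ?_⟩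
  intro S A _ _ _ M argmax hargmax ε p hε hεD hp0 hp1 alg halg Ω _ μ _ s hs
  subst halg
  obtain ⟨ω⟩ := μ.nonempty_of_neZero
  have hS : 1 ≤ Fintype.card S := Fintype.card_pos_iff.2 ⟨s 0 ω⟩
  have hA : 1 ≤ Fintype.card A := Fintype.card_pos_iff.2 ⟨argmax (s 0 ω) fun _ => 0⟩
  exact ⟨UCBMultiStageAdvantage.card_register_le hA,
    UCBMultiStageAdvantage.measure_sampleComplexity_le M argmax hargmax hε hεD hp0 hp1
      rfl rfl rfl rfl rfl rfl μ s hs hS hA⟩
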